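/- **Setting.** Let $w\in(0,1)$ be an arbitrary (small) constant, $k(n)\le n$, and let $N(n)$ and the number of servers $T(n)\ge 1$ be polynomially bounded. Let $\Phi_n$ be the deterministic linear measurement of an arbitrary deterministic polynomial-time algorithm $\mathsf{StreamAlg}_0$ for relaxed $k$-sparse recovery on $[-N,N]^n$: it reconstructs every $k$-sparse $x\in[-N,N]^n$ from $\Phi_n(x)$, and outputs some vector of $[-N,N]^n$ when $x\in[-N,N]^n$ is not $k$-sparse. Let $g$ be the least power of two with $g\ge n^w$, let $q$ be a prime with $\log q=\omega(\log^2 n)$ and $\log q\le\operatorname{polylog}(n)$, let $t$ be a polynomially bounded prime with $t>nN$, let $R_q=\mathbb Z_q[x]/(x^g+1)$ and $R_t=\mathbb Z_t[x]/(x^g+1)$, and let the noise $\chi$ be the discrete Gaussian on $\mathbb Z^g$ with parameter $0<\sigma\le\operatorname{poly}(n)$. In the BV scheme the secret key is $s\gets\chi$, the public key is $(-(as+te),a)\in R_q^2$ with $a$ uniform and $e\gets\chi$, an encryption of $\mu\in R_t$ under $(a_0,a_1)$ is $(a_0v+te_1+\mu,\;a_1v+te_2)$ with $v,e_1,e_2\gets\chi$,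 ciphertexts are added and multiplied as polynomials in a formal variable standing for $s$, and decryption substitutes $s$, takes representatives of the coefficients in $(-q/2,q/2]$, and reduces them modulo $t$. **Protocol.** Cut $x\in\mathbb Z^n$ into $\lceil n/g\rceil$ consecutive segments of length $g$ (the last one padded with zeros), read as ring elements $x_j$. The coordinator samples a pseudo-public key and pseudo-ciphertexts $\tilde{\mathsf{ct}}_1,\dots,\tilde{\mathsf{ct}}_{\lceil\log n\rceil}$ uniformly from $R_q^2$ and sends them to all servers. Let $\hat{\mathsf{ct}}_j$ be the BV evaluation on the $\tilde{\mathsf{ct}}_i$ of the circuit that tests whether the input bits represent a value in $[jg,(j+1)g)$, and let $\mathrm{hash}(x)=\sum_j\hat{\mathsf{ct}}_j\cdot x_j$. Server $i$, with data $x^{(i)}$, sends $(\mathrm{hash}(x^{(i)}),\Phi_n(x^{(i)}))$. The coordinator reconstructs $x'$ with $\mathsf{StreamAlg}_0$ from $\sum_i\Phi_n(x^{(i)})$, outputs $x'$ if $x'$ is $k$-sparse and $\mathrm{hash}(x')=\sum_i\mathrm{hash}(x^{(i)})$, and outputs $\bot$ otherwise. All data are such that every subset sum of the $x^{(i)}$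 lies in $[-N,N]^n$. **Proposition 5.4.** Write $\mathcal R(\cdot)$ for running time, and let $\tilde{\mathcal O}$ hide factors polylogarithmic in $n$. For all $n\ge1$, all states of the protocol and all admissible data: 1. the total number of bits exchanged between a server with data $x$ and the coordinator is at most $\tilde{\mathcal O}(n^{w})+\mathrm{size}(\Phi_n(x))$; 2. the coordinator can be run in time $\tilde{\mathcal O}(n)+\mathcal R(\mathsf{StreamAlg}_0.\mathsf{Report})$, plus the time $T\cdot\bigl(\tilde{\mathcal O}(n^{w})+O(b_n)\bigr)$ for adding up the $T$ received packets, where $b_n$ is the bit length of a measurement result; 3. each server can be run in time $\tilde{\mathcal O}(n)+\mathcal R(\Phi_n)$. Moreover the protocol is correct in the following sense. 4. Suppose that the pseudo-public key and pseudo-ciphertexts are replaced by a genuine BV public key and genuine encryptions of the bits of a coordinate $m$. Then, except with probability negligible in $n$ (uniformly in $m$), for all $x,x'\in[-N,N]^n$ the value $\mathrm{hash}(x)$ decrypts to the segment of $x$ that contains the coordinate $m$, as an element of $R_t$; and if $x_m\ne x'_m$, then $\mathrm{hash}(x)$ and $\mathrm{hash}(x')$ decrypt to distinct ring elements, so that $\mathrm{hash}(x)\ne\mathrm{hash}(x')$.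 5. Assume the polynomial hardness of Ring-LWE for $(g,q,\chi)$: for every $h=\operatorname{poly}(n)$, no non-uniform probabilistic polynomial-time algorithm distinguishes with non-negligible advantage $h$ samples $(a_i,a_is+e_i)$, with $a_i$ uniform in $R_q$ and $s,e_i\gets\chi$, from $h$ uniform pairs in $R_q^2$. Then the protocol is white-box adversarially robust for $k$-sparse recovery: for every non-uniform probabilistic polynomial-time adversary that sees all the randomness of the protocol and then chooses admissible data $x^{(1)},\dots,x^{(T)}$, the probability that the output differs from the correct answer ($\sum_i x^{(i)}$ if this vector is $k$-sparse, and $\bot$ otherwise) is negligible in $n$. Running time is that of a single program for all $n$, in a model with unit-cost pointer operations, in which arithmetic on integers is charged by their bit lengths (addition linearly, multiplication and division by the product of the lengths). The programs receive the public parameters of the protocol as part of the input. -/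

import Mathlib

open Polynomial
open scoped ENNReal

noncomputable section

namespace WBRecovery

/-! ## Machine model: first-order recursive programs on binary trees, with a running time

Every step on pointers costs one; arithmetic on natural numbers is charged by the bit lengths of
the operands (schoolbook cost for multiplication and division), so that a step of cost `c` is
`c` bit operations up to a constant factor. -/

/-- Data: binary trees with natural numbers at the leaves. -/
inductive Val : Type
  | nat (n : ℕ)
  | pair (a b : Val)

namespace Val

/-- A self-delimiting binary code. A number is a tag bit, then its binary digits each announced by
a flag `true`, then an end flag; a pair is a tag bit followed by the two codes. -/
def bits : Val → List Bool
  | nat n => false :: (n.bits.flatMap (fun b => [true, b]) ++ [false])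
  | pair a b => true :: (a.bits ++ b.bits)

/-- Number of bits needed to transmit a value. -/
def size (v : Val) : ℕ := v.bits.length

/-- Lists, ended by the leaf `0`. -/
def list (l : List Val) : Val := l.foldr pair (nat 0)

/-- Integers, as sign and absolute value. -/
def int (z : ℤ) : Val := pair (nat (if z < 0 then 1 else 0)) (nat z.natAbs)

/-- Integer vectors, as the list of all entries. -/
def vec {n : ℕ} (x : Fin n → ℤ) : Val := list (List.ofFn fun i => int (x i))

/-- Integer vectors, as the list of the pairs (position, entry) of the nonzero entries, by
increasing position. -/
def sparseVec {n : ℕ} (x : Fin n → ℤ) : Val :=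
  list (((List.finRange n).filter fun i : Fin n => x i ≠ 0).map fun i : Fin n => pair (nat i) (int (x i)))

def bitString {m : ℕ} (b : Fin m → Bool) : Val :=
  list (List.ofFn fun i => nat (b i).toNat)

end Val

/-- Programs; each denotes a partial function on `Val`. `self` is a recursive call of the innermost
enclosing `fix` (or of the whole program, if there is none). -/
inductive Prog : Type
  | id
  | const (k : ℕ)
  | fst
  | snd
  | pair (f g : Prog)
  | comp (g f : Prog)
  | cond (c f g : Prog)
  | add
  | sub
  | mul
  | div
  | mod
  | fix (p : Prog)
  | self

/-- `Eval r p v b c`: with `r` as the meaning of `self`, the program `p` halts on input `v` with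
output `b` after `c` steps. A program that takes apart a number, or computes with something that
is not a pair of numbers, is stuck and has no output. -/
inductive Eval : Prog → Prog → Val → Val → ℕ → Prop
  | id (r v) : Eval r .id v v 1
  | const (r k v) : Eval r (.const k) v (.nat k) 1
  | fst (r a b) : Eval r .fst (.pair a b) a 1
  | snd (r a b) : Eval r .snd (.pair a b) b 1
  | pair {r f g v a b m n} : Eval r f v a m → Eval r g v b n →
      Eval r (.pair f g) v (.pair a b) (m + n + 1)
  | comp {r f g v a b m n} : Eval r f v a m → Eval r g a b n →
      Eval r (.comp g f) v b (m + n + 1)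
  | cond_true {r c f g v a b m n} : Eval r c v a m → a ≠ .nat 0 → Eval r f v b n →
      Eval r (.cond c f g) v b (m + n + 1)
  | cond_false {r c f g v b m n} : Eval r c v (.nat 0) m → Eval r g v b n →
      Eval r (.cond c f g) v b (m + n + 1)
  | add (r a b) : Eval r .add (.pair (.nat a) (.nat b)) (.nat (a + b)) (a.size + b.size + 1)
  | sub (r a b) : Eval r .sub (.pair (.nat a) (.nat b)) (.nat (a - b)) (a.size + b.size + 1)
  | mul (r a b) :
      Eval r .mul (.pair (.nat a) (.nat b)) (.nat (a * b)) ((a.size + 1) * (b.size + 1))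
  | div (r a b) :
      Eval r .div (.pair (.nat a) (.nat b)) (.nat (a / b)) ((a.size + 1) * (b.size + 1))
  | mod (r a b) :
      Eval r .mod (.pair (.nat a) (.nat b)) (.nat (a % b)) ((a.size + 1) * (b.size + 1))
  | fix {r p v b n} : Eval p p v b n → Eval r (.fix p) v b (n + 1)
  | self {r v b n} : Eval r r v b n → Eval r .self v b (n + 1)

/-- `p` halts on `v` with output `b` within `time` steps. -/
def Prog.RunsIn (p : Prog) (v b : Val) (time : ℝ) : Prop := ∃ c : ℕ, (c : ℝ) ≤ time ∧ Eval p p v b c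

/-! ## Asymptotics and adversaries -/

def PolyBounded (f : ℕ → ℕ) : Prop := ∃ c : ℕ, ∀ n, f n ≤ n ^ c + c

def Negligible (f : ℕ → ℝ) : Prop := ∀ c : ℝ, 0 < c → ∃ n₀ : ℕ, ∀ n : ℕ, n₀ < n → f n < (n : ℝ) ^ (-c)

/-- The factor `(1 + ⌊log₂ n⌋) ^ c` hidden in `Õ(·)`. -/
def polylog (c n : ℕ) : ℝ := ((Nat.log 2 n + 1 : ℕ) : ℝ) ^ c

/-- A non-uniform probabilistic polynomial-time algorithm: a program with polynomially long advice,
polynomially many random bits, and a polynomial time limit. -/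
structure Adversary where
  prog : Prog
  advice : ℕ → Val
  coins : ℕ → ℕ
  time : ℕ → ℕ
  advice_poly : PolyBounded fun n => (advice n).size
  coins_poly : PolyBounded coins
  time_poly : PolyBounded time

/-- With random bits `ρ`, the adversary answers `out` on `input` before the time limit. -/
def Adversary.Outputs (A : Adversary) (n : ℕ) (ρ : Fin (A.coins n) → Bool) (input out : Val) :
    Prop :=
  A.prog.RunsIn (.pair (A.advice n) (.pair (Val.bitString ρ) input)) out (A.time n)

def Adversary.coinDist (A : Adversary) (n : ℕ) : PMF (Fin (A.coins n) → Bool) :=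
  PMF.uniformOfFintype _

/-- The probability of an event, for a random proposition. -/
def prob (E : PMF Prop) : ℝ := (E True).toReal

/-- Independent samples from the given distributions. -/
def independent {α : Type} : (h : ℕ) → (Fin h → PMF α) → PMF (Fin h → α)
  | 0, _ => PMF.pure Fin.elim0
  | h + 1, p => (p 0).bind fun a =>
      (independent h fun i => p i.succ).bind fun f => PMF.pure (Fin.cons a f)

/-- `h` independent samples from `p`. -/
def iid {α : Type} (h : ℕ) (p : PMF α) : PMF (Fin h → α) := independent h fun _ => p

/-! ## The discrete Gaussian on `ℤ ^ g` -/

/-- `ρ_σ(x) = exp (-π ‖x‖² / σ²)`, with the Euclidean norm. -/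
def gaussWeight (g : ℕ) (σ : ℝ) (x : Fin g → ℤ) : ℝ≥0∞ :=
  ENNReal.ofReal (Real.exp (-Real.pi * (∑ i, (x i : ℝ) ^ 2) / σ ^ 2))

theorem tsum_pi_prod (f : ℤ → ℝ≥0∞) (g : ℕ) :
    ∑' x : Fin g → ℤ, ∏ i, f (x i) = (∑' a, f a) ^ g := by
  induction g with
  | zero => simp
  | succ g ih =>
    rw [← (Fin.consEquiv fun _ : Fin (g + 1) => ℤ).tsum_eq, ENNReal.tsum_prod', pow_succ', ← ih,
      ← ENNReal.tsum_mul_right]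
    refine tsum_congr fun a => ?_
    rw [← ENNReal.tsum_mul_left]
    refine tsum_congr fun y => ?_
    simp [Fin.consEquiv, Fin.prod_univ_succ]

theorem gaussWeight_one_summable {σ : ℝ} (hσ : 0 < σ) :
    Summable fun a : ℤ => Real.exp (-Real.pi * (a : ℝ) ^ 2 / σ ^ 2) := by
  have hc : 0 < Real.pi / σ ^ 2 := by positivity
  have key : Summable fun n : ℕ => Real.exp (-Real.pi * (n : ℝ) ^ 2 / σ ^ 2) := by
    refine Summable.of_nonneg_of_le (fun _ => (Real.exp_pos _).le) (fun n => ?_)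
      (summable_geometric_of_lt_one (Real.exp_pos (-(Real.pi / σ ^ 2))).le
        (by simpa using hc))
    rw [← Real.exp_nat_mul]
    refine Real.exp_le_exp.2 ?_
    have h1 : (n : ℝ) ≤ (n : ℝ) ^ 2 := by
      exact_mod_cast Nat.le_self_pow (by norm_num) n
    have h2 : -Real.pi * (n : ℝ) ^ 2 / σ ^ 2 = (n : ℝ) ^ 2 * -(Real.pi / σ ^ 2) := by ring
    rw [h2]
    nlinarith
  refine Summable.of_nat_of_neg ?_ ?_
  · simpa using key
  · simpa using key

theorem gaussWeight_tsum_ne_top (g : ℕ) {σ : ℝ} (hσ : 0 < σ) :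
    ∑' x, gaussWeight g σ x ≠ ∞ := by
  have h : ∀ x : Fin g → ℤ, gaussWeight g σ x =
      ∏ i, ENNReal.ofReal (Real.exp (-Real.pi * (x i : ℝ) ^ 2 / σ ^ 2)) := by
    intro x
    rw [gaussWeight, ← ENNReal.ofReal_prod_of_nonneg (fun _ _ => (Real.exp_pos _).le),
      ← Real.exp_sum, Finset.mul_sum, Finset.sum_div]
  rw [tsum_congr h, tsum_pi_prod (fun a => ENNReal.ofReal (Real.exp (-Real.pi * (a : ℝ) ^ 2 / σ ^ 2)))]
  exact ENNReal.pow_ne_top (gaussWeight_one_summable hσ).tsum_ofReal_ne_top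

theorem gaussWeight_tsum_ne_zero (g : ℕ) (σ : ℝ) : ∑' x, gaussWeight g σ x ≠ 0 := by
  intro h
  have h0 := ENNReal.tsum_eq_zero.1 h 0
  simp [gaussWeight] at h0

/-- The discrete Gaussian distribution on `ℤ ^ g` with parameter `σ`. -/
def discreteGaussian (g : ℕ) (σ : ℝ) (hσ : 0 < σ) : PMF (Fin g → ℤ) :=
  PMF.normalize (gaussWeight g σ) (gaussWeight_tsum_ne_zero g σ) (gaussWeight_tsum_ne_top g hσ)

/-! ## The rings `ℤ_q[x] / (x ^ g + 1)` with `g = 2 ^ r` -/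

abbrev Ring2 (q r : ℕ) : Type := AdjoinRoot (X ^ 2 ^ r + 1 : (ZMod q)[X])

theorem monic_modulus (q r : ℕ) : (X ^ 2 ^ r + 1 : (ZMod q)[X]).Monic := by
  simpa using monic_X_pow_add_C (1 : ZMod q) (n := 2 ^ r) (by positivity)

namespace Ring2

variable {q r : ℕ}

/-- The class of the polynomial with the given coefficients. -/
def ofCoeffs (a : Fin (2 ^ r) → ZMod q) : Ring2 q r := AdjoinRoot.mk _ (∑ i, C (a i) * X ^ (i : ℕ))

/-- The coefficients of the representative of degree less than `2 ^ r`. -/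
def coeffs (a : Ring2 q r) (i : Fin (2 ^ r)) : ZMod q :=
  (AdjoinRoot.modByMonicHom (monic_modulus q r) a).coeff i

def ofInts (a : Fin (2 ^ r) → ℤ) : Ring2 q r := ofCoeffs fun i => (a i : ZMod q)

/-- Reads the coefficients as integers in `(-q/2, q/2]` and reduces them modulo `q'`. -/
def lift (q' : ℕ) (a : Ring2 q r) : Ring2 q' r := ofInts fun i => (coeffs a i).valMinAbs

def enc (a : Ring2 q r) : Val := Val.list (List.ofFn fun i => Val.nat (coeffs a i).val)

end Ring2

/-! ## Ring-LWE -/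

/-- Degree `2 ^ logDeg`, prime modulus `q` and noise parameter `σ`. -/
structure RingParams where
  logDeg : ℕ
  q : ℕ
  σ : ℝ
  q_prime : q.Prime
  σ_pos : 0 < σ

namespace RingParams

variable (P : RingParams)

instance : NeZero P.q := ⟨P.q_prime.ne_zero⟩

abbrev R : Type := Ring2 P.q P.logDeg

def uniform : PMF P.R := (PMF.uniformOfFintype (Fin (2 ^ P.logDeg) → ZMod P.q)).map Ring2.ofCoeffs

/-- The noise distribution on the ring. -/
def noise : PMF P.R := (discreteGaussian (2 ^ P.logDeg) P.σ P.σ_pos).map Ring2.ofInts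

def encPair (c : P.R × P.R) : Val := .pair (Ring2.enc c.1) (Ring2.enc c.2)

/-- `h` samples `(aᵢ, aᵢ s + eᵢ)`, with the secret drawn from the noise distribution. -/
def rlweSamples (h : ℕ) : PMF (Fin h → P.R × P.R) :=
  P.noise.bind fun s => iid h <|
    P.uniform.bind fun a => P.noise.bind fun e => PMF.pure (a, a * s + e)

def uniformPair : PMF (P.R × P.R) :=
  P.uniform.bind fun a => P.uniform.bind fun u => PMF.pure (a, u)

end RingParams

/-- The event that `D` answers `1` on `h` sample pairs drawn from `dist`. -/
def acceptExperiment (P : RingParams) (D : Adversary) (n h : ℕ)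
    (dist : PMF (Fin h → P.R × P.R)) : PMF Prop :=
  dist.bind fun y => (D.coinDist n).map fun ρ =>
    D.Outputs n ρ (Val.list (List.ofFn fun i => P.encPair (y i))) (.nat 1)

/-- Polynomial hardness of Ring-LWE: for every polynomial number of samples and every non-uniform
polynomial-time distinguisher, the advantage is negligible. -/
def RingLWEHard (P : ℕ → RingParams) : Prop :=
  ∀ h : ℕ → ℕ, PolyBounded h → ∀ D : Adversary, Negligible fun n =>
    |prob (acceptExperiment (P n) D n (h n) ((P n).rlweSamples (h n))) -
      prob (acceptExperiment (P n) D n (h n) (iid (h n) (P n).uniformPair))|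

/-! ## The BV encryption scheme

Ciphertexts are polynomials over `R_q` in a formal variable that stands for the secret key, so
that sums and products of ciphertexts are sums and products of polynomials. -/

namespace BV

variable (P : RingParams)

abbrev Ciphertext : Type := P.R[X]

/-- A fresh ciphertext is a vector in `R_q ^ 2`. -/
def ofPair (c : P.R × P.R) : Ciphertext P := C c.1 + C c.2 * X

/-- Key generation, with message modulus `t`: the pair of public and secret key. -/
def keyGen (t : ℕ) : PMF ((P.R × P.R) × P.R) :=
  P.noise.bind fun s => P.uniform.bind fun a => P.noise.bind fun e =>
    PMF.pure ((-(a * s + (t : P.R) * e), a), s)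

/-- Encryption of `μ ∈ R_t`. -/
def encrypt (t : ℕ) (pk : P.R × P.R) (μ : Ring2 t P.logDeg) : PMF (P.R × P.R) :=
  P.noise.bind fun v => P.noise.bind fun e₁ => P.noise.bind fun e₂ =>
    PMF.pure (pk.1 * v + (t : P.R) * e₁ + Ring2.lift P.q μ, pk.2 * v + (t : P.R) * e₂)

/-- Homomorphic evaluation of an arithmetic circuit. It is deterministic, and does not use the
public key. -/
def eval {ℓ : ℕ} (circuit : MvPolynomial (Fin ℓ) ℤ) (ct : Fin ℓ → P.R × P.R) : Ciphertext P :=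
  MvPolynomial.aeval (fun i => ofPair P (ct i)) circuit

def decrypt (t : ℕ) (sk : P.R) (c : Ciphertext P) : Ring2 t P.logDeg :=
  Ring2.lift t (Polynomial.eval sk c)

end BV

/-! ## The chunked hash -/

/-- Number of bits of a coordinate, `⌈log₂ n⌉`. Coordinates are `0, …, n - 1`. -/
def addrBits (n : ℕ) : ℕ := Nat.clog 2 n

/-- Binary digits of `m`, least significant first. -/
def digit (n m : ℕ) (i : Fin (addrBits n)) : Bool := m.testBit i

/-- Number of chunks of length `2 ^ r`, i.e. `⌈n / 2 ^ r⌉`. -/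
def numChunks (n r : ℕ) : ℕ := (n + 2 ^ r - 1) / 2 ^ r

/-- The circuit which tests whether its input bits represent a value in
`[j * 2 ^ r, (j + 1) * 2 ^ r)`: it compares the bits from position `r` on with those of `j`. -/
def chunkCircuit (n r j : ℕ) : MvPolynomial (Fin (addrBits n)) ℤ :=
  ∏ i : Fin (addrBits n), if r ≤ (i : ℕ) then
    (if j.testBit (i - r) then MvPolynomial.X i else 1 - MvPolynomial.X i) else 1

theorem chunkCircuit_spec (n r j m : ℕ) (hj : j < numChunks n r) (hm : m < n) :
    MvPolynomial.eval (fun i => if digit n m i then (1 : ℤ) else 0) (chunkCircuit n r j) =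
      if j * 2 ^ r ≤ m ∧ m < (j + 1) * 2 ^ r then 1 else 0 := by
  have hp : 0 < 2 ^ r := by positivity
  have hn2 : n ≤ 2 ^ addrBits n := Nat.le_pow_clog (by norm_num) n
  have hjn : j * 2 ^ r < n := by
    have h1 : (j + 1) * 2 ^ r ≤ n + 2 ^ r - 1 := (Nat.le_div_iff_mul_le hp).1 hj
    rw [Nat.succ_mul] at h1
    omega
  have hfac : ∀ i : Fin (addrBits n),
      MvPolynomial.eval (fun i => if digit n m i then (1 : ℤ) else 0)
        (if r ≤ (i : ℕ) then
          (if j.testBit (i - r) then MvPolynomial.X i else 1 - MvPolynomial.X i) else 1) =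
      if r ≤ (i : ℕ) → m.testBit i = j.testBit (i - r) then 1 else 0 := by
    intro i
    by_cases hi : r ≤ (i : ℕ)
    · cases h1 : j.testBit (i - r) <;> cases h2 : m.testBit i <;>
        simp [hi, h2, digit]
    · simp [hi]
  have hdiv : m / 2 ^ r = j ↔ j * 2 ^ r ≤ m ∧ m < (j + 1) * 2 ^ r := by
    rw [← Nat.le_div_iff_mul_le hp, ← Nat.div_lt_iff_lt_mul hp]
    omega
  have hiff : (∀ i : Fin (addrBits n), r ≤ (i : ℕ) → m.testBit i = j.testBit (i - r)) ↔
      j * 2 ^ r ≤ m ∧ m < (j + 1) * 2 ^ r := by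
    rw [← hdiv]
    constructor
    · intro h
      refine Nat.eq_of_testBit_eq fun b => ?_
      rw [Nat.testBit_div_two_pow]
      by_cases hb : b + r < addrBits n
      · simpa [Nat.add_comm] using h ⟨b + r, hb⟩ (Nat.le_add_left r b)
      · have hpow : 2 ^ addrBits n ≤ 2 ^ (b + r) := Nat.pow_le_pow_right (by norm_num) (by omega)
        have hjb : j < 2 ^ b := by
          rw [pow_add] at hpow
          exact lt_of_mul_lt_mul_right (by omega : j * 2 ^ r < 2 ^ b * 2 ^ r) hp.le
        rw [Nat.testBit_eq_false_of_lt hjb]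
        exact Nat.testBit_eq_false_of_lt (by
          have hc : 2 ^ (r + b) = 2 ^ (b + r) := by rw [Nat.add_comm]
          omega)
    · rintro rfl i hi
      rw [Nat.testBit_div_two_pow]
      congr 1
      omega
  rw [chunkCircuit, map_prod, Finset.prod_congr rfl fun i _ => hfac i]
  by_cases h : j * 2 ^ r ≤ m ∧ m < (j + 1) * 2 ^ r
  · rw [if_pos h]
    exact Finset.prod_eq_one fun i _ => if_pos (hiff.2 h i)
  · rw [if_neg h]
    obtain ⟨i, hi⟩ := not_forall.1 (mt hiff.1 h)
    exact Finset.prod_eq_zero (Finset.mem_univ i) (if_neg hi)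

/-- The `j`-th segment of length `2 ^ r` of `x` (padded with zeros), as a ring element. -/
def chunk (q r : ℕ) {n : ℕ} (x : Fin n → ℤ) (j : ℕ) : Ring2 q r :=
  Ring2.ofInts fun i => if h : j * 2 ^ r + i < n then x ⟨j * 2 ^ r + i, h⟩ else 0

/-- `∑ⱼ ĉtⱼ · xⱼ`, where `ĉtⱼ` is the evaluation of the `j`-th circuit. -/
def chunkedHash (P : RingParams) {n : ℕ} (ct : Fin (addrBits n) → P.R × P.R) (x : Fin n → ℤ) :
    BV.Ciphertext P :=
  ∑ j ∈ Finset.range (numChunks n P.logDeg),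
    BV.eval P (chunkCircuit n P.logDeg j) ct * C (chunk P.q P.logDeg x j)

/-- The evaluated ciphertexts are polynomials of degree at most `⌈log₂ n⌉ - r`. All coefficients up
to that degree are sent. -/
def encHash (P : RingParams) (n : ℕ) (c : BV.Ciphertext P) : Val :=
  Val.list (List.ofFn fun i : Fin (addrBits n - P.logDeg + 1) => Ring2.enc (c.coeff i))

/-! ## Sparse recovery -/

/-- `x ∈ [-N, N] ^ n`. -/
def InBox {n : ℕ} (N : ℕ) (x : Fin n → ℤ) : Prop := ∀ i, |x i| ≤ (N : ℤ)

/-- `‖x‖₀` -/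
def sparsity {n : ℕ} (x : Fin n → ℤ) : ℕ := (Finset.univ.filter fun i => x i ≠ 0).card

/-- The query function of `k`-sparse recovery; `none` stands for `⊥`. -/
def sparseRecovery (k : ℕ) {n : ℕ} (x : Fin n → ℤ) : Option (Fin n → ℤ) :=
  if sparsity x ≤ k then some x else none

def encAnswer {n : ℕ} : Option (Fin n → ℤ) → Val
  | none => .nat 0
  | some x => .pair (.nat 1) (Val.sparseVec x)

/-- A linear measurement of vectors in `ℤ ^ n`: an integer matrix, whose `i`-th row is evaluated
modulo `modulus i`. (A measurement with integer values, which are bounded on `[-N, N] ^ n`, is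
the case of large moduli.) -/
structure Measurement (n : ℕ) where
  rows : ℕ
  modulus : Fin rows → ℕ
  modulus_pos : ∀ i, 0 < modulus i
  matrix : Matrix (Fin rows) (Fin n) ℤ

namespace Measurement

variable {n : ℕ} (Φ : Measurement n)

/-- The space of measurement results. -/
abbrev Result : Type := (i : Fin Φ.rows) → ZMod (Φ.modulus i)

def apply (x : Fin n → ℤ) : Φ.Result := fun i => (Φ.matrix.mulVec x i : ZMod (Φ.modulus i))

def enc (y : Φ.Result) : Val := Val.list (List.ofFn fun i => Val.nat (y i).val)

/-- Total bit length of the moduli: the bit length of a measurement result. -/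
def resultBits : ℕ := ∑ i, (Φ.modulus i).size

end Measurement

/-- A deterministic polynomial-time algorithm for relaxed `k`-sparse recovery of vectors in
`[-N, N] ^ n`: linear measurements `Φ n`, reconstruction maps, and programs for both. -/
structure RelaxedRecovery (k N : ℕ → ℕ) where
  Φ : (n : ℕ) → Measurement n
  report : (n : ℕ) → (Φ n).Result → (Fin n → ℤ)
  /-- The reconstruction stays in the range of the data. -/
  report_inBox : ∀ n (x : Fin n → ℤ), InBox (N n) x → InBox (N n) (report n ((Φ n).apply x))
  /-- Sparse vectors are recovered; nothing else is required of the reconstruction. -/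
  report_sparse : ∀ n (x : Fin n → ℤ), InBox (N n) x → sparsity x ≤ k n →
    report n ((Φ n).apply x) = x
  /-- Public description of the measurement, for measurements that are not uniform in `n`. -/
  descr : ℕ → Val
  measureProg : Prog
  reportProg : Prog
  measureTime : ℕ → ℕ
  reportTime : ℕ → ℕ
  measureProg_runs : ∀ n (x : Fin n → ℤ), InBox (N n) x →
    measureProg.RunsIn (.pair (.nat n) (.pair (descr n) (Val.vec x)))
      ((Φ n).enc ((Φ n).apply x)) (measureTime n)
  reportProg_runs : ∀ n (x : Fin n → ℤ), InBox (N n) x →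
    reportProg.RunsIn (.pair (.nat n) (.pair (descr n) ((Φ n).enc ((Φ n).apply x))))
      (Val.sparseVec (report n ((Φ n).apply x))) (reportTime n)
  descr_poly : PolyBounded fun n => (descr n).size
  resultBits_poly : PolyBounded fun n => (Φ n).resultBits
  measureTime_poly : PolyBounded measureTime
  reportTime_poly : PolyBounded reportTime

/-! ## Distributed protocols -/

/-- A single-round protocol with a coordinator and `T` servers for data in `ℤ ^ n`, in which all
randomness is used by the setup. -/
structure DistProt (n T : ℕ) (X : Type) where
  State : Type
  Packet : Type
  setup : PMF State
  server : State → (Fin n → ℤ) → Packet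
  coordinator : State → (Fin T → Packet) → X
  encState : State → Val
  encPacket : Packet → Val

/-- Data of `T` servers such that all subset sums are in `[-N, N] ^ n`. -/
def ValidData {n T : ℕ} (N : ℕ) (x : Fin T → Fin n → ℤ) : Prop :=
  ∀ S : Finset (Fin T), InBox N (∑ t ∈ S, x t)

/-- The white-box experiment: the adversary sees the state, which comprises all random choices of
the protocol, and picks the data of all servers. It wins if the response is wrong. -/
def DistProt.experiment {n T : ℕ} {X : Type} (D : DistProt n T X) (f : (Fin n → ℤ) → X)
    (N : ℕ) (A : Adversary) : PMF Prop :=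
  D.setup.bind fun ζ => (A.coinDist n).map fun ρ =>
    ∃ x : Fin T → Fin n → ℤ,
      A.Outputs n ρ (D.encState ζ) (Val.list (List.ofFn fun t => Val.vec (x t))) ∧
      ValidData N x ∧ D.coordinator ζ (fun t => D.server ζ (x t)) ≠ f (∑ t, x t)

/-- Bits exchanged with one server: the state that it receives and the packet that it sends. -/
def DistProt.communication {n T : ℕ} {X : Type} (D : DistProt n T X) (ζ : D.State)
    (x : Fin n → ℤ) : ℕ :=
  (D.encState ζ).size + (D.encPacket (D.server ζ x)).size

/-- On public parameters `pp`, the state and the data of a server, `prog` computes the packet of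
that server within `time` steps. -/
def DistProt.ServerRunsIn {n T : ℕ} {X : Type} (D : DistProt n T X) (prog : Prog) (pp : Val)
    (ζ : D.State) (x : Fin n → ℤ) (time : ℝ) : Prop :=
  prog.RunsIn (.pair pp (.pair (D.encState ζ) (Val.vec x))) (D.encPacket (D.server ζ x)) time

/-- On public parameters `pp`, the state and the packets of all servers, `prog` computes the
response of the coordinator within `time` steps. -/
def DistProt.CoordinatorRunsIn {n T : ℕ} {X : Type} (D : DistProt n T X) (prog : Prog) (pp : Val)
    (encResponse : X → Val) (ζ : D.State) (p : Fin T → D.Packet) (time : ℝ) : Prop :=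
  prog.RunsIn
    (.pair pp (.pair (D.encState ζ) (Val.list (List.ofFn fun i => D.encPacket (p i)))))
    (encResponse (D.coordinator ζ p)) time

/-- White-box adversarial robustness, for data bounded by `N`. -/
def WhiteBoxRobust {T : ℕ → ℕ} {X : ℕ → Type} (D : ∀ n, DistProt n (T n) (X n))
    (f : ∀ n, (Fin n → ℤ) → X n) (N : ℕ → ℕ) : Prop :=
  ∀ A : Adversary, Negligible fun n => prob ((D n).experiment (f n) (N n) A)

open Classical in
/-- The chunked protocol. The state consists of a pseudo-public key and `⌈log₂ n⌉`
pseudo-ciphertexts, uniform in `R_q ^ 2`. -/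
def chunkedProtocol {k N : ℕ → ℕ} (A : RelaxedRecovery k N) (P : RingParams) (n T : ℕ) :
    DistProt n T (Option (Fin n → ℤ)) where
  State := (P.R × P.R) × (Fin (addrBits n) → P.R × P.R)
  Packet := BV.Ciphertext P × (A.Φ n).Result
  setup := P.uniformPair.bind fun pk =>
    (iid (addrBits n) P.uniformPair).bind fun ct => PMF.pure (pk, ct)
  server ζ x := (chunkedHash P ζ.2 x, (A.Φ n).apply x)
  coordinator ζ p :=
    let x' := A.report n (∑ t, (p t).2)
    if sparsity x' ≤ k n ∧ chunkedHash P ζ.2 x' = ∑ t, (p t).1 then some x' else none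
  encState ζ := .pair (P.encPair ζ.1) (Val.list (List.ofFn fun i => P.encPair (ζ.2 i)))
  encPacket p := .pair (encHash P n p.1) ((A.Φ n).enc p.2)

/-- The public parameters, known to all parties. -/
def publicParams {k N : ℕ → ℕ} (A : RelaxedRecovery k N) (P : RingParams) (n : ℕ) : Val :=
  Val.list [.nat n, .nat (k n), .nat P.logDeg, .nat P.q,
    Val.list (List.ofFn fun i => .nat ((A.Φ n).modulus i)), A.descr n]

/-- A secret key, and independent encryptions under the matching public key of the binary digits of
the coordinate `m`. -/
def encryptedCoordinate (P : RingParams) (t n m : ℕ) :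
    PMF (P.R × (Fin (addrBits n) → P.R × P.R)) :=
  (BV.keyGen P t).bind fun key =>
    (independent (addrBits n) fun i =>
      BV.encrypt P t key.1 (if digit n m i then 1 else 0)).map fun ct => (key.2, ct)

end WBRecovery

end

open WBRecovery

/-! Efficiency. A selector ciphertext is a product, over the address bits from position log g on, of
factors c or 1 - c, where c encrypts the bit. The hash, a sum of selector times chunk, can therefore
be folded one bit at a time, replacing an even and an odd half by he + c (ho - he)
(`polyOf_hashList`). This takes n/g operations in R_q up to polylogarithmic factors, so each of them
must cost g up to such factors. The prime q is arbitrary and Z_q need not contain roots of unity of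
high order. Multiplication is therefore done by Nussbaumer's algorithm (`runs_fastMul`): a power y ^
2 ^ b = -1 makes y itself a root of unity, multiplication by powers of y is a signed shift
(`runs_addShift`), and no inverses are needed apart from a final exact division by a power of two.
All programs are verified with a weakest precondition that also bounds the cost (`Runs.of_wp`), and
`resources` collects the bounds.

Decryption. `Lifts a b B` says that a modulo q and b modulo t are reductions of one integer vector
with entries at most B. A ciphertext evaluated at the secret key lifts its message, with noise in
the multiples of t. Sums and products preserve the relation with explicit growth of B, and
decryption is exact as soon as 2 B < q (`Lifts.lift_eq`). Fresh noise is polynomially bounded by a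
Gaussian tail estimate (`pr_discreteGaussian_le`). The selectors multiply O(log n) factors, hence B
= n ^ O(log n), which stays below q because log q dominates log² n (`eventually_pow_lt_modulus`).
Finally t > 2 N keeps entries that differ as integers distinct modulo t.

Robustness. Let y be the sum of the data and x' its reconstruction. A wrong answer means that x' ≠ y
while the hashes agree: a collision at some coordinate m (`exists_collides_of_ne`). Were the
ciphertexts genuine encryptions of m, such a collision could exist only when decryption fails
(`genuine_le`). Whether the data of the adversary give a collision at m can be tested in polynomial
time, by running the measurement and the reconstruction on y; so the probability of finding one can
grow only negligibly when uniform states are exchanged for encryptions of m. The exchange is a chain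
of hybrids (`hybrid_unif_le`). First each uniform ciphertext becomes an encryption under a uniform
public key (`hybrid_step`), then the public key becomes genuine (`hybrid_le_genuine`). Each step
uses two Ring-LWE samples, scaled by the unit t, and the whole state is an affine function of these
samples. The coefficients of that function, which contain the randomness of all other ciphertexts,
are fixed to their best value and given to the distinguisher as advice (`exists_advantage_bound`). A
union bound over m costs a factor n.

The distinguisher must never accept when there is no collision, whatever the adversary outputs.
Hence the sum of the data is re-checked to lie in [-N, N] ^ n, and this half of the analysis uses a
partial-correctness calculus (`post`) in place of `wp`. -/

noncomputable section

set_option linter.unusedSimpArgs false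
set_option linter.unusedSectionVars false
set_option maxRecDepth 4000

namespace WBRecovery

/-! ## Running programs -/

/-- The program `p`, run on `v`, halts with output `b` after at most `t` steps. -/
def Runs (p : Prog) (v b : Val) (t : ℕ) : Prop := ∃ c ≤ t, Eval p p v b c

theorem Runs.weaken {p v b t t'} (h : Runs p v b t) (ht : t ≤ t') : Runs p v b t' :=
  let ⟨c, hc, he⟩ := h
  ⟨c, hc.trans ht, he⟩

/-- Cost bound for the multiplicative operations on `s`-bit numbers. -/
def opCost (s : ℕ) : ℕ := (s + 1) ^ 2

theorem two_mul_add_one_le_opCost (s : ℕ) : 2 * s + 1 ≤ opCost s := by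
  unfold opCost; nlinarith

/-- Weakest precondition, on numbers of at most `s` bits: `p` halts on `v` with an output `b` after
at most `c` steps such that `Q b c`. -/
def wp (s : ℕ) (r : Prog) : Prog → Val → (Val → ℕ → Prop) → Prop
  | .id, v, Q => Q v 1
  | .const k, _, Q => Q (.nat k) 1
  | .fst, .pair a _, Q => Q a 1
  | .fst, .nat _, _ => False
  | .snd, .pair _ b, Q => Q b 1
  | .snd, .nat _, _ => False
  | .pair f g, v, Q =>
      wp s r f v fun a m => wp s r g v fun b n => Q (.pair a b) (m + n + 1)
  | .comp g f, v, Q => wp s r f v fun a m => wp s r g a fun b n => Q b (m + n + 1)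
  | .cond c f g, v, Q => wp s r c v fun a m =>
      (a ≠ .nat 0 ∧ wp s r f v fun b n => Q b (m + n + 1)) ∨
        (a = .nat 0 ∧ wp s r g v fun b n => Q b (m + n + 1))
  | .add, .pair (.nat a) (.nat b), Q => a < 2 ^ s ∧ b < 2 ^ s ∧ Q (.nat (a + b)) (2 * s + 1)
  | .sub, .pair (.nat a) (.nat b), Q => a < 2 ^ s ∧ b < 2 ^ s ∧ Q (.nat (a - b)) (2 * s + 1)
  | .mul, .pair (.nat a) (.nat b), Q => a < 2 ^ s ∧ b < 2 ^ s ∧ Q (.nat (a * b)) (opCost s)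
  | .div, .pair (.nat a) (.nat b), Q => a < 2 ^ s ∧ b < 2 ^ s ∧ Q (.nat (a / b)) (opCost s)
  | .mod, .pair (.nat a) (.nat b), Q => a < 2 ^ s ∧ b < 2 ^ s ∧ Q (.nat (a % b)) (opCost s)
  | .add, _, _ => False
  | .sub, _, _ => False
  | .mul, _, _ => False
  | .div, _, _ => False
  | .mod, _, _ => False
  | .fix p, v, Q => ∃ b c, Runs p v b c ∧ Q b (c + 1)
  | .self, v, Q => ∃ b c, Runs r v b c ∧ Q b (c + 1)

theorem size_cost_linear {a b s : ℕ} (ha : a < 2 ^ s) (hb : b < 2 ^ s) :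
    a.size + b.size + 1 ≤ 2 * s + 1 := by
  have := Nat.size_le.2 ha
  have := Nat.size_le.2 hb
  omega

theorem size_cost_mul {a b s : ℕ} (ha : a < 2 ^ s) (hb : b < 2 ^ s) :
    (a.size + 1) * (b.size + 1) ≤ opCost s := by
  rw [opCost, sq]
  exact Nat.mul_le_mul (Nat.succ_le_succ (Nat.size_le.2 ha)) (Nat.succ_le_succ (Nat.size_le.2 hb))

/-- Soundness by induction on the program. The postcondition receives an upper bound of the cost in
place of the cost, so it need not be monotone. Calls through `fix` and `self` come with complete
runs, so no recursion is unfolded here. -/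
theorem exists_eval_of_wp {s : ℕ} {r p : Prog} {v : Val} {Q : Val → ℕ → Prop}
    (hw : wp s r p v Q) : ∃ b c t, c ≤ t ∧ Eval r p v b c ∧ Q b t := by
  induction p generalizing v Q with
  | id => exact ⟨_, _, _, le_rfl, .id _ _, hw⟩
  | const k => exact ⟨_, _, _, le_rfl, .const _ _ _, hw⟩
  | fst =>
    cases v with
    | nat => exact hw.elim
    | pair a b => exact ⟨_, _, _, le_rfl, .fst _ _ _, hw⟩
  | snd =>
    cases v with
    | nat => exact hw.elim
    | pair a b => exact ⟨_, _, _, le_rfl, .snd _ _ _, hw⟩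
  | pair f g hf hg =>
    obtain ⟨a, m, m', hm, ha, hw⟩ := hf hw
    obtain ⟨b, n, n', hn, hb, hw⟩ := hg hw
    exact ⟨_, _, _, by omega, .pair ha hb, hw⟩
  | comp g f hg hf =>
    obtain ⟨a, m, m', hm, ha, hw⟩ := hf hw
    obtain ⟨b, n, n', hn, hb, hw⟩ := hg hw
    exact ⟨_, _, _, by omega, .comp ha hb, hw⟩
  | cond c f g hc hf hg =>
    obtain ⟨a, m, m', hm, ha, hw⟩ := hc hw
    rcases hw with ⟨hne, hw⟩ | ⟨rfl, hw⟩
    · obtain ⟨b, n, n', hn, hb, hw⟩ := hf hw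
      exact ⟨_, _, _, by omega, .cond_true ha hne hb, hw⟩
    · obtain ⟨b, n, n', hn, hb, hw⟩ := hg hw
      exact ⟨_, _, _, by omega, .cond_false ha hb, hw⟩
  | add =>
    rcases v with _ | ⟨_ | _, _ | _⟩ <;> simp only [wp] at hw
    exact ⟨_, _, _, size_cost_linear hw.1 hw.2.1, .add _ _ _, hw.2.2⟩
  | sub =>
    rcases v with _ | ⟨_ | _, _ | _⟩ <;> simp only [wp] at hw
    exact ⟨_, _, _, size_cost_linear hw.1 hw.2.1, .sub _ _ _, hw.2.2⟩
  | mul =>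
    rcases v with _ | ⟨_ | _, _ | _⟩ <;> simp only [wp] at hw
    exact ⟨_, _, _, size_cost_mul hw.1 hw.2.1, .mul _ _ _, hw.2.2⟩
  | div =>
    rcases v with _ | ⟨_ | _, _ | _⟩ <;> simp only [wp] at hw
    exact ⟨_, _, _, size_cost_mul hw.1 hw.2.1, .div _ _ _, hw.2.2⟩
  | mod =>
    rcases v with _ | ⟨_ | _, _ | _⟩ <;> simp only [wp] at hw
    exact ⟨_, _, _, size_cost_mul hw.1 hw.2.1, .mod _ _ _, hw.2.2⟩
  | fix p _ =>
    obtain ⟨b, t, ⟨c, hc, he⟩, hq⟩ := hw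
    exact ⟨b, c + 1, t + 1, by omega, .fix he, hq⟩
  | self =>
    obtain ⟨b, t, ⟨c, hc, he⟩, hq⟩ := hw
    exact ⟨b, c + 1, t + 1, by omega, .self he, hq⟩

/-- Every program below is verified through this: unfold `wp`, and answer each `self` with the
induction hypothesis and each call with the run of the called program. -/
theorem Runs.of_wp (s : ℕ) {p : Prog} {v b : Val} {t : ℕ}
    (hw : wp s p p v fun b' c => b' = b ∧ c ≤ t) : Runs p v b t := by
  obtain ⟨b', c, t', hc, he, rfl, ht⟩ := exists_eval_of_wp hw
  exact ⟨c, hc.trans ht, he⟩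

/-! ## Programs with variables

An environment is a list of values. -/

namespace Prog

def arg : ℕ → Prog
  | 0 => .fst
  | i + 1 => .comp (arg i) .snd

/-- A list of expressions, all evaluated in the same environment. -/
def tup : List Prog → Prog
  | [] => .const 0
  | e :: es => .pair e (tup es)

/-- A call of the closed program `p`. -/
def call (p : Prog) (es : List Prog) : Prog := .comp (.fix p) (tup es)

/-- A recursive call. -/
def again (es : List Prog) : Prog := .comp .self (tup es)

/-- Evaluates `e` and puts its value in front of the environment of the program `body`. -/
def letIn (e body : Prog) : Prog := .comp body (.pair e .id)

/-- A binary operation. -/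
def op (o e f : Prog) : Prog := .comp o (.pair e f)

def head (e : Prog) : Prog := .comp .fst e
def tail (e : Prog) : Prog := .comp .snd e

end Prog

namespace Val

theorem list_nil : list [] = nat 0 := rfl
theorem list_cons (a : Val) (l : List Val) : list (a :: l) = pair a (list l) := rfl

theorem pair_ne_nat (a b : Val) (n : ℕ) : pair a b ≠ nat n := nofun

theorem nat_ne_zero {n : ℕ} (h : n ≠ 0) : nat n ≠ nat 0 := fun h' => h (by injection h')

theorem nat_eq_zero {n : ℕ} (h : n = 0) : nat n = nat 0 := by rw [h]

end Val

open Prog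

/-! ## Powers of two -/

def powTwo : Prog :=
  .cond (arg 0) (op .mul (.const 2) (again [op .sub (arg 0) (.const 1)])) (.const 1)

/-- As in all later cost bounds, the numerical constant is generous: with `opCost s` treated as an
atom, the count of steps becomes linear arithmetic. -/
theorem runs_powTwo {s k : ℕ} (hk : k < s) :
    Runs powTwo (.list [.nat k]) (.nat (2 ^ k)) ((k + 1) * (20 * opCost s)) := by
  have hW := two_mul_add_one_le_opCost s
  induction k with
  | zero =>
    refine .of_wp s ?_
    simp only [powTwo, wp, arg, Val.list_cons, again, tup, op]
    exact .inr ⟨trivial, rfl, by omega⟩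
  | succ k ih =>
    refine .of_wp s ?_
    simp only [powTwo, wp, arg, Val.list_cons, again, tup, op]
    have h1 : 2 ^ k < 2 ^ s := Nat.pow_lt_pow_right (by norm_num) (by omega)
    have h2 : k + 1 < 2 ^ s := lt_trans hk Nat.lt_two_pow_self
    have h3 : 2 ^ 1 < 2 ^ s := Nat.pow_lt_pow_right (by norm_num) (by omega)
    refine .inl ⟨Val.nat_ne_zero (by omega), h2, by omega, _, _, ih (by omega), by omega, h1, ?_, ?_⟩
    · rw [pow_succ']
    · rw [Nat.succ_mul (k + 1)]; omega

/-! ## Trees of coefficients -/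

/-- Complete binary trees of depth `d` with leaves less than `Q`. -/
def Tree (Q : ℕ) : ℕ → Val → Prop
  | 0, v => ∃ a < Q, v = .nat a
  | d + 1, v => ∃ u w, v = .pair u w ∧ Tree Q d u ∧ Tree Q d w

variable {S : Type} [CommRing S]

/-- Polynomial in `z` with coefficients in a tree of depth `k`, by increasing bits of the exponent. -/
def evOuter (φ : Val → S) : ℕ → Val → S → S
  | 0, v, _ => φ v
  | k + 1, .pair u v, z => evOuter φ k u (z ^ 2) + z * evOuter φ k v (z ^ 2)
  | _ + 1, .nat _, _ => 0

def leaf : Val → S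
  | .nat a => a
  | .pair _ _ => 0

/-- Polynomial with coefficients in a tree of depth `d`. -/
def evTree (d : ℕ) (v : Val) (x : S) : S := evOuter leaf d v x

/-- Polynomial in `y` and `z`. -/
def evTwo (k b : ℕ) (v : Val) (z y : S) : S := evOuter (fun w => evTree b w y) k v z

/-- Trees branch on the lowest bit of the exponent first. Cutting a tree at depth `a` thus writes
the exponent as i + 2 ^ a * j, and makes it a polynomial in x whose coefficients are polynomials in
x ^ 2 ^ a. This regrouping costs nothing, and it is the substitution on which Nussbaumer's algorithm
rests. -/
theorem evTree_add (a b : ℕ) (v : Val) (x : S) :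
    evTree (a + b) v x = evTwo a b v x (x ^ 2 ^ a) := by
  induction a generalizing v x with
  | zero => simp [evTwo, evOuter]
  | succ a ih =>
    rw [Nat.succ_add, evTwo, evTree]
    cases v with
    | nat => simp [evOuter]
    | pair u v =>
      have h : x ^ 2 ^ (a + 1) = (x ^ 2) ^ 2 ^ a := by rw [← pow_mul, pow_succ']
      rw [evOuter, evOuter, h]
      exact congrArg₂ (· + x * ·) (ih _ _) (ih _ _)

/-- On input `k, b, h, Q, u, v`: adds `u` and `y ^ h * v`, coefficientwise for the outer variable,
where `y ^ 2 ^ b = -1`. -/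
def addShift : Prog :=
  .cond (arg 0)
    (.pair
      (again [op .sub (arg 0) (.const 1), arg 1, arg 2, arg 3, head (arg 4), head (arg 5)])
      (again [op .sub (arg 0) (.const 1), arg 1, arg 2, arg 3, tail (arg 4), tail (arg 5)]))
    (.cond (arg 1)
      (letIn (op .div (arg 2) (.const 2)) (letIn (op .sub (arg 2) (.const 1))
        (.cond (op .mod (arg 4) (.const 2))
          (.pair
            (again [.const 0, arg 0, op .add (arg 1) (.const 1), arg 5, head (arg 6), tail (arg 7)])
            (again [.const 0, arg 0, arg 1, arg 5, tail (arg 6), head (arg 7)]))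
          (.pair
            (again [.const 0, arg 0, arg 1, arg 5, head (arg 6), head (arg 7)])
            (again [.const 0, arg 0, arg 1, arg 5, tail (arg 6), tail (arg 7)])))))
      (.cond (op .mod (arg 2) (.const 2))
        (op .mod (op .add (arg 4) (op .sub (arg 3) (arg 5))) (arg 3))
        (op .mod (op .add (arg 4) (arg 5)) (arg 3))))

theorem natCast_mod_of_eq_zero {Q : ℕ} (hQ : (Q : S) = 0) (a : ℕ) : ((a % Q : ℕ) : S) = a := by
  conv_rhs => rw [← Nat.mod_add_div a Q]
  simp [hQ]

/-- A negacyclic shift in linear time: passing to y ^ 2 halves the shift, an odd shift swaps the two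
subtrees, and at the leaves y = -1, so that only a sign is left. In particular h = 2 ^ b subtracts.
-/
theorem runs_addShift_inner {s b h Q : ℕ} {u v : Val} (hs : 2 ≤ s) (hQ : 2 * Q < 2 ^ s)
    (hb : b < 2 ^ s) (hh : h < 2 ^ s) (hu : Tree Q b u) (hv : Tree Q b v) :
    ∃ w, Runs addShift (.list [.nat 0, .nat b, .nat h, .nat Q, u, v]) w
        ((2 * 2 ^ b - 1) * (100 * opCost s)) ∧ Tree Q b w ∧
      ∀ (S : Type) [CommRing S] (y : S), (Q : S) = 0 → y ^ 2 ^ b = -1 →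
        evTree b w y = evTree b u y + y ^ h * evTree b v y := by
  have hW := two_mul_add_one_le_opCost s
  have h4 : 2 ^ 2 ≤ 2 ^ s := Nat.pow_le_pow_right (by norm_num) hs
  induction b generalizing h u v with
  | zero =>
    obtain ⟨a, ha, rfl⟩ := hu
    obtain ⟨c, hc, rfl⟩ := hv
    rcases Nat.mod_two_eq_zero_or_one h with h0 | h1
    · refine ⟨.nat ((a + c) % Q), .of_wp s ?_, ⟨_, Nat.mod_lt _ (by omega), rfl⟩, ?_⟩
      · simp only [addShift, wp, arg, Val.list_cons, again, tup, op, letIn, head, tail]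
        refine .inr ⟨trivial, .inr ⟨trivial, hh, by omega, .inr ⟨Val.nat_eq_zero h0, by omega, by omega,
          by omega, by omega, trivial, by omega⟩⟩⟩
      · intro S _ y hQ0 hy
        simp only [pow_zero, pow_one] at hy
        simp only [evTree, evOuter, leaf, natCast_mod_of_eq_zero hQ0]
        rw [hy, (Nat.even_iff.2 h0).neg_one_pow]
        push_cast; ring
    · refine ⟨.nat ((a + (Q - c)) % Q), .of_wp s ?_, ⟨_, Nat.mod_lt _ (by omega), rfl⟩, ?_⟩
      · simp only [addShift, wp, arg, Val.list_cons, again, tup, op, letIn, head, tail]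
        refine .inr ⟨trivial, .inr ⟨trivial, hh, by omega, .inl ⟨Val.nat_ne_zero (by omega), by omega,
          by omega, by omega, by omega, by omega, by omega, trivial, by omega⟩⟩⟩
      · intro S _ y hQ0 hy
        simp only [pow_zero, pow_one] at hy
        simp only [evTree, evOuter, leaf, natCast_mod_of_eq_zero hQ0]
        rw [hy, (Nat.odd_iff.2 h1).neg_one_pow]
        push_cast [hc.le, hQ0]; ring
  | succ b ih =>
    obtain ⟨u0, u1, rfl, hu0, hu1⟩ := hu
    obtain ⟨v0, v1, rfl, hv0, hv1⟩ := hv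
    have hpos : 1 ≤ 2 ^ b := Nat.one_le_two_pow
    have hcost : (2 * 2 ^ (b + 1) - 1) * (100 * opCost s) =
      2 * ((2 * 2 ^ b - 1) * (100 * opCost s)) + 100 * opCost s := by
      have : 2 * 2 ^ (b + 1) - 1 = 2 * (2 * 2 ^ b - 1) + 1 := by rw [pow_succ]; omega
      rw [this]; ring
    rw [hcost]
    rcases Nat.mod_two_eq_zero_or_one h with h0 | h1
    · obtain ⟨w0, hr0, ht0, he0⟩ := ih (h := h / 2) (by omega) (by omega) hu0 hv0
      obtain ⟨w1, hr1, ht1, he1⟩ := ih (h := h / 2) (by omega) (by omega) hu1 hv1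
      refine ⟨.pair w0 w1, .of_wp s ?_, ⟨_, _, rfl, ht0, ht1⟩, ?_⟩
      · simp only [addShift, wp, arg, Val.list_cons, again, tup, op, letIn, head, tail]
        exact .inr ⟨trivial, .inl ⟨Val.nat_ne_zero (by omega), hh, by omega, by omega, by omega, hh,
          by omega, .inr ⟨Val.nat_eq_zero h0, _, _, hr0, _, _, hr1, rfl, by omega⟩⟩⟩
      · intro S _ y hQ0 hy
        have hy' : (y ^ 2) ^ 2 ^ b = -1 := by rw [← pow_mul, ← pow_succ', hy]
        have e0 := he0 S (y ^ 2) hQ0 hy'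
        have e1 := he1 S (y ^ 2) hQ0 hy'
        have hp : (y ^ 2) ^ (h / 2) = y ^ h := by rw [← pow_mul]; congr 1; omega
        rw [hp] at e0 e1
        simp only [evTree, evOuter] at e0 e1 ⊢
        rw [e0, e1]; ring
    -- For odd h, y ^ h (v0 + y v1) = (y ^ 2) ^ (h / 2 + 1) v1 + y (y ^ 2) ^ (h / 2) v0, where v0
    -- and v1 are taken at y ^ 2: the odd part of v joins the even part of u with one more shift.
    · obtain ⟨w0, hr0, ht0, he0⟩ := ih (h := h / 2 + 1) (by omega) (by omega) hu0 hv1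
      obtain ⟨w1, hr1, ht1, he1⟩ := ih (h := h / 2) (by omega) (by omega) hu1 hv0
      refine ⟨.pair w0 w1, .of_wp s ?_, ⟨_, _, rfl, ht0, ht1⟩, ?_⟩
      · simp only [addShift, wp, arg, Val.list_cons, again, tup, op, letIn, head, tail]
        exact .inr ⟨trivial, .inl ⟨Val.nat_ne_zero (by omega), hh, by omega, by omega, by omega, hh,
          by omega, .inl ⟨Val.nat_ne_zero (by omega), by omega, by omega, _, _, hr0, _, _, hr1, rfl, by omega⟩⟩⟩
      · intro S _ y hQ0 hy
        have hy' : (y ^ 2) ^ 2 ^ b = -1 := by rw [← pow_mul, ← pow_succ', hy]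
        have e0 := he0 S (y ^ 2) hQ0 hy'
        have e1 := he1 S (y ^ 2) hQ0 hy'
        have hp : y ^ h = y * (y ^ 2) ^ (h / 2) := by
          rw [← pow_mul, ← pow_succ']; congr 1; omega
        rw [hp]
        simp only [evTree, evOuter] at e0 e1 ⊢
        rw [e0, e1]; ring

/-- `2 * 2 ^ k - 1` is the number of nodes of a complete binary tree of depth `k`. This is the
recurrence for a program that spends `C` at every node. -/
theorem two_pow_mul_cost (k C : ℕ) :
    (2 * 2 ^ (k + 1) - 1) * C = 2 * ((2 * 2 ^ k - 1) * C) + C := by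
  have hpos : 1 ≤ 2 ^ k := Nat.one_le_two_pow
  have : 2 * 2 ^ (k + 1) - 1 = 2 * (2 * 2 ^ k - 1) + 1 := by rw [pow_succ]; omega
  rw [this]; ring

theorem two_pow_mul_cost_le (k c C : ℕ) :
    (2 * 2 ^ k - 1) * (c * C) ≤ 2 * c * (2 ^ k * C) := by
  calc (2 * 2 ^ k - 1) * (c * C) ≤ (2 * 2 ^ k) * (c * C) := Nat.mul_le_mul_right _ (Nat.sub_le _ _)
    _ = _ := by ring

theorem runs_addShift {s k b h Q : ℕ} {u v : Val} (hs : 2 ≤ s) (hQ : 2 * Q < 2 ^ s)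
    (hk : k < 2 ^ s) (hb : b < 2 ^ s) (hh : h < 2 ^ s) (hu : Tree Q (k + b) u)
    (hv : Tree Q (k + b) v) :
    ∃ w, Runs addShift (.list [.nat k, .nat b, .nat h, .nat Q, u, v]) w
        (200 * (2 ^ (k + b) * opCost s)) ∧ Tree Q (k + b) w ∧
      ∀ (S : Type) [CommRing S] (y z : S), (Q : S) = 0 → y ^ 2 ^ b = -1 →
        evTwo k b w z y = evTwo k b u z y + y ^ h * evTwo k b v z y := by
  suffices H : ∃ w, Runs addShift (.list [.nat k, .nat b, .nat h, .nat Q, u, v]) w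
        ((2 * 2 ^ (k + b) - 1) * (100 * opCost s)) ∧ Tree Q (k + b) w ∧
      ∀ (S : Type) [CommRing S] (y z : S), (Q : S) = 0 → y ^ 2 ^ b = -1 →
        evTwo k b w z y = evTwo k b u z y + y ^ h * evTwo k b v z y by
    obtain ⟨w, hr, hw⟩ := H
    exact ⟨w, hr.weaken (two_pow_mul_cost_le _ _ _), hw⟩
  have hW := two_mul_add_one_le_opCost s
  have h4 : 2 ^ 2 ≤ 2 ^ s := Nat.pow_le_pow_right (by norm_num) hs
  induction k generalizing u v with
  | zero =>
    rw [Nat.zero_add] at hu hv ⊢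
    obtain ⟨w, hr, ht, he⟩ := runs_addShift_inner hs hQ hb hh hu hv
    exact ⟨w, hr, ht, fun S _ y _ => he S y⟩
  | succ k ih =>
    rw [Nat.succ_add] at hu hv ⊢
    obtain ⟨u0, u1, rfl, hu0, hu1⟩ := hu
    obtain ⟨v0, v1, rfl, hv0, hv1⟩ := hv
    rw [two_pow_mul_cost]
    obtain ⟨w0, hr0, ht0, he0⟩ := ih (by omega) hu0 hv0
    obtain ⟨w1, hr1, ht1, he1⟩ := ih (by omega) hu1 hv1
    refine ⟨.pair w0 w1, .of_wp s ?_, ⟨_, _, rfl, ht0, ht1⟩, ?_⟩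
    · simp only [addShift, wp, arg, Val.list_cons, again, tup, op, letIn, head, tail]
      exact .inl ⟨Val.nat_ne_zero (by omega), hk, by omega, _, _, hr0, hk, by omega, _, _, hr1, rfl,
        by omega⟩
    · intro S _ y z hQ0 hy
      have e0 := he0 S y (z ^ 2) hQ0 hy
      have e1 := he1 S y (z ^ 2) hQ0 hy
      simp only [evTwo, evOuter] at e0 e1 ⊢
      rw [e0, e1]; ring

/-- On input `k, i, A`: the coefficients of `A`, a polynomial of degree less than `2 ^ (k + 1)`, from
`0` (if `i = 0`) or `2 ^ k` on. -/
def half : Prog :=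
  .cond (arg 0)
    (.pair (again [op .sub (arg 0) (.const 1), arg 1, head (arg 2)])
      (again [op .sub (arg 0) (.const 1), arg 1, tail (arg 2)]))
    (.cond (arg 1) (tail (arg 2)) (head (arg 2)))

/-- The top bit of an exponent below 2 ^ (k + 1) is the branch taken last, at depth k. The lower and
the upper half of the coefficients are found by descending k levels and keeping one child; `join` is
the inverse. -/
theorem runs_half {s k d Q : ℕ} {A : Val} (hs : 2 ≤ s) (hk : k < 2 ^ s) (hkd : k ≤ d)
    (hA : Tree Q (d + 1) A) :
    ∃ A₀ A₁, Runs half (.list [.nat k, .nat 0, A]) A₀ (100 * (2 ^ k * opCost s)) ∧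
      Runs half (.list [.nat k, .nat 1, A]) A₁ (100 * (2 ^ k * opCost s)) ∧
      Tree Q d A₀ ∧ Tree Q d A₁ ∧
      ∀ (S : Type) [CommRing S] (φ : Val → S) (z : S),
        evOuter φ (k + 1) A z = evOuter φ k A₀ z + z ^ 2 ^ k * evOuter φ k A₁ z := by
  suffices H : ∃ A₀ A₁, Runs half (.list [.nat k, .nat 0, A]) A₀ ((2 * 2 ^ k - 1) * (50 * opCost s)) ∧
      Runs half (.list [.nat k, .nat 1, A]) A₁ ((2 * 2 ^ k - 1) * (50 * opCost s)) ∧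
      Tree Q d A₀ ∧ Tree Q d A₁ ∧
      ∀ (S : Type) [CommRing S] (φ : Val → S) (z : S),
        evOuter φ (k + 1) A z = evOuter φ k A₀ z + z ^ 2 ^ k * evOuter φ k A₁ z by
    obtain ⟨A₀, A₁, h0, h1, h⟩ := H
    exact ⟨A₀, A₁, h0.weaken (two_pow_mul_cost_le _ _ _), h1.weaken (two_pow_mul_cost_le _ _ _), h⟩
  have hW := two_mul_add_one_le_opCost s
  have h4 : 2 ^ 2 ≤ 2 ^ s := Nat.pow_le_pow_right (by norm_num) hs
  induction k generalizing d A with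
  | zero =>
    obtain ⟨A0, A1, rfl, h0, h1⟩ := hA
    refine ⟨A0, A1, .of_wp s ?_, .of_wp s ?_, h0, h1, ?_⟩
    · simp only [half, wp, arg, Val.list_cons, again, tup, op, head, tail]
      exact .inr ⟨trivial, .inr ⟨trivial, trivial, by omega⟩⟩
    · simp only [half, wp, arg, Val.list_cons, again, tup, op, head, tail]
      exact .inr ⟨trivial, .inl ⟨Val.nat_ne_zero one_ne_zero, trivial, by omega⟩⟩
    · intro S _ φ z
      simp [evOuter]
  | succ k ih =>
    obtain ⟨A0, A1, rfl, h0, h1⟩ := hA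
    obtain ⟨d, rfl⟩ : ∃ d', d = d' + 1 := ⟨d - 1, by omega⟩
    obtain ⟨A00, A01, r00, r01, t00, t01, e0⟩ := ih (by omega) (by omega) h0
    obtain ⟨A10, A11, r10, r11, t10, t11, e1⟩ := ih (by omega) (by omega) h1
    rw [two_pow_mul_cost]
    refine ⟨.pair A00 A10, .pair A01 A11, .of_wp s ?_, .of_wp s ?_, ⟨_, _, rfl, t00, t10⟩,
      ⟨_, _, rfl, t01, t11⟩, ?_⟩
    · simp only [half, wp, arg, Val.list_cons, again, tup, op, head, tail]
      exact .inl ⟨Val.nat_ne_zero (by omega), hk, by omega, _, _, r00, hk, by omega, _, _, r10, rfl,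
        by omega⟩
    · simp only [half, wp, arg, Val.list_cons, again, tup, op, head, tail]
      exact .inl ⟨Val.nat_ne_zero (by omega), hk, by omega, _, _, r01, hk, by omega, _, _, r11, rfl,
        by omega⟩
    · intro S _ φ z
      have e0 := e0 S φ (z ^ 2)
      have e1 := e1 S φ (z ^ 2)
      rw [evOuter, e0, e1, evOuter, evOuter]
      have : z ^ 2 ^ (k + 1) = (z ^ 2) ^ 2 ^ k := by rw [← pow_mul, pow_succ']
      rw [this]; ring

/-- On input `k, u, v`: `u + z ^ 2 ^ k * v`, for polynomials in `z` of degree less than `2 ^ k`. -/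
def join : Prog :=
  .cond (arg 0)
    (.pair (again [op .sub (arg 0) (.const 1), head (arg 1), head (arg 2)])
      (again [op .sub (arg 0) (.const 1), tail (arg 1), tail (arg 2)]))
    (.pair (arg 1) (arg 2))

theorem runs_join {s k d Q : ℕ} {u v : Val} (hs : 2 ≤ s) (hk : k < 2 ^ s) (hkd : k ≤ d)
    (hu : Tree Q d u) (hv : Tree Q d v) :
    ∃ w, Runs join (.list [.nat k, u, v]) w (100 * (2 ^ k * opCost s)) ∧ Tree Q (d + 1) w ∧
      ∀ (S : Type) [CommRing S] (φ : Val → S) (z : S),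
        evOuter φ (k + 1) w z = evOuter φ k u z + z ^ 2 ^ k * evOuter φ k v z := by
  suffices H : ∃ w, Runs join (.list [.nat k, u, v]) w ((2 * 2 ^ k - 1) * (50 * opCost s)) ∧
      Tree Q (d + 1) w ∧ ∀ (S : Type) [CommRing S] (φ : Val → S) (z : S),
        evOuter φ (k + 1) w z = evOuter φ k u z + z ^ 2 ^ k * evOuter φ k v z by
    obtain ⟨w, hr, hw⟩ := H
    exact ⟨w, hr.weaken (two_pow_mul_cost_le _ _ _), hw⟩
  have hW := two_mul_add_one_le_opCost s
  have h4 : 2 ^ 2 ≤ 2 ^ s := Nat.pow_le_pow_right (by norm_num) hs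
  induction k generalizing d u v with
  | zero =>
    refine ⟨.pair u v, .of_wp s ?_, ⟨_, _, rfl, hu, hv⟩, ?_⟩
    · simp only [join, wp, arg, Val.list_cons, again, tup, op, head, tail]
      exact .inr ⟨trivial, trivial, by omega⟩
    · intro S _ φ z
      simp [evOuter]
  | succ k ih =>
    obtain ⟨d, rfl⟩ : ∃ d', d = d' + 1 := ⟨d - 1, by omega⟩
    obtain ⟨u0, u1, rfl, hu0, hu1⟩ := hu
    obtain ⟨v0, v1, rfl, hv0, hv1⟩ := hv
    obtain ⟨w0, hr0, ht0, he0⟩ := ih (by omega) (by omega) hu0 hv0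
    obtain ⟨w1, hr1, ht1, he1⟩ := ih (by omega) (by omega) hu1 hv1
    rw [two_pow_mul_cost]
    refine ⟨.pair w0 w1, .of_wp s ?_, ⟨_, _, rfl, ht0, ht1⟩, ?_⟩
    · simp only [join, wp, arg, Val.list_cons, again, tup, op, head, tail]
      exact .inl ⟨Val.nat_ne_zero (by omega), hk, by omega, _, _, hr0, hk, by omega, _, _, hr1, rfl,
        by omega⟩
    · intro S _ φ z
      have e0 := he0 S φ (z ^ 2)
      have e1 := he1 S φ (z ^ 2)
      rw [evOuter, e0, e1, evOuter, evOuter]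
      have : z ^ 2 ^ (k + 1) = (z ^ 2) ^ 2 ^ k := by rw [← pow_mul, pow_succ']
      rw [this]; ring

/-! ## Nussbaumer's fast multiplication -/

/-- The factor by which `fastMul` multiplies a product of polynomials modulo `y ^ 2 ^ b + 1`. -/
def mulScale (b : ℕ) : ℕ :=
  if b ≤ 1 then 1 else 2 * 2 ^ (b / 2) * mulScale (b - b / 2)
termination_by b
decreasing_by omega

/-- On input `b, k, e, Q, A, B`: the product of `A` and `B` in `ℤ_Q[y, z]` modulo `y ^ 2 ^ b + 1` and
`z ^ 2 ^ k - y ^ e`, times `2 ^ k * mulScale b`. -/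
def fastMul : Prog :=
  .cond (arg 1)
    (letIn (op .sub (arg 1) (.const 1)) <| letIn (op .div (arg 3) (.const 2)) <|
      letIn (call powTwo [arg 2]) <| letIn (op .add (arg 1) (arg 0)) <|
      letIn (call half [arg 3, .const 0, arg 8]) <|
      letIn (call half [arg 4, .const 1, arg 9]) <|
      letIn (call half [arg 5, .const 0, arg 11]) <|
      letIn (call half [arg 6, .const 1, arg 12]) <|
      letIn (again [arg 8, arg 7, arg 6, arg 11,
        call addShift [arg 7, arg 8, arg 6, arg 11, arg 3, arg 2],
        call addShift [arg 7, arg 8, arg 6, arg 11, arg 1, arg 0]]) <|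
      letIn (again [arg 9, arg 8, arg 5, arg 12,
        call addShift [arg 8, arg 9, arg 5, arg 12, arg 4, arg 3],
        call addShift [arg 8, arg 9, arg 5, arg 12, arg 2, arg 1]]) <|
      call join [arg 9, call addShift [arg 9, arg 10, .const 0, arg 13, arg 1, arg 0],
        call addShift [arg 9, arg 10, op .sub (op .add (arg 7) (arg 7)) (arg 8), arg 13,
          call addShift [arg 9, arg 10, arg 7, arg 13, arg 1, arg 1],
          call addShift [arg 9, arg 10, arg 7, arg 13, arg 1, arg 0]]])
    (.cond (arg 0)
      (.cond (op .sub (arg 0) (.const 1))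
        (letIn (op .div (arg 0) (.const 2)) <| letIn (op .sub (arg 1) (arg 0)) <|
          letIn (call powTwo [arg 0]) <|
          letIn (again [arg 1, arg 2, .const 0, arg 6, arg 7, arg 8]) <|
          letIn (again [arg 2, arg 3, arg 1, arg 7, arg 8, arg 9]) <|
          call addShift [arg 4, arg 3, .const 1, arg 8,
            call addShift [arg 4, arg 3, .const 0, arg 8, arg 1, arg 0],
            call addShift [arg 4, arg 3, arg 2, arg 8, arg 1, arg 0]])
        (.pair
          (op .mod (op .add (op .mul (head (arg 4)) (head (arg 5)))
            (op .sub (arg 3) (op .mod (op .mul (tail (arg 4)) (tail (arg 5))) (arg 3)))) (arg 3))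
          (op .mod (op .add (op .mul (head (arg 4)) (tail (arg 5)))
            (op .mul (tail (arg 4)) (head (arg 5)))) (arg 3))))
      (op .mod (op .mul (arg 4) (arg 5)) (arg 3)))

theorem map_evOuter {S' : Type} [CommRing S'] (f : S →+* S') (φ : Val → S) (k : ℕ) (v : Val) (z : S) :
    f (evOuter φ k v z) = evOuter (fun w => f (φ w)) k v (f z) := by
  induction k generalizing v z with
  | zero => rfl
  | succ k ih =>
    cases v with
    | nat => simp [evOuter]
    | pair u v => simp [evOuter, ih]

theorem map_leaf {S' : Type} [CommRing S'] (f : S →+* S') (v : Val) : f (leaf v) = leaf v := by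
  cases v <;> simp [leaf]

theorem map_evTree {S' : Type} [CommRing S'] (f : S →+* S') (d : ℕ) (v : Val) (x : S) :
    f (evTree d v x) = evTree d v (f x) := by
  simp [evTree, map_evOuter, map_leaf]

theorem map_evTwo {S' : Type} [CommRing S'] (f : S →+* S') (k b : ℕ) (v : Val) (z y : S) :
    f (evTwo k b v z y) = evTwo k b v (f z) (f y) := by
  simp [evTwo, map_evOuter, map_evTree]

/-- The variable is a power X ^ j because `evOuter` squares it at each level; only j = 1 is used. -/
theorem natDegree_evOuter_le (φ : Val → S) (k : ℕ) (v : Val) (j : ℕ) :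
    (evOuter (fun w => C (φ w)) k v (X ^ j : S[X])).natDegree ≤ j * (2 ^ k - 1) := by
  induction k generalizing v j with
  | zero => simp [evOuter]
  | succ k ih =>
    cases v with
    | nat => simp [evOuter]
    | pair u v =>
      have h1 : 1 ≤ 2 ^ k := Nat.one_le_two_pow
      have e : j * (2 ^ (k + 1) - 1) = j + j * 2 * (2 ^ k - 1) := by
        have : 2 ^ (k + 1) - 1 = 1 + 2 * (2 ^ k - 1) := by rw [pow_succ]; omega
        rw [this]; ring
      rw [evOuter, ← pow_mul, e]
      refine (natDegree_add_le _ _).trans (max_le ((ih u (j * 2)).trans (Nat.le_add_left _ _)) ?_)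
      exact natDegree_mul_le.trans (Nat.add_le_add (natDegree_X_pow_le _) (ih v (j * 2)))

/-- The recombination step of Nussbaumer's algorithm: no wraparound occurs. -/
theorem eval_eq_of_dvd (m : ℕ) (hm : 0 < m) (c x : S) (a b p₁ p₂ : S[X])
    (ha : a.natDegree ≤ m - 1) (hb : b.natDegree ≤ m - 1)
    (hp₁ : p₁.natDegree ≤ m - 1) (hp₂ : p₂.natDegree ≤ m - 1)
    (h₁ : X ^ m - 1 ∣ p₁ - C c * (a * b)) (h₂ : X ^ m + 1 ∣ p₂ - C c * (a * b)) :
    (p₁.eval x + p₂.eval x) + x ^ m * (p₁.eval x - p₂.eval x) = 2 * c * (a.eval x * b.eval x) := by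
  nontriviality S
  -- Since (1 + X ^ m) + (1 - X ^ m) = 2, the combination p₁ (1 + X ^ m) + p₂ (1 - X ^ m) is
  -- congruent to 2 c a b modulo (X ^ m - 1)(X ^ m + 1) = X ^ (2 m) - 1. Both sides have degree
  -- below 2 m, so they are equal.
  set D : S[X] := (p₁ + p₂) + X ^ m * (p₁ - p₂) - 2 * C c * (a * b) with hD
  have hdvd : X ^ (2 * m) - 1 ∣ D := by
    obtain ⟨u, hu⟩ := h₁
    obtain ⟨v, hv⟩ := h₂
    refine ⟨u - v, ?_⟩
    have e₁ : p₁ = C c * (a * b) + (X ^ m - 1) * u := by rw [← hu]; ring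
    have e₂ : p₂ = C c * (a * b) + (X ^ m + 1) * v := by rw [← hv]; ring
    rw [hD, e₁, e₂]; ring
  have hmonic : (X ^ (2 * m) - 1 : S[X]).Monic := by
    simpa using monic_X_pow_sub_C (1 : S) (n := 2 * m) (by omega)
  have hdeg : (X ^ (2 * m) - 1 : S[X]).natDegree = 2 * m := by
    simpa using natDegree_X_pow_sub_C (n := 2 * m) (r := (1 : S))
  have hDdeg : D.natDegree < 2 * m := by
    have i₁ : (p₁ + p₂).natDegree ≤ 2 * m - 1 :=
      (natDegree_add_le _ _).trans (max_le (by omega) (by omega))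
    have i₂ : (X ^ m * (p₁ - p₂)).natDegree ≤ 2 * m - 1 := by
      refine natDegree_mul_le.trans ?_
      have := natDegree_X_pow_le (R := S) m
      have := (natDegree_sub_le p₁ p₂).trans (max_le hp₁ hp₂)
      omega
    have i₃ : (2 * C c * (a * b)).natDegree ≤ 2 * m - 1 := by
      have e : (2 * C c : S[X]) = C (2 * c) := by rw [C_mul, map_ofNat]
      rw [e]
      refine (natDegree_C_mul_le _ _).trans (natDegree_mul_le.trans (by omega))
    rw [hD]
    have := (natDegree_sub_le ((p₁ + p₂) + X ^ m * (p₁ - p₂)) (2 * C c * (a * b))).trans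
      (max_le ((natDegree_add_le _ _).trans (max_le i₁ i₂)) i₃)
    omega
  have hD0 : D = 0 := by
    by_contra hne
    refine hmonic.not_dvd_of_natDegree_lt hne (by omega) hdvd
  have := congrArg (Polynomial.eval x) hD0
  simp [hD] at this
  linear_combination this

theorem pow_two_pow_eq_neg_one_mul {b j : ℕ} {y : S} (hy : y ^ 2 ^ b = -1) :
    y ^ (j + 2 ^ b) = -y ^ j := by
  rw [pow_add, hy]; ring

set_option maxRecDepth 4000 in
-- The modulus z ^ 2 ^ (k+1) - y ^ (2 f) factors into z ^ 2 ^ k - y ^ f and z ^ 2 ^ k + y ^ f, and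
-- the latter is z ^ 2 ^ k - y ^ (f + 2 ^ b) because y ^ 2 ^ b = -1. Reduction replaces A₀ + z ^ 2 ^
-- k A₁ by A₀ ± y ^ f A₁, two shifts. The results are recombined without dividing by 2, which
-- doubles the scale factor. The assumption k + 1 ≤ b keeps both new exponents divisible by 2 ^ k.
theorem runs_fastMul_split {s Q b k C₀ : ℕ} (hs : 2 ≤ s) (hb : b + 2 < s) (hQ : 2 * Q ^ 2 < 2 ^ s)
    (hQ0 : 0 < Q) (hkb : k + 1 ≤ b)
    (ih : ∀ e A B, 2 ^ k ∣ e → e < 2 ^ (b + 1) → Tree Q (k + b) A → Tree Q (k + b) B →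
      ∃ w, Runs fastMul (.list [.nat b, .nat k, .nat e, .nat Q, A, B]) w C₀ ∧ Tree Q (k + b) w ∧
        ∀ (S : Type) [CommRing S] (y z : S), (Q : S) = 0 → y ^ 2 ^ b = -1 →
          z ^ 2 ^ k - y ^ e ∣
            evTwo k b w z y - 2 ^ k * mulScale b * (evTwo k b A z y * evTwo k b B z y))
    {e : ℕ} {A B : Val} (hke : 2 ^ (k + 1) ∣ e) (heb : e < 2 ^ (b + 1))
    (hA : Tree Q (k + 1 + b) A) (hB : Tree Q (k + 1 + b) B) :
    ∃ w, Runs fastMul (.list [.nat b, .nat (k + 1), .nat e, .nat Q, A, B]) w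
        (2 * C₀ + 4000 * (2 ^ (k + b) * opCost s)) ∧ Tree Q (k + 1 + b) w ∧
      ∀ (S : Type) [CommRing S] (y z : S), (Q : S) = 0 → y ^ 2 ^ b = -1 →
        z ^ 2 ^ (k + 1) - y ^ e ∣
          evTwo (k + 1) b w z y - 2 ^ (k + 1) * mulScale b *
            (evTwo (k + 1) b A z y * evTwo (k + 1) b B z y) := by
  have hW := two_mul_add_one_le_opCost s
  have h4 : 2 ^ 2 ≤ 2 ^ s := Nat.pow_le_pow_right (by norm_num) hs
  have hbs : 2 ^ (b + 3) ≤ 2 ^ s := Nat.pow_le_pow_right (by norm_num) hb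
  have hbb : b < 2 ^ b := Nat.lt_two_pow_self
  have hb1 : 2 ^ (b + 1) = 2 * 2 ^ b := pow_succ' _ _
  have hb3 : 2 ^ (b + 3) = 8 * 2 ^ b := by rw [pow_add]; ring
  have hQ2 : Q ≤ Q ^ 2 := Nat.le_self_pow (by norm_num) _
  obtain ⟨f, rfl⟩ : ∃ f, e = 2 * f := by
    obtain ⟨f, hf⟩ := hke
    exact ⟨2 ^ k * f, by rw [hf, pow_succ]; ring⟩
  have hf2 : 2 * f / 2 = f := by omega
  have hkf : 2 ^ k ∣ f := by
    rw [pow_succ'] at hke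
    exact Nat.dvd_of_mul_dvd_mul_left (by norm_num) hke
  have hkfM : 2 ^ k ∣ f + 2 ^ b := hkf.add (pow_dvd_pow 2 (by omega))
  rw [Nat.succ_add] at hA hB ⊢
  obtain ⟨A0, A1, rA0, rA1, tA0, tA1, eA⟩ := runs_half (k := k) hs (by omega) (by omega) hA
  obtain ⟨B0, B1, rB0, rB1, tB0, tB1, eB⟩ := runs_half (k := k) hs (by omega) (by omega) hB
  have ax {h : ℕ} {u v : Val} (hh : h < 2 ^ s) (hu : Tree Q (k + b) u) (hv : Tree Q (k + b) v) :=
    runs_addShift (k := k) (b := b) hs (Q := Q) (by omega) (by omega) (by omega) hh hu hv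
  obtain ⟨Ap, rAp, tAp, eAp⟩ := ax (h := f) (by omega) tA0 tA1
  obtain ⟨Am, rAm, tAm, eAm⟩ := ax (h := f + 2 ^ b) (by omega) tA0 tA1
  obtain ⟨Bp, rBp, tBp, eBp⟩ := ax (h := f) (by omega) tB0 tB1
  obtain ⟨Bm, rBm, tBm, eBm⟩ := ax (h := f + 2 ^ b) (by omega) tB0 tB1
  obtain ⟨Pp, rPp, tPp, ePp⟩ := ih f Ap Bp hkf (by omega) tAp tBp
  obtain ⟨Pm, rPm, tPm, ePm⟩ := ih (f + 2 ^ b) Am Bm hkfM (by omega) tAm tBm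
  obtain ⟨R0, rR0, tR0, eR0⟩ := ax (h := 0) (by omega) tPp tPm
  -- `Z` is zero, obtained as Pp - Pp: `addShift` always adds to something, and here a bare shift of
  -- `D` = Pp - Pm is wanted.
  obtain ⟨Z, rZ, tZ, eZ⟩ := ax (h := 2 ^ b) (by omega) tPp tPp
  obtain ⟨D, rD, tD, eD⟩ := ax (h := 2 ^ b) (by omega) tPp tPm
  obtain ⟨R1, rR1, tR1, eR1⟩ := ax (h := 2 ^ b + 2 ^ b - f) (by omega) tZ tD
  obtain ⟨w, rw', tw, ew⟩ := runs_join (k := k) hs (by omega) (by omega) tR0 tR1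
  have rM := runs_powTwo (s := s) (k := b) (by omega)
  refine ⟨w, .of_wp s ?_, tw, ?_⟩
  · have c1 : 2 ^ k * opCost s ≤ 2 ^ (k + b) * opCost s :=
      Nat.mul_le_mul_right _ (Nat.pow_le_pow_right (by norm_num) (by omega))
    have c2 : (b + 1) * (20 * opCost s) ≤ 20 * (2 ^ (k + b) * opCost s) := by
      have : b + 1 ≤ 2 ^ (k + b) := hbb.trans_le (Nat.pow_le_pow_right (by norm_num) (by omega))
      calc (b + 1) * (20 * opCost s) ≤ 2 ^ (k + b) * (20 * opCost s) := Nat.mul_le_mul_right _ this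
        _ = _ := by ring
    have c3 : opCost s ≤ 2 ^ (k + b) * opCost s := Nat.le_mul_of_pos_left _ (by positivity)
    simp only [fastMul, wp, arg, Val.list_cons, again, tup, op, head, tail, letIn, call, Val.list_nil,
      Nat.add_sub_cancel, hf2]
    exact .inl ⟨Val.nat_ne_zero (by omega), by omega, by omega, by omega, by omega, _, _, rM,
      by omega, by omega, _, _, rA0, _, _, rA1, _, _, rB0, _, _, rB1, _, _, rAp, _, _, rBp, _, _, rPp,
      _, _, rAm, _, _, rBm, _, _, rPm, _, _, rR0, by omega, by omega, by omega, by omega, _, _, rZ,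
      _, _, rD, _, _, rR1, _, _, rw', rfl, by omega⟩
  · intro S _ y z hQS hy
    obtain ⟨u, hu⟩ := ePp S y z hQS hy
    obtain ⟨v, hv⟩ := ePm S y z hQS hy
    -- Since y ^ (2 * 2 ^ b) = 1, division by y ^ f is a shift too.
    have hinv : y ^ (2 ^ b + 2 ^ b - f) * y ^ f = 1 := by
      rw [← pow_add, show 2 ^ b + 2 ^ b - f + f = 2 ^ b + 2 ^ b by omega, pow_add, hy]; ring
    have ew := ew S (fun w => evTree b w y) z
    have eA := eA S (fun w => evTree b w y) z
    have eB := eB S (fun w => evTree b w y) z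
    rw [eAp S y z hQS hy, eBp S y z hQS hy] at hu
    rw [eAm S y z hQS hy, eBm S y z hQS hy, pow_two_pow_eq_neg_one_mul hy] at hv
    have eR1 := eR1 S y z hQS hy
    have eR0 := eR0 S y z hQS hy
    rw [eZ S y z hQS hy, eD S y z hQS hy, hy] at eR1
    simp only [evTwo] at *
    rw [ew, eA, eB, eR0, eR1]
    generalize evOuter (fun w => evTree b w y) k Pp z = pp at *
    generalize evOuter (fun w => evTree b w y) k Pm z = pm at *
    generalize evOuter (fun w => evTree b w y) k A0 z = a0 at *
    generalize evOuter (fun w => evTree b w y) k A1 z = a1 at *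
    generalize evOuter (fun w => evTree b w y) k B0 z = b0 at *
    generalize evOuter (fun w => evTree b w y) k B1 z = b1 at *
    rw [show z ^ 2 ^ (k + 1) = (z ^ 2 ^ k) ^ 2 by rw [← pow_mul, pow_succ],
      show y ^ (2 * f) = (y ^ f) ^ 2 by rw [← pow_mul, mul_comm]]
    generalize z ^ 2 ^ k = Zk at *
    generalize y ^ f = Y at *
    generalize y ^ (2 ^ b + 2 ^ b - f) = Yi at *
    set κ : S := 2 ^ k * (mulScale b : S) with hκ
    have hκ2 : (2 : S) ^ (k + 1) * (mulScale b : S) = 2 * κ := by rw [hκ, pow_succ]; ring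
    rw [hκ2]
    have hpp : pp = κ * ((a0 + Y * a1) * (b0 + Y * b1)) + (Zk - Y) * u := by rw [← hu]; ring
    have hpm : pm = κ * ((a0 - Y * a1) * (b0 - Y * b1)) + (Zk + Y) * v := by
      linear_combination hv
    set a := a0 + Zk * a1 with ha
    set bb := b0 + Zk * b1 with hbb'
    -- Modulo Zk - Y the reduced factors may be replaced by the full ones: if a - a' = (Zk - Y) a1
    -- and b - b' = (Zk - Y) b1, then a b - a' b' = (Zk - Y)(a1 b + a' b1). The other factor is
    -- treated alike.
    obtain ⟨u', hu'⟩ : ∃ u', pp = κ * (a * bb) + (Zk - Y) * u' :=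
      ⟨u - κ * (a1 * bb + b1 * (a0 + Y * a1)), by rw [hpp, ha, hbb']; ring⟩
    obtain ⟨v', hv'⟩ : ∃ v', pm = κ * (a * bb) + (Zk + Y) * v' :=
      ⟨v - κ * (a1 * bb + b1 * (a0 - Y * a1)), by rw [hpm, ha, hbb']; ring⟩
    refine ⟨Yi * (u' - v'), ?_⟩
    rw [hu', hv']
    linear_combination ((Zk - Y) * u' + (Zk + Y) * v') * (-hinv)

set_option maxRecDepth 4000 in
theorem runs_fastMul_zero {s Q e : ℕ} (hs : 2 ≤ s) (hQ : 2 * Q ^ 2 < 2 ^ s) {A B : Val}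
    (hA : Tree Q 0 A) (hB : Tree Q 0 B) :
    ∃ w, Runs fastMul (.list [.nat 0, .nat 0, .nat e, .nat Q, A, B]) w (2000 * opCost s) ∧
      Tree Q 0 w ∧ ∀ (S : Type) [CommRing S] (y : S), (Q : S) = 0 →
        evTree 0 w y = evTree 0 A y * evTree 0 B y := by
  have hW := two_mul_add_one_le_opCost s
  obtain ⟨a, ha, rfl⟩ := hA
  obtain ⟨c, hc, rfl⟩ := hB
  have hac : a * c < Q ^ 2 := by rw [sq]; exact Nat.mul_lt_mul'' ha hc
  have hQ2 : Q ≤ Q ^ 2 := Nat.le_self_pow (by norm_num) _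
  refine ⟨.nat (a * c % Q), .of_wp s ?_, ⟨_, Nat.mod_lt _ (by omega), rfl⟩, ?_⟩
  · simp only [fastMul, wp, arg, Val.list_cons, again, tup, op, head, tail, letIn, call, Val.list_nil]
    exact .inr ⟨trivial, .inr ⟨trivial, by omega, by omega, by omega, by omega, trivial, by omega⟩⟩
  · intro S _ y hQS
    simp [evTree, evOuter, leaf, natCast_mod_of_eq_zero hQS]

set_option maxRecDepth 4000 in
theorem runs_fastMul_one {s Q e : ℕ} (hs : 2 ≤ s) (hQ : 2 * Q ^ 2 < 2 ^ s) {A B : Val}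
    (hA : Tree Q 1 A) (hB : Tree Q 1 B) :
    ∃ w, Runs fastMul (.list [.nat 1, .nat 0, .nat e, .nat Q, A, B]) w (2000 * opCost s) ∧
      Tree Q 1 w ∧ ∀ (S : Type) [CommRing S] (y : S), (Q : S) = 0 → y ^ 2 ^ 1 = -1 →
        evTree 1 w y = evTree 1 A y * evTree 1 B y := by
  have hW := two_mul_add_one_le_opCost s
  have h4 : 2 ^ 2 ≤ 2 ^ s := Nat.pow_le_pow_right (by norm_num) hs
  obtain ⟨_, _, rfl, ⟨a, ha, rfl⟩, ⟨a', ha', rfl⟩⟩ := hA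
  obtain ⟨_, _, rfl, ⟨c, hc, rfl⟩, ⟨c', hc', rfl⟩⟩ := hB
  have h1 : a * c < Q ^ 2 := by rw [sq]; exact Nat.mul_lt_mul'' ha hc
  have h2 : a * c' < Q ^ 2 := by rw [sq]; exact Nat.mul_lt_mul'' ha hc'
  have h3 : a' * c < Q ^ 2 := by rw [sq]; exact Nat.mul_lt_mul'' ha' hc
  have h5 : a' * c' < Q ^ 2 := by rw [sq]; exact Nat.mul_lt_mul'' ha' hc'
  have hQ2 : Q ≤ Q ^ 2 := Nat.le_self_pow (by norm_num) _
  have hm : a' * c' % Q < Q := Nat.mod_lt _ (by omega)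
  refine ⟨.pair (.nat ((a * c + (Q - a' * c' % Q)) % Q)) (.nat ((a * c' + a' * c) % Q)), .of_wp s ?_,
    ⟨_, _, rfl, ⟨_, Nat.mod_lt _ (by omega), rfl⟩, ⟨_, Nat.mod_lt _ (by omega), rfl⟩⟩, ?_⟩
  · simp only [fastMul, wp, arg, Val.list_cons, again, tup, op, head, tail, letIn, call, Val.list_nil]
    exact .inr ⟨trivial, .inl ⟨Val.nat_ne_zero one_ne_zero, by omega, by omega, .inr ⟨trivial,
      by omega, by omega, by omega, by omega, by omega, by omega, by omega, by omega, by omega,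
      by omega, by omega, by omega, by omega, by omega, by omega, by omega, by omega, by omega,
      by omega, by omega, trivial, by omega⟩⟩⟩
  · intro S _ y hQS hy
    simp only [evTree, evOuter, leaf, natCast_mod_of_eq_zero hQS]
    push_cast [hm.le, hQS, natCast_mod_of_eq_zero hQS]
    linear_combination (-(a' * c' : S)) * hy

set_option maxRecDepth 4000 in
-- A product modulo y ^ 2 ^ b + 1 is regarded as a product of polynomials in z of degree below 2 ^ a
-- over powers of Y = y ^ 2 ^ a, where Y ^ 2 ^ b' = -1. It is computed modulo z ^ 2 ^ a - 1
-- (exponent 0) and modulo z ^ 2 ^ a + 1 (exponent 2 ^ b'). Together these determine the full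
-- product in z, so that z = y may be put in afterwards.
theorem runs_fastMul_reduce {s Q b e : ℕ} (hs : 2 ≤ s) (hb : b + 2 < s) (hQ : 2 * Q ^ 2 < 2 ^ s)
    (hb2 : 2 ≤ b) {C₀ : ℕ}
    (ih : ∀ e A B, 2 ^ (b / 2) ∣ e → e < 2 ^ (b - b / 2 + 1) → Tree Q b A → Tree Q b B →
      ∃ w, Runs fastMul (.list [.nat (b - b / 2), .nat (b / 2), .nat e, .nat Q, A, B]) w C₀ ∧
        Tree Q b w ∧ ∀ (S : Type) [CommRing S] (y z : S), (Q : S) = 0 → y ^ 2 ^ (b - b / 2) = -1 →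
          z ^ 2 ^ (b / 2) - y ^ e ∣
            evTwo (b / 2) (b - b / 2) w z y - 2 ^ (b / 2) * mulScale (b - b / 2) *
              (evTwo (b / 2) (b - b / 2) A z y * evTwo (b / 2) (b - b / 2) B z y))
    {A B : Val} (hA : Tree Q b A) (hB : Tree Q b B) :
    ∃ w, Runs fastMul (.list [.nat b, .nat 0, .nat e, .nat Q, A, B]) w
        (2 * C₀ + 2000 * (2 ^ b * opCost s)) ∧ Tree Q b w ∧
      ∀ (S : Type) [CommRing S] (y : S), (Q : S) = 0 → y ^ 2 ^ b = -1 →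
        evTree b w y = mulScale b * (evTree b A y * evTree b B y) := by
  have hW := two_mul_add_one_le_opCost s
  have h4 : 2 ^ 2 ≤ 2 ^ s := Nat.pow_le_pow_right (by norm_num) hs
  have hbs : 2 ^ (b + 3) ≤ 2 ^ s := Nat.pow_le_pow_right (by norm_num) hb
  have hbb : b < 2 ^ b := Nat.lt_two_pow_self
  have hb3 : 2 ^ (b + 3) = 8 * 2 ^ b := by rw [pow_add]; ring
  have hQ2 : Q ≤ Q ^ 2 := Nat.le_self_pow (by norm_num) _
  have hsc : (mulScale b : ℕ) = 2 * (2 ^ (b / 2) * mulScale (b - b / 2)) := by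
    rw [mulScale, if_neg (by omega), mul_assoc]
  obtain ⟨a, ha⟩ : ∃ a, b / 2 = a := ⟨_, rfl⟩
  obtain ⟨b', hb'⟩ : ∃ b', b - a = b' := ⟨_, rfl⟩
  simp only [ha, hb'] at ih hsc
  have hab : a + b' = b := by omega
  have hpb : 2 ^ b' ≤ 2 ^ b := Nat.pow_le_pow_right (by norm_num) (by omega)
  have hb'1 : 2 ^ (b' + 1) = 2 * 2 ^ b' := pow_succ' _ _
  have hpos : 0 < 2 ^ b' := by positivity
  obtain ⟨P, rP, tP, eP⟩ := ih 0 A B (dvd_zero _) (by omega) hA hB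
  obtain ⟨P', rP', tP', eP'⟩ := ih (2 ^ b') A B (pow_dvd_pow 2 (by omega)) (by omega) hA hB
  have ax {h : ℕ} {u v : Val} (hh : h < 2 ^ s) (hu : Tree Q b u) (hv : Tree Q b v) :=
    runs_addShift (k := a) (b := b') hs (Q := Q) (by omega) (by omega) (by omega) hh
      (hab ▸ hu) (hab ▸ hv)
  rw [hab] at ax
  obtain ⟨U, rU, tU, eU⟩ := ax (h := 0) (by omega) tP tP'
  obtain ⟨V, rV, tV, eV⟩ := ax (h := 2 ^ b') (by omega) tP tP'
  obtain ⟨w, rw', tw, ew⟩ := ax (h := 1) (by omega) tU tV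
  have rM := runs_powTwo (s := s) (k := b') (by omega)
  refine ⟨w, .of_wp s ?_, tw, ?_⟩
  · have c2 : (b' + 1) * (20 * opCost s) ≤ 20 * (2 ^ b * opCost s) := by
      have : b' + 1 ≤ 2 ^ b := by omega
      calc (b' + 1) * (20 * opCost s) ≤ 2 ^ b * (20 * opCost s) := Nat.mul_le_mul_right _ this
        _ = _ := by ring
    have c3 : opCost s ≤ 2 ^ b * opCost s := Nat.le_mul_of_pos_left _ (by positivity)
    simp only [fastMul, wp, arg, Val.list_cons, again, tup, op, head, tail, letIn, call, Val.list_nil,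
      ha, hb']
    exact .inr ⟨trivial, .inl ⟨Val.nat_ne_zero (by omega), by omega, by omega,
      .inl ⟨Val.nat_ne_zero (by omega), by omega, by omega, by omega, by omega, _, _, rM,
        _, _, rP, _, _, rP', _, _, rU, _, _, rV, _, _, rw', rfl, by omega⟩⟩⟩
  · intro S _ y hQS hy
    have hyb : (y ^ 2 ^ a) ^ 2 ^ b' = -1 := by rw [← pow_mul, ← pow_add, hab, hy]
    rw [← hab, evTree_add, evTree_add, evTree_add, ew S _ _ hQS hyb, eU S _ _ hQS hyb,
      eV S _ _ hQS hyb, hyb, hab, hsc]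
    have hQX : (Q : S[X]) = 0 := by
      have := congrArg (C : S → S[X]) hQS
      simpa using this
    have hyX : (C (y ^ 2 ^ a) : S[X]) ^ 2 ^ b' = -1 := by rw [← C_pow, hyb]; simp
    -- The congruences are needed for an indeterminate z, since degrees decide that there is no
    -- wraparound. So the induction hypothesis is applied over `S[X]` with z = X, and the value at y
    -- is taken last.
    have dP := eP S[X] (C (y ^ 2 ^ a)) X hQX hyX
    have dP' := eP' S[X] (C (y ^ 2 ^ a)) X hQX hyX
    rw [pow_zero] at dP
    rw [hyX, sub_neg_eq_add] at dP'
    have hdeg (v : Val) : (evTwo a b' v (X : S[X]) (C (y ^ 2 ^ a))).natDegree ≤ 2 ^ a - 1 := by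
      have h1 : evTwo a b' v (X : S[X]) (C (y ^ 2 ^ a)) =
          evOuter (fun w => C (evTree b' w (y ^ 2 ^ a))) a v (X ^ 1) := by
        rw [evTwo, pow_one]
        congr 1
        funext w
        rw [map_evTree]
      rw [h1]
      simpa using natDegree_evOuter_le (fun w => evTree b' w (y ^ 2 ^ a)) a v 1
    have hev (v : Val) : (evTwo a b' v (X : S[X]) (C (y ^ 2 ^ a))).eval y =
        evTwo a b' v y (y ^ 2 ^ a) := by
      have := map_evTwo (evalRingHom y) a b' v (X : S[X]) (C (y ^ 2 ^ a))
      simpa using this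
    have hc : (2 ^ a * (mulScale b' : S[X])) = C (2 ^ a * (mulScale b' : S)) := by
      rw [C_mul, C_pow, map_ofNat, map_natCast]
    rw [hc] at dP dP'
    have := eval_eq_of_dvd (2 ^ a) (by positivity) (2 ^ a * (mulScale b' : S)) y _ _ _ _
      (hdeg A) (hdeg B) (hdeg P) (hdeg P') dP dP'
    rw [hev, hev, hev, hev] at this
    push_cast
    linear_combination this

/-- Cost of `fastMul`. -/
def fastMulCost (s k b : ℕ) : ℕ := 2000 * (2 ^ (k + b) * ((k + 4 * b ^ 2 + 1) * opCost s))

/-- The specification quantifies over all rings because the induction enlarges the ring to `S[X]`.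
Induction on b contains an induction on k: a positive k is lowered by splitting the modulus, and k =
0 is traded for the pair (b / 2, b - b / 2). -/
theorem runs_fastMul {s Q k b e : ℕ} (hs : 2 ≤ s) (hb : b + 2 < s) (hQ : 2 * Q ^ 2 < 2 ^ s)
    (hQ0 : 0 < Q) (hkb : k ≤ b) {A B : Val} (hke : 2 ^ k ∣ e) (heb : e < 2 ^ (b + 1))
    (hA : Tree Q (k + b) A) (hB : Tree Q (k + b) B) :
    ∃ w, Runs fastMul (.list [.nat b, .nat k, .nat e, .nat Q, A, B]) w (fastMulCost s k b) ∧
      Tree Q (k + b) w ∧ ∀ (S : Type) [CommRing S] (y z : S), (Q : S) = 0 → y ^ 2 ^ b = -1 →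
        z ^ 2 ^ k - y ^ e ∣
          evTwo k b w z y - 2 ^ k * mulScale b * (evTwo k b A z y * evTwo k b B z y) := by
  induction b using Nat.strong_induction_on generalizing k e A B with
  | _ b IH =>
  induction k generalizing e A B with
  | succ k ih =>
    have hC : fastMulCost s (k + 1) b = 2 * fastMulCost s k b + 4000 * (2 ^ (k + b) * opCost s) := by
      rw [fastMulCost, fastMulCost, Nat.succ_add, pow_succ]; ring
    rw [hC]
    exact runs_fastMul_split hs hb hQ hQ0 hkb
      (fun e A B h1 h2 h3 h4 => ih (by omega) h1 h2 h3 h4) hke heb hA hB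
  | zero =>
    rw [Nat.zero_add] at hA hB ⊢
    -- At k = 0 no outer variable is left, and the congruence is an equality.
    suffices H : ∃ w, Runs fastMul (.list [.nat b, .nat 0, .nat e, .nat Q, A, B]) w
        (fastMulCost s 0 b) ∧ Tree Q b w ∧
      ∀ (S : Type) [CommRing S] (y : S), (Q : S) = 0 → y ^ 2 ^ b = -1 →
        evTree b w y = mulScale b * (evTree b A y * evTree b B y) by
      obtain ⟨w, h1, h2, h3⟩ := H
      refine ⟨w, h1, h2, fun S _ y z hQS hy => ?_⟩
      have h : evTwo 0 b w z y - 2 ^ 0 * mulScale b * (evTwo 0 b A z y * evTwo 0 b B z y) = 0 := by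
        rw [pow_zero, one_mul, sub_eq_zero]; exact h3 S y hQS hy
      rw [h]; exact dvd_zero _
    rcases lt_or_ge b 2 with hb2 | hb2
    · interval_cases b
      · obtain ⟨w, h1, h2, h3⟩ := runs_fastMul_zero (e := e) hs hQ hA hB
        refine ⟨w, h1.weaken (by simp [fastMulCost]), h2, fun S _ y hQS _ => ?_⟩
        rw [h3 S y hQS]; simp [mulScale]
      · obtain ⟨w, h1, h2, h3⟩ := runs_fastMul_one (e := e) hs hQ hA hB
        refine ⟨w, h1.weaken (by simp only [fastMulCost]; omega), h2, fun S _ y hQS hy => ?_⟩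
        rw [h3 S y hQS hy]; simp [mulScale]
    · have hab : b / 2 + (b - b / 2) = b := by omega
      obtain ⟨w, h1, h2, h3⟩ := runs_fastMul_reduce (C₀ := fastMulCost s (b / 2) (b - b / 2))
        hs hb hQ hb2 (fun e A B i1 i2 i3 i4 => by
          have := IH (b - b / 2) (by omega) (k := b / 2) (e := e) (A := A) (B := B) (by omega)
            (by omega) i1 i2
          rw [hab] at this
          exact this i3 i4) hA hB
      refine ⟨w, h1.weaken ?_, h2, h3⟩
      simp only [fastMulCost, hab, zero_add]
      -- Recurrence for the cost per coefficient: a reduction makes two products of the same total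
      -- size 2 ^ b, and splitting adds the term linear in k. As b is halved, the bound 4 b ^ 2
      -- closes the induction.
      have hφ : 2 * (b / 2 + 4 * (b - b / 2) ^ 2 + 1) + 1 ≤ 4 * b ^ 2 + 1 := by
        obtain ⟨m, hm | hm⟩ := Nat.even_or_odd' b
        · have e1 : b / 2 = m := by omega
          have e2 : b - b / 2 = m := by omega
          rw [e2, e1, hm]; nlinarith
        · have e1 : b / 2 = m := by omega
          have e2 : b - b / 2 = m + 1 := by omega
          obtain ⟨j, rfl⟩ : ∃ j, m = j + 1 := ⟨m - 1, by omega⟩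
          rw [e2, e1, hm]; nlinarith
      calc _ = 2000 * (2 ^ b * ((2 * (b / 2 + 4 * (b - b / 2) ^ 2 + 1) + 1) * opCost s)) := by ring
        _ ≤ _ := by gcongr

/-! ## Coefficients of trees -/

/-- The tree of depth `d` with the coefficients `f 0, …, f (2 ^ d - 1)`. -/
def treeOf : ℕ → (ℕ → ℕ) → Val
  | 0, f => .nat (f 0)
  | d + 1, f => .pair (treeOf d fun i => f (2 * i)) (treeOf d fun i => f (2 * i + 1))

theorem exists_eq_treeOf {Q d : ℕ} {v : Val} (h : Tree Q d v) :
    ∃ f : ℕ → ℕ, (∀ i, f i < Q) ∧ v = treeOf d f := by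
  induction d generalizing v with
  | zero =>
    obtain ⟨a, ha, rfl⟩ := h
    exact ⟨fun _ => a, fun _ => ha, rfl⟩
  | succ d ih =>
    obtain ⟨u, w, rfl, hu, hw⟩ := h
    obtain ⟨f, hf, rfl⟩ := ih hu
    obtain ⟨g, hg, rfl⟩ := ih hw
    refine ⟨fun i => if i % 2 = 0 then f (i / 2) else g (i / 2), fun i => ?_, ?_⟩
    · dsimp only; split
      exacts [hf _, hg _]
    · rw [treeOf]
      congr 2
      · funext i
        rw [if_pos (by omega)]; congr 1; omega
      · funext i
        rw [if_neg (by omega)]; congr 1; omega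

theorem treeOf_congr {d : ℕ} {f g : ℕ → ℕ} (h : ∀ i < 2 ^ d, f i = g i) :
    treeOf d f = treeOf d g := by
  induction d generalizing f g with
  | zero => rw [treeOf, treeOf, h 0 (by norm_num)]
  | succ d ih =>
    rw [pow_succ] at h
    rw [treeOf, treeOf, ih fun i hi => h (2 * i) (by omega),
      ih fun i hi => h (2 * i + 1) (by omega)]

theorem tree_treeOf {Q d : ℕ} {f : ℕ → ℕ} (h : ∀ i < 2 ^ d, f i < Q) : Tree Q d (treeOf d f) := by
  induction d generalizing f with
  | zero => exact ⟨_, h 0 (by norm_num), rfl⟩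
  | succ d ih =>
    rw [pow_succ] at h
    exact ⟨_, _, rfl, ih fun i hi => h (2 * i) (by omega), ih fun i hi => h (2 * i + 1) (by omega)⟩

theorem sum_range_two_mul {M : Type*} [AddCommMonoid M] (f : ℕ → M) (n : ℕ) :
    ∑ i ∈ Finset.range (2 * n), f i =
      ∑ i ∈ Finset.range n, f (2 * i) + ∑ i ∈ Finset.range n, f (2 * i + 1) := by
  induction n with
  | zero => simp
  | succ n ih =>
    rw [show 2 * (n + 1) = 2 * n + 1 + 1 by ring, Finset.sum_range_succ, Finset.sum_range_succ, ih,
      Finset.sum_range_succ, Finset.sum_range_succ]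
    abel

theorem evTree_treeOf (d : ℕ) (f : ℕ → ℕ) (x : S) :
    evTree d (treeOf d f) x = ∑ i ∈ Finset.range (2 ^ d), (f i : S) * x ^ i := by
  induction d generalizing f x with
  | zero => simp [evTree, evOuter, treeOf, leaf]
  | succ d ih =>
    have h0 := ih (fun i => f (2 * i)) (x ^ 2)
    have h1 := ih (fun i => f (2 * i + 1)) (x ^ 2)
    simp only [evTree] at h0 h1
    rw [evTree, treeOf, evOuter, h0, h1, pow_succ' 2 d, sum_range_two_mul, Finset.mul_sum]
    congr 1
    · exact Finset.sum_congr rfl fun i _ => by rw [← pow_mul]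
    · exact Finset.sum_congr rfl fun i _ => by rw [← pow_mul, pow_succ]; ring

/-! ## Ring elements as trees -/

namespace Ring2

variable {q r : ℕ}

/-- The root of `X ^ 2 ^ r + 1`. -/
def root (q r : ℕ) : Ring2 q r := AdjoinRoot.root _

theorem root_pow (q r : ℕ) : root q r ^ 2 ^ r = -1 := by
  have h := AdjoinRoot.eval₂_root (X ^ 2 ^ r + 1 : (ZMod q)[X])
  simp only [eval₂_add, eval₂_X_pow, eval₂_one] at h
  exact eq_neg_of_add_eq_zero_left h

theorem cast_eq_zero (q r : ℕ) : ((q : ℕ) : Ring2 q r) = 0 := by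
  have h : ((q : ZMod q) : ZMod q) = 0 := by simp
  rw [← map_natCast (AdjoinRoot.of (X ^ 2 ^ r + 1 : (ZMod q)[X])), h, map_zero]

theorem ofCoeffs_eq_sum (a : Fin (2 ^ r) → ZMod q) :
    ofCoeffs a = ∑ i, AdjoinRoot.of _ (a i) * root q r ^ (i : ℕ) := by
  simp [ofCoeffs, root, map_sum, map_mul, map_pow]

theorem coeffs_ofCoeffs (a : Fin (2 ^ r) → ZMod q) : coeffs (ofCoeffs a) = a := by
  rcases subsingleton_or_nontrivial (ZMod q) with hs | hn
  · exact Subsingleton.elim _ _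
  have hdeg : (∑ i, C (a i) * X ^ (i : ℕ) : (ZMod q)[X]).degree <
      (X ^ 2 ^ r + 1 : (ZMod q)[X]).degree := by
    have h1 : (X ^ 2 ^ r + 1 : (ZMod q)[X]).degree = (2 ^ r : ℕ) := by
      simpa using degree_X_pow_add_C (n := 2 ^ r) (by positivity) (1 : ZMod q)
    rw [h1]
    refine (degree_sum_le _ _).trans_lt ((Finset.sup_lt_iff ?_).2 fun i _ => ?_)
    · exact WithBot.bot_lt_coe _
    · exact (degree_C_mul_X_pow_le _ _).trans_lt (by exact_mod_cast i.2)
  funext i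
  rw [coeffs, ofCoeffs, AdjoinRoot.modByMonicHom_mk,
    (modByMonic_eq_self_iff (monic_modulus q r)).2 hdeg, finsetSum_coeff]
  simp [coeff_X_pow, Fin.val_inj]

theorem ofCoeffs_coeffs (a : Ring2 q r) : ofCoeffs (coeffs a) = a := by
  rcases subsingleton_or_nontrivial (ZMod q) with hs | hn
  · have : Subsingleton (Ring2 q r) := by
      refine subsingleton_of_zero_eq_one ?_
      rw [← map_zero (AdjoinRoot.of (X ^ 2 ^ r + 1 : (ZMod q)[X])),
        ← map_one (AdjoinRoot.of (X ^ 2 ^ r + 1 : (ZMod q)[X])), Subsingleton.elim (0 : ZMod q) 1]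
    exact Subsingleton.elim _ _
  obtain ⟨p, rfl⟩ := AdjoinRoot.mk_surjective a
  have hp : (p %ₘ (X ^ 2 ^ r + 1)).natDegree < 2 ^ r := by
    have h2 : (X ^ 2 ^ r + 1 : (ZMod q)[X]).natDegree = 2 ^ r := by
      simpa using natDegree_X_pow_add_C (n := 2 ^ r) (r := (1 : ZMod q))
    have h1 := natDegree_modByMonic_lt p (monic_modulus q r) (by
      intro h
      have := congrArg natDegree h
      rw [h2, natDegree_one] at this
      exact absurd this (by positivity))
    omega
  have hc : (fun i : Fin (2 ^ r) => coeffs (AdjoinRoot.mk (X ^ 2 ^ r + 1 : (ZMod q)[X]) p) i) =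
      fun i : Fin (2 ^ r) => (p %ₘ (X ^ 2 ^ r + 1)).coeff i := by
    funext i
    rw [coeffs, AdjoinRoot.modByMonicHom_mk]
  rw [ofCoeffs]
  simp only [congrFun hc]
  rw [Fin.sum_univ_eq_sum_range (fun i => C ((p %ₘ (X ^ 2 ^ r + 1)).coeff i) * X ^ i) (2 ^ r),
    ← as_sum_range_C_mul_X_pow' _ hp, AdjoinRoot.mk_eq_mk]
  exact ⟨-(p /ₘ (X ^ 2 ^ r + 1)), by
    linear_combination modByMonic_add_div p (X ^ 2 ^ r + 1 : (ZMod q)[X])⟩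

theorem coeffs_injective : Function.Injective (coeffs : Ring2 q r → _) :=
  fun a b h => by rw [← ofCoeffs_coeffs a, h, ofCoeffs_coeffs]

/-- Coefficients as natural numbers less than `q`. -/
def natCoeff (a : Ring2 q r) (i : ℕ) : ℕ := if h : i < 2 ^ r then (coeffs a ⟨i, h⟩).val else 0

def tree (a : Ring2 q r) : Val := treeOf r (natCoeff a)

theorem natCoeff_lt [NeZero q] (a : Ring2 q r) (i : ℕ) : natCoeff a i < q := by
  rw [natCoeff]; split
  · exact ZMod.val_lt _
  · exact NeZero.pos q

theorem tree_tree [NeZero q] (a : Ring2 q r) : Tree q r (tree a) :=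
  tree_treeOf fun i _ => natCoeff_lt a i

theorem ofCoeffs_natCast (f : ℕ → ℕ) :
    (ofCoeffs fun i : Fin (2 ^ r) => (f i : ZMod q)) =
      ∑ i ∈ Finset.range (2 ^ r), (f i : Ring2 q r) * root q r ^ i := by
  rw [ofCoeffs_eq_sum, ← Fin.sum_univ_eq_sum_range (fun i => (f i : Ring2 q r) * root q r ^ i)]
  simp

theorem natCoeff_ofCoeffs [NeZero q] {f : ℕ → ℕ} (hf : ∀ i < 2 ^ r, f i < q) {i : ℕ} (hi : i < 2 ^ r) :
    natCoeff (ofCoeffs fun i : Fin (2 ^ r) => (f i : ZMod q)) i = f i := by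
  rw [natCoeff, dif_pos hi, coeffs_ofCoeffs, ZMod.val_natCast_of_lt (hf i hi)]

theorem evTree_tree [NeZero q] (a : Ring2 q r) : evTree r (tree a) (root q r) = a := by
  rw [tree, evTree_treeOf, ← ofCoeffs_natCast]
  conv_rhs => rw [← ofCoeffs_coeffs a]
  congr 1
  funext i
  rw [natCoeff, dif_pos i.2, ZMod.natCast_zmod_val]

theorem treeOf_eq_tree [NeZero q] {f : ℕ → ℕ} (hf : ∀ i < 2 ^ r, f i < q) :
    treeOf r f = tree (ofCoeffs fun i : Fin (2 ^ r) => (f i : ZMod q)) :=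
  treeOf_congr fun _ hi => (natCoeff_ofCoeffs hf hi).symm

/-- A tree of reduced residues is determined by its value at the root of X ^ 2 ^ r + 1. Programs on
trees thus need only be checked as identities in the ring. -/
theorem eq_tree [NeZero q] {v : Val} (h : Tree q r v) : v = tree (evTree r v (root q r)) := by
  obtain ⟨f, hf, rfl⟩ := exists_eq_treeOf h
  rw [evTree_treeOf, ← ofCoeffs_natCast, treeOf_eq_tree fun i _ => hf i]

theorem enc_eq (a : Ring2 q r) :
    enc a = .list ((List.range (2 ^ r)).map fun i => .nat (natCoeff a i)) := by
  rw [enc]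
  congr 1
  refine List.ext_getElem (by simp) fun i h1 h2 => ?_
  have hi : i < 2 ^ r := by simpa using h1
  simp [natCoeff, hi]

end Ring2

/-- An integer polynomial in a root of `x ^ g + 1`, when its value is divisible by `K` modulo `q * K`. -/
theorem exists_mul_of_eq_mul {q K r : ℕ} (hq : 2 ≤ q) (hK : 0 < K) (w c : ℤ[X])
    (hw : w.natDegree < 2 ^ r)
    (h : aeval (Ring2.root (q * K) r) w = K * aeval (Ring2.root (q * K) r) c) :
    ∃ w' : ℤ[X], w = C (K : ℤ) * w' ∧ aeval (Ring2.root q r) w' = aeval (Ring2.root q r) c := by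
  have hQ : 2 ≤ q * K := hq.trans (Nat.le_mul_of_pos_right _ hK)
  have : Fact (1 < q * K) := ⟨hQ⟩
  have hmonic : (X ^ 2 ^ r + 1 : ℤ[X]).Monic := by
    simpa using monic_X_pow_add_C (1 : ℤ) (n := 2 ^ r) (by positivity)
  have hdeg : (X ^ 2 ^ r + 1 : ℤ[X]).natDegree = 2 ^ r := by
    simpa using natDegree_X_pow_add_C (n := 2 ^ r) (r := (1 : ℤ))
  have hr (Q : ℕ) (p : ℤ[X]) : aeval (Ring2.root Q r) (p %ₘ (X ^ 2 ^ r + 1)) =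
      aeval (Ring2.root Q r) p := by
    conv_rhs => rw [← modByMonic_add_div p (X ^ 2 ^ r + 1)]
    simp [Ring2.root_pow]
  have hcdeg : (c %ₘ (X ^ 2 ^ r + 1)).natDegree < 2 ^ r := by
    have := natDegree_modByMonic_lt c hmonic (by
      intro h
      have := congrArg natDegree h
      rw [hdeg, natDegree_one] at this
      exact absurd this (by positivity))
    omega
  -- After reduction, both w and K c' have degree below that of the modulus.
  set c' := c %ₘ (X ^ 2 ^ r + 1) with hc'
  have hz : aeval (Ring2.root (q * K) r) (w - C (K : ℤ) * c') = 0 := by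
    rw [map_sub, map_mul, hr, h]; simp
  have hmk (p : ℤ[X]) : aeval (Ring2.root (q * K) r) p =
      AdjoinRoot.mk (X ^ 2 ^ r + 1 : (ZMod (q * K))[X]) (p.map (Int.castRingHom _)) := by
    induction p using Polynomial.induction_on' with
    | add p q hp hq => simp [hp, hq]
    | monomial n a =>
      rw [Polynomial.map_monomial, ← C_mul_X_pow_eq_monomial, ← C_mul_X_pow_eq_monomial]
      simp [Ring2.root]
  rw [hmk, AdjoinRoot.mk_eq_zero] at hz
  -- A multiple of a monic polynomial of larger degree vanishes. Hence all coefficients of w - K c'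
  -- are divisible by q K, and w / K is congruent to c' modulo q.
  have hzero : (w - C (K : ℤ) * c').map (Int.castRingHom (ZMod (q * K))) = 0 := by
    by_contra hne
    refine (monic_modulus (q * K) r).not_dvd_of_natDegree_lt hne ?_ hz
    have h1 : (X ^ 2 ^ r + 1 : (ZMod (q * K))[X]).natDegree = 2 ^ r := by
      simpa using natDegree_X_pow_add_C (n := 2 ^ r) (r := (1 : ZMod (q * K)))
    rw [h1]
    refine natDegree_map_le.trans_lt ((natDegree_sub_le _ _).trans_lt (max_lt hw ?_))
    exact (natDegree_C_mul_le _ _).trans_lt hcdeg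
  have hdvd : C ((q * K : ℕ) : ℤ) ∣ w - C (K : ℤ) * c' := by
    rw [C_dvd_iff_dvd_coeff]
    intro i
    rw [← ZMod.intCast_zmod_eq_zero_iff_dvd]
    · have := congrArg (fun p => coeff p i) hzero
      simpa only [coeff_map, coeff_zero, eq_intCast] using this
  obtain ⟨u, hu⟩ := hdvd
  refine ⟨c' + C (q : ℤ) * u, ?_, ?_⟩
  · have : (C ((q * K : ℕ) : ℤ) : ℤ[X]) = C (K : ℤ) * C (q : ℤ) := by
      rw [← C_mul]; push_cast; rw [mul_comm]
    rw [mul_add, ← mul_assoc, ← this, ← hu]; ring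
  · rw [map_add, map_mul, hr]
    simp [Ring2.cast_eq_zero]

/-! ## Ring arithmetic -/

theorem mulScale_pos (b : ℕ) : 0 < mulScale b := by
  induction b using Nat.strong_induction_on with
  | _ b ih =>
    rw [mulScale]
    split
    · exact one_pos
    · have := ih (b - b / 2) (by omega)
      positivity

theorem mulScale_le (b : ℕ) : mulScale b ≤ 2 ^ (2 * b) := by
  induction b using Nat.strong_induction_on with
  | _ b ih =>
    rw [mulScale]
    split
    · exact Nat.one_le_two_pow
    · calc 2 * 2 ^ (b / 2) * mulScale (b - b / 2)
          ≤ 2 * 2 ^ (b / 2) * 2 ^ (2 * (b - b / 2)) := Nat.mul_le_mul_left _ (ih _ (by omega))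
        _ = 2 ^ (1 + b / 2 + 2 * (b - b / 2)) := by rw [pow_add, pow_add, pow_one]
        _ ≤ 2 ^ (2 * b) := Nat.pow_le_pow_right (by norm_num) (by omega)

/-- On input `b`: `mulScale b`. -/
def scaleProg : Prog :=
  .cond (op .sub (arg 0) (.const 1))
    (letIn (op .div (arg 0) (.const 2)) <|
      op .mul (op .mul (.const 2) (call powTwo [arg 0])) (again [op .sub (arg 1) (arg 0)]))
    (.const 1)

theorem runs_scaleProg {s b : ℕ} (hb : 2 * b + 2 < s) :
    Runs scaleProg (.list [.nat b]) (.nat (mulScale b)) ((b + 1) ^ 2 * (100 * opCost s)) := by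
  have hW := two_mul_add_one_le_opCost s
  induction b using Nat.strong_induction_on with
  | _ b ih =>
  have hbs : 2 ^ (2 * b + 3) ≤ 2 ^ s := Nat.pow_le_pow_right (by norm_num) hb
  have hb3 : 2 ^ (2 * b + 3) = 8 * 2 ^ (2 * b) := by rw [pow_add]; ring
  have hb2 : 2 * b < 2 ^ (2 * b) := Nat.lt_two_pow_self
  have hsc := mulScale_le b
  refine .of_wp s ?_
  rcases le_or_gt b 1 with h | h
  · rw [mulScale, if_pos h]
    simp only [scaleProg, wp, arg, Val.list_cons, again, tup, op, head, tail, letIn, call, Val.list_nil]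
    refine ⟨by omega, by omega, .inr ⟨Val.nat_eq_zero (by omega), trivial, ?_⟩⟩
    have := Nat.le_mul_of_pos_left (100 * opCost s) (show 0 < (b + 1) ^ 2 by positivity)
    omega
  · have hsc2 : mulScale b = 2 * 2 ^ (b / 2) * mulScale (b - b / 2) := by
      rw [mulScale, if_neg (by omega)]
    have h1 := ih (b - b / 2) (by omega) (by omega)
    have h2 := runs_powTwo (s := s) (k := b / 2) (by omega)
    have h3 := mulScale_le (b - b / 2)
    have h4 : 2 ^ (2 * (b - b / 2)) ≤ 2 ^ (2 * b) := Nat.pow_le_pow_right (by norm_num) (by omega)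
    have h5 : 2 ^ (b / 2) ≤ 2 ^ (2 * b) := Nat.pow_le_pow_right (by norm_num) (by omega)
    simp only [scaleProg, wp, arg, Val.list_cons, again, tup, op, head, tail, letIn, call, Val.list_nil]
    refine ⟨by omega, by omega, .inl ⟨Val.nat_ne_zero (by omega), by omega, by omega, _, _, h2,
      by omega, by omega, by omega, by omega, _, _, h1, ?_, by omega, congrArg _ hsc2.symm, ?_⟩⟩
    · rw [← pow_succ']
      exact Nat.pow_lt_pow_right (by norm_num) (by omega)
    have h6 : (b - b / 2 + 1) ^ 2 + (b + 1) + 1 ≤ (b + 1) ^ 2 := by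
      have : b - b / 2 + 1 ≤ b := by omega
      nlinarith
    have h7 : (b / 2 + 1) * (20 * opCost s) ≤ (b + 1) * (20 * opCost s) :=
      Nat.mul_le_mul_right _ (by omega)
    nlinarith [Nat.mul_le_mul_right (100 * opCost s) h6]

/-- On input `d, K, v`: divides the leaves of a tree by `K`. -/
def divLeaves : Prog :=
  .cond (arg 0)
    (.pair (again [op .sub (arg 0) (.const 1), arg 1, head (arg 2)])
      (again [op .sub (arg 0) (.const 1), arg 1, tail (arg 2)]))
    (op .div (arg 2) (arg 1))

theorem runs_divLeaves {s d K : ℕ} {f : ℕ → ℕ} (hs : 2 ≤ s) (hd : d < 2 ^ s) (hK : K < 2 ^ s)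
    (hf : ∀ i, f i < 2 ^ s) :
    Runs divLeaves (.list [.nat d, .nat K, treeOf d f]) (treeOf d fun i => f i / K)
      (100 * (2 ^ d * opCost s)) := by
  refine Runs.weaken ?_ (two_pow_mul_cost_le d 50 (opCost s))
  have hW := two_mul_add_one_le_opCost s
  have h4 : 2 ^ 2 ≤ 2 ^ s := Nat.pow_le_pow_right (by norm_num) hs
  induction d generalizing f with
  | zero =>
    refine .of_wp s ?_
    simp only [divLeaves, treeOf, wp, arg, Val.list_cons, again, tup, op, head, tail, letIn, call]
    exact .inr ⟨trivial, hf _, hK, trivial, by omega⟩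
  | succ d ih =>
    have h1 := ih (by omega) fun i => hf (2 * i)
    have h2 := ih (by omega) fun i => hf (2 * i + 1)
    rw [two_pow_mul_cost]
    refine .of_wp s ?_
    simp only [divLeaves, treeOf, wp, arg, Val.list_cons, again, tup, op, head, tail, letIn, call,
      Nat.add_sub_cancel]
    exact .inl ⟨Val.nat_ne_zero (by omega), hd, by omega, _, _, h1, hd, by omega, _, _, h2, rfl,
      by omega⟩

/-- `s` bits suffice for the intermediate results of arithmetic in `Ring2 q r`. -/
def FitsWord (s q r : ℕ) : Prop := 2 * r + 2 < s ∧ 2 * (q * 2 ^ (2 * r)) ^ 2 < 2 ^ s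

theorem FitsWord.modulus_lt {s q r : ℕ} (h : FitsWord s q r) : 2 * q < 2 ^ s := by
  have h2 : q ≤ q * 2 ^ (2 * r) := Nat.le_mul_of_pos_right _ (by positivity)
  have h3 : q * 2 ^ (2 * r) ≤ (q * 2 ^ (2 * r)) ^ 2 := Nat.le_self_pow (by norm_num) _
  have := h.2
  omega

/-- Bound for the cost of an operation in `Ring2 q r`. -/
def ringCost (s r : ℕ) : ℕ := 2 ^ r * ((r + 1) ^ 2 * (10000 * opCost s))

theorem ringCost_ge (s r : ℕ) : 10000 * (2 ^ r * opCost s) ≤ ringCost s r := by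
  have h : 1 ≤ (r + 1) ^ 2 := Nat.one_le_pow _ _ (by omega)
  calc 10000 * (2 ^ r * opCost s) = 2 ^ r * (1 * (10000 * opCost s)) := by ring
    _ ≤ _ := Nat.mul_le_mul_left _ (Nat.mul_le_mul_right _ h)

theorem ringCost_ge_op (s r : ℕ) : 10000 * opCost s ≤ ringCost s r := by
  refine le_trans ?_ (ringCost_ge s r)
  have : opCost s ≤ 2 ^ r * opCost s := Nat.le_mul_of_pos_left _ (by positivity)
  omega

section
variable {s q r : ℕ} [NeZero q]

/-- On input `r, q, u, v`: the sum of ring elements. -/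
def ringAdd : Prog := call addShift [.const 0, arg 0, .const 0, arg 1, arg 2, arg 3]

theorem runs_ringAdd (h : FitsWord s q r) (a b : Ring2 q r) :
    Runs ringAdd (.list [.nat r, .nat q, a.tree, b.tree]) (a + b).tree (ringCost s r) := by
  have hr : r < 2 ^ s := lt_of_lt_of_le (by have := h.1; omega) Nat.lt_two_pow_self.le
  have ha := Ring2.tree_tree a
  have hb := Ring2.tree_tree b
  obtain ⟨w, hw, ht, he⟩ := runs_addShift (k := 0) (b := r) (h := 0) (Q := q) (u := a.tree)
    (v := b.tree) (by have := h.1; omega) h.modulus_lt (by positivity) hr (by positivity)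
    (by rwa [zero_add]) (by rwa [zero_add])
  rw [zero_add] at ht hw
  have hsum : w = (a + b).tree := by
    rw [Ring2.eq_tree ht]
    have := he (Ring2 q r) (Ring2.root q r) 0 (Ring2.cast_eq_zero q r) (Ring2.root_pow q r)
    change evTree r w _ = evTree r _ _ + _ * evTree r _ _ at this
    rw [this, Ring2.evTree_tree, Ring2.evTree_tree, pow_zero, one_mul]
  subst hsum
  have := ringCost_ge s r
  have := ringCost_ge_op s r
  have hW := two_mul_add_one_le_opCost s
  refine .of_wp s ?_
  simp only [ringAdd, wp, arg, Val.list_cons, tup, call, Val.list_nil]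
  exact ⟨_, _, hw, rfl, by omega⟩

/-- On input `r, q, u, v`: the difference of ring elements. -/
def ringSub : Prog := call addShift [.const 0, arg 0, call powTwo [arg 0], arg 1, arg 2, arg 3]

/-- Subtraction is addition with a shift by 2 ^ r, as the root satisfies x ^ 2 ^ r = -1. -/
theorem runs_ringSub (h : FitsWord s q r) (a b : Ring2 q r) :
    Runs ringSub (.list [.nat r, .nat q, a.tree, b.tree]) (a - b).tree (ringCost s r) := by
  have h1 := h.1
  have hr : r < 2 ^ s := lt_of_lt_of_le (by omega) Nat.lt_two_pow_self.le
  have hr' : 2 ^ r < 2 ^ s := Nat.pow_lt_pow_right (by norm_num) (by omega)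
  have ha := Ring2.tree_tree a
  have hb := Ring2.tree_tree b
  obtain ⟨w, hw, ht, he⟩ := runs_addShift (k := 0) (b := r) (h := 2 ^ r) (Q := q) (u := a.tree)
    (v := b.tree) (by omega) h.modulus_lt (by positivity) hr hr'
    (by rwa [zero_add]) (by rwa [zero_add])
  rw [zero_add] at ht hw
  have hsum : w = (a - b).tree := by
    rw [Ring2.eq_tree ht]
    have := he (Ring2 q r) (Ring2.root q r) 0 (Ring2.cast_eq_zero q r) (Ring2.root_pow q r)
    change evTree r w _ = evTree r _ _ + _ * evTree r _ _ at this
    rw [this, Ring2.evTree_tree, Ring2.evTree_tree, Ring2.root_pow]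
    congr 1; ring
  subst hsum
  have := ringCost_ge s r
  have := ringCost_ge_op s r
  have hW := two_mul_add_one_le_opCost s
  have hp := runs_powTwo (s := s) (k := r) (by omega)
  have hrr : (r + 1) * (20 * opCost s) ≤ 20 * (2 ^ r * opCost s) := by
    have : r + 1 ≤ 2 ^ r := Nat.lt_two_pow_self
    calc (r + 1) * (20 * opCost s) ≤ 2 ^ r * (20 * opCost s) := Nat.mul_le_mul_right _ this
      _ = _ := by ring
  refine .of_wp s ?_
  simp only [ringSub, wp, arg, Val.list_cons, tup, call, Val.list_nil]
  exact ⟨_, _, hp, _, _, hw, rfl, by omega⟩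

/-- On input `r, q, u, v`: the product of ring elements. -/
def ringMul : Prog :=
  letIn (call scaleProg [arg 0]) <|
    call divLeaves [arg 1, arg 0,
      call fastMul [arg 1, .const 0, .const 0, op .mul (arg 2) (arg 0), arg 3, arg 4]]

theorem evTree_natDegree (f : ℕ → ℕ) : (evTree r (treeOf r f) (X : ℤ[X])).natDegree < 2 ^ r := by
  rw [evTree_treeOf]
  have : (2 ^ r - 1) < 2 ^ r := by have : 0 < 2 ^ r := by positivity
                                   omega
  refine (natDegree_sum_le_of_forall_le (n := 2 ^ r - 1) _ _ fun i hi => ?_).trans_lt this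
  have hi := Finset.mem_range.1 hi
  have e : ((f i : ℤ[X]) * X ^ i) = C (f i : ℤ) * X ^ i := by simp
  rw [e]
  exact (natDegree_C_mul_X_pow_le _ _).trans (by omega)

/-- `fastMul` returns K times the product, with K = `mulScale r`. It is therefore run modulo q K,
where the scaled product determines the true one modulo q and division of the coefficients by K is
exact. No inverse of K modulo q is needed. -/
theorem runs_ringMul (hq : 2 ≤ q) (h : FitsWord s q r) (a b : Ring2 q r) :
    Runs ringMul (.list [.nat r, .nat q, a.tree, b.tree]) (a * b).tree (ringCost s r) := by
  have h1 := h.1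
  have hr : r < 2 ^ s := lt_of_lt_of_le (by omega) Nat.lt_two_pow_self.le
  have hK0 := mulScale_pos r
  have hKle := mulScale_le r
  have hKs : mulScale r < 2 ^ s := hKle.trans_lt (Nat.pow_lt_pow_right (by norm_num) (by omega))
  set K := mulScale r with hK
  have hqQ : q ≤ q * K := Nat.le_mul_of_pos_right _ hK0
  have hQQ : q * K ≤ (q * K) ^ 2 := Nat.le_self_pow (by norm_num) _
  have hQ : 2 * (q * K) ^ 2 < 2 ^ s :=
    lt_of_le_of_lt (Nat.mul_le_mul_left _ (Nat.pow_le_pow_left (Nat.mul_le_mul_left _ hKle) 2)) h.2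
  have tr (x : Ring2 q r) : Tree (q * K) (0 + r) x.tree := by
    rw [zero_add]
    exact tree_treeOf fun i _ => (Ring2.natCoeff_lt x i).trans_le hqQ
  obtain ⟨w, hw, ht, he⟩ := runs_fastMul (s := s) (k := 0) (b := r) (e := 0) (Q := q * K)
    (by omega) (by omega) hQ (by omega) (Nat.zero_le _) (dvd_zero _) (by positivity) (tr a) (tr b)
  have : NeZero (q * K) := ⟨by omega⟩
  rw [zero_add] at ht
  obtain ⟨f, hf, rfl⟩ := exists_eq_treeOf ht
  have hmap (Q : ℕ) (g : ℕ → ℕ) : aeval (Ring2.root Q r) (evTree r (treeOf r g) (X : ℤ[X])) =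
      evTree r (treeOf r g) (Ring2.root Q r) := by
    have := map_evTree ((aeval (Ring2.root Q r) : ℤ[X] →ₐ[ℤ] Ring2 Q r) : ℤ[X] →+* Ring2 Q r)
      r (treeOf r g) X
    simpa using this
  obtain ⟨w', hw1, hw2⟩ := exists_mul_of_eq_mul (q := q) (r := r) hq hK0
    (evTree r (treeOf r f) (X : ℤ[X])) (evTree r a.tree X * evTree r b.tree X)
    (evTree_natDegree f) (by
      have := he (Ring2 (q * K) r) (Ring2.root _ r) 1 (Ring2.cast_eq_zero _ r) (Ring2.root_pow _ r)
      simp only [pow_zero, one_pow, sub_self, zero_dvd_iff, one_mul, sub_eq_zero] at this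
      rw [map_mul, hmap, Ring2.tree, Ring2.tree, hmap, hmap]
      exact this)
  -- Exactness is read off from the integer polynomial: its coefficients are the leaves, and it is K
  -- times an integer polynomial.
  have hdvd (i : ℕ) (hi : i < 2 ^ r) : f i / K * K = f i := by
    refine Nat.div_mul_cancel ?_
    have hc := congrArg (fun p => coeff p i) hw1
    rw [evTree_treeOf] at hc
    simp only [finsetSum_coeff, coeff_C_mul, ← C_eq_natCast, coeff_X_pow] at hc
    rw [Finset.sum_eq_single i (fun j _ hj => by simp [hj.symm]) (by simp [hi])] at hc
    simp only [if_true, mul_one] at hc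
    exact Int.natCast_dvd_natCast.1 ⟨_, by simpa using hc⟩
  have hlt (i : ℕ) (hi : i < 2 ^ r) : f i / K < q := by
    refine Nat.div_lt_of_lt_mul ?_
    rw [mul_comm]; exact hf i
  have hres : (treeOf r fun i => f i / K) = (a * b).tree := by
    rw [Ring2.eq_tree (tree_treeOf (Q := q) hlt)]
    congr 1
    rw [← hmap]
    have hwe : w' = evTree r (treeOf r fun i => f i / K) X := by
      have hKne : (C (K : ℤ) : ℤ[X]) ≠ 0 := by
        rw [Ne, C_eq_zero]; exact_mod_cast hK0.ne'
      refine mul_left_cancel₀ hKne ?_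
      rw [← hw1, evTree_treeOf, evTree_treeOf, Finset.mul_sum]
      refine Finset.sum_congr rfl fun i hi => ?_
      rw [← hdvd i (Finset.mem_range.1 hi), ← C_eq_natCast, ← C_eq_natCast, ← mul_assoc, ← C_mul]
      push_cast [hdvd i (Finset.mem_range.1 hi)]
      rw [mul_comm (K : ℤ)]
      norm_cast
      rw [hdvd i (Finset.mem_range.1 hi)]
    rw [← hwe, hw2, map_mul, Ring2.tree, Ring2.tree, hmap, hmap]
    exact congrArg₂ _ (Ring2.evTree_tree a) (Ring2.evTree_tree b)
  have hsc := runs_scaleProg (s := s) (b := r) (by omega)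
  have hdiv := runs_divLeaves (s := s) (d := r) (K := K) (f := f) (by omega) hr hKs
    fun i => (hf i).trans (by omega)
  rw [hres] at hdiv
  have hW := two_mul_add_one_le_opCost s
  have c0 : 2 ^ r * ((r + 1) ^ 2 * (10000 * opCost s)) = ringCost s r := rfl
  have c1 : (r + 1) ^ 2 * (100 * opCost s) * 100 ≤ ringCost s r := by
    rw [ringCost]
    calc (r + 1) ^ 2 * (100 * opCost s) * 100 = 1 * ((r + 1) ^ 2 * (10000 * opCost s)) := by ring
      _ ≤ _ := Nat.mul_le_mul_right _ Nat.one_le_two_pow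
  have c2 : fastMulCost s 0 r * 10 ≤ 8 * ringCost s r := by
    rw [ringCost, fastMulCost]
    have : 0 + 4 * r ^ 2 + 1 ≤ 4 * (r + 1) ^ 2 := by nlinarith
    calc 2000 * (2 ^ (0 + r) * ((0 + 4 * r ^ 2 + 1) * opCost s)) * 10
        ≤ 2000 * (2 ^ (0 + r) * ((4 * (r + 1) ^ 2) * opCost s)) * 10 := by gcongr
      _ = _ := by rw [zero_add]; ring
  have c3 := ringCost_ge s r
  have c4 := ringCost_ge_op s r
  refine .of_wp s ?_
  simp only [ringMul, wp, arg, Val.list_cons, tup, call, Val.list_nil, letIn, op]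
  exact ⟨_, _, hsc, h.modulus_lt.trans_le' (by omega), hKs, _, _, hw, _, _, hdiv, rfl, by omega⟩

end

/-! ## Lists and trees -/

/-- The entries at even and at odd positions. -/
def unzipList {α : Type*} : List α → List α × List α
  | [] => ([], [])
  | a :: l => (a :: (unzipList l).2, (unzipList l).1)

theorem unzipList_getD {α : Type*} (l : List α) (i : ℕ) (d : α) :
    (unzipList l).1.getD i d = l.getD (2 * i) d ∧ (unzipList l).2.getD i d = l.getD (2 * i + 1) d := by
  induction l generalizing i with
  | nil => simp [unzipList]
  | cons a l ih =>
    refine ⟨?_, ?_⟩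
    · cases i with
      | zero => simp [unzipList]
      | succ i =>
        rw [unzipList, List.getD_cons_succ, (ih i).2, Nat.mul_succ, List.getD_cons_succ]
    · rw [unzipList, (ih i).1, List.getD_cons_succ]

theorem unzipList_length {α : Type*} (l : List α) :
    (unzipList l).1.length = (l.length + 1) / 2 ∧ (unzipList l).2.length = l.length / 2 := by
  induction l with
  | nil => simp [unzipList]
  | cons a l ih =>
    rw [unzipList]
    refine ⟨?_, ?_⟩
    · rw [List.length_cons, ih.2, List.length_cons]; omega
    · rw [ih.1, List.length_cons]

theorem unzipList_map {α β : Type*} (f : α → β) (l : List α) :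
    unzipList (l.map f) = ((unzipList l).1.map f, (unzipList l).2.map f) := by
  induction l with
  | nil => rfl
  | cons a l ih => simp [unzipList, ih]

def unzip : Prog :=
  .cond (arg 0)
    (letIn (again [tail (arg 0)]) (.pair (.pair (head (arg 1)) (tail (arg 0))) (head (arg 0))))
    (.pair (.const 0) (.const 0))

theorem runs_unzip (l : List Val) :
    Runs unzip (.list [.list l]) (.pair (.list (unzipList l).1) (.list (unzipList l).2))
      ((l.length + 1) * 100) := by
  induction l with
  | nil =>
    refine .of_wp 0 ?_
    simp only [unzip, wp, arg, Val.list_cons, again, tup, op, head, tail, letIn, Val.list_nil]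
    exact .inr ⟨trivial, rfl, by simp⟩
  | cons a l ih =>
    refine .of_wp 0 ?_
    simp only [unzip, wp, arg, Val.list_cons, again, tup, op, head, tail, letIn, Val.list_nil]
    exact .inl ⟨Val.pair_ne_nat _ _ _, _, _, ih, rfl, by simp only [List.length_cons]; omega⟩

/-- On input `d, l`: the tree of depth `d` with the entries of the list `l`, padded with zeros. -/
def build : Prog :=
  .cond (arg 0)
    (letIn (call unzip [arg 1]) (.pair (again [op .sub (arg 1) (.const 1), head (arg 0)])
      (again [op .sub (arg 1) (.const 1), tail (arg 0)])))
    (.cond (arg 1) (head (arg 1)) (.const 0))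

/-- The order of the leaves is the bit reversal of the order of the list. Separating even and odd
positions at each level realises it, at linear cost per level. -/
theorem runs_build_aux {s d : ℕ} {l : List ℕ} (hd : d < s) (hl : l.length ≤ 2 ^ d) :
    Runs build (.list [.nat d, .list (l.map .nat)]) (treeOf d fun i => l.getD i 0)
      ((d + 1) * (2 ^ d * (400 * opCost s))) := by
  have hW := two_mul_add_one_le_opCost s
  induction d generalizing l with
  | zero =>
    refine .of_wp s ?_
    simp only [build, wp, arg, Val.list_cons, again, tup, op, head, tail, letIn, treeOf]
    cases l with
    | nil => exact .inr ⟨trivial, .inr ⟨rfl, rfl, by omega⟩⟩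
    | cons a l => exact .inr ⟨trivial, .inl ⟨Val.pair_ne_nat _ _ _, rfl, by omega⟩⟩
  | succ d ih =>
    have hlen := unzipList_length l
    rw [pow_succ] at hl
    have h1 := ih (l := (unzipList l).1) (by omega) (by omega)
    have h2 := ih (l := (unzipList l).2) (by omega) (by omega)
    simp only [unzipList_getD] at h1 h2
    have h3 := runs_unzip (l.map Val.nat)
    rw [unzipList_map, List.length_map] at h3
    have hds : d + 1 < 2 ^ s := hd.trans Nat.lt_two_pow_self
    have hc : (l.length + 1) * 100 ≤ 300 * (2 ^ d * opCost s) := by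
      have : 1 ≤ 2 ^ d := Nat.one_le_two_pow
      have h5 : 2 ^ d * 1 ≤ 2 ^ d * opCost s := Nat.mul_le_mul_left _ (by omega)
      omega
    have hc2 : opCost s ≤ 2 ^ d * opCost s := Nat.le_mul_of_pos_left _ (by positivity)
    have e : (d + 1 + 1) * (2 ^ (d + 1) * (400 * opCost s)) =
        2 * ((d + 1) * (2 ^ d * (400 * opCost s))) + 800 * (2 ^ d * opCost s) := by
      rw [pow_succ]; ring
    rw [e]
    refine .of_wp s ?_
    simp only [build, wp, arg, Val.list_cons, again, tup, op, head, tail, letIn, call, treeOf,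
      Nat.add_sub_cancel]
    exact .inl ⟨Val.nat_ne_zero (by omega), _, _, h3, hds, by omega, _, _, h1, hds, by omega, _, _, h2,
      rfl, by omega⟩

theorem range_succ_map {α : Type*} (n : ℕ) (f : ℕ → α) :
    (List.range (n + 1)).map f = f 0 :: (List.range n).map fun i => f (i + 1) := by
  rw [List.range_succ_eq_map, List.map_cons, List.map_map]; rfl

/-- Interleaves two lists of the same length. -/
def interleave : Prog :=
  .cond (arg 0)
    (.pair (head (arg 0)) (.pair (head (arg 1)) (again [tail (arg 0), tail (arg 1)])))
    (.const 0)

theorem runs_interleave (n : ℕ) (f : ℕ → Val) :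
    Runs interleave (.list [.list ((List.range n).map fun i => f (2 * i)),
      .list ((List.range n).map fun i => f (2 * i + 1))]) (.list ((List.range (2 * n)).map f))
      ((n + 1) * 100) := by
  induction n generalizing f with
  | zero =>
    refine .of_wp 0 ?_
    simp only [interleave, wp, arg, Val.list_cons, again, tup, op, head, tail, letIn, Val.list_nil]
    exact .inr ⟨rfl, rfl, by simp⟩
  | succ n ih =>
    have := ih fun i => f (i + 2)
    rw [range_succ_map, range_succ_map, Nat.mul_succ, range_succ_map, range_succ_map]
    refine .of_wp 0 ?_
    simp only [interleave, wp, arg, Val.list_cons, again, tup, op, head, tail, letIn, Val.list_nil]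
    exact .inl ⟨Val.pair_ne_nat _ _ _, _, _, this, rfl, by omega⟩

/-- On input `d, v`: the list of the leaves of a tree of depth `d`. -/
def flatten : Prog :=
  .cond (arg 0)
    (call interleave [again [op .sub (arg 0) (.const 1), head (arg 1)],
      again [op .sub (arg 0) (.const 1), tail (arg 1)]])
    (.pair (arg 1) (.const 0))

theorem runs_flatten_aux {s d : ℕ} (f : ℕ → ℕ) (hd : d < s) :
    Runs flatten (.list [.nat d, treeOf d f]) (.list ((List.range (2 ^ d)).map fun i => .nat (f i)))
      ((d + 1) * (2 ^ d * (400 * opCost s))) := by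
  have hW := two_mul_add_one_le_opCost s
  induction d generalizing f with
  | zero =>
    refine .of_wp s ?_
    simp only [flatten, wp, arg, Val.list_cons, again, tup, op, head, tail, letIn, treeOf]
    exact .inr ⟨trivial, rfl, by omega⟩
  | succ d ih =>
    have h1 := ih (fun i => f (2 * i)) (by omega)
    have h2 := ih (fun i => f (2 * i + 1)) (by omega)
    have h3 := runs_interleave (2 ^ d) fun i => .nat (f i)
    rw [← pow_succ'] at h3
    have hds : d + 1 < 2 ^ s := hd.trans Nat.lt_two_pow_self
    have hc : (2 ^ d + 1) * 100 ≤ 200 * (2 ^ d * opCost s) := by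
      have : 1 ≤ 2 ^ d := Nat.one_le_two_pow
      have h5 : 2 ^ d * 1 ≤ 2 ^ d * opCost s := Nat.mul_le_mul_left _ (by omega)
      omega
    have hc2 : opCost s ≤ 2 ^ d * opCost s := Nat.le_mul_of_pos_left _ (by positivity)
    have e : (d + 1 + 1) * (2 ^ (d + 1) * (400 * opCost s)) =
        2 * ((d + 1) * (2 ^ d * (400 * opCost s))) + 800 * (2 ^ d * opCost s) := by
      rw [pow_succ]; ring
    rw [e]
    refine .of_wp s ?_
    simp only [flatten, wp, arg, Val.list_cons, again, tup, op, head, tail, letIn, call, treeOf,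
      Nat.add_sub_cancel]
    exact .inl ⟨Val.nat_ne_zero (by omega), hds, by omega, _, _, h1, hds, by omega, _, _, h2,
      _, _, h3, rfl, by omega⟩

theorem listCost_le (s r : ℕ) : (r + 1) * (2 ^ r * (400 * opCost s)) ≤ ringCost s r := by
  have : r + 1 ≤ (r + 1) ^ 2 := Nat.le_self_pow (by norm_num) _
  calc (r + 1) * (2 ^ r * (400 * opCost s)) = 2 ^ r * ((r + 1) * (400 * opCost s)) := by ring
    _ ≤ 2 ^ r * ((r + 1) ^ 2 * (10000 * opCost s)) := by gcongr; norm_num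

theorem runs_flatten {s q r : ℕ} (hr : r < s) (a : Ring2 q r) :
    Runs flatten (.list [.nat r, a.tree]) a.enc (ringCost s r) := by
  rw [Ring2.enc_eq]
  exact (runs_flatten_aux _ hr).weaken (listCost_le s r)

section
variable {s q r : ℕ} [NeZero q]

theorem runs_build_list (hr : r < s) {l : List ℕ} (hl : l.length ≤ 2 ^ r) (hq : ∀ a ∈ l, a < q) :
    Runs build (.list [.nat r, .list (l.map .nat)])
      (Ring2.ofCoeffs fun i : Fin (2 ^ r) => ((l.getD i 0 : ℕ) : ZMod q)).tree (ringCost s r) := by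
  have h := runs_build_aux hr hl
  rw [Ring2.treeOf_eq_tree (q := q)] at h
  · exact h.weaken (listCost_le s r)
  · intro i _
    rcases lt_or_ge i l.length with hi | hi
    · rw [List.getD_eq_getElem _ _ hi]
      exact hq _ (List.getElem_mem hi)
    · rw [List.getD_eq_default _ _ hi]
      exact NeZero.pos q

theorem runs_build_enc (hr : r < s) (a : Ring2 q r) :
    Runs build (.list [.nat r, a.enc]) a.tree (ringCost s r) := by
  have h := runs_build_list (q := q) hr (l := (List.range (2 ^ r)).map a.natCoeff) (by simp) (by
    intro x hx
    obtain ⟨i, _, rfl⟩ := List.mem_map.1 hx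
    exact Ring2.natCoeff_lt a i)
  rw [List.map_map] at h
  rw [Ring2.enc_eq]
  have e : (Ring2.ofCoeffs fun i : Fin (2 ^ r) =>
      ((((List.range (2 ^ r)).map a.natCoeff).getD i 0 : ℕ) : ZMod q)) = a := by
    conv_rhs => rw [← Ring2.ofCoeffs_coeffs a]
    congr 1
    funext i
    rw [List.getD_eq_getElem _ _ (by simp)]
    simp [Ring2.natCoeff]
  rw [e] at h
  exact h

theorem runs_build_zero (hr : r < s) :
    Runs build (.list [.nat r, .nat 0]) (0 : Ring2 q r).tree (ringCost s r) := by
  have h := runs_build_list (q := q) hr (l := []) (by simp) (by simp)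
  have e : (Ring2.ofCoeffs fun i : Fin (2 ^ r) => ((([] : List ℕ).getD i 0 : ℕ) : ZMod q)) = 0 := by
    simp [Ring2.ofCoeffs]
  rw [e] at h
  exact h

end

/-! ## Residues and chunks -/

/-- On input `i, q, l`: the residues modulo `q` of the first `i` entries of a list of integers, and
the rest of the list. -/
def takeResidues : Prog :=
  .cond (arg 0)
    (.cond (arg 2)
      (letIn (again [op .sub (arg 0) (.const 1), arg 1, tail (arg 2)])
        (.pair (.pair
          (.cond (head (head (arg 3)))
            (op .mod (op .sub (arg 2) (op .mod (tail (head (arg 3))) (arg 2))) (arg 2))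
            (op .mod (tail (head (arg 3))) (arg 2)))
          (head (arg 0))) (tail (arg 0))))
      (.pair (.const 0) (.const 0)))
    (.pair (.const 0) (arg 2))

/-- The least nonnegative residue. -/
def residue (q : ℕ) (z : ℤ) : ℕ := (z : ZMod q).val

theorem residue_lt {q : ℕ} [NeZero q] (z : ℤ) : residue q z < q := ZMod.val_lt _

theorem val_intCast_neg {q : ℕ} [NeZero q] {z : ℤ} (hz : z < 0) :
    (q - z.natAbs % q) % q = residue q z := by
  have h : ((q - z.natAbs % q : ℕ) : ZMod q) = z := by
    rw [Nat.cast_sub (Nat.mod_lt _ (NeZero.pos q)).le]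
    simp only [CharP.cast_eq_zero, ZMod.natCast_mod, zero_sub]
    have : z = -(z.natAbs : ℤ) := by omega
    conv_rhs => rw [this]
    rw [Int.cast_neg, Int.cast_natCast]
  rw [residue, ← h, ZMod.val_natCast]

theorem val_intCast_nonneg {q : ℕ} {z : ℤ} (hz : 0 ≤ z) :
    z.natAbs % q = residue q z := by
  have : z = (z.natAbs : ℤ) := by omega
  conv_rhs => rw [this]
  rw [residue, Int.cast_natCast, ZMod.val_natCast]

theorem runs_takeResidues {s q i : ℕ} [NeZero q] (hs : 2 ≤ s) (hi : i < 2 ^ s) (hq : q < 2 ^ s)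
    (l : List ℤ) (hl : ∀ z ∈ l, z.natAbs < 2 ^ s) :
    Runs takeResidues (.list [.nat i, .nat q, .list (l.map .int)])
      (.pair (.list ((l.take i).map fun z => .nat (residue q z))) (.list ((l.drop i).map .int)))
      ((i + 1) * (200 * opCost s)) := by
  have hW := two_mul_add_one_le_opCost s
  have h4 : 2 ^ 2 ≤ 2 ^ s := Nat.pow_le_pow_right (by norm_num) hs
  have hq0 : 0 < q := NeZero.pos q
  induction i generalizing l with
  | zero =>
    refine .of_wp s ?_
    simp only [takeResidues, wp, arg, Val.list_cons, again, tup, op, head, tail, letIn, Val.list_nil]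
    exact .inr ⟨trivial, rfl, by omega⟩
  | succ i ih =>
    rw [Nat.succ_mul (i + 1)]
    cases l with
    | nil =>
      refine .of_wp s ?_
      simp only [takeResidues, wp, arg, Val.list_cons, again, tup, op, head, tail, letIn,
        Val.list_nil, List.map_nil]
      exact .inl ⟨Val.nat_ne_zero (by omega), .inr ⟨trivial, rfl, by omega⟩⟩
    | cons z l =>
      have h1 := ih (by omega) l fun w hw => hl w (List.mem_cons_of_mem _ hw)
      have hz := hl z List.mem_cons_self
      have hm : z.natAbs % q < q := Nat.mod_lt _ hq0
      refine .of_wp s ?_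
      simp only [takeResidues, wp, arg, Val.list_cons, again, tup, op, head, tail, letIn,
        Val.list_nil, List.map_cons, Val.int, Nat.add_sub_cancel]
      refine .inl ⟨Val.nat_ne_zero (by omega), .inl ⟨Val.pair_ne_nat _ _ _, hi, by omega, _, _, h1, ?_⟩⟩
      rcases lt_or_ge z 0 with hz0 | hz0
      · refine .inl ⟨Val.nat_ne_zero (by rw [if_pos hz0]; norm_num), hz, hq, hq, by omega, by omega, hq,
          ?_, by omega⟩
        rw [val_intCast_neg hz0]; rfl
      · refine .inr ⟨Val.nat_eq_zero (by rw [if_neg (by omega)]), hz, hq, ?_, by omega⟩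
        rw [val_intCast_nonneg hz0]; rfl

/-- The ring element with the first entries of a list as coefficients. -/
def listChunk (q r : ℕ) (l : List ℤ) : Ring2 q r := Ring2.ofInts fun i => l.getD i 0

theorem chunk_eq_listChunk (q r : ℕ) {n : ℕ} (x : Fin n → ℤ) (j : ℕ) :
    chunk q r x j = listChunk q r ((List.ofFn x).drop (j * 2 ^ r)) := by
  rw [chunk, listChunk]
  congr 1
  funext i
  rw [List.getD_eq_getElem?_getD, List.getElem?_drop, List.getElem?_ofFn]
  split <;> simp [*]

/-- On input `r, 2 ^ r, q, l`: the list of the chunks of a list of integers. -/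
def chunksProg : Prog :=
  .cond (arg 3)
    (letIn (call takeResidues [arg 1, arg 2, arg 3])
      (.pair (call build [arg 1, head (arg 0)]) (again [arg 1, arg 2, arg 3, tail (arg 0)])))
    (.const 0)

theorem numChunks_of_pos {n r : ℕ} (hn : 0 < n) : numChunks n r = numChunks (n - 2 ^ r) r + 1 := by
  have hp : 0 < 2 ^ r := by positivity
  rw [numChunks, numChunks]
  rcases le_or_gt (2 ^ r) n with h | h
  · rw [show n + 2 ^ r - 1 = (n - 2 ^ r + 2 ^ r - 1) + 2 ^ r by omega, Nat.add_div_right _ hp]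
  · rw [show n - 2 ^ r = 0 by omega, Nat.div_eq_of_lt (a := 0 + 2 ^ r - 1) (by omega),
      Nat.div_eq_of_lt_le] <;> omega

theorem numChunks_zero (r : ℕ) : numChunks 0 r = 0 := by
  have hp : 0 < 2 ^ r := by positivity
  exact Nat.div_eq_of_lt (by omega)

theorem runs_chunksProg {s q r : ℕ} [NeZero q] (hr : r < s) (hq : q < 2 ^ s)
    (hs : 2 ≤ s) (l : List ℤ) (hl : ∀ z ∈ l, z.natAbs < 2 ^ s) :
    Runs chunksProg (.list [.nat r, .nat (2 ^ r), .nat q, .list (l.map .int)])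
      (.list ((List.range (numChunks l.length r)).map fun j =>
        (listChunk q r (l.drop (j * 2 ^ r))).tree))
      ((numChunks l.length r + 1) * (3 * ringCost s r)) := by
  have hW := two_mul_add_one_le_opCost s
  have h4 : 2 ^ 2 ≤ 2 ^ s := Nat.pow_le_pow_right (by norm_num) hs
  have hq0 : 0 < q := NeZero.pos q
  have hp : 0 < 2 ^ r := by positivity
  have hrs : 2 ^ r < 2 ^ s := Nat.pow_lt_pow_right (by norm_num) hr
  have hR := ringCost_ge_op s r
  induction hn : l.length using Nat.strong_induction_on generalizing l with
  | _ n ih =>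
  subst hn
  rcases Nat.eq_zero_or_pos l.length with h0 | h0
  · obtain rfl := List.length_eq_zero_iff.1 h0
    simp only [List.length_nil, numChunks_zero]
    refine .of_wp s ?_
    simp only [chunksProg, wp, arg, Val.list_cons, again, tup, op, head, tail, letIn, Val.list_nil,
      List.map_nil, List.range_zero]
    exact .inr ⟨trivial, trivial, by omega⟩
  · have h1 := runs_takeResidues hs hrs hq l hl
    have h2 := ih (l.length - 2 ^ r) (by omega) (l.drop (2 ^ r))
      (fun z hz => hl z (List.mem_of_mem_drop hz)) (by simp)
    have h3 := runs_build_list (q := q) (s := s) hr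
      (l := (l.take (2 ^ r)).map (residue q)) (by simp) (by
        intro a ha
        obtain ⟨z, _, rfl⟩ := List.mem_map.1 ha
        exact residue_lt z)
    have e : (Ring2.ofCoeffs fun i : Fin (2 ^ r) =>
        ((((l.take (2 ^ r)).map (residue q)).getD i 0 : ℕ) : ZMod q)) =
        listChunk q r l := by
      rw [listChunk, Ring2.ofInts]
      congr 1
      funext i
      simp only [List.getD_eq_getElem?_getD, List.getElem?_map, List.getElem?_take, if_pos i.2]
      cases l[(i : ℕ)]? <;> simp [residue]
    rw [e, List.map_map] at h3
    have c1 : (2 ^ r + 1) * (200 * opCost s) ≤ ringCost s r := by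
      refine le_trans ?_ (ringCost_ge s r)
      calc (2 ^ r + 1) * (200 * opCost s) ≤ (2 * 2 ^ r) * (200 * opCost s) :=
            Nat.mul_le_mul_right _ (by omega)
        _ = 400 * (2 ^ r * opCost s) := by ring
        _ ≤ _ := Nat.mul_le_mul_right _ (by norm_num)
    obtain ⟨z, l', rfl⟩ := List.exists_cons_of_length_pos h0
    rw [numChunks_of_pos h0, range_succ_map, Nat.succ_mul (_ + 1)]
    simp only [zero_mul, List.drop_zero]
    have e2 : (fun j => (listChunk q r (((z :: l').drop (2 ^ r)).drop (j * 2 ^ r))).tree) =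
        fun j => (listChunk q r ((z :: l').drop ((j + 1) * 2 ^ r))).tree := by
      funext j
      rw [List.drop_drop]
      congr 3
      ring
    rw [e2] at h2
    refine .of_wp s ?_
    simp only [chunksProg, wp, arg, Val.list_cons, again, tup, op, head, tail, letIn, call,
      Val.list_nil, List.map_cons]
    exact .inl ⟨Val.pair_ne_nat _ _ _, _, _, h1, _, _, h3, _, _, h2, rfl, by omega⟩

/-! ## The hash as a recursion over the address bits -/

/-- The polynomial with the given coefficients. -/
def polyOf {R : Type*} [CommRing R] : List R → R[X]
  | [] => 0
  | a :: l => C a + X * polyOf l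

theorem coeff_polyOf {R : Type*} [CommRing R] (l : List R) (i : ℕ) :
    (polyOf l).coeff i = l.getD i 0 := by
  induction l generalizing i with
  | nil => simp [polyOf]
  | cons a l ih =>
    cases i with
    | zero => simp [polyOf]
    | succ i =>
      rw [polyOf, coeff_add, coeff_X_mul, ih, List.getD_cons_succ, coeff_C_succ, zero_add]

section
variable {R : Type} [CommRing R]

/-- One step of Horner's scheme on coefficients: `he + (c₁ + c₂ X) (ho - he)`, plus a carry. -/
def hashStep (c₁ c₂ : R) : R → List R → List R → List R
  | carry, o :: ho, e :: he => (e + carry + c₁ * (o - e)) :: hashStep c₁ c₂ (c₂ * (o - e)) ho he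
  | carry, _, _ => [carry]

theorem polyOf_hashStep (c₁ c₂ carry : R) (ho he : List R) (h : ho.length = he.length) :
    polyOf (hashStep c₁ c₂ carry ho he) =
      C carry + polyOf he + (C c₁ + C c₂ * X) * (polyOf ho - polyOf he) := by
  induction ho generalizing carry he with
  | nil =>
    obtain rfl := List.length_eq_zero_iff.1 h.symm
    simp [hashStep, polyOf]
  | cons o ho ih =>
    cases he with
    | nil => simp at h
    | cons e he =>
      rw [hashStep, polyOf, ih _ _ (by simpa using h), polyOf, polyOf]
      simp only [C_add, C_mul, C_sub]
      ring

theorem length_hashStep (c₁ c₂ carry : R) (ho he : List R) (h : ho.length = he.length) :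
    (hashStep c₁ c₂ carry ho he).length = he.length + 1 := by
  induction ho generalizing carry he with
  | nil =>
    obtain rfl := List.length_eq_zero_iff.1 h.symm
    simp [hashStep]
  | cons o ho ih =>
    cases he with
    | nil => simp at h
    | cons e he =>
      rw [hashStep, List.length_cons, ih _ _ (by simpa using h), List.length_cons]

/-- Coefficients of the hash of a list of chunks; `cs` are the ciphertexts of the address bits. -/
def hashList : List (R × R) → List R → List R
  | [], l => [l.getD 0 0]
  | c :: cs, l => hashStep c.1 c.2 0 (hashList cs (unzipList l).2) (hashList cs (unzipList l).1)

/-- The length depends only on the number of ciphertexts. `hashStep` stops at the end of the shorter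
list, so equal lengths are needed, and the format of a transmitted hash becomes independent of the
data. -/
theorem length_hashList (cs : List (R × R)) (l : List R) :
    (hashList cs l).length = cs.length + 1 := by
  induction cs generalizing l with
  | nil => rfl
  | cons c cs ih => rw [hashList, length_hashStep _ _ _ _ _ (by rw [ih, ih]), ih]; rfl

/-- The circuit that compares the address bits with those of `j`. -/
def selectProd : List (R × R) → ℕ → R[X]
  | [], _ => 1
  | c :: cs, j => (if j % 2 = 1 then C c.1 + C c.2 * X else 1 - (C c.1 + C c.2 * X)) *
      selectProd cs (j / 2)

/-- The selector of j has the factor c or 1 - c according to the parity of j, and the rest of it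
depends on j / 2 only. The sum is thus c times the hash of the odd entries plus 1 - c times the hash
of the even entries. -/
theorem polyOf_hashList (cs : List (R × R)) (l : List R) :
    polyOf (hashList cs l) =
      ∑ j ∈ Finset.range (2 ^ cs.length), selectProd cs j * C (l.getD j 0) := by
  induction cs generalizing l with
  | nil => simp [hashList, polyOf, selectProd]
  | cons c cs ih =>
    rw [hashList, polyOf_hashStep _ _ _ _ _ (by rw [length_hashList, length_hashList]), ih, ih,
      List.length_cons, pow_succ' 2, sum_range_two_mul]
    simp only [unzipList_getD, selectProd]
    have h0 (j : ℕ) : (2 * j) % 2 ≠ 1 := by omega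
    have h1 (j : ℕ) : (2 * j + 1) % 2 = 1 := by omega
    have h2 (j : ℕ) : (2 * j) / 2 = j := by omega
    have h3 (j : ℕ) : (2 * j + 1) / 2 = j := by omega
    simp only [h0, h1, h2, h3, if_true, if_false, mul_assoc, ← Finset.mul_sum, C_0]
    ring

theorem selectProd_eq_prod (cs : List (R × R)) (j : ℕ) :
    selectProd cs j = ∏ i : Fin cs.length,
      if j.testBit i then C cs[i].1 + C cs[i].2 * X else 1 - (C cs[i].1 + C cs[i].2 * X) := by
  induction cs generalizing j with
  | nil => simp [selectProd]
  | cons c cs ih =>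
    rw [selectProd, ih]
    refine Eq.trans ?_ (Fin.prod_univ_succ (n := cs.length) _).symm
    congr 1
    · simp [Nat.testBit_zero]
    · refine Finset.prod_congr rfl fun i _ => ?_
      have e : j.testBit (i.succ : Fin (cs.length + 1)) = (j / 2).testBit i := by
        rw [Fin.val_succ, Nat.testBit_succ]
      refine if_congr ?_ rfl rfl
      rw [← e]

end

/-- Factors below position `logDeg` are 1, since a chunk is named by the higher address bits.
Dropping the low ciphertexts re-indexes the product. -/
theorem eval_chunkCircuit (P : RingParams) {n : ℕ} (j : ℕ) (ct : Fin (addrBits n) → P.R × P.R) :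
    BV.eval P (chunkCircuit n P.logDeg j) ct =
      selectProd ((List.ofFn ct).drop P.logDeg) j := by
  rw [BV.eval, chunkCircuit, map_prod, selectProd_eq_prod]
  have hlen : ((List.ofFn ct).drop P.logDeg).length = addrBits n - P.logDeg := by simp
  rw [← Fin.prod_congr' (fun i : Fin ((List.ofFn ct).drop P.logDeg).length => _) hlen.symm]
  have hfac (i : Fin (addrBits n)) : MvPolynomial.aeval (fun i => BV.ofPair P (ct i))
      (if P.logDeg ≤ (i : ℕ) then
        (if j.testBit (i - P.logDeg) then MvPolynomial.X i else 1 - MvPolynomial.X i) else 1 :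
        MvPolynomial (Fin (addrBits n)) ℤ) =
      if P.logDeg ≤ (i : ℕ) then (if j.testBit (i - P.logDeg) then BV.ofPair P (ct i) else
        1 - BV.ofPair P (ct i)) else 1 := by
    split_ifs <;> simp
  rw [Finset.prod_congr rfl fun i _ => hfac i, Finset.prod_ite, Finset.prod_const_one, mul_one]
  refine Finset.prod_bij' (fun i hi => ⟨i - P.logDeg, by
      have := (Finset.mem_filter.1 hi).2
      have := i.2
      omega⟩) (fun i _ => ⟨i + P.logDeg, by have := i.2; omega⟩) ?_ ?_ ?_ ?_ ?_
  · simp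
  · simp
  · intro i hi
    have := (Finset.mem_filter.1 hi).2
    ext; simp; omega
  · intro i hi
    ext; simp
  · intro i hi
    have h := (Finset.mem_filter.1 hi).2
    have e : ((List.ofFn ct).drop P.logDeg)[(i : ℕ) - P.logDeg]'(by rw [hlen]; have := i.2; omega) = ct i := by
      simp [List.getElem_drop, h]
    simp only [Fin.val_cast, Fin.getElem_fin, e]
    rfl

/-- The hash, computed by recursion. -/
theorem chunkedHash_eq (P : RingParams) {n : ℕ} (hr : P.logDeg ≤ addrBits n)
    (ct : Fin (addrBits n) → P.R × P.R) (x : Fin n → ℤ) :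
    chunkedHash P ct x = polyOf (hashList ((List.ofFn ct).drop P.logDeg)
      ((List.range (numChunks n P.logDeg)).map fun j => chunk P.q P.logDeg x j)) := by
  rw [polyOf_hashList, chunkedHash]
  have hp : 0 < 2 ^ P.logDeg := by positivity
  have hlen : ((List.ofFn ct).drop P.logDeg).length = addrBits n - P.logDeg := by simp
  have hle : numChunks n P.logDeg ≤ 2 ^ ((List.ofFn ct).drop P.logDeg).length := by
    rw [hlen, numChunks, ← Nat.lt_succ_iff, Nat.div_lt_iff_lt_mul hp, Nat.succ_mul, ← pow_add,
      Nat.sub_add_cancel hr]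
    have : n ≤ 2 ^ addrBits n := Nat.le_pow_clog (by norm_num) n
    omega
  -- The recursion runs over all 2 ^ (number of bits) indices; beyond the last chunk it reads the
  -- default value 0.
  rw [← Finset.sum_subset (Finset.range_mono hle)]
  · refine Finset.sum_congr rfl fun j hj => ?_
    rw [eval_chunkCircuit, List.getD_eq_getElem _ _ (by simpa using hj)]
    simp
  · intro j _ hj
    rw [List.getD_eq_default _ _ (by simpa using hj)]
    simp

/-! ## Programs for the hash -/

section
variable {s q r : ℕ} [NeZero q]

/-- On input `r, q, c₁, c₂, carry, ho, he`: `hashStep`. -/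
def stepProg : Prog :=
  .cond (arg 5)
    (letIn (call ringSub [arg 0, arg 1, head (arg 5), head (arg 6)]) <|
      .pair
        (call ringAdd [arg 1, arg 2, call ringAdd [arg 1, arg 2, head (arg 7), arg 5],
          call ringMul [arg 1, arg 2, arg 3, arg 0]])
        (again [arg 1, arg 2, arg 3, arg 4, call ringMul [arg 1, arg 2, arg 4, arg 0],
          tail (arg 6), tail (arg 7)]))
    (.pair (arg 4) (.const 0))

/-- Lists of ring elements. -/
def ringList (l : List (Ring2 q r)) : Val := .list (l.map Ring2.tree)

theorem runs_stepProg (hq : 2 ≤ q) (h : FitsWord s q r) (c₁ c₂ carry : Ring2 q r)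
    (ho he : List (Ring2 q r)) (hl : ho.length = he.length) :
    Runs stepProg (.list [.nat r, .nat q, c₁.tree, c₂.tree, carry.tree, ringList ho, ringList he])
      (ringList (hashStep c₁ c₂ carry ho he)) ((ho.length + 1) * (6 * ringCost s r)) := by
  have hR := ringCost_ge_op s r
  have hW := two_mul_add_one_le_opCost s
  induction ho generalizing carry he with
  | nil =>
    obtain rfl := List.length_eq_zero_iff.1 hl.symm
    refine .of_wp s ?_
    simp only [stepProg, wp, arg, Val.list_cons, tup, again, call, Val.list_nil, letIn, head, tail, op,
      ringList, List.map_nil, hashStep]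
    exact .inr ⟨trivial, rfl, by simp; omega⟩
  | cons o ho ih =>
    cases he with
    | nil => simp at hl
    | cons e he =>
      have h1 := ih (c₂ * (o - e)) he (by simpa using hl)
      have h2 := runs_ringSub h o e
      have h3 := runs_ringAdd h e carry
      have h4 := runs_ringMul hq h c₁ (o - e)
      have h5 := runs_ringMul hq h c₂ (o - e)
      have h6 := runs_ringAdd h (e + carry) (c₁ * (o - e))
      rw [List.length_cons, Nat.succ_mul (ho.length + 1)]
      refine .of_wp s ?_
      simp only [stepProg, wp, arg, Val.list_cons, tup, again, call, Val.list_nil, letIn, head, tail, op,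
        ringList, List.map_cons, hashStep]
      exact .inl ⟨Val.pair_ne_nat _ _ _, _, _, h2, _, _, h3, _, _, h4, _, _, h6, _, _, h5, _, _, h1,
        rfl, by omega⟩

/-- On input `r, q, cs, l`: `hashList`. -/
def hashListProg : Prog :=
  .cond (arg 2)
    (letIn (call unzip [arg 3]) <|
      call stepProg [arg 1, arg 2, head (head (arg 3)), tail (head (arg 3)),
        call build [arg 1, .const 0], again [arg 1, arg 2, tail (arg 3), tail (arg 0)],
        again [arg 1, arg 2, tail (arg 3), head (arg 0)]])
    (.pair (.cond (arg 3) (head (arg 3)) (call build [arg 0, .const 0])) (.const 0))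

def pairTree (c : Ring2 q r × Ring2 q r) : Val := .pair c.1.tree c.2.tree

/-- The recursion visits at most twice as many nodes as there are addresses of chunks, and a node
does one step of Horner's scheme, on as many coefficients as there are bits below it. -/
theorem runs_hashListProg (hq : 2 ≤ q) (h : FitsWord s q r) (cs : List (Ring2 q r × Ring2 q r))
    (l : List (Ring2 q r)) (hl : l.length ≤ 2 ^ cs.length) :
    Runs hashListProg (.list [.nat r, .nat q, .list (cs.map pairTree), ringList l])
      (ringList (hashList cs l)) ((cs.length + 1) * (2 ^ cs.length * (20 * ringCost s r))) := by
  have hR := ringCost_ge_op s r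
  have hW := two_mul_add_one_le_opCost s
  have hr : r < s := by have := h.1; omega
  have hz := runs_build_zero (q := q) hr
  induction cs generalizing l with
  | nil =>
    refine .of_wp s ?_
    simp only [hashListProg, wp, arg, Val.list_cons, tup, again, call, Val.list_nil, letIn, head, tail,
      op, ringList, List.map_nil, hashList, List.map_cons]
    refine .inr ⟨trivial, ?_⟩
    cases l with
    | nil => exact .inr ⟨rfl, _, _, hz, rfl, by simp; omega⟩
    | cons a l => exact .inl ⟨Val.pair_ne_nat _ _ _, rfl, by simp; omega⟩
  | cons c cs ih =>
    have hlen := unzipList_length l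
    rw [List.length_cons, pow_succ] at hl
    have h1 := ih (unzipList l).1 (by omega)
    have h2 := ih (unzipList l).2 (by omega)
    have h3 := runs_unzip (l.map Ring2.tree)
    have h4 := runs_stepProg hq h c.1 c.2 0 (hashList cs (unzipList l).2) (hashList cs (unzipList l).1)
      (by rw [length_hashList, length_hashList])
    rw [length_hashList] at h4
    rw [unzipList_map, List.length_map] at h3
    have c1 : (l.length + 1) * 100 ≤ 2 ^ cs.length * ringCost s r := by
      have : 1 ≤ 2 ^ cs.length := Nat.one_le_two_pow
      have h5 : 2 ^ cs.length * 300 ≤ 2 ^ cs.length * ringCost s r :=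
        Nat.mul_le_mul_left _ (by omega)
      omega
    -- A node of height ℓ needs O(ℓ) ring operations; bounding ℓ by 2 ^ ℓ makes each level cost at
    -- most a multiple of 2 ^ `cs.length`, which fits the recurrence.
    have c2 : (cs.length + 1 + 1) * (6 * ringCost s r) ≤ 12 * (2 ^ cs.length * ringCost s r) := by
      have : cs.length < 2 ^ cs.length := Nat.lt_two_pow_self
      calc (cs.length + 1 + 1) * (6 * ringCost s r) ≤ (2 * 2 ^ cs.length) * (6 * ringCost s r) :=
            Nat.mul_le_mul_right _ (by omega)
        _ = _ := by ring
    have c3 : ringCost s r ≤ 2 ^ cs.length * ringCost s r := Nat.le_mul_of_pos_left _ (by positivity)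
    have e : ((c :: cs).length + 1) * (2 ^ (c :: cs).length * (20 * ringCost s r)) =
        2 * ((cs.length + 1) * (2 ^ cs.length * (20 * ringCost s r))) +
          40 * (2 ^ cs.length * ringCost s r) := by
      rw [List.length_cons, pow_succ]; ring
    rw [e]
    refine .of_wp s ?_
    simp only [hashListProg, wp, arg, Val.list_cons, tup, again, call, Val.list_nil, letIn, head, tail,
      op, ringList, List.map_cons, hashList, pairTree]
    exact .inl ⟨Val.pair_ne_nat _ _ _, _, _, h3, _, _, hz, _, _, h2, _, _, h1, _, _, h4, rfl, by omega⟩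

/-- On input `i, r, l`: the ciphertexts in the list `l` from position `i` on. -/
def dropCiphertexts : Prog :=
  .cond (arg 0)
    (.cond (arg 2) (again [op .sub (arg 0) (.const 1), arg 1, tail (arg 2)]) (.const 0))
    (.cond (arg 2)
      (.pair (.pair (call build [arg 1, head (head (arg 2))]) (call build [arg 1, tail (head (arg 2))]))
        (again [.const 0, arg 1, tail (arg 2)]))
      (.const 0))

/-- Pairs of ring elements, as they are transmitted. -/
def pairEnc (c : Ring2 q r × Ring2 q r) : Val := .pair c.1.enc c.2.enc

theorem runs_dropCiphertexts {i : ℕ} (hs : 2 ≤ s) (hr : r < s) (hi : i < 2 ^ s)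
    (cs : List (Ring2 q r × Ring2 q r)) :
    Runs dropCiphertexts (.list [.nat i, .nat r, .list (cs.map pairEnc)])
      (.list ((cs.drop i).map pairTree)) ((cs.length + 1) * (3 * ringCost s r)) := by
  have hR := ringCost_ge_op s r
  have hW := two_mul_add_one_le_opCost s
  have h4 : 2 ^ 2 ≤ 2 ^ s := Nat.pow_le_pow_right (by norm_num) hs
  induction cs generalizing i with
  | nil =>
    rw [List.drop_nil]
    refine .of_wp s ?_
    simp only [dropCiphertexts, wp, arg, Val.list_cons, tup, again, call, Val.list_nil, letIn, head,
      tail, op, List.map_nil]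
    rcases Nat.eq_zero_or_pos i with rfl | h0
    · exact .inr ⟨rfl, .inr ⟨trivial, trivial, by simp; omega⟩⟩
    · exact .inl ⟨Val.nat_ne_zero (by omega), .inr ⟨trivial, trivial, by simp; omega⟩⟩
  | cons c cs ih =>
    rw [List.length_cons, Nat.succ_mul (cs.length + 1)]
    refine .of_wp s ?_
    simp only [dropCiphertexts, wp, arg, Val.list_cons, tup, again, call, Val.list_nil, letIn, head,
      tail, op, List.map_cons, pairEnc]
    cases i with
    | zero =>
      have h1 := ih (i := 0) (by positivity)
      have h2 := runs_build_enc hr c.1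
      have h3 := runs_build_enc hr c.2
      exact .inr ⟨rfl, .inl ⟨Val.pair_ne_nat _ _ _, _, _, h2, _, _, h3, _, _, h1, rfl, by omega⟩⟩
    | succ i =>
      have h1 := ih (i := i) (by omega)
      exact .inl ⟨Val.nat_ne_zero (by omega), .inl ⟨Val.pair_ne_nat _ _ _, hi, by omega, _, _, h1,
        rfl, by omega⟩⟩

/-- On input `r, l`: the coefficient lists of a list of ring elements. -/
def flattenAll : Prog :=
  .cond (arg 1) (.pair (call flatten [arg 0, head (arg 1)]) (again [arg 0, tail (arg 1)])) (.const 0)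

theorem runs_flattenAll (hr : r < s) (l : List (Ring2 q r)) :
    Runs flattenAll (.list [.nat r, ringList l]) (.list (l.map Ring2.enc))
      ((l.length + 1) * (2 * ringCost s r)) := by
  have hR := ringCost_ge_op s r
  have hW := two_mul_add_one_le_opCost s
  induction l with
  | nil =>
    refine .of_wp s ?_
    simp only [flattenAll, wp, arg, Val.list_cons, tup, again, call, Val.list_nil, letIn, head,
      tail, op, List.map_nil, ringList]
    exact .inr ⟨trivial, trivial, by simp; omega⟩
  | cons a l ih =>
    have h1 := runs_flatten hr a
    rw [List.length_cons, Nat.succ_mul (l.length + 1)]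
    refine .of_wp s ?_
    simp only [flattenAll, wp, arg, Val.list_cons, tup, again, call, Val.list_nil, letIn, head,
      tail, op, List.map_cons, ringList]
    exact .inl ⟨Val.pair_ne_nat _ _ _, _, _, h1, _, _, ih, rfl, by omega⟩

end

/-- On input `r, q, ciphertexts, x`: the hash of `x`. -/
def hashProg : Prog :=
  call flattenAll [arg 0, call hashListProg [arg 0, arg 1,
    call dropCiphertexts [arg 0, arg 0, arg 2],
    call chunksProg [arg 0, call powTwo [arg 0], arg 1, arg 3]]]

/-- Number of steps of `hashProg`. -/
def hashCost (s r L : ℕ) : ℕ := 60 * ((L + 1) * (2 ^ (L - r) * ringCost s r))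

theorem vec_eq {n : ℕ} (x : Fin n → ℤ) : Val.vec x = .list ((List.ofFn x).map .int) := by
  rw [Val.vec, List.map_ofFn]; rfl

/-- There are at most 2 ^ (L - r) chunks and a ring operation costs 2 ^ r up to factors polynomial
in r and in the word length. The product is nearly linear in n, and this is where a fast ring
multiplication pays. -/
theorem runs_hashProg {s : ℕ} (P : RingParams) {n : ℕ} (h : FitsWord s P.q P.logDeg)
    (hr : P.logDeg ≤ addrBits n) (ct : Fin (addrBits n) → P.R × P.R) (x : Fin n → ℤ)
    (hx : ∀ i, (x i).natAbs < 2 ^ s) :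
    Runs hashProg (.list [.nat P.logDeg, .nat P.q, .list (List.ofFn fun i => P.encPair (ct i)),
      Val.vec x]) (encHash P n (chunkedHash P ct x)) (hashCost s P.logDeg (addrBits n)) := by
  have hW := two_mul_add_one_le_opCost s
  have h1 := h.1
  have hq := P.q_prime.two_le
  have hrs : P.logDeg < 2 ^ s := lt_of_lt_of_le (by omega) Nat.lt_two_pow_self.le
  have hp := runs_powTwo (s := s) (k := P.logDeg) (by omega)
  have hc := runs_chunksProg (q := P.q) (s := s) (r := P.logDeg) (by omega)
    (h.modulus_lt.trans_le' (by omega)) (by omega) (List.ofFn x) (by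
      intro z hz
      obtain ⟨i, rfl⟩ := (List.mem_ofFn' _ _).1 hz
      exact hx i)
  have hd := runs_dropCiphertexts (s := s) (q := P.q) (r := P.logDeg) (by omega) (by omega) hrs
    (List.ofFn ct)
  have hlen : ((List.ofFn ct).drop P.logDeg).length = addrBits n - P.logDeg := by simp
  have hp0 : 0 < 2 ^ P.logDeg := by positivity
  have hle : numChunks n P.logDeg ≤ 2 ^ (addrBits n - P.logDeg) := by
    rw [numChunks, ← Nat.lt_succ_iff, Nat.div_lt_iff_lt_mul hp0, Nat.succ_mul, ← pow_add,
      Nat.sub_add_cancel hr]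
    have : n ≤ 2 ^ addrBits n := Nat.le_pow_clog (by norm_num) n
    omega
  have hh := runs_hashListProg hq h ((List.ofFn ct).drop P.logDeg)
    ((List.range (numChunks n P.logDeg)).map fun j => chunk P.q P.logDeg x j)
    (by rw [List.length_map, List.length_range, hlen]; exact hle)
  have hf := runs_flattenAll (s := s) (r := P.logDeg) (by omega) (hashList ((List.ofFn ct).drop P.logDeg)
    ((List.range (numChunks n P.logDeg)).map fun j => chunk P.q P.logDeg x j))
  have hout : Val.list ((hashList ((List.ofFn ct).drop P.logDeg)
      ((List.range (numChunks n P.logDeg)).map fun j => chunk P.q P.logDeg x j)).map Ring2.enc) =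
      encHash P n (chunkedHash P ct x) := by
    rw [encHash, chunkedHash_eq P hr]
    congr 1
    refine List.ext_getElem (by simp [length_hashList]) fun i i1 i2 => ?_
    simp only [List.getElem_map, List.getElem_ofFn, coeff_polyOf]
    rw [List.getD_eq_getElem]
  rw [hout] at hf
  have evec : Val.vec x = .list ((List.ofFn x).map .int) := vec_eq x
  have ect : Val.list (List.ofFn fun i => P.encPair (ct i)) =
      .list ((List.ofFn ct).map pairEnc) := by rw [List.map_ofFn]; rfl
  have ech : Val.list ((List.range (numChunks (List.ofFn x).length P.logDeg)).map fun j =>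
        (listChunk P.q P.logDeg ((List.ofFn x).drop (j * 2 ^ P.logDeg))).tree) =
      ringList ((List.range (numChunks n P.logDeg)).map fun j => chunk P.q P.logDeg x j) := by
    rw [List.length_ofFn, ringList, List.map_map]
    congr 1
    refine List.map_congr_left fun j _ => ?_
    rw [Function.comp, chunk_eq_listChunk]
  rw [ech, List.length_ofFn, ← evec] at hc
  rw [List.length_ofFn, ← ect] at hd
  rw [hlen] at hh
  rw [length_hashList, hlen] at hf
  have hR := ringCost_ge_op s P.logDeg
  have c1 : (P.logDeg + 1) * (20 * opCost s) ≤ ringCost s P.logDeg := by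
    refine le_trans ?_ (ringCost_ge s _)
    have : P.logDeg + 1 ≤ 2 ^ P.logDeg := Nat.lt_two_pow_self
    calc (P.logDeg + 1) * (20 * opCost s) ≤ 2 ^ P.logDeg * (20 * opCost s) :=
          Nat.mul_le_mul_right _ this
      _ = 20 * (2 ^ P.logDeg * opCost s) := by ring
      _ ≤ _ := Nat.mul_le_mul_right _ (by norm_num)
  generalize hR' : ringCost s P.logDeg = RC at *
  have c5 : 1 ≤ 2 ^ (addrBits n - P.logDeg) := Nat.one_le_two_pow
  set E := 2 ^ (addrBits n - P.logDeg) with hE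
  have c6 : E * RC ≤ (addrBits n + 1) * (E * RC) := Nat.le_mul_of_pos_left _ (by omega)
  have c7 : RC ≤ E * RC := Nat.le_mul_of_pos_left _ (by omega)
  have c2 : (numChunks n P.logDeg + 1) * (3 * RC) ≤ 6 * ((addrBits n + 1) * (E * RC)) := by
    calc (numChunks n P.logDeg + 1) * (3 * RC) ≤ (2 * E) * (3 * RC) :=
          Nat.mul_le_mul_right _ (by omega)
      _ = 6 * (E * RC) := by ring
      _ ≤ _ := Nat.mul_le_mul_left _ c6
  have c3 : (addrBits n + 1) * (3 * RC) ≤ 3 * ((addrBits n + 1) * (E * RC)) := by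
    calc (addrBits n + 1) * (3 * RC) = 3 * ((addrBits n + 1) * RC) := by ring
      _ ≤ _ := by gcongr
  have c4 : (addrBits n - P.logDeg + 1) * (E * (20 * RC)) ≤ 20 * ((addrBits n + 1) * (E * RC)) := by
    calc (addrBits n - P.logDeg + 1) * (E * (20 * RC)) = 20 * ((addrBits n - P.logDeg + 1) * (E * RC)) := by
          ring
      _ ≤ _ := Nat.mul_le_mul_left _ (Nat.mul_le_mul_right _ (by omega))
  have c8 : (addrBits n - P.logDeg + 1 + 1) * (2 * RC) ≤ 4 * ((addrBits n + 1) * (E * RC)) := by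
    calc (addrBits n - P.logDeg + 1 + 1) * (2 * RC) ≤ (2 * (addrBits n + 1)) * (2 * RC) :=
          Nat.mul_le_mul_right _ (by omega)
      _ = 4 * ((addrBits n + 1) * RC) := by ring
      _ ≤ _ := by gcongr
  refine .of_wp s ?_
  simp only [hashProg, wp, arg, Val.list_cons, tup, again, call, Val.list_nil, letIn, head, tail, op,
    hashCost]
  rw [hR', ← hE]
  exact ⟨_, _, hd, _, _, hp, _, _, hc, _, _, hh, _, _, hf, rfl, by omega⟩

/-! ## Programs for the coordinator -/

theorem ofFn_succ_map {α : Type*} {n : ℕ} (f : Fin (n + 1) → α) :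
    List.ofFn f = f 0 :: List.ofFn fun i => f i.succ := List.ofFn_succ

/-- On input `q, l, m`: the sum of two lists of residues modulo `q`. -/
def addResidues : Prog :=
  .cond (arg 1)
    (.pair (op .mod (op .add (head (arg 1)) (head (arg 2))) (arg 0))
      (again [arg 0, tail (arg 1), tail (arg 2)]))
    (.const 0)

theorem runs_addResidues {s q n : ℕ} (hq : 2 * q < 2 ^ s) (f g : Fin n → ℕ) (hf : ∀ i, f i < q)
    (hg : ∀ i, g i < q) :
    Runs addResidues (.list [.nat q, .list (List.ofFn fun i => .nat (f i)),
      .list (List.ofFn fun i => .nat (g i))]) (.list (List.ofFn fun i => .nat ((f i + g i) % q)))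
      ((n + 1) * (50 * opCost s)) := by
  have hW := two_mul_add_one_le_opCost s
  induction n with
  | zero =>
    refine .of_wp s ?_
    simp only [addResidues, wp, arg, Val.list_cons, again, tup, op, head, tail, letIn, Val.list_nil,
      List.ofFn_zero]
    exact .inr ⟨trivial, trivial, by omega⟩
  | succ n ih =>
    have h1 := ih (fun i => f i.succ) (fun i => g i.succ) (fun i => hf _) (fun i => hg _)
    have h2 := hf 0
    have h3 := hg 0
    rw [Nat.succ_mul (n + 1)]
    refine .of_wp s ?_
    simp only [addResidues, wp, arg, Val.list_cons, again, tup, op, head, tail, letIn, Val.list_nil,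
      ofFn_succ_map]
    exact .inl ⟨Val.pair_ne_nat _ _ _, by omega, by omega, by omega, by omega, _, _, h1, rfl, by omega⟩

namespace Ring2

variable {q r : ℕ}

theorem coeffs_add (a b : Ring2 q r) (i : Fin (2 ^ r)) : coeffs (a + b) i = coeffs a i + coeffs b i := by
  simp [coeffs]

theorem enc_add [NeZero q] (a b : Ring2 q r) :
    (a + b).enc = .list (List.ofFn fun i => .nat (((coeffs a i).val + (coeffs b i).val) % q)) := by
  rw [enc]
  simp only [coeffs_add, ZMod.val_add]

end Ring2

/-- On input `q, l, m`: the sum of two lists of ring elements. -/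
def addRingLists : Prog :=
  .cond (arg 1)
    (.pair (call addResidues [arg 0, head (arg 1), head (arg 2)])
      (again [arg 0, tail (arg 1), tail (arg 2)]))
    (.const 0)

theorem residueCost_le (s r : ℕ) : (2 ^ r + 1) * (50 * opCost s) ≤ ringCost s r := by
  refine le_trans ?_ (ringCost_ge s r)
  have : 1 ≤ 2 ^ r := Nat.one_le_two_pow
  calc (2 ^ r + 1) * (50 * opCost s) ≤ (2 * 2 ^ r) * (50 * opCost s) :=
        Nat.mul_le_mul_right _ (by omega)
    _ = 100 * (2 ^ r * opCost s) := by ring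
    _ ≤ _ := Nat.mul_le_mul_right _ (by norm_num)

theorem runs_addRingLists {s q r n : ℕ} [NeZero q] (hq : 2 * q < 2 ^ s) (f g : Fin n → Ring2 q r) :
    Runs addRingLists (.list [.nat q, .list (List.ofFn fun i => (f i).enc),
      .list (List.ofFn fun i => (g i).enc)]) (.list (List.ofFn fun i => (f i + g i).enc))
      ((n + 1) * (2 * ringCost s r)) := by
  have hW := two_mul_add_one_le_opCost s
  have hR := ringCost_ge_op s r
  induction n with
  | zero =>
    refine .of_wp s ?_
    simp only [addRingLists, wp, arg, Val.list_cons, again, tup, op, head, tail, letIn, Val.list_nil,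
      List.ofFn_zero]
    exact .inr ⟨trivial, trivial, by omega⟩
  | succ n ih =>
    have h1 := ih (fun i => f i.succ) (fun i => g i.succ)
    have h2 := runs_addResidues hq (fun i => (Ring2.coeffs (f 0) i).val)
      (fun i => (Ring2.coeffs (g 0) i).val) (fun i => ZMod.val_lt _) (fun i => ZMod.val_lt _)
    rw [← Ring2.enc_add] at h2
    have h3 := residueCost_le s r
    rw [Nat.succ_mul (n + 1)]
    refine .of_wp s ?_
    simp only [addRingLists, wp, arg, Val.list_cons, again, tup, op, head, tail, letIn, Val.list_nil,
      ofFn_succ_map, call]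
    exact .inl ⟨Val.pair_ne_nat _ _ _, _, _, h2, _, _, h1, rfl, by omega⟩

/-- On input `M, l, m`: the sum of two lists of residues, for the list `M` of moduli. -/
def addMeasurements : Prog :=
  .cond (arg 1)
    (letIn (op .add (head (arg 1)) (head (arg 2))) <|
      .pair (.cond (op .sub (head (arg 1)) (arg 0)) (arg 0) (op .sub (arg 0) (head (arg 1))))
      (again [tail (arg 1), tail (arg 2), tail (arg 3)]))
    (.const 0)

/-- The moduli of the measurement may have many bits, and division is charged quadratically. One
conditional subtraction reduces the sum of two residues at a cost linear in the bit length. -/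
theorem runs_addMeasurements {n : ℕ} (m f g : Fin n → ℕ) (hf : ∀ i, f i < m i) (hg : ∀ i, g i < m i) :
    Runs addMeasurements (.list [.list (List.ofFn fun i => .nat (m i)),
      .list (List.ofFn fun i => .nat (f i)), .list (List.ofFn fun i => .nat (g i))])
      (.list (List.ofFn fun i => .nat ((f i + g i) % m i))) (100 * ∑ i, (m i).size + 50) := by
  induction n with
  | zero =>
    refine .of_wp 0 ?_
    simp only [addMeasurements, wp, arg, Val.list_cons, again, tup, op, head, tail, letIn, Val.list_nil,
      List.ofFn_zero]
    exact .inr ⟨trivial, trivial, by simp⟩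
  | succ n ih =>
    have h1 := ih (fun i => m i.succ) (fun i => f i.succ) (fun i => g i.succ) (fun i => hf _)
      (fun i => hg _)
    have h2 := hf 0
    have h3 := hg 0
    have h4 : 1 ≤ (m 0).size := Nat.size_pos.2 (by omega)
    have h5 : m 0 < 2 ^ (m 0).size := Nat.lt_size_self _
    have h6 : 2 ^ ((m 0).size + 1) = 2 * 2 ^ (m 0).size := pow_succ' _ _
    rw [Fin.sum_univ_succ]
    -- The word length follows the modulus at hand, with one more bit for the carry.
    refine .of_wp ((m 0).size + 1) ?_
    simp only [addMeasurements, wp, arg, Val.list_cons, again, tup, op, head, tail, letIn, Val.list_nil,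
      ofFn_succ_map]
    refine .inl ⟨Val.pair_ne_nat _ _ _, by omega, by omega, by omega, by omega, ?_⟩
    rcases lt_or_ge (f 0 + g 0) (m 0) with h | h
    · refine .inl ⟨Val.nat_ne_zero (by omega), _, _, h1, ?_, by omega⟩
      rw [Nat.mod_eq_of_lt h]
    · refine .inr ⟨Val.nat_eq_zero (by omega), by omega, by omega, _, _, h1, ?_, by omega⟩
      rw [Nat.mod_eq_sub_mod h, Nat.mod_eq_of_lt (by omega)]

/-- On input `k, l`: whether the list `l` has at most `k` entries. -/
def lengthLe : Prog :=
  .cond (arg 1) (.cond (arg 0) (again [op .sub (arg 0) (.const 1), tail (arg 1)]) (.const 0)) (.const 1)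

theorem runs_lengthLe {s k : ℕ} (hk : k + 1 < 2 ^ s) (l : List Val) :
    Runs lengthLe (.list [.nat k, .list l]) (.nat (if l.length ≤ k then 1 else 0))
      ((l.length + 1) * (50 * opCost s)) := by
  have hW := two_mul_add_one_le_opCost s
  induction l generalizing k with
  | nil =>
    refine .of_wp s ?_
    simp only [lengthLe, wp, arg, Val.list_cons, again, tup, op, head, tail, letIn, Val.list_nil]
    exact .inr ⟨trivial, by simp, by simp; omega⟩
  | cons a l ih =>
    rw [List.length_cons, Nat.succ_mul (l.length + 1)]
    refine .of_wp s ?_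
    simp only [lengthLe, wp, arg, Val.list_cons, again, tup, op, head, tail, letIn, Val.list_nil]
    refine .inl ⟨Val.pair_ne_nat _ _ _, ?_⟩
    cases k with
    | zero => exact .inr ⟨rfl, by simp, by omega⟩
    | succ k => exact .inl ⟨Val.nat_ne_zero (by omega), by omega, by omega, _, _, ih (by omega),
        by simp, by omega⟩

/-- Entries of a list of integers from position `i` on, as a sparse list. -/
def sparseList : ℕ → List ℤ → List Val
  | _, [] => []
  | i, z :: l => if z = 0 then sparseList (i + 1) l else
      .pair (.nat i) (.int z) :: sparseList (i + 1) l

theorem filter_map_finRange {n : ℕ} (x : Fin n → ℤ) (i : ℕ) :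
    (((List.finRange n).filter fun j : Fin n => x j ≠ 0).map fun j : Fin n =>
      Val.pair (.nat (i + j)) (.int (x j))) = sparseList i (List.ofFn x) := by
  induction n generalizing i with
  | zero => rfl
  | succ n ih =>
    have h := ih (fun j => x j.succ) (i + 1)
    rw [List.finRange_succ, List.ofFn_succ, sparseList, ← h]
    have e : (fun j : Fin n => Val.pair (.nat (i + 1 + j)) (.int (x j.succ))) =
        (fun j : Fin (n + 1) => Val.pair (.nat (i + j)) (.int (x j))) ∘ Fin.succ := by
      funext j
      simp only [Function.comp, Fin.val_succ]
      congr 2; omega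
    rw [List.filter_cons, List.filter_map, e, ← List.map_map]
    by_cases h0 : x 0 = 0
    · simp [h0, Function.comp_def]
    · simp [h0, Function.comp_def]

theorem sparseVec_eq {n : ℕ} (x : Fin n → ℤ) : Val.sparseVec x = .list (sparseList 0 (List.ofFn x)) := by
  rw [← filter_map_finRange, Val.sparseVec]
  simp only [zero_add]

theorem length_sparse {n : ℕ} (x : Fin n → ℤ) : (sparseList 0 (List.ofFn x)).length = sparsity x := by
  rw [← filter_map_finRange, List.length_map, sparsity]
  rw [← List.toFinset_card_of_nodup ((List.nodup_finRange n).filter _)]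
  congr 1
  ext i
  simp

/-- The first position listed is never smaller than the current one. Hence truncated subtraction
tells in `densify` whether the current entry is zero. -/
theorem sparseList_head (i : ℕ) (l : List ℤ) : sparseList i l = [] ∨
    ∃ p z t, i ≤ p ∧ p < i + l.length ∧ sparseList i l = .pair (.nat p) (.int z) :: t := by
  induction l generalizing i with
  | nil => exact .inl rfl
  | cons z l ih =>
    rw [sparseList]
    split
    · rcases ih (i + 1) with h | ⟨p, w, t, h1, h2, h3⟩
      · exact .inl h
      · exact .inr ⟨p, w, t, by omega, by rw [List.length_cons]; omega, h3⟩
    · exact .inr ⟨i, z, _, le_rfl, by simp, rfl⟩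

/-- On input `i, m, l`: the list of the entries from position `i` to `i + m - 1` of a sparse list. -/
def densify : Prog :=
  .cond (arg 1)
    (.cond (arg 2)
      (.cond (op .sub (head (head (arg 2))) (arg 0))
        (.pair (.pair (.const 0) (.const 0))
          (again [op .add (arg 0) (.const 1), op .sub (arg 1) (.const 1), arg 2]))
        (.pair (tail (head (arg 2)))
          (again [op .add (arg 0) (.const 1), op .sub (arg 1) (.const 1), tail (arg 2)])))
      (.pair (.pair (.const 0) (.const 0))
        (again [op .add (arg 0) (.const 1), op .sub (arg 1) (.const 1), arg 2])))
    (.const 0)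

theorem runs_densify {s i : ℕ} (l : List ℤ) (hi : i + l.length + 1 < 2 ^ s) :
    Runs densify (.list [.nat i, .nat l.length, .list (sparseList i l)]) (.list (l.map .int))
      ((l.length + 1) * (100 * opCost s)) := by
  have hW := two_mul_add_one_le_opCost s
  induction l generalizing i with
  | nil =>
    refine .of_wp s ?_
    simp only [densify, wp, arg, Val.list_cons, again, tup, op, head, tail, letIn, Val.list_nil,
      List.length_nil, List.map_nil]
    exact .inr ⟨trivial, trivial, by omega⟩
  | cons z l ih =>
    rw [List.length_cons] at hi
    have h1 := ih (i := i + 1) (by omega)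
    rw [List.length_cons, Nat.succ_mul (l.length + 1)]
    refine .of_wp s ?_
    simp only [densify, wp, arg, Val.list_cons, again, tup, op, head, tail, letIn, Val.list_nil,
      List.length_cons, List.map_cons, Nat.add_sub_cancel]
    refine .inl ⟨Val.nat_ne_zero (by omega), ?_⟩
    by_cases hz : z = 0
    · subst hz
      rw [sparseList, if_pos rfl]
      rcases sparseList_head (i + 1) l with h | ⟨p, w, t, hp, hp', h⟩
      · rw [h] at h1 ⊢
        simp only [Val.list_nil]
        exact .inr ⟨trivial, by omega, by omega, by omega, by omega, _, _, h1, rfl, by omega⟩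
      · rw [h] at h1 ⊢
        simp only [Val.list_cons, wp]
        exact .inl ⟨Val.pair_ne_nat _ _ _, by omega, by omega, .inl ⟨Val.nat_ne_zero (by omega),
          by omega, by omega, by omega, by omega, _, _, h1, rfl, by omega⟩⟩
    · rw [sparseList, if_neg hz]
      simp only [Val.list_cons, wp]
      exact .inl ⟨Val.pair_ne_nat _ _ _, by omega, by omega, .inr ⟨Val.nat_eq_zero (by omega),
          by omega, by omega, by omega, by omega, _, _, h1, rfl, by omega⟩⟩

/-- Equality of lists of numbers of the same length. -/
def eqNats : Prog :=
  .cond (arg 0)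
    (.cond (op .add (op .sub (head (arg 0)) (head (arg 1))) (op .sub (head (arg 1)) (head (arg 0))))
      (.const 0) (again [tail (arg 0), tail (arg 1)]))
    (.const 1)

theorem runs_eqNats {s n : ℕ} (f g : Fin n → ℕ) (hf : ∀ i, f i < 2 ^ s) (hg : ∀ i, g i < 2 ^ s)
    [Decidable (f = g)] :
    Runs eqNats (.list [.list (List.ofFn fun i => .nat (f i)), .list (List.ofFn fun i => .nat (g i))])
      (.nat (if f = g then 1 else 0)) ((n + 1) * (50 * opCost s)) := by
  classical
  have hW := two_mul_add_one_le_opCost s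
  induction n with
  | zero =>
    refine .of_wp s ?_
    simp only [eqNats, wp, arg, Val.list_cons, again, tup, op, head, tail, letIn, Val.list_nil,
      List.ofFn_zero]
    exact .inr ⟨trivial, by rw [if_pos (Subsingleton.elim _ _)], by omega⟩
  | succ n ih =>
    have h1 := ih (fun i => f i.succ) (fun i => g i.succ) (fun i => hf _) (fun i => hg _)
    have h2 := hf 0
    have h3 := hg 0
    have hfg : f = g ↔ f 0 = g 0 ∧ (fun i : Fin n => f i.succ) = fun i => g i.succ := by
      simp only [funext_iff, Fin.forall_fin_succ]
    rw [Nat.succ_mul (n + 1)]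
    refine .of_wp s ?_
    simp only [eqNats, wp, arg, Val.list_cons, again, tup, op, head, tail, letIn, Val.list_nil,
      ofFn_succ_map]
    refine .inl ⟨Val.pair_ne_nat _ _ _, by omega, by omega, by omega, by omega, by omega, by omega, ?_⟩
    by_cases h : f 0 = g 0
    · refine .inr ⟨Val.nat_eq_zero (by omega), _, _, h1, ?_, by omega⟩
      simp only [hfg, h, true_and]
    · refine .inl ⟨Val.nat_ne_zero (by omega), ?_, by omega⟩
      simp only [hfg, h, false_and, if_false]

/-- Equality of lists of ring elements of the same length. -/
def eqRingLists : Prog :=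
  .cond (arg 0)
    (.cond (call eqNats [head (arg 0), head (arg 1)]) (again [tail (arg 0), tail (arg 1)]) (.const 0))
    (.const 1)

theorem runs_eqRingLists {s q r n : ℕ} [NeZero q] (hq : q < 2 ^ s) (f g : Fin n → Ring2 q r)
    [Decidable (f = g)] :
    Runs eqRingLists (.list [.list (List.ofFn fun i => (f i).enc),
      .list (List.ofFn fun i => (g i).enc)]) (.nat (if f = g then 1 else 0))
      ((n + 1) * (2 * ringCost s r)) := by
  classical
  have hW := two_mul_add_one_le_opCost s
  have hR := ringCost_ge_op s r
  induction n with
  | zero =>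
    refine .of_wp s ?_
    simp only [eqRingLists, wp, arg, Val.list_cons, again, tup, op, head, tail, letIn, Val.list_nil,
      List.ofFn_zero]
    exact .inr ⟨trivial, by rw [if_pos (Subsingleton.elim _ _)], by omega⟩
  | succ n ih =>
    have h1 := ih (fun i => f i.succ) (fun i => g i.succ)
    have h2 := runs_eqNats (s := s) (fun i => (Ring2.coeffs (f 0) i).val)
      (fun i => (Ring2.coeffs (g 0) i).val) (fun i => (ZMod.val_lt _).trans hq)
      (fun i => (ZMod.val_lt _).trans hq)
    have h3 := residueCost_le s r
    have hiff : ((fun i => (Ring2.coeffs (f 0) i).val) = fun i => (Ring2.coeffs (g 0) i).val) ↔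
        f 0 = g 0 := by
      refine ⟨fun h => Ring2.coeffs_injective (funext fun i => ZMod.val_injective _ (congrFun h i)),
        fun h => by rw [h]⟩
    simp only [hiff] at h2
    have hfg : f = g ↔ f 0 = g 0 ∧ (fun i : Fin n => f i.succ) = fun i => g i.succ := by
      simp only [funext_iff, Fin.forall_fin_succ]
    rw [Nat.succ_mul (n + 1)]
    refine .of_wp s ?_
    simp only [eqRingLists, wp, arg, Val.list_cons, again, tup, op, head, tail, letIn, Val.list_nil,
      ofFn_succ_map, call]
    refine .inl ⟨Val.pair_ne_nat _ _ _, _, _, h2, ?_⟩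
    by_cases h : f 0 = g 0
    · refine .inl ⟨Val.nat_ne_zero (by simp [h]), _, _, h1, ?_, by omega⟩
      simp only [hfg, h, true_and]
    · refine .inr ⟨Val.nat_eq_zero (by simp [h]), ?_, by omega⟩
      simp only [hfg, h, false_and, if_false]

/-- On input `q, M, packets`: the sum of a nonempty list of packets. -/
def sumPackets : Prog :=
  .cond (tail (arg 2))
    (letIn (again [arg 0, arg 1, tail (arg 2)]) <|
      .pair (call addRingLists [arg 1, head (head (arg 3)), head (arg 0)])
        (call addMeasurements [arg 2, tail (head (arg 3)), tail (arg 0)]))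
    (head (arg 2))

theorem Measurement.enc_add {n : ℕ} (Φ : Measurement n) (y z : Φ.Result) :
    Φ.enc (y + z) = .list (List.ofFn fun i => .nat (((y i).val + (z i).val) % Φ.modulus i)) := by
  rw [Measurement.enc]
  congr 2
  funext i
  have : NeZero (Φ.modulus i) := ⟨(Φ.modulus_pos i).ne'⟩
  rw [Pi.add_apply, ZMod.val_add]

theorem Measurement.apply_sum {n : ℕ} (Φ : Measurement n) {ι : Type*} (S : Finset ι)
    (x : ι → Fin n → ℤ) : Φ.apply (∑ i ∈ S, x i) = ∑ i ∈ S, Φ.apply (x i) := by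
  classical
  have h0 : Φ.apply 0 = 0 := by
    funext i; simp [Measurement.apply]
  have h1 (y z : Fin n → ℤ) : Φ.apply (y + z) = Φ.apply y + Φ.apply z := by
    funext i; simp [Measurement.apply, Matrix.mulVec_add]
  induction S using Finset.induction_on with
  | empty => simp [h0]
  | insert a S ha ih => rw [Finset.sum_insert ha, Finset.sum_insert ha, h1, ih]

/-- Number of steps for adding a packet. -/
def packetCost (s r L bits : ℕ) : ℕ := (L + 2) * (3 * ringCost s r) + 100 * bits

theorem runs_sumPackets {s T n : ℕ} (P : RingParams) (Φ : Measurement n) (hq : 2 * P.q < 2 ^ s)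
    (p : Fin (T + 1) → BV.Ciphertext P × Φ.Result) :
    Runs sumPackets (.list [.nat P.q, .list (List.ofFn fun i => .nat (Φ.modulus i)),
      .list (List.ofFn fun i => .pair (encHash P n (p i).1) (Φ.enc (p i).2))])
      (.pair (encHash P n (∑ i, (p i).1)) (Φ.enc (∑ i, (p i).2)))
      ((T + 1) * packetCost s P.logDeg (addrBits n) Φ.resultBits) := by
  have hW := two_mul_add_one_le_opCost s
  have hR := ringCost_ge_op s P.logDeg
  have hlow : 3 * ringCost s P.logDeg ≤ (addrBits n + 2) * (3 * ringCost s P.logDeg) :=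
    Nat.le_mul_of_pos_left _ (by omega)
  induction T with
  | zero =>
    refine .of_wp s ?_
    simp only [sumPackets, wp, arg, Val.list_cons, again, tup, op, head, tail, letIn, Val.list_nil,
      ofFn_succ_map, List.ofFn_zero, Fin.sum_univ_succ, Finset.univ_eq_empty, Finset.sum_empty, add_zero,
      packetCost]
    exact .inr ⟨trivial, trivial, by omega⟩
  | succ T ih =>
    have h1 := ih fun i => p i.succ
    have h2 := runs_addRingLists (s := s) (r := P.logDeg) (n := addrBits n - P.logDeg + 1) hq
      (fun i => (p 0).1.coeff i) (fun i => (∑ i : Fin (T + 1), (p i.succ).1).coeff i)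
    have h3 := runs_addMeasurements Φ.modulus (fun i => ((p 0).2 i).val)
      (fun i => ((∑ i : Fin (T + 1), (p i.succ).2) i).val)
      (fun i => by have : NeZero (Φ.modulus i) := ⟨(Φ.modulus_pos i).ne'⟩
                   exact ZMod.val_lt _)
      (fun i => by have : NeZero (Φ.modulus i) := ⟨(Φ.modulus_pos i).ne'⟩
                   exact ZMod.val_lt _)
    rw [← Measurement.enc_add] at h3
    simp only [← coeff_add] at h2
    rw [← Fin.sum_univ_succ (fun i => (p i).1)] at h2
    rw [← Fin.sum_univ_succ (fun i => (p i).2)] at h3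
    have hc : (addrBits n - P.logDeg + 1 + 1) * (2 * ringCost s P.logDeg) +
        ringCost s P.logDeg ≤ (addrBits n + 2) * (3 * ringCost s P.logDeg) := by
      calc _ ≤ (addrBits n + 2) * (2 * ringCost s P.logDeg) +
            (addrBits n + 2) * ringCost s P.logDeg := by
              exact Nat.add_le_add (Nat.mul_le_mul_right _ (by omega))
                (Nat.le_mul_of_pos_left _ (by omega))
        _ = _ := by ring
    rw [Nat.succ_mul (T + 1)]
    have hb : Φ.resultBits = ∑ i, (Φ.modulus i).size := rfl
    refine .of_wp s ?_
    rw [ofFn_succ_map, ofFn_succ_map]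
    rw [ofFn_succ_map] at h1
    simp only [sumPackets, wp, arg, Val.list_cons, again, tup, op, head, tail, letIn, Val.list_nil,
      call, packetCost]
    rw [hb]
    exact .inl ⟨Val.pair_ne_nat _ _ _, _, _, h1, _, _, h2, _, _, h3, rfl, by
      simp only [packetCost, hb]; omega⟩

/-! ## Linearity and degree of the hash -/

theorem Ring2.ofInts_add {q r : ℕ} (a b : Fin (2 ^ r) → ℤ) :
    (Ring2.ofInts (a + b) : Ring2 q r) = Ring2.ofInts a + Ring2.ofInts b := by
  simp only [Ring2.ofInts, Ring2.ofCoeffs, ← map_add, ← Finset.sum_add_distrib]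
  congr 1
  refine Finset.sum_congr rfl fun i _ => ?_
  simp [add_mul]

theorem Ring2.ofInts_zero {q r : ℕ} : (Ring2.ofInts 0 : Ring2 q r) = 0 := by
  have h := Ring2.ofInts_add (q := q) (0 : Fin (2 ^ r) → ℤ) 0
  rw [add_zero] at h
  exact left_eq_add.1 h

theorem chunk_add (q r : ℕ) {n : ℕ} (x y : Fin n → ℤ) (j : ℕ) :
    chunk q r (x + y) j = chunk q r x j + chunk q r y j := by
  rw [chunk, chunk, chunk, ← Ring2.ofInts_add]
  congr 1
  funext i
  simp only [Pi.add_apply]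
  split <;> simp

theorem chunk_zero (q r : ℕ) {n : ℕ} (j : ℕ) : chunk q r (0 : Fin n → ℤ) j = 0 := by
  have h := chunk_add q r (0 : Fin n → ℤ) 0 j
  rw [add_zero] at h
  exact left_eq_add.1 h

/-- The ciphertexts enter as fixed coefficients, so the hash is additive in the data: the packets
add up to the packet of the summed data. -/
theorem chunkedHash_sum (P : RingParams) {n : ℕ} (ct : Fin (addrBits n) → P.R × P.R) {ι : Type*}
    (S : Finset ι) (x : ι → Fin n → ℤ) :
    chunkedHash P ct (∑ i ∈ S, x i) = ∑ i ∈ S, chunkedHash P ct (x i) := by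
  classical
  induction S using Finset.induction_on with
  | empty => simp [chunkedHash, chunk_zero]
  | insert a S ha ih =>
    rw [Finset.sum_insert ha, Finset.sum_insert ha, ← ih]
    simp only [chunkedHash, chunk_add, C_add, mul_add, Finset.sum_add_distrib]

/-- Each address bit from position `logDeg` on raises the degree by at most one. The transmitted
coefficients therefore determine the hash, and comparing them decides equality. -/
theorem coeff_chunkedHash (P : RingParams) {n : ℕ} (hr : P.logDeg ≤ addrBits n)
    (ct : Fin (addrBits n) → P.R × P.R) (x : Fin n → ℤ) {i : ℕ} (hi : addrBits n - P.logDeg < i) :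
    (chunkedHash P ct x).coeff i = 0 := by
  rw [chunkedHash_eq P hr, coeff_polyOf, List.getD_eq_default]
  rw [length_hashList, List.length_drop, List.length_ofFn]
  omega

theorem chunkedHash_eq_iff (P : RingParams) {n : ℕ} (hr : P.logDeg ≤ addrBits n)
    (ct : Fin (addrBits n) → P.R × P.R) (x y : Fin n → ℤ) :
    ((fun i : Fin (addrBits n - P.logDeg + 1) => (chunkedHash P ct x).coeff i) =
      fun i : Fin (addrBits n - P.logDeg + 1) => (chunkedHash P ct y).coeff i) ↔
      chunkedHash P ct x = chunkedHash P ct y := by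
  refine ⟨fun h => Polynomial.ext fun i => ?_, fun h => by rw [h]⟩
  rcases lt_or_ge (addrBits n - P.logDeg) i with hi | hi
  · rw [coeff_chunkedHash P hr ct x hi, coeff_chunkedHash P hr ct y hi]
  · exact congrFun h ⟨i, by omega⟩

/-! ## The programs of the parties -/

/-- The environment below the `d` topmost values. -/
def Prog.beneath : ℕ → Prog
  | 0 => .id
  | d + 1 => .comp (beneath d) .snd

/-- The public parameter number `i`. -/
def Prog.param (d i : ℕ) : Prog := .comp (.comp (arg i) .fst) (beneath d)

/-- The pseudo-ciphertexts. -/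
def Prog.ciphertexts (d : ℕ) : Prog := .comp (.comp .snd (.comp .fst .snd)) (beneath d)

/-- The data after public parameters and state. -/
def Prog.payload (d : ℕ) : Prog := .comp (.comp .snd .snd) (beneath d)

section

variable {k N : ℕ → ℕ} (A : RelaxedRecovery k N)

def serverProg : Prog :=
  .pair (call hashProg [param 0 2, param 0 3, ciphertexts 0, payload 0])
    (.comp (.fix A.measureProg) (.pair (param 0 0) (.pair (param 0 5) (payload 0))))

def coordProg : Prog :=
  letIn (call sumPackets [param 0 3, param 0 4, payload 0]) <|
  letIn (.comp (.fix A.reportProg) (.pair (param 1 0) (.pair (param 1 5) (tail (arg 0))))) <|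
  .cond (call lengthLe [param 2 1, arg 0])
    (.cond (call eqRingLists [head (arg 1), call hashProg [param 2 2, param 2 3, ciphertexts 2,
        call densify [.const 0, param 2 0, arg 0]]])
      (.pair (.const 1) (arg 0)) (.const 0))
    (.const 0)

theorem Prog.RunsIn.runs {p : Prog} {v b : Val} {t : ℕ} (h : p.RunsIn v b t) : Runs p v b t :=
  let ⟨c, hc, he⟩ := h
  ⟨c, by exact_mod_cast hc, he⟩

theorem Runs.runsIn {p : Prog} {v b : Val} {t : ℕ} {t' : ℝ} (h : Runs p v b t) (ht : (t : ℝ) ≤ t') :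
    p.RunsIn v b t' :=
  let ⟨c, hc, he⟩ := h
  ⟨c, le_trans (by exact_mod_cast hc) ht, he⟩

/-- Words of `s` bits hold all numbers that the parties use, up to the entries of the data. -/
structure FitsProtocol (s : ℕ) (P : RingParams) (n k N : ℕ) : Prop where
  ring : FitsWord s P.q P.logDeg
  deg : P.logDeg ≤ addrBits n
  dim : n + 2 < 2 ^ s
  sparse : k + 1 < 2 ^ s
  box : N < 2 ^ s

theorem InBox.natAbs_lt {n N s : ℕ} {x : Fin n → ℤ} (h : InBox N x) (hN : N < 2 ^ s) (i : Fin n) :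
    (x i).natAbs < 2 ^ s := by
  have := abs_le.1 (h i)
  zify at hN
  have : (N : ℤ) < ((2 ^ s : ℕ) : ℤ) := by exact_mod_cast hN
  omega

theorem runs_serverProg {s n T : ℕ} {P : RingParams} (h : FitsProtocol s P n (k n) (N n))
    (ζ : (chunkedProtocol A P n T).State) (x : Fin n → ℤ) (hx : InBox (N n) x) :
    Runs (serverProg A) (.pair (publicParams A P n) (.pair ((chunkedProtocol A P n T).encState ζ)
      (Val.vec x))) ((chunkedProtocol A P n T).encPacket ((chunkedProtocol A P n T).server ζ x))
      (hashCost s P.logDeg (addrBits n) + A.measureTime n + 100) := by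
  have h1 := runs_hashProg P h.ring h.deg ζ.2 x (hx.natAbs_lt h.box)
  have h2 := (A.measureProg_runs n x hx).runs
  refine .of_wp s ?_
  simp only [serverProg, publicParams, chunkedProtocol, wp, arg, Val.list_cons, tup, call, head, tail,
    param, beneath, ciphertexts, payload]
  exact ⟨_, _, h1, _, _, h2, rfl, by omega⟩

/-- Number of steps of the coordinator after adding up the packets and reconstructing. -/
def checkCost (s r n : ℕ) : ℕ :=
  hashCost s r (addrBits n) + (n + 2) * (200 * opCost s) + (addrBits n + 2) * (2 * ringCost s r) + 300

/-- By linearity the summed packets are the packet of y, the sum of the data. It lies in the box, so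
the time bound of the reconstruction applies to it, and so does the bound for the entries of the
reconstruction. -/
theorem runs_coordProg {s n T : ℕ} {P : RingParams} (h : FitsProtocol s P n (k n) (N n)) (hT : 1 ≤ T)
    (ζ : (chunkedProtocol A P n T).State) (x : Fin T → Fin n → ℤ) (hx : InBox (N n) (∑ i, x i)) :
    Runs (coordProg A) (.pair (publicParams A P n) (.pair ((chunkedProtocol A P n T).encState ζ)
      (Val.list (List.ofFn fun i => (chunkedProtocol A P n T).encPacket
        ((chunkedProtocol A P n T).server ζ (x i))))))
      (encAnswer ((chunkedProtocol A P n T).coordinator ζ fun i =>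
        (chunkedProtocol A P n T).server ζ (x i)))
      (T * packetCost s P.logDeg (addrBits n) (A.Φ n).resultBits + A.reportTime n +
        checkCost s P.logDeg n) := by
  classical
  obtain ⟨T, rfl⟩ : ∃ T', T = T' + 1 := ⟨T - 1, by omega⟩
  have hW := two_mul_add_one_le_opCost s
  have hml := h.ring.modulus_lt
  have h1 := runs_sumPackets (s := s) P (A.Φ n) hml fun i =>
    (chunkedHash P ζ.2 (x i), (A.Φ n).apply (x i))
  simp only at h1
  rw [← chunkedHash_sum, ← Measurement.apply_sum] at h1
  set y := ∑ i, x i with hy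
  have h2 := (A.reportProg_runs n y hx).runs
  have hbox := A.report_inBox n y hx
  set x' := A.report n ((A.Φ n).apply y) with hx'
  have h3 := runs_lengthLe (s := s) (k := k n) h.sparse (sparseList 0 (List.ofFn x'))
  rw [← sparseVec_eq, length_sparse] at h3
  have hsp : sparsity x' ≤ n := (Finset.card_le_univ _).trans (by simp)
  have h4 := runs_densify (s := s) (i := 0) (List.ofFn x') (by have := h.dim; simp; omega)
  rw [← sparseVec_eq, ← vec_eq, List.length_ofFn] at h4
  have h5 := runs_hashProg P h.ring h.deg ζ.2 x' (hbox.natAbs_lt h.box)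
  have h6 := runs_eqRingLists (s := s) (by omega)
    (fun i : Fin (addrBits n - P.logDeg + 1) => (chunkedHash P ζ.2 y).coeff i)
    (fun i : Fin (addrBits n - P.logDeg + 1) => (chunkedHash P ζ.2 x').coeff i)
  have hout : (chunkedProtocol A P n (T + 1)).coordinator ζ (fun i =>
      (chunkedProtocol A P n (T + 1)).server ζ (x i)) =
      if sparsity x' ≤ k n ∧ chunkedHash P ζ.2 x' = chunkedHash P ζ.2 y then some x' else none := by
    simp only [chunkedProtocol]
    rw [← chunkedHash_sum, ← Measurement.apply_sum]
  rw [hout]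
  have c1 : (sparsity x' + 1) * (50 * opCost s) + (n + 1) * (100 * opCost s) ≤
      (n + 2) * (200 * opCost s) := by
    calc _ ≤ (n + 2) * (50 * opCost s) + (n + 2) * (100 * opCost s) :=
          Nat.add_le_add (Nat.mul_le_mul_right _ (by omega)) (Nat.mul_le_mul_right _ (by omega))
      _ = (n + 2) * (150 * opCost s) := by ring
      _ ≤ _ := Nat.mul_le_mul_left _ (by omega)
  have c2 : (addrBits n - P.logDeg + 1 + 1) * (2 * ringCost s P.logDeg) ≤
      (addrBits n + 2) * (2 * ringCost s P.logDeg) := Nat.mul_le_mul_right _ (by omega)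
  refine .of_wp s ?_
  simp only [coordProg, publicParams, chunkedProtocol, wp, arg, Val.list_cons, tup, call, head, tail,
    param, beneath, ciphertexts, payload, letIn, checkCost]
  refine ⟨_, _, h1, _, _, h2, _, _, h3, ?_⟩
  by_cases hs : sparsity x' ≤ k n
  · refine .inl ⟨Val.nat_ne_zero (by simp [hs]), _, _, h4, _, _, h5, _, _, h6, ?_⟩
    by_cases he : chunkedHash P ζ.2 y = chunkedHash P ζ.2 x'
    · refine .inl ⟨Val.nat_ne_zero ?_, ?_, by omega⟩
      · rw [if_pos ((chunkedHash_eq_iff P h.deg _ _ _).2 he)]; exact one_ne_zero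
      · rw [if_pos ⟨hs, he.symm⟩]; rfl
    · refine .inr ⟨Val.nat_eq_zero ?_, ?_, by omega⟩
      · rw [if_neg (mt (chunkedHash_eq_iff P h.deg _ _ _).1 he)]
      · rw [if_neg fun h => he h.2.symm]; rfl
  · refine .inr ⟨Val.nat_eq_zero (by simp [hs]), ?_, by omega⟩
    rw [if_neg fun h => hs h.1]; rfl

end

/-! ## Growth classes -/

/-- `f` is bounded by a polynomial in `u`. -/
def GrowsLike (u f : ℕ → ℕ) : Prop := ∃ c, ∀ n, f n ≤ c * (u n + 1) ^ c

namespace GrowsLike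

variable {u f g : ℕ → ℕ}

theorem of_le (hg : GrowsLike u g) (h : ∀ n, f n ≤ g n) : GrowsLike u f :=
  let ⟨c, hc⟩ := hg
  ⟨c, fun n => (h n).trans (hc n)⟩

theorem const (a : ℕ) : GrowsLike u fun _ => a :=
  ⟨a, fun n => Nat.le_mul_of_pos_right _ (by positivity)⟩

theorem self : GrowsLike u u := ⟨1, fun n => by simp⟩

theorem add (hf : GrowsLike u f) (hg : GrowsLike u g) : GrowsLike u fun n => f n + g n := by
  obtain ⟨a, ha⟩ := hf
  obtain ⟨b, hb⟩ := hg
  refine ⟨a + b, fun n => ?_⟩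
  rw [add_mul]
  refine Nat.add_le_add ((ha n).trans ?_) ((hb n).trans ?_) <;>
  exact Nat.mul_le_mul_left _ (Nat.pow_le_pow_right (by omega) (by omega))

theorem mul (hf : GrowsLike u f) (hg : GrowsLike u g) : GrowsLike u fun n => f n * g n := by
  obtain ⟨a, ha⟩ := hf
  obtain ⟨b, hb⟩ := hg
  refine ⟨a * b + (a + b), fun n => (Nat.mul_le_mul (ha n) (hb n)).trans ?_⟩
  calc a * (u n + 1) ^ a * (b * (u n + 1) ^ b) = a * b * (u n + 1) ^ (a + b) := by ring
    _ ≤ (a * b + (a + b)) * (u n + 1) ^ (a * b + (a + b)) :=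
      Nat.mul_le_mul (by omega) (Nat.pow_le_pow_right (by omega) (by omega))

theorem pow (hf : GrowsLike u f) (m : ℕ) : GrowsLike u fun n => f n ^ m := by
  induction m with
  | zero => simpa using const 1
  | succ m ih => simpa only [pow_succ] using ih.mul hf

theorem trans {v : ℕ → ℕ} (hf : GrowsLike u f) (hu : GrowsLike v u) : GrowsLike v f :=
  let ⟨c, hc⟩ := hf
  ((const c).mul ((hu.add (const 1)).pow c)).of_le hc

end GrowsLike

theorem polyBounded_iff {f : ℕ → ℕ} : PolyBounded f ↔ GrowsLike (fun n => n) f := by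
  constructor
  · rintro ⟨c, hc⟩
    exact ((GrowsLike.self.pow c).add (.const c)).of_le hc
  · rintro ⟨c, hc⟩
    refine ⟨3 * c + c * 2 ^ c, fun n => (hc n).trans ?_⟩
    -- For n ≤ 1 the power n ^ c does not grow with c, so the additive constant must suffice.
    rcases Nat.lt_or_ge n 2 with hn | hn
    · refine le_trans ?_ (Nat.le_add_left _ _)
      refine le_trans ?_ (Nat.le_add_left _ _)
      exact Nat.mul_le_mul_left _ (Nat.pow_le_pow_left (by simp only; omega) _)
    · refine le_trans ?_ (Nat.le_add_right _ _)
      have h1 : c ≤ n ^ c := (Nat.lt_pow_self (by omega)).le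
      have h2 : n + 1 ≤ n ^ 2 := by nlinarith
      calc c * (n + 1) ^ c ≤ n ^ c * (n ^ 2) ^ c := Nat.mul_le_mul h1 (Nat.pow_le_pow_left h2 _)
        _ = n ^ (3 * c) := by rw [← pow_mul, ← pow_add]; congr 1; ring
        _ ≤ _ := Nat.pow_le_pow_right (by omega) (by omega)

/-- Polylogarithmic growth. -/
abbrev Polylog (f : ℕ → ℕ) : Prop := GrowsLike (Nat.log 2) f

theorem Polylog.growsLike {f : ℕ → ℕ} (hf : Polylog f) : GrowsLike (fun n => n) f :=
  hf.trans (GrowsLike.self.of_le fun n => Nat.log_le_self 2 n)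

theorem size_le_log (n : ℕ) : n.size ≤ Nat.log 2 n + 1 :=
  Nat.size_le.2 (Nat.lt_pow_succ_log_self (by norm_num) n)

theorem polylog_size : Polylog Nat.size :=
  (GrowsLike.self.add (.const 1)).of_le size_le_log

theorem polylog_addrBits : Polylog addrBits :=
  (GrowsLike.self.add (.const 1)).of_le fun n =>
    Nat.clog_le_of_le_pow (Nat.lt_pow_succ_log_self (by norm_num) n).le

theorem PolyBounded.polylog_size {f : ℕ → ℕ} (hf : PolyBounded f) : Polylog fun n => (f n).size := by
  obtain ⟨c, hc⟩ := hf
  refine (((GrowsLike.self.add (.const 1)).mul (.const c)).add (.const (c + 1))).of_le fun n => ?_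
  refine Nat.size_le.2 ((hc n).trans_lt ?_)
  have h1 : n ^ c ≤ 2 ^ ((Nat.log 2 n + 1) * c) := by
    rw [pow_mul]
    exact Nat.pow_le_pow_left (Nat.lt_pow_succ_log_self (by norm_num) n).le _
  have h2 : c < 2 ^ c := Nat.lt_two_pow_self
  have h3 : 1 ≤ 2 ^ ((Nat.log 2 n + 1) * c) := Nat.one_le_two_pow
  rw [pow_add, pow_succ]
  generalize 2 ^ ((Nat.log 2 n + 1) * c) = a at *
  generalize 2 ^ c = b at *
  nlinarith

theorem polylog_size_of_log_le {q : ℕ → ℕ} (h0 : ∀ n, 0 < q n)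
    (h : ∃ C c : ℕ, ∀ n : ℕ, Real.log (q n) ≤ C * polylog c n) : Polylog fun n => (q n).size := by
  obtain ⟨C, c, h⟩ := h
  have h1 : Polylog fun n => C * (Nat.log 2 n + 1) ^ c :=
    (GrowsLike.const C).mul ((GrowsLike.self.add (.const 1)).pow c)
  refine (((GrowsLike.const 2).mul h1).add (.const 1)).of_le fun n => ?_
  refine Nat.size_le.2 ?_
  have hn := h n
  rw [polylog] at hn
  set m := C * (Nat.log 2 n + 1) ^ c with hm
  have hn' : Real.log (q n) ≤ m := by rw [hm]; push_cast; push_cast at hn; exact hn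
  have hq : (0 : ℝ) < q n := by exact_mod_cast h0 n
  -- The factor 2 exceeds 1 / log 2, which converts natural logarithms into bits; the summand 1
  -- gives strictness.
  have : (q n : ℝ) < (2 ^ (2 * m + 1) : ℕ) := by
    have h2 : Real.log (q n) < Real.log ((2 ^ (2 * m + 1) : ℕ) : ℝ) := by
      push_cast
      rw [Real.log_pow]
      have := Real.log_two_gt_d9
      push_cast
      have hm0 : (0 : ℝ) ≤ m := by positivity
      nlinarith
    exact (Real.log_lt_log_iff hq (by positivity)).1 h2
  exact_mod_cast this

/-! ## Sizes of codes -/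

namespace Val

theorem size_nat (n : ℕ) : (nat n).size = 2 * n.size + 2 := by
  have h : ∀ l : List Bool, (l.flatMap fun b => [true, b]).length = 2 * l.length := by
    intro l
    induction l with
    | nil => rfl
    | cons b l ih => rw [List.flatMap_cons, List.length_append, ih, List.length_cons]; simp; omega
  rw [size, bits, List.length_cons, List.length_append, h, Nat.size_eq_bits_len]
  rfl

theorem size_pair (a b : Val) : (pair a b).size = a.size + b.size + 1 := by
  simp [size, bits]

theorem size_list_le {l : List Val} {m : ℕ} (h : ∀ v ∈ l, v.size ≤ m) :
    (list l).size ≤ l.length * (m + 1) + 2 := by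
  induction l with
  | nil => simp [list_nil, size_nat]
  | cons a l ih =>
    rw [list_cons, size_pair, List.length_cons, Nat.succ_mul]
    have h1 := ih fun v hv => h v (List.mem_cons_of_mem _ hv)
    have h2 := h a List.mem_cons_self
    omega

theorem size_list_ofFn_le {n m : ℕ} {f : Fin n → Val} (h : ∀ i, (f i).size ≤ m) :
    (list (List.ofFn f)).size ≤ n * (m + 1) + 2 := by
  refine (size_list_le (m := m) ?_).trans (by simp)
  intro v hv
  obtain ⟨i, rfl⟩ := (List.mem_ofFn' _ _).1 hv
  exact h i

end Val

theorem Ring2.size_enc_le {q r : ℕ} [NeZero q] (a : Ring2 q r) :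
    a.enc.size ≤ 2 ^ r * (2 * q.size + 5) := by
  have h : a.enc.size ≤ 2 ^ r * (2 * q.size + 2 + 1) + 2 := Val.size_list_ofFn_le fun i => by
    rw [Val.size_nat]
    have := Nat.size_le_size (ZMod.val_lt (Ring2.coeffs a i)).le
    omega
  have h1 : 1 ≤ 2 ^ r := Nat.one_le_two_pow
  nlinarith

theorem RingParams.size_encPair_le (P : RingParams) (c : P.R × P.R) :
    (P.encPair c).size ≤ 2 ^ P.logDeg * (4 * P.q.size + 11) := by
  have h1 := Ring2.size_enc_le c.1
  have h2 := Ring2.size_enc_le c.2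
  have h3 : 1 ≤ 2 ^ P.logDeg := Nat.one_le_two_pow
  rw [encPair, Val.size_pair]
  nlinarith

section

variable {k N : ℕ → ℕ} (A : RelaxedRecovery k N)

theorem communication_le {P : RingParams} {n T : ℕ} (ζ : (chunkedProtocol A P n T).State)
    (x : Fin n → ℤ) : (chunkedProtocol A P n T).communication ζ x ≤
      2 ^ P.logDeg * ((addrBits n + 1) * (20 * P.q.size + 100)) +
        ((A.Φ n).enc ((A.Φ n).apply x)).size := by
  have h1 := P.size_encPair_le ζ.1
  have h2 : (Val.list (List.ofFn fun i => P.encPair (ζ.2 i))).size ≤ _ :=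
    Val.size_list_ofFn_le fun i => P.size_encPair_le (ζ.2 i)
  have h3 : (encHash P n (chunkedHash P ζ.2 x)).size ≤ _ :=
    Val.size_list_ofFn_le fun i => Ring2.size_enc_le _
  have h4 : 1 ≤ 2 ^ P.logDeg := Nat.one_le_two_pow
  have h5 : (chunkedProtocol A P n T).communication ζ x = (P.encPair ζ.1).size +
      (Val.list (List.ofFn fun i => P.encPair (ζ.2 i))).size + 1 +
      ((encHash P n (chunkedHash P ζ.2 x)).size + ((A.Φ n).enc ((A.Φ n).apply x)).size + 1) := by
    simp only [DistProt.communication, chunkedProtocol, Val.size_pair]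
  rw [h5]
  have h6 : (addrBits n - P.logDeg + 1) * (2 ^ P.logDeg * (2 * P.q.size + 5) + 1) ≤
      (addrBits n + 1) * (2 ^ P.logDeg * (2 * P.q.size + 5) + 1) :=
    Nat.mul_le_mul_right _ (by omega)
  generalize (P.encPair ζ.1).size = a₁ at *
  generalize (Val.list (List.ofFn fun i => P.encPair (ζ.2 i))).size = a₂ at *
  generalize (encHash P n (chunkedHash P ζ.2 x)).size = a₃ at *
  generalize 2 ^ P.logDeg = g at *
  generalize P.q.size = b at *
  generalize addrBits n - P.logDeg + 1 = L' at *
  clear h5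
  generalize addrBits n = L at *
  nlinarith [Nat.zero_le (L * g), Nat.zero_le (L * g * b), Nat.zero_le (g * b),
    Nat.mul_le_mul_left L h4]

end

/-! ## The resources of the protocol -/

section

variable {w : ℝ} {P : ℕ → RingParams}

theorem logDeg_le_addrBits (hw₁ : w < 1) (hdeg : ∀ n : ℕ, (P n).logDeg = ⌈w * Real.logb 2 n⌉₊) (n : ℕ) :
    (P n).logDeg ≤ addrBits n := by
  rw [hdeg, Nat.ceil_le]
  rcases Nat.eq_zero_or_pos n with rfl | hn
  · simp
  have h1 : (0 : ℝ) ≤ Real.logb 2 n := Real.logb_nonneg (by norm_num) (by exact_mod_cast hn)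
  have h2 : Real.logb 2 n ≤ addrBits n := by
    rw [Real.logb_le_iff_le_rpow (by norm_num) (by exact_mod_cast hn), Real.rpow_natCast]
    exact_mod_cast Nat.le_pow_clog (by norm_num) n
  nlinarith

/-- The factor 2 is the loss from rounding up to a power of two. -/
theorem two_pow_logDeg_le (hdeg : ∀ n : ℕ, (P n).logDeg = ⌈w * Real.logb 2 n⌉₊) (hw₀ : 0 < w) {n : ℕ}
    (hn : 1 ≤ n) : ((2 ^ (P n).logDeg : ℕ) : ℝ) ≤ 2 * (n : ℝ) ^ w := by
  have hn' : (0 : ℝ) < n := by exact_mod_cast hn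
  have h1 : (0 : ℝ) ≤ Real.logb 2 n := Real.logb_nonneg (by norm_num) (by exact_mod_cast hn)
  have h2 := (Nat.ceil_lt_add_one (mul_nonneg hw₀.le h1)).le
  rw [← hdeg] at h2
  push_cast
  rw [← Real.rpow_natCast]
  calc (2 : ℝ) ^ (((P n).logDeg : ℕ) : ℝ) ≤ 2 ^ (w * Real.logb 2 n + 1) :=
        Real.rpow_le_rpow_of_exponent_le (by norm_num) h2
    _ = 2 * (n : ℝ) ^ w := by
        rw [Real.rpow_add (by norm_num), Real.rpow_one, mul_comm w, Real.rpow_mul (by norm_num),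
          Real.rpow_logb (by norm_num) (by norm_num) hn', mul_comm]

theorem two_pow_addrBits_le {n : ℕ} (hn : 1 ≤ n) : 2 ^ addrBits n ≤ 2 * n := by
  rcases Nat.lt_or_ge 1 n with h | h
  · have h1 := Nat.pow_pred_clog_lt_self (b := 2) (by norm_num) h
    have h2 : 0 < Nat.clog 2 n := Nat.clog_pos (by norm_num) h
    rw [addrBits]
    obtain ⟨m, hm⟩ : ∃ m, Nat.clog 2 n = m + 1 := ⟨_, (Nat.succ_pred_eq_of_pos h2).symm⟩
    rw [hm] at h1 ⊢
    rw [Nat.pred_succ] at h1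
    rw [pow_succ]; omega
  · obtain rfl : n = 1 := by omega
    simp [addrBits]

/-- A sufficient word size. -/
def wordSize (P : ℕ → RingParams) (N : ℕ → ℕ) (n : ℕ) : ℕ :=
  2 * (P n).q.size + 4 * addrBits n + (N n).size + n.size + 10

/-- The largest intermediate numbers are sums of two products of residues modulo q times the scale
of `fastMul`; they have about 2 |q| + 4 r bits. The other summands of the word length cover the
dimension and the entries of the data. -/
theorem fitsProtocol_wordSize {k N : ℕ → ℕ} (hk : ∀ n, k n ≤ n)
    (hr : ∀ n, (P n).logDeg ≤ addrBits n) (n : ℕ) :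
    FitsProtocol (wordSize P N n) (P n) n (k n) (N n) := by
  have h1 : n < 2 ^ n.size := Nat.lt_size_self n
  have h2 : N n < 2 ^ (N n).size := Nat.lt_size_self _
  have h3 : (P n).q < 2 ^ (P n).q.size := Nat.lt_size_self _
  have h4 : 2 ^ (n.size + 2) ≤ 2 ^ wordSize P N n :=
    Nat.pow_le_pow_right (by norm_num) (by unfold wordSize; omega)
  have h5 : 2 ^ (N n).size ≤ 2 ^ wordSize P N n :=
    Nat.pow_le_pow_right (by norm_num) (by unfold wordSize; omega)
  rw [pow_add] at h4
  have := hr n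
  have := hk n
  refine ⟨⟨by unfold wordSize; omega, ?_⟩, hr n, by omega, by omega, by omega⟩
  calc 2 * ((P n).q * 2 ^ (2 * (P n).logDeg)) ^ 2
      ≤ 2 * (2 ^ (P n).q.size * 2 ^ (2 * (P n).logDeg)) ^ 2 := by gcongr
    _ = 2 ^ (1 + (2 * (P n).q.size + 4 * (P n).logDeg)) := by
        rw [← pow_add, ← pow_mul, pow_add 2 1]; congr 2; ring
    _ < 2 ^ wordSize P N n := Nat.pow_lt_pow_right (by norm_num) (by unfold wordSize; omega)

theorem polylog_wordSize {N : ℕ → ℕ} (hN : PolyBounded N)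
    (hq : Polylog fun n => (P n).q.size) : Polylog (wordSize P N) :=
  (((((GrowsLike.const 2).mul hq).add ((GrowsLike.const 4).mul polylog_addrBits)).add
    hN.polylog_size).add polylog_size).add (.const 10)

theorem polylog_opCost {s : ℕ → ℕ} (hs : Polylog s) : Polylog fun n => opCost (s n) :=
  (hs.add (.const 1)).pow 2

/-- A bound for the cost of a ring operation per coefficient. -/
def coeffCost (s L : ℕ) : ℕ := (L + 1) ^ 2 * (10000 * opCost s)

theorem ringCost_le {s r L : ℕ} (h : r ≤ L) : ringCost s r ≤ 2 ^ r * coeffCost s L := by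
  unfold ringCost coeffCost
  gcongr

theorem hashCost_le {s r n : ℕ} (h : r ≤ addrBits n) (hn : 1 ≤ n) :
    hashCost s r (addrBits n) ≤ n * (120 * ((addrBits n + 1) * coeffCost s (addrBits n))) := by
  unfold hashCost
  calc 60 * ((addrBits n + 1) * (2 ^ (addrBits n - r) * ringCost s r))
      ≤ 60 * ((addrBits n + 1) * (2 ^ (addrBits n - r) * (2 ^ r * coeffCost s (addrBits n)))) := by
        gcongr; exact ringCost_le h
    _ = 60 * ((addrBits n + 1) * (2 ^ addrBits n * coeffCost s (addrBits n))) := by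
        rw [← mul_assoc (2 ^ (addrBits n - r)), ← pow_add, Nat.sub_add_cancel h]
    _ ≤ 60 * ((addrBits n + 1) * (2 * n * coeffCost s (addrBits n))) := by
        gcongr; exact two_pow_addrBits_le hn
    _ = _ := by ring

theorem packetCost_le {s r L bits : ℕ} (h : r ≤ L) :
    packetCost s r L bits ≤ 2 ^ r * ((L + 2) * (3 * coeffCost s L)) + 100 * bits := by
  unfold packetCost
  refine Nat.add_le_add_right ?_ _
  calc (L + 2) * (3 * ringCost s r) ≤ (L + 2) * (3 * (2 ^ r * coeffCost s L)) := by
        gcongr; exact ringCost_le h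
    _ = _ := by ring

theorem checkCost_le {s r n : ℕ} (h : r ≤ addrBits n) (hn : 1 ≤ n) :
    checkCost s r n ≤ n * (120 * ((addrBits n + 1) * coeffCost s (addrBits n)) + 600 * opCost s +
      4 * ((addrBits n + 2) * coeffCost s (addrBits n)) + 300) := by
  have h1 := hashCost_le (s := s) h hn
  have h2 : (n + 2) * (200 * opCost s) ≤ n * (600 * opCost s) := by
    calc (n + 2) * (200 * opCost s) ≤ (3 * n) * (200 * opCost s) :=
          Nat.mul_le_mul_right _ (by omega)
      _ = _ := by ring
  have h3 : (addrBits n + 2) * (2 * ringCost s r) ≤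
      n * (4 * ((addrBits n + 2) * coeffCost s (addrBits n))) := by
    calc (addrBits n + 2) * (2 * ringCost s r)
        ≤ (addrBits n + 2) * (2 * (2 * n * coeffCost s (addrBits n))) := by
          gcongr
          refine (ringCost_le h).trans ?_
          gcongr
          exact (Nat.pow_le_pow_right (by norm_num) h).trans (two_pow_addrBits_le hn)
      _ = _ := by ring
  unfold checkCost
  have h4 : 300 ≤ n * 300 := by omega
  simp only [mul_add] at *
  omega

theorem polylog_coeffCost {s : ℕ → ℕ} (hs : Polylog s) :
    Polylog fun n => coeffCost (s n) (addrBits n) :=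
  ((polylog_addrBits.add (.const 1)).pow 2).mul ((GrowsLike.const 10000).mul (polylog_opCost hs))

theorem Polylog.exists_le {f : ℕ → ℕ} (hf : Polylog f) : ∃ c : ℕ, ∀ n, (f n : ℝ) ≤ c * polylog c n := by
  obtain ⟨c, hc⟩ := hf
  refine ⟨c, fun n => ?_⟩
  rw [polylog]
  exact_mod_cast hc n

theorem one_le_polylog (c n : ℕ) : 1 ≤ polylog c n := by
  rw [polylog]
  exact one_le_pow₀ (by simp)

/-- Each cost bound is a power of the dimension or of the degree times a function of log n. The word
length is polylogarithmic, hence so are these functions. -/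
theorem resources {k N T : ℕ → ℕ} (A : RelaxedRecovery k N) (hk : ∀ n, k n ≤ n) (hN : PolyBounded N)
    (hT : ∀ n, 1 ≤ T n) (hw₀ : 0 < w) (hw₁ : w < 1)
    (hdeg : ∀ n : ℕ, (P n).logDeg = ⌈w * Real.logb 2 n⌉₊)
    (hqp : ∃ C c : ℕ, ∀ n : ℕ, Real.log (P n).q ≤ C * polylog c n) :
    ∃ C c : ℕ,
      (∀ n, 1 ≤ n → ∀ ζ (x : Fin n → ℤ), InBox (N n) x →
        ((chunkedProtocol A (P n) n (T n)).communication ζ x : ℝ) ≤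
          C * (n : ℝ) ^ w * polylog c n + ((A.Φ n).enc ((A.Φ n).apply x)).size) ∧
      (∀ n, 1 ≤ n → ∀ ζ (x : Fin (T n) → Fin n → ℤ), ValidData (N n) x →
        (chunkedProtocol A (P n) n (T n)).CoordinatorRunsIn (coordProg A) (publicParams A (P n) n)
          encAnswer ζ (fun i => (chunkedProtocol A (P n) n (T n)).server ζ (x i))
          (C * n * polylog c n + A.reportTime n +
            C * T n * ((n : ℝ) ^ w * polylog c n + (A.Φ n).resultBits))) ∧
      (∀ n, 1 ≤ n → ∀ ζ (x : Fin n → ℤ), InBox (N n) x →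
        (chunkedProtocol A (P n) n (T n)).ServerRunsIn (serverProg A) (publicParams A (P n) n) ζ x
          (C * n * polylog c n + A.measureTime n)) := by
  have hq : Polylog fun n => (P n).q.size :=
    polylog_size_of_log_le (fun n => (P n).q_prime.pos) hqp
  have hr := logDeg_le_addrBits hw₁ hdeg
  have hfit := fitsProtocol_wordSize hk hr (N := N)
  set s := wordSize P N with hs_def
  have hs : Polylog s := polylog_wordSize hN hq
  have hcc := polylog_coeffCost hs
  have hL := polylog_addrBits
  set F₁ : ℕ → ℕ := fun n => (addrBits n + 1) * (20 * (P n).q.size + 100) with hF₁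
  set F₂ : ℕ → ℕ := fun n => (addrBits n + 2) * (3 * coeffCost (s n) (addrBits n)) with hF₂
  set F₃ : ℕ → ℕ := fun n => 120 * ((addrBits n + 1) * coeffCost (s n) (addrBits n)) +
    600 * opCost (s n) + 4 * ((addrBits n + 2) * coeffCost (s n) (addrBits n)) + 300 with hF₃
  have h₁ : Polylog F₁ := (hL.add (.const 1)).mul (((GrowsLike.const 20).mul hq).add (.const 100))
  have h₂ : Polylog F₂ := (hL.add (.const 2)).mul ((GrowsLike.const 3).mul hcc)
  have h₃ : Polylog F₃ := ((((GrowsLike.const 120).mul ((hL.add (.const 1)).mul hcc)).add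
    ((GrowsLike.const 600).mul (polylog_opCost hs))).add
    ((GrowsLike.const 4).mul ((hL.add (.const 2)).mul hcc))).add (.const 300)
  -- One exponent serves all three polylogarithmic factors, obtained from their sum.
  obtain ⟨c, hc⟩ := Polylog.exists_le ((h₁.add h₂).add h₃)
  have b₁ (n) : (F₁ n : ℝ) ≤ c * polylog c n := le_trans (by
    exact_mod_cast (by omega : F₁ n ≤ F₁ n + F₂ n + F₃ n)) (hc n)
  have b₂ (n) : (F₂ n : ℝ) ≤ c * polylog c n := le_trans (by
    exact_mod_cast (by omega : F₂ n ≤ F₁ n + F₂ n + F₃ n)) (hc n)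
  have b₃ (n) : (F₃ n : ℝ) ≤ c * polylog c n := le_trans (by
    exact_mod_cast (by omega : F₃ n ≤ F₁ n + F₂ n + F₃ n)) (hc n)
  -- The 2 comes from rounding the degree, the 100 from the cost per bit of `addMeasurements`.
  refine ⟨2 * c + 100, c, fun n hn ζ x _ => ?_, fun n hn ζ x hx => ?_, fun n hn ζ x hx => ?_⟩
  · have h := communication_le A (P := P n) (T := T n) ζ x
    have hg := two_pow_logDeg_le hdeg hw₀ hn
    have hp := one_le_polylog c n
    have hw : (0 : ℝ) ≤ (n : ℝ) ^ w := by positivity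
    calc ((chunkedProtocol A (P n) n (T n)).communication ζ x : ℝ)
        ≤ ((2 ^ (P n).logDeg : ℕ) : ℝ) * (F₁ n : ℝ) + (((A.Φ n).enc ((A.Φ n).apply x)).size : ℝ) := by
          exact_mod_cast h
      _ ≤ (2 * (n : ℝ) ^ w) * (c * polylog c n) + (((A.Φ n).enc ((A.Φ n).apply x)).size : ℝ) := by
          gcongr; exact b₁ n
      _ ≤ _ := by
          push_cast
          have : 0 ≤ (n : ℝ) ^ w * polylog c n := by positivity
          nlinarith
  · have hbox : InBox (N n) (∑ i, x i) := hx Finset.univ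
    have h := runs_coordProg A (hfit n) (hT n) ζ x hbox
    refine h.runsIn ?_
    have hg := two_pow_logDeg_le hdeg hw₀ hn
    have hp := one_le_polylog c n
    have hw : (0 : ℝ) ≤ (n : ℝ) ^ w := by positivity
    have hpk := packetCost_le (s := s n) (bits := (A.Φ n).resultBits) (hr n)
    have hck := checkCost_le (s := s n) (hr n) hn
    have e1 : (packetCost (s n) (P n).logDeg (addrBits n) (A.Φ n).resultBits : ℝ) ≤
        (2 * (n : ℝ) ^ w) * (c * polylog c n) + 100 * (A.Φ n).resultBits := by
      calc _ ≤ ((2 ^ (P n).logDeg : ℕ) : ℝ) * (F₂ n : ℝ) + 100 * ((A.Φ n).resultBits : ℝ) := by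
            exact_mod_cast hpk
        _ ≤ _ := by gcongr; exact b₂ n
    have e2 : (checkCost (s n) (P n).logDeg n : ℝ) ≤ n * (c * polylog c n) := by
      calc _ ≤ (n : ℝ) * (F₃ n : ℝ) := by exact_mod_cast hck
        _ ≤ _ := by gcongr; exact b₃ n
    push_cast
    have e3 : (T n : ℝ) * packetCost (s n) (P n).logDeg (addrBits n) (A.Φ n).resultBits ≤
        (2 * c + 100) * T n * ((n : ℝ) ^ w * polylog c n + (A.Φ n).resultBits) := by
      calc _ ≤ (T n : ℝ) * ((2 * (n : ℝ) ^ w) * (c * polylog c n) + 100 * (A.Φ n).resultBits) := by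
            gcongr
        _ ≤ (T n : ℝ) * ((2 * c + 100) * ((n : ℝ) ^ w * polylog c n + (A.Φ n).resultBits)) := by
            gcongr
            have f1 : 0 ≤ (n : ℝ) ^ w * polylog c n := by positivity
            have f2 : (0 : ℝ) ≤ c * (A.Φ n).resultBits := by positivity
            nlinarith
        _ = _ := by ring
    have e4 : (n : ℝ) * (c * polylog c n) ≤ (2 * c + 100) * n * polylog c n := by
      have f1 : 0 ≤ (n : ℝ) * polylog c n := by positivity
      have f2 : (0 : ℝ) ≤ c := by positivity
      nlinarith
    linarith
  · refine (runs_serverProg A (hfit n) ζ x hx).runsIn ?_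
    have hh := hashCost_le (s := s n) (hr n) hn
    have hp := one_le_polylog c n
    have e1 : hashCost (s n) (P n).logDeg (addrBits n) + 100 ≤ n * F₃ n := by
      refine le_trans (Nat.add_le_add_right hh _) ?_
      simp only [hF₃, mul_add]
      omega
    have e2 : (hashCost (s n) (P n).logDeg (addrBits n) : ℝ) + 100 ≤ n * (c * polylog c n) := by
      calc _ ≤ (n : ℝ) * (F₃ n : ℝ) := by exact_mod_cast e1
        _ ≤ _ := by gcongr; exact b₃ n
    have e4 : (n : ℝ) * (c * polylog c n) ≤ (2 * c + 100) * n * polylog c n := by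
      have f1 : 0 ≤ (n : ℝ) * polylog c n := by positivity
      have f2 : (0 : ℝ) ≤ c := by positivity
      nlinarith
    push_cast
    linarith

end

/-! ## Probabilities of events -/

section

variable {α β : Type} (p : PMF α)

/-- The probability of an event. -/
def pr (E : α → Prop) : ℝ≥0∞ := p.toOuterMeasure {a | E a}

theorem prob_map (E : α → Prop) : prob (p.map E) = (pr p E).toReal := by
  rw [prob, ← PMF.toOuterMeasure_apply_singleton, PMF.toOuterMeasure_map_apply, pr]
  congr 2
  ext a
  simp

theorem pr_mono {E F : α → Prop} (h : ∀ a, E a → F a) : pr p E ≤ pr p F :=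
  p.toOuterMeasure.mono h

theorem pr_congr {E F : α → Prop} (h : ∀ a, E a ↔ F a) : pr p E = pr p F :=
  le_antisymm (pr_mono p fun a => (h a).1) (pr_mono p fun a => (h a).2)

theorem pr_le_one (E : α → Prop) : pr p E ≤ 1 := by
  rw [pr, PMF.toOuterMeasure_apply, ← p.tsum_coe]
  exact ENNReal.tsum_le_tsum fun a => Set.indicator_le_self _ _ _

theorem pr_ne_top (E : α → Prop) : pr p E ≠ ∞ := ne_top_of_le_ne_top ENNReal.one_ne_top (pr_le_one p E)

theorem pr_exists_le {ι : Type} [Fintype ι] (E : ι → α → Prop) :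
    pr p (fun a => ∃ i, E i a) ≤ ∑ i, pr p (E i) := by
  have h := MeasureTheory.measure_iUnion_fintype_le p.toOuterMeasure fun i => {a | E i a}
  have e : {a | ∃ i, E i a} = ⋃ i, {a | E i a} := by ext; simp
  rw [pr, e]
  exact h

theorem pr_add_pr_not (E : α → Prop) : pr p E + pr p (fun a => ¬E a) = 1 := by
  rw [pr, pr, PMF.toOuterMeasure_apply, PMF.toOuterMeasure_apply, ← ENNReal.tsum_add, ← p.tsum_coe]
  refine tsum_congr fun a => ?_
  exact congrFun (Set.indicator_self_add_compl {a | E a} p) a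

theorem pr_bind (f : α → PMF β) (E : β → Prop) : pr (p.bind f) E = ∑' a, p a * pr (f a) E :=
  PMF.toOuterMeasure_bind_apply _ _ _

theorem pr_map (f : α → β) (E : β → Prop) : pr (p.map f) E = pr p fun a => E (f a) :=
  PMF.toOuterMeasure_map_apply _ _ _

theorem pr_pure_le {a : α} {E : α → Prop} (h : ¬E a) : pr (PMF.pure a) E = 0 := by
  classical
  exact (PMF.toOuterMeasure_pure_apply _ _).trans (if_neg h)

/-- The union bound along a sampling step: either the sample is bad, or what follows fails with
probability at most δ. -/
theorem pr_bind_le {f : α → PMF β} {bad : α → Prop} {E : β → Prop} {ε δ : ℝ≥0∞}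
    (hp : pr p bad ≤ ε) (hf : ∀ a, ¬bad a → pr (f a) E ≤ δ) : pr (p.bind f) E ≤ ε + δ := by
  classical
  rw [pr_bind]
  calc ∑' a, p a * pr (f a) E ≤ ∑' a, ({a | bad a}.indicator p a + p a * δ) := by
        refine ENNReal.tsum_le_tsum fun a => ?_
        by_cases h : bad a
        · rw [Set.indicator_of_mem (by exact h)]
          refine le_trans ?_ le_self_add
          simpa using mul_le_mul_right (pr_le_one (f a) E) (p a)
        · exact (mul_le_mul_right (hf a h) _).trans le_add_self
    _ = pr p bad + δ := by
        rw [ENNReal.tsum_add, ENNReal.tsum_mul_right, p.tsum_coe, one_mul, pr,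
          PMF.toOuterMeasure_apply]
    _ ≤ _ := by gcongr

theorem pr_independent_exists_le {h : ℕ} {p : Fin h → PMF α} {bad : Fin h → α → Prop} {ε : ℝ≥0∞}
    (hp : ∀ i, pr (p i) (bad i) ≤ ε) :
    pr (independent h p) (fun f => ∃ i, bad i (f i)) ≤ h * ε := by
  induction h with
  | zero => rw [independent, pr_pure_le (by simp)]; simp
  | succ h ih =>
    rw [independent]
    refine (pr_bind_le (bad := bad 0) (ε := ε) (δ := h * ε) _ (hp 0) fun a ha => ?_).trans ?_
    · refine (pr_bind_le (bad := fun f => ∃ i : Fin h, bad i.succ (f i)) (δ := 0) _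
        (ih fun i => hp i.succ) fun f hf => ?_).trans (by simp)
      rw [pr_pure_le]
      rintro ⟨i, hi⟩
      induction i using Fin.cases with
      | zero => exact ha (by simpa using hi)
      | succ i => exact hf ⟨i, by simpa using hi⟩
    · push_cast
      rw [add_mul, one_mul, add_comm]

end

/-! ## Small representatives -/

/-- `a` and `b` are the residues of an integer vector with entries at most `B`. -/
def Lifts {q t r : ℕ} (a : Ring2 q r) (b : Ring2 t r) (B : ℕ) : Prop :=
  ∃ z : Fin (2 ^ r) → ℤ, (∀ i, |z i| ≤ B) ∧ a = Ring2.ofInts z ∧ b = Ring2.ofInts z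

namespace Lifts

variable {q t r : ℕ} {a a' : Ring2 q r} {b b' : Ring2 t r} {B B' : ℕ}

theorem mono (h : Lifts a b B) (hB : B ≤ B') : Lifts a b B' :=
  let ⟨z, hz, ha, hb⟩ := h
  ⟨z, fun i => (hz i).trans (by exact_mod_cast hB), ha, hb⟩

theorem zero : Lifts (0 : Ring2 q r) (0 : Ring2 t r) 0 :=
  ⟨0, by simp, Ring2.ofInts_zero.symm, Ring2.ofInts_zero.symm⟩

theorem add (h : Lifts a b B) (h' : Lifts a' b' B') : Lifts (a + a') (b + b') (B + B') := by
  obtain ⟨z, hz, rfl, rfl⟩ := h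
  obtain ⟨z', hz', rfl, rfl⟩ := h'
  refine ⟨z + z', fun i => ?_, (Ring2.ofInts_add _ _).symm, (Ring2.ofInts_add _ _).symm⟩
  push_cast
  exact (abs_add_le _ _).trans (add_le_add (hz i) (hz' i))

theorem _root_.WBRecovery.Ring2.ofInts_smul (c : ℤ) (z : Fin (2 ^ r) → ℤ) :
    (Ring2.ofInts (c • z) : Ring2 q r) = (c : Ring2 q r) * Ring2.ofInts z := by
  simp only [Ring2.ofInts, Ring2.ofCoeffs_eq_sum, Finset.mul_sum]
  refine Finset.sum_congr rfl fun i _ => ?_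
  simp [mul_assoc]

theorem intCast_mul (c : ℤ) (h : Lifts a b B) :
    Lifts ((c : Ring2 q r) * a) ((c : Ring2 t r) * b) (c.natAbs * B) := by
  obtain ⟨z, hz, rfl, rfl⟩ := h
  refine ⟨c • z, fun i => ?_, (Ring2.ofInts_smul _ _).symm, (Ring2.ofInts_smul _ _).symm⟩
  rw [Pi.smul_apply, smul_eq_mul, abs_mul]
  push_cast
  exact mul_le_mul_of_nonneg_left (hz i) (abs_nonneg _)

theorem neg (h : Lifts a b B) : Lifts (-a) (-b) B := by
  simpa using h.intCast_mul (-1)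

theorem sub (h : Lifts a b B) (h' : Lifts a' b' B') : Lifts (a - a') (b - b') (B + B') := by
  simpa only [sub_eq_add_neg] using h.add h'.neg

theorem sum {ι : Type*} (S : Finset ι) {f : ι → Ring2 q r} {f' : ι → Ring2 t r}
    (h : ∀ i ∈ S, Lifts (f i) (f' i) B) : Lifts (∑ i ∈ S, f i) (∑ i ∈ S, f' i) (S.card * B) := by
  classical
  induction S using Finset.induction_on with
  | empty => simpa using zero
  | insert i S hi ih =>
    rw [Finset.sum_insert hi, Finset.sum_insert hi, Finset.card_insert_of_notMem hi, add_mul, one_mul,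
      add_comm (S.card * B)]
    exact (h i (Finset.mem_insert_self _ _)).add (ih fun j hj => h j (Finset.mem_insert_of_mem hj))

/-- The range up to twice the degree covers the exponents in a product of two reduced polynomials;
from the degree on, only a sign appears. -/
theorem root_pow {m : ℕ} (hm : m < 2 ^ r * 2) : Lifts (Ring2.root q r ^ m) (Ring2.root t r ^ m) 1 := by
  have key (m : Fin (2 ^ r)) : Lifts (Ring2.root q r ^ (m : ℕ)) (Ring2.root t r ^ (m : ℕ)) 1 := by
    refine ⟨Pi.single m 1, fun i => ?_, ?_, ?_⟩
    · by_cases h : i = m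
      · subst h; simp
      · simp [Pi.single_apply, h]
    · simp [Ring2.ofInts, Ring2.ofCoeffs_eq_sum, Pi.single_apply]
    · simp [Ring2.ofInts, Ring2.ofCoeffs_eq_sum, Pi.single_apply]
  rcases lt_or_ge m (2 ^ r) with h | h
  · exact key ⟨m, h⟩
  · obtain ⟨k, rfl⟩ := Nat.exists_eq_add_of_le h
    rw [pow_add, pow_add, Ring2.root_pow, Ring2.root_pow]
    have := (key ⟨k, by omega⟩).neg
    simpa using this

theorem one : Lifts (1 : Ring2 q r) (1 : Ring2 t r) 1 := by
  simpa using root_pow (q := q) (t := t) (r := r) (m := 0) (by positivity)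

/-- The product is a sum of g ^ 2 signed monomials with coefficients at most B B'. The factor g ^ 2
in place of g is crude, but still polynomial, and it makes the lemma a mere sum. -/
theorem mul (h : Lifts a b B) (h' : Lifts a' b' B') :
    Lifts (a * a') (b * b') ((2 ^ r) ^ 2 * (B * B')) := by
  obtain ⟨z, hz, rfl, rfl⟩ := h
  obtain ⟨z', hz', rfl, rfl⟩ := h'
  have key (q : ℕ) : (Ring2.ofInts z * Ring2.ofInts z' : Ring2 q r) =
      ∑ i : Fin (2 ^ r), ∑ j : Fin (2 ^ r),
        ((z i * z' j : ℤ) : Ring2 q r) * Ring2.root q r ^ ((i : ℕ) + (j : ℕ)) := by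
    simp only [Ring2.ofInts, Ring2.ofCoeffs_eq_sum, Finset.sum_mul_sum]
    refine Finset.sum_congr rfl fun i _ => Finset.sum_congr rfl fun j _ => ?_
    push_cast
    simp
    ring
  rw [key, key]
  have e : (2 ^ r) ^ 2 * (B * B') = (Finset.univ : Finset (Fin (2 ^ r))).card *
      ((Finset.univ : Finset (Fin (2 ^ r))).card * (B * B')) := by
    rw [Finset.card_univ, Fintype.card_fin]; ring
  rw [e]
  refine sum _ fun i _ => sum _ fun j _ => ?_
  have hi := i.isLt
  have hj := j.isLt
  refine ((root_pow (by omega)).intCast_mul _).mono ?_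
  rw [mul_one, Int.natAbs_mul]
  have h1 := hz i
  have h2 := hz' j
  rw [Int.abs_eq_natAbs] at h1 h2
  exact Nat.mul_le_mul (by exact_mod_cast h1) (by exact_mod_cast h2)

theorem prod {ι : Type*} (S : Finset ι) {f : ι → Ring2 q r} {f' : ι → Ring2 t r}
    (h : ∀ i ∈ S, Lifts (f i) (f' i) B) :
    Lifts (∏ i ∈ S, f i) (∏ i ∈ S, f' i) (((2 ^ r) ^ 2 * B) ^ S.card) := by
  classical
  induction S using Finset.induction_on with
  | empty => simpa using one
  | insert i S hi ih =>
    rw [Finset.prod_insert hi, Finset.prod_insert hi, Finset.card_insert_of_notMem hi, pow_succ']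
    have := (h i (Finset.mem_insert_self _ _)).mul (ih fun j hj => h j (Finset.mem_insert_of_mem hj))
    exact this.mono (le_of_eq (by ring))

/-- Encryption lifts the message by its centred representatives, so a message is small and reduces
to itself modulo t. -/
theorem lift_right [NeZero t] (b : Ring2 t r) : Lifts (Ring2.lift q b) b t := by
  refine ⟨fun i => (Ring2.coeffs b i).valMinAbs, fun i => ?_, rfl, ?_⟩
  · have := ZMod.natAbs_valMinAbs_le (Ring2.coeffs b i)
    have h2 : t / 2 ≤ t := Nat.div_le_self _ _
    rw [Int.abs_eq_natAbs]
    exact_mod_cast this.trans h2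
  · rw [Ring2.ofInts]
    simp only [ZMod.coe_valMinAbs]
    exact (Ring2.ofCoeffs_coeffs b).symm

/-- The centred representative of a residue modulo q is the only integer congruent to it of absolute
value below q / 2. So `Ring2.lift` recovers the integer vector itself, and its reduction modulo t is
b. -/
theorem lift_eq [NeZero q] (h : Lifts a b B) (hB : 2 * B < q) : Ring2.lift t a = b := by
  obtain ⟨z, hz, rfl, rfl⟩ := h
  have h : Ring2.coeffs (Ring2.ofInts z : Ring2 q r) = fun i => (z i : ZMod q) :=
    Ring2.coeffs_ofCoeffs _
  rw [Ring2.lift, h]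
  congr 1
  funext i
  rw [ZMod.valMinAbs_spec]
  have := abs_le.1 (hz i)
  refine ⟨rfl, ?_, ?_⟩ <;> omega

/-- Noise enters in multiples of t: it is small modulo q and invisible modulo t. -/
theorem natCast_mul_left (h : Lifts a b B) : Lifts ((t : Ring2 q r) * a) (0 : Ring2 t r) (t * B) := by
  have := h.intCast_mul t
  rwa [Int.cast_natCast, Int.cast_natCast, Ring2.cast_eq_zero, zero_mul, Int.natAbs_natCast] at this

end Lifts

/-! ## Tails of the discrete Gaussian -/

/-- From a² ≥ |a| the sum is at most a two-sided geometric series with ratio ρ = exp (-1 / S²), and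
exp x ≥ 1 + x gives 1 / (1 - ρ) ≤ 1 + S². -/
theorem tsum_exp_neg_le {S : ℕ} (hS : 1 ≤ S) :
    ∑' a : ℤ, ENNReal.ofReal (Real.exp (-(a : ℝ) ^ 2 / (S : ℝ) ^ 2)) ≤
      ENNReal.ofReal (2 * (1 + (S : ℝ) ^ 2)) := by
  have hS' : (1 : ℝ) ≤ S := by exact_mod_cast hS
  set ρ := Real.exp (-(1 / (S : ℝ) ^ 2)) with hρ
  have hρ0 : 0 < ρ := Real.exp_pos _
  have hinv : ρ * (1 + 1 / (S : ℝ) ^ 2) ≤ 1 := by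
    have h1 := Real.add_one_le_exp (1 / (S : ℝ) ^ 2)
    calc ρ * (1 + 1 / (S : ℝ) ^ 2) ≤ ρ * Real.exp (1 / (S : ℝ) ^ 2) := by gcongr; linarith
      _ = 1 := by rw [hρ, ← Real.exp_add]; simp
  have hSS : (1 : ℝ) / (S : ℝ) ^ 2 * (S : ℝ) ^ 2 = 1 := by field_simp
  have hc : 0 < 1 / (S : ℝ) ^ 2 := by positivity
  have hρ1 : ρ < 1 := by nlinarith
  have hg := hasSum_geometric_of_lt_one hρ0.le hρ1
  have hsum : HasSum (fun a : ℤ => ρ ^ a.natAbs) ((1 - ρ)⁻¹ + ρ * (1 - ρ)⁻¹) := by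
    refine HasSum.of_nat_of_neg_add_one (by simpa using hg) ?_
    have e : (fun n : ℕ => ρ ^ (-((n : ℤ) + 1)).natAbs) = fun n => ρ * ρ ^ n := by
      funext n
      rw [Int.natAbs_neg, show ((n : ℤ) + 1).natAbs = n + 1 by omega, pow_succ']
    rw [e]
    exact hg.mul_left ρ
  have hle : (1 - ρ)⁻¹ ≤ 1 + (S : ℝ) ^ 2 := by
    rw [inv_le_comm₀ (by linarith) (by positivity), ← one_div, div_le_iff₀ (by positivity)]
    nlinarith
  calc ∑' a : ℤ, ENNReal.ofReal (Real.exp (-(a : ℝ) ^ 2 / (S : ℝ) ^ 2))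
      ≤ ∑' a : ℤ, ENNReal.ofReal (ρ ^ a.natAbs) := by
        refine ENNReal.tsum_le_tsum fun a => ENNReal.ofReal_le_ofReal ?_
        rw [hρ, ← Real.exp_nat_mul]
        refine Real.exp_le_exp.2 ?_
        have h1 : (a.natAbs : ℝ) ≤ (a : ℝ) ^ 2 := by
          have : a.natAbs ≤ a.natAbs ^ 2 := Nat.le_self_pow (by norm_num) _
          have h2 : ((a.natAbs ^ 2 : ℕ) : ℝ) = (a : ℝ) ^ 2 := by
            rw [Nat.cast_pow, Nat.cast_natAbs, Int.cast_abs, sq_abs]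
          rw [← h2]
          exact_mod_cast this
        have h2 : -(a : ℝ) ^ 2 / (S : ℝ) ^ 2 = (a : ℝ) ^ 2 * -(1 / (S : ℝ) ^ 2) := by ring
        rw [h2]
        nlinarith
    _ = ENNReal.ofReal ((1 - ρ)⁻¹ + ρ * (1 - ρ)⁻¹) := by
        rw [← hsum.tsum_eq, ENNReal.ofReal_tsum_of_nonneg (fun a => by positivity) hsum.summable]
    _ ≤ _ := by
        refine ENNReal.ofReal_le_ofReal ?_
        have : 0 ≤ (1 - ρ)⁻¹ := by rw [inv_nonneg]; linarith
        nlinarith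

/-- Since π > 2 and σ ≤ S, the weight of z is at most exp (-|z|² / S²) squared. On the bad event one
of the two factors is at most exp (-B² / S²), and the other sums over all z to a g-th power of a
one-dimensional sum. The hypothesis on B lets the first absorb that power and leave exp (-m). -/
theorem pr_discreteGaussian_le {g : ℕ} {σ : ℝ} (hσ : 0 < σ) {S B m : ℕ} (hS : 1 ≤ S) (hσS : σ ≤ S)
    (hB : S ^ 2 * (m + g * (2 * S ^ 2 + 1)) ≤ B ^ 2) :
    pr (discreteGaussian g σ hσ) (fun z => ∃ i, (B : ℤ) < |z i|) ≤ ENNReal.ofReal (Real.exp (-m)) := by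
  classical
  have hS' : (1 : ℝ) ≤ S := by exact_mod_cast hS
  have hS0 : (0 : ℝ) < (S : ℝ) ^ 2 := by positivity
  set h : ℤ → ℝ≥0∞ := fun a => ENNReal.ofReal (Real.exp (-(a : ℝ) ^ 2 / (S : ℝ) ^ 2)) with hh
  -- The normalising constant is at least the weight of 0, which is 1.
  have hmass (z : Fin g → ℤ) : discreteGaussian g σ hσ z ≤ gaussWeight g σ z := by
    rw [discreteGaussian, PMF.normalize_apply]
    have h1 : (1 : ℝ≥0∞) ≤ ∑' x, gaussWeight g σ x := by
      refine le_trans ?_ (ENNReal.le_tsum 0)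
      simp [gaussWeight]
    calc gaussWeight g σ z * (∑' x, gaussWeight g σ x)⁻¹ ≤ gaussWeight g σ z * 1 := by
          gcongr; exact ENNReal.inv_le_one.2 h1
      _ = _ := mul_one _
  have hweight (z : Fin g → ℤ) (hz : ∃ i, (B : ℤ) < |z i|) : gaussWeight g σ z ≤
      ENNReal.ofReal (Real.exp (-(B : ℝ) ^ 2 / (S : ℝ) ^ 2)) * ∏ i, h (z i) := by
    obtain ⟨i, hi⟩ := hz
    rw [hh, ← ENNReal.ofReal_prod_of_nonneg (fun _ _ => (Real.exp_pos _).le), ← Real.exp_sum,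
      ← ENNReal.ofReal_mul (Real.exp_pos _).le, ← Real.exp_add, gaussWeight]
    refine ENNReal.ofReal_le_ofReal (Real.exp_le_exp.2 ?_)
    rw [← Finset.sum_div, Finset.sum_neg_distrib]
    set Q := ∑ i, (z i : ℝ) ^ 2 with hQ
    have h1 : (B : ℝ) ^ 2 ≤ Q := by
      have h2 : (B : ℝ) ^ 2 ≤ (z i : ℝ) ^ 2 := by
        rw [← sq_abs (z i : ℝ)]
        have : (B : ℝ) ≤ |(z i : ℝ)| := by exact_mod_cast hi.le
        gcongr
      exact h2.trans (Finset.single_le_sum (f := fun i => (z i : ℝ) ^ 2) (fun _ _ => sq_nonneg _)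
        (Finset.mem_univ i))
    have hQ0 : 0 ≤ Q := Finset.sum_nonneg fun _ _ => sq_nonneg _
    -- Half of the exponent will supply B, the other half the convergent sum.
    have h3 : 2 * Q / (S : ℝ) ^ 2 ≤ Real.pi * Q / σ ^ 2 := by
      have hpi := Real.pi_gt_three
      gcongr
      linarith
    have h4 : -(B : ℝ) ^ 2 / (S : ℝ) ^ 2 + -Q / (S : ℝ) ^ 2 = -(((B : ℝ) ^ 2 + Q) / (S : ℝ) ^ 2) := by
      ring
    have h5 : ((B : ℝ) ^ 2 + Q) / (S : ℝ) ^ 2 ≤ 2 * Q / (S : ℝ) ^ 2 := by gcongr; linarith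
    have h6 : -Real.pi * Q / σ ^ 2 = -(Real.pi * Q / σ ^ 2) := by ring
    rw [h4, h6]
    linarith
  calc pr (discreteGaussian g σ hσ) (fun z => ∃ i, (B : ℤ) < |z i|)
      ≤ ∑' z : Fin g → ℤ, ENNReal.ofReal (Real.exp (-(B : ℝ) ^ 2 / (S : ℝ) ^ 2)) * ∏ i, h (z i) := by
        rw [pr, PMF.toOuterMeasure_apply]
        refine ENNReal.tsum_le_tsum fun z => ?_
        by_cases hz : ∃ i, (B : ℤ) < |z i|
        · rw [Set.indicator_of_mem (by exact hz)]
          exact (hmass z).trans (hweight z hz)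
        · rw [Set.indicator_of_notMem (by exact hz)]
          exact zero_le
    _ = ENNReal.ofReal (Real.exp (-(B : ℝ) ^ 2 / (S : ℝ) ^ 2)) * (∑' a, h a) ^ g := by
        rw [ENNReal.tsum_mul_left, tsum_pi_prod]
    _ ≤ ENNReal.ofReal (Real.exp (-(B : ℝ) ^ 2 / (S : ℝ) ^ 2)) *
          (ENNReal.ofReal (2 * (1 + (S : ℝ) ^ 2))) ^ g := by
        gcongr; exact tsum_exp_neg_le hS
    _ ≤ ENNReal.ofReal (Real.exp (-(B : ℝ) ^ 2 / (S : ℝ) ^ 2)) *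
          (ENNReal.ofReal (Real.exp (2 * (S : ℝ) ^ 2 + 1))) ^ g := by
        gcongr
        have := Real.add_one_le_exp (2 * (S : ℝ) ^ 2 + 1)
        linarith
    _ = ENNReal.ofReal (Real.exp (-(B : ℝ) ^ 2 / (S : ℝ) ^ 2 + g * (2 * (S : ℝ) ^ 2 + 1))) := by
        rw [← ENNReal.ofReal_pow (Real.exp_pos _).le, ← Real.exp_nat_mul,
          ← ENNReal.ofReal_mul (Real.exp_pos _).le, ← Real.exp_add]
    _ ≤ _ := by
        refine ENNReal.ofReal_le_ofReal (Real.exp_le_exp.2 ?_)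
        have h1 : (S : ℝ) ^ 2 * (m + g * (2 * (S : ℝ) ^ 2 + 1)) ≤ (B : ℝ) ^ 2 := by exact_mod_cast hB
        have h2 : (m + g * (2 * (S : ℝ) ^ 2 + 1)) ≤ (B : ℝ) ^ 2 / (S : ℝ) ^ 2 := by
          rw [le_div_iff₀ hS0]; linarith
        have h3 : -(B : ℝ) ^ 2 / (S : ℝ) ^ 2 = -((B : ℝ) ^ 2 / (S : ℝ) ^ 2) := by ring
        rw [h3]; linarith

/-! ## Correctness of the decryption of hashes -/

section

variable {P : RingParams} {t n B : ℕ}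

/-- Small noise. -/
def Short (t B : ℕ) (e : P.R) : Prop := ∃ e' : Ring2 t P.logDeg, Lifts e e' B

theorem pr_noise_le {S m : ℕ} (hS : 1 ≤ S) (hσS : P.σ ≤ S)
    (hB : S ^ 2 * (m + 2 ^ P.logDeg * (2 * S ^ 2 + 1)) ≤ B ^ 2) :
    pr P.noise (fun e => ¬Short t B e) ≤ ENNReal.ofReal (Real.exp (-m)) := by
  rw [RingParams.noise, pr_map]
  refine (pr_mono _ fun z hz => ?_).trans (pr_discreteGaussian_le P.σ_pos hS hσS hB)
  by_contra h
  push Not at h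
  exact hz ⟨_, z, h, rfl, rfl⟩

/-- A bound for the coefficients of a decrypted fresh ciphertext. -/
def freshBound (t g B : ℕ) : ℕ := t * (1 + (B + 2 * (g ^ 2 * (B * B))))

/-- A key pair with small secrets. -/
def GoodKey (t B : ℕ) (key : (P.R × P.R) × P.R) : Prop :=
  Short t B key.2 ∧ ∃ e, Short t B e ∧ key.1.1 = -(key.1.2 * key.2 + (t : P.R) * e)

theorem pr_keyGen_le {τ : ℝ≥0∞} (h : pr P.noise (fun e => ¬Short t B e) ≤ τ) :
    pr (BV.keyGen P t) (fun key => ¬GoodKey t B key) ≤ 2 * τ := by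
  rw [BV.keyGen]
  refine (pr_bind_le (δ := τ) _ h fun s hs => ?_).trans (by rw [two_mul])
  refine (pr_bind_le (bad := fun _ => False) (ε := 0) (δ := τ) _ ?_ fun a _ => ?_).trans (by simp)
  · simp [pr]
  refine (pr_bind_le (δ := 0) _ h fun e he => ?_).trans (by simp)
  refine (pr_pure_le ?_).le
  exact not_not.2 ⟨not_not.1 hs, e, not_not.1 he, rfl⟩

/-- With public key (-(a s + t e), a), the ciphertext takes at s the value μ + t (e₁ + e₂ s - e v):
the terms a v s cancel. `freshBound` is the resulting bound when all of s, e, v, e₁, e₂ are at most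
B; a failure of one of the last three accounts for 3 τ. -/
theorem pr_encrypt_le [NeZero t] {τ : ℝ≥0∞} (h : pr P.noise (fun e => ¬Short t B e) ≤ τ)
    {key : (P.R × P.R) × P.R} (hkey : GoodKey t B key) (μ : Ring2 t P.logDeg) :
    pr (BV.encrypt P t key.1 μ) (fun ct => ¬Lifts (Polynomial.eval key.2 (BV.ofPair P ct)) μ
      (freshBound t (2 ^ P.logDeg) B)) ≤ 3 * τ := by
  obtain ⟨⟨s', hs⟩, e, ⟨e', he⟩, hpk⟩ := hkey
  have e3 : 3 * τ = τ + (τ + (τ + 0)) := by ring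
  rw [BV.encrypt, e3]
  refine pr_bind_le _ h fun v hv => pr_bind_le _ h fun e₁ h₁ => pr_bind_le _ h fun e₂ h₂ => ?_
  obtain ⟨v', hv⟩ := not_not.1 hv
  obtain ⟨e₁', h₁⟩ := not_not.1 h₁
  obtain ⟨e₂', h₂⟩ := not_not.1 h₂
  refine (pr_pure_le ?_).le
  refine not_not.2 ?_
  have hl := (Lifts.lift_right (q := P.q) μ).add
    ((h₁.add ((h₂.mul hs).sub (he.mul hv))).natCast_mul_left)
  rw [add_zero] at hl
  have hev : Polynomial.eval key.2 (BV.ofPair P (key.1.1 * v + (t : P.R) * e₁ + Ring2.lift P.q μ,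
      key.1.2 * v + (t : P.R) * e₂)) =
      Ring2.lift P.q μ + (t : P.R) * (e₁ + (e₂ * key.2 - e * v)) := by
    rw [BV.ofPair, Polynomial.eval_add, Polynomial.eval_mul, Polynomial.eval_C, Polynomial.eval_C,
      Polynomial.eval_X]
    simp only
    rw [hpk]
    ring
  rw [hev]
  exact hl.mono (le_of_eq (by unfold freshBound; ring))

/-- Both sides are the same product, over the ciphertexts and over the true bits, and
`chunkCircuit_spec` identifies the latter with the indicator. A factor is c, 1 - c or 1, hence
bounded by D + 1; the bound of the product is exponential in the number of bits. -/
theorem lifts_eval_chunkCircuit {ct : Fin (addrBits n) → P.R × P.R} {s : P.R} {m D j : ℕ} (hm : m < n)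
    (hj : j < numChunks n P.logDeg)
    (h : ∀ i, Lifts (Polynomial.eval s (BV.ofPair P (ct i)))
      (if digit n m i then 1 else 0 : Ring2 t P.logDeg) D) :
    Lifts (Polynomial.eval s (BV.eval P (chunkCircuit n P.logDeg j) ct))
      (if j * 2 ^ P.logDeg ≤ m ∧ m < (j + 1) * 2 ^ P.logDeg then 1 else 0 : Ring2 t P.logDeg)
      (((2 ^ P.logDeg) ^ 2 * (D + 1)) ^ addrBits n) := by
  have h1 : Polynomial.eval s (BV.eval P (chunkCircuit n P.logDeg j) ct) =
      ∏ i : Fin (addrBits n), if P.logDeg ≤ (i : ℕ) then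
        (if j.testBit (i - P.logDeg) then Polynomial.eval s (BV.ofPair P (ct i))
          else 1 - Polynomial.eval s (BV.ofPair P (ct i))) else 1 := by
    rw [BV.eval, chunkCircuit, map_prod, Polynomial.eval_prod]
    refine Finset.prod_congr rfl fun i _ => ?_
    split
    · split <;> simp
    · simp
  have h2 : (if j * 2 ^ P.logDeg ≤ m ∧ m < (j + 1) * 2 ^ P.logDeg then 1 else 0 : Ring2 t P.logDeg) =
      ∏ i : Fin (addrBits n), if P.logDeg ≤ (i : ℕ) then
        (if j.testBit (i - P.logDeg) then (if digit n m i then 1 else 0 : Ring2 t P.logDeg)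
          else 1 - (if digit n m i then 1 else 0 : Ring2 t P.logDeg)) else 1 := by
    have := congrArg (Int.cast : ℤ → Ring2 t P.logDeg) (chunkCircuit_spec n P.logDeg j m hj hm)
    rw [chunkCircuit, map_prod, Int.cast_prod] at this
    push_cast at this
    rw [← this]
    refine Finset.prod_congr rfl fun i _ => ?_
    split
    · split <;> simp
    · simp
  rw [h1, h2]
  refine (Lifts.prod (B := D + 1) _ fun i _ => ?_).mono (le_of_eq (by simp))
  split
  · split
    · exact (h i).mono (by omega)
    · exact (Lifts.one.sub (h i)).mono (by omega)
  · exact Lifts.one.mono (by omega)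

theorem lifts_chunk {N : ℕ} {x : Fin n → ℤ} (hx : InBox N x) (q t r j : ℕ) :
    Lifts (chunk q r x j) (chunk t r x j) N := by
  refine ⟨_, fun i => ?_, rfl, rfl⟩
  split
  · exact hx _
  · simp

/-- The hash at the secret key lifts the sum of indicator times chunk, in which only the chunk
containing m survives. The hypothesis on q says that the accumulated bound is below q / 2. -/
theorem decrypt_chunkedHash {N m D : ℕ} (hm : m < n) {ct : Fin (addrBits n) → P.R × P.R} {s : P.R}
    (h : ∀ i, Lifts (Polynomial.eval s (BV.ofPair P (ct i)))
      (if digit n m i then 1 else 0 : Ring2 t P.logDeg) D)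
    (hq : 2 * (numChunks n P.logDeg * ((2 ^ P.logDeg) ^ 2 *
      (((2 ^ P.logDeg) ^ 2 * (D + 1)) ^ addrBits n * N))) < P.q)
    {x : Fin n → ℤ} (hx : InBox N x) :
    BV.decrypt P t s (chunkedHash P ct x) = chunk t P.logDeg x (m / 2 ^ P.logDeg) := by
  have hp : 0 < 2 ^ P.logDeg := by positivity
  have hl : Lifts (Polynomial.eval s (chunkedHash P ct x))
      (∑ j ∈ Finset.range (numChunks n P.logDeg),
        (if j * 2 ^ P.logDeg ≤ m ∧ m < (j + 1) * 2 ^ P.logDeg then 1 else 0 : Ring2 t P.logDeg) *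
          chunk t P.logDeg x j) ((Finset.range (numChunks n P.logDeg)).card *
            ((2 ^ P.logDeg) ^ 2 * (((2 ^ P.logDeg) ^ 2 * (D + 1)) ^ addrBits n * N))) := by
    rw [chunkedHash, Polynomial.eval_finsetSum]
    refine Lifts.sum _ fun j hj => ?_
    rw [Polynomial.eval_mul, Polynomial.eval_C]
    exact (lifts_eval_chunkCircuit hm (Finset.mem_range.1 hj) h).mul (lifts_chunk hx _ _ _ _)
  rw [BV.decrypt, hl.lift_eq (by rwa [Finset.card_range])]
  have hdiv (j : ℕ) : (j * 2 ^ P.logDeg ≤ m ∧ m < (j + 1) * 2 ^ P.logDeg) ↔ m / 2 ^ P.logDeg = j := by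
    rw [← Nat.le_div_iff_mul_le hp, ← Nat.div_lt_iff_lt_mul hp]
    omega
  simp only [hdiv, ite_mul, one_mul, zero_mul]
  rw [Finset.sum_ite_eq, if_pos]
  rw [Finset.mem_range, numChunks, Nat.div_lt_iff_lt_mul hp]
  have : (n + 2 ^ P.logDeg - 1) / 2 ^ P.logDeg * 2 ^ P.logDeg + (n + 2 ^ P.logDeg - 1) % 2 ^ P.logDeg =
    n + 2 ^ P.logDeg - 1 := Nat.div_add_mod' _ _
  have := Nat.mod_lt (n + 2 ^ P.logDeg - 1) hp
  omega

/-- Entries in [-N, N] differ by at most 2 N < t, so they are distinct modulo t if distinct. -/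
theorem chunk_ne {t r N : ℕ} (htN : 2 * N < t) {x x' : Fin n → ℤ} (hx : InBox N x) (hx' : InBox N x')
    {m : Fin n} (hne : x m ≠ x' m) : chunk t r x (m / 2 ^ r) ≠ chunk t r x' (m / 2 ^ r) := by
  intro h
  have hp : 0 < 2 ^ r := by positivity
  have h1 := congrFun (congrArg Ring2.coeffs h) ⟨m % 2 ^ r, Nat.mod_lt _ hp⟩
  have e (y : Fin n → ℤ) : Ring2.coeffs (chunk t r y (m / 2 ^ r)) ⟨m % 2 ^ r, Nat.mod_lt _ hp⟩ =
      (y m : ZMod t) := by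
    rw [chunk, Ring2.ofInts, Ring2.coeffs_ofCoeffs]
    have h2 : (m : ℕ) / 2 ^ r * 2 ^ r + m % 2 ^ r = m := Nat.div_add_mod' _ _
    simp only [h2, Fin.is_lt, dite_true]
  rw [e, e, ZMod.intCast_eq_intCast_iff_dvd_sub] at h1
  have h2 := abs_le.1 (hx m)
  have h3 := abs_le.1 (hx' m)
  refine hne (sub_eq_zero.1 (Int.eq_zero_of_abs_lt_dvd h1 ?_)).symm
  rw [abs_lt]
  omega

/-- Decryption of hashes under encryptions of the coordinate `m`. -/
def DecryptsAt (P : RingParams) (t N n : ℕ) (m : Fin n)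
    (key : P.R × (Fin (addrBits n) → P.R × P.R)) : Prop :=
  (∀ x : Fin n → ℤ, InBox N x →
    BV.decrypt P t key.1 (chunkedHash P key.2 x) = chunk t P.logDeg x (m / 2 ^ P.logDeg)) ∧
  ∀ x x' : Fin n → ℤ, InBox N x → InBox N x' → x m ≠ x' m →
    BV.decrypt P t key.1 (chunkedHash P key.2 x) ≠ BV.decrypt P t key.1 (chunkedHash P key.2 x') ∧
      chunkedHash P key.2 x ≠ chunkedHash P key.2 x'

/-- Two noise terms in the key and three in each encryption may fail to be short. Otherwise
decryption is exact for all vectors of the box simultaneously; this matters because the data are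
chosen after the state has been seen. -/
theorem pr_not_decryptsAt_le [NeZero t] {N : ℕ} {τ : ℝ≥0∞}
    (h : pr P.noise (fun e => ¬Short t B e) ≤ τ) (htN : 2 * N < t)
    (hq : 2 * (numChunks n P.logDeg * ((2 ^ P.logDeg) ^ 2 *
      (((2 ^ P.logDeg) ^ 2 * (freshBound t (2 ^ P.logDeg) B + 1)) ^ addrBits n * N))) < P.q)
    (m : Fin n) :
    pr (encryptedCoordinate P t n m) (fun key => ¬DecryptsAt P t N n m key) ≤
      2 * τ + addrBits n * (3 * τ) := by
  rw [encryptedCoordinate]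
  refine pr_bind_le _ (pr_keyGen_le h) fun key hkey => ?_
  have hkey := not_not.1 hkey
  rw [pr_map]
  refine (pr_mono _ fun ct hct => ?_).trans (pr_independent_exists_le fun i =>
    pr_encrypt_le h hkey (if digit n m i then 1 else 0))
  by_contra hgood
  push Not at hgood
  refine hct ?_
  have hdec : ∀ x : Fin n → ℤ, InBox N x → BV.decrypt P t key.2 (chunkedHash P ct x) =
      chunk t P.logDeg x (m / 2 ^ P.logDeg) := fun x hx =>
    decrypt_chunkedHash m.isLt hgood hq hx
  refine ⟨hdec, fun x x' hx hx' hne => ?_⟩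
  have : BV.decrypt P t key.2 (chunkedHash P ct x) ≠ BV.decrypt P t key.2 (chunkedHash P ct x') := by
    rw [hdec x hx, hdec x' hx']
    exact chunk_ne htN hx hx' hne
  exact ⟨this, fun h => this (by rw [h])⟩

end

/-! ## Negligible functions -/

theorem Negligible.of_le {f g : ℕ → ℝ} (hg : Negligible g) {n₀ : ℕ} (h : ∀ n, n₀ < n → f n ≤ g n) :
    Negligible f := fun c hc =>
  let ⟨m, hm⟩ := hg c hc
  ⟨max m n₀, fun n hn => (h n ((le_max_right _ _).trans_lt hn)).trans_lt
    (hm n ((le_max_left _ _).trans_lt hn))⟩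

theorem GrowsLike.exists_le_pow {a : ℕ → ℕ} (ha : GrowsLike (fun n => n) a) :
    ∃ C n₀ : ℕ, ∀ n, n₀ < n → 1 < n ∧ a n ≤ n ^ C := by
  obtain ⟨c, hc⟩ := ha
  refine ⟨1 + 2 * c, c + 1, fun n hn => ⟨by omega, (hc n).trans ?_⟩⟩
  have h2 : n + 1 ≤ n ^ 2 := by nlinarith
  calc c * (n + 1) ^ c ≤ n * (n ^ 2) ^ c := Nat.mul_le_mul (by omega) (Nat.pow_le_pow_left h2 _)
    _ = n ^ (1 + 2 * c) := by rw [← pow_mul, pow_add, pow_one]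

theorem Negligible.mul_poly {f : ℕ → ℝ} (hf : Negligible f) {a : ℕ → ℕ}
    (ha : GrowsLike (fun n => n) a) : Negligible fun n => a n * f n := by
  obtain ⟨C, n₀, hC⟩ := ha.exists_le_pow
  intro c hc
  obtain ⟨m, hm⟩ := hf (c + C) (by positivity)
  refine ⟨max m n₀, fun n hn => ?_⟩
  obtain ⟨h1, h2⟩ := hC n ((le_max_right _ _).trans_lt hn)
  have h3 := hm n ((le_max_left _ _).trans_lt hn)
  have hn0 : (0 : ℝ) < n := by exact_mod_cast (by omega : 0 < n)
  have hpos : (0 : ℝ) < (n : ℝ) ^ (-c) := by positivity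
  have hid : (n : ℝ) ^ C * (n : ℝ) ^ (-(c + C)) = (n : ℝ) ^ (-c) := by
    rw [← Real.rpow_natCast, ← Real.rpow_add hn0]; congr 1; ring
  have h2' : (a n : ℝ) ≤ (n : ℝ) ^ C := by exact_mod_cast h2
  rcases Nat.eq_zero_or_pos (a n) with h0 | h0
  · simp only [h0, Nat.cast_zero, zero_mul]; exact hpos
  · have h0' : (0 : ℝ) < a n := by exact_mod_cast h0
    calc (a n : ℝ) * f n < a n * (n : ℝ) ^ (-(c + C)) := by gcongr
      _ ≤ (n : ℝ) ^ C * (n : ℝ) ^ (-(c + C)) := by gcongr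
      _ = _ := hid

theorem Negligible.add {f g : ℕ → ℝ} (hf : Negligible f) (hg : Negligible g) :
    Negligible fun n => f n + g n := by
  have h : Negligible fun n => max (f n) (g n) := fun c hc => by
    obtain ⟨m, hm⟩ := hf c hc
    obtain ⟨m', hm'⟩ := hg c hc
    exact ⟨max m m', fun n hn => max_lt (hm n ((le_max_left _ _).trans_lt hn))
      (hm' n ((le_max_right _ _).trans_lt hn))⟩
  refine (h.mul_poly (.const 2)).of_le (n₀ := 0) fun n _ => ?_
  have h1 := le_max_left (f n) (g n)
  have h2 := le_max_right (f n) (g n)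
  push_cast
  linarith

theorem negligible_exp : Negligible fun n => Real.exp (-(n : ℝ)) := by
  intro c hc
  have h := (isLittleO_exp_neg_mul_rpow_atTop (a := 1) one_pos (-c)).comp_tendsto
    tendsto_natCast_atTop_atTop
  have h2 := h.bound (c := 1 / 2) (by norm_num)
  obtain ⟨n₀, hn₀⟩ := Filter.eventually_atTop.1 h2
  refine ⟨n₀, fun n hn => ?_⟩
  have h3 := hn₀ n hn.le
  have hn0 : (0 : ℝ) < n := by exact_mod_cast (by omega : 0 < n)
  have hpos : (0 : ℝ) < (n : ℝ) ^ (-c) := by positivity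
  simp only [Function.comp, Real.norm_eq_abs, abs_of_pos (Real.exp_pos _), abs_of_pos hpos,
    neg_mul, one_mul] at h3
  linarith

/-! ## Size of the modulus -/

section

variable {w : ℝ} {P : ℕ → RingParams}

/-- For f ≤ n ^ C the logarithm of the left side is C (log₂ n + O(1)) log n = O(log² n), which log q
dominates. This is the only place where the growth of q from below is used. -/
theorem eventually_pow_lt_modulus
    (hq : (fun n : ℕ => Real.log n ^ 2) =o[Filter.atTop] fun n : ℕ => Real.log (P n).q)
    {f : ℕ → ℕ} (hf : GrowsLike (fun n => n) f) :
    ∃ n₀, ∀ n, n₀ < n → f n ^ (addrBits n + 1) < (P n).q := by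
  obtain ⟨C, n₁, hC⟩ := hf.exists_le_pow
  -- The number of address bits plus one is at most 4 log n once log n ≥ 1, so 4 C log² n has to be
  -- beaten; the additional 1 makes the inequality strict.
  have h := hq.bound (c := 1 / (4 * (C : ℝ) + 1)) (by positivity)
  obtain ⟨n₂, hn₂⟩ := Filter.eventually_atTop.1 h
  refine ⟨max (max n₁ n₂) 3, fun n hn => ?_⟩
  have hn1 : n₁ < n := (le_max_left _ _).trans_lt ((le_max_left _ _).trans_lt hn)
  have hn2 : n₂ ≤ n := ((le_max_right _ _).trans_lt ((le_max_left _ _).trans_lt hn)).le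
  have hn3 : 3 < n := (le_max_right _ _).trans_lt hn
  have hlog : 1 ≤ Real.log n := by
    rw [Real.le_log_iff_exp_le (by exact_mod_cast (by omega : 0 < n))]
    refine Real.exp_one_lt_d9.le.trans ?_
    have : (4 : ℝ) ≤ n := by exact_mod_cast hn3
    linarith
  have h3 := hn₂ n hn2
  rw [Real.norm_eq_abs, Real.norm_eq_abs, abs_of_nonneg (sq_nonneg _),
    abs_of_nonneg (Real.log_natCast_nonneg _), one_div, inv_mul_eq_div,
    le_div_iff₀ (by positivity)] at h3
  have hL : ((addrBits n : ℕ) : ℝ) + 1 ≤ 4 * Real.log n := by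
    have h4 : addrBits n ≤ Nat.log 2 n + 1 :=
      Nat.clog_le_of_le_pow (Nat.lt_pow_succ_log_self (by norm_num) n).le
    have h5 : ((Nat.log 2 n : ℕ) : ℝ) ≤ Real.logb 2 n := by
      simpa using Real.natLog_le_logb n 2
    have h6 : Real.logb 2 n ≤ 2 * Real.log n := by
      rw [Real.logb, div_le_iff₀ (Real.log_pos (by norm_num))]
      have := Real.log_two_gt_d9
      nlinarith
    have h7 : ((addrBits n : ℕ) : ℝ) ≤ Nat.log 2 n + 1 := by exact_mod_cast h4
    linarith
  have hpow : f n ^ (addrBits n + 1) ≤ n ^ (C * (addrBits n + 1)) := by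
    rw [pow_mul]; exact Nat.pow_le_pow_left (hC n hn1).2 _
  refine hpow.trans_lt ?_
  have hqpos : (0 : ℝ) < (P n).q := by exact_mod_cast (P n).q_prime.pos
  have hnpos : (0 : ℝ) < n := by exact_mod_cast (by omega : 0 < n)
  have : ((n ^ (C * (addrBits n + 1)) : ℕ) : ℝ) < (P n).q := by
    rw [← Real.log_lt_log_iff (by positivity) hqpos]
    push_cast
    rw [Real.log_pow]
    push_cast
    have h8 : (C : ℝ) * (addrBits n + 1) * Real.log n ≤ 4 * C * Real.log n ^ 2 := by
      have : (C : ℝ) * (addrBits n + 1) * Real.log n ≤ C * (4 * Real.log n) * Real.log n := by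
        gcongr
      linarith [this]
    nlinarith
  exact_mod_cast this

theorem polyBounded_two_pow_addrBits : GrowsLike (fun n => n) fun n => 2 ^ addrBits n := by
  refine (((GrowsLike.const 2).mul GrowsLike.self).add (.const 1)).of_le fun n => ?_
  rcases Nat.eq_zero_or_pos n with rfl | hn
  · simp [addrBits]
  · exact (two_pow_addrBits_le hn).trans (Nat.le_succ _)

theorem numChunks_le (n r : ℕ) : numChunks n r ≤ n + 1 := by
  have hp : 0 < 2 ^ r := by positivity
  rw [numChunks, ← Nat.lt_succ_iff, Nat.div_lt_iff_lt_mul hp]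
  have h1 : n ≤ n * 2 ^ r := Nat.le_mul_of_pos_right _ hp
  have h2 : (n + 1).succ * 2 ^ r = n * 2 ^ r + 2 ^ r + 2 ^ r := by rw [Nat.succ_eq_add_one]; ring
  omega

theorem exists_noise_bound {N t : ℕ → ℕ} (hN : PolyBounded N) (htp : PolyBounded t)
    (hr : ∀ n, (P n).logDeg ≤ addrBits n) (hσ : ∃ c : ℕ, ∀ n : ℕ, (P n).σ ≤ (n : ℝ) ^ c + c)
    (hq : (fun n : ℕ => Real.log n ^ 2) =o[Filter.atTop] fun n : ℕ => Real.log (P n).q) :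
    ∃ (B : ℕ → ℕ) (n₀ : ℕ), ∀ n, n₀ < n →
      pr (P n).noise (fun e => ¬Short (t n) (B n) e) ≤ ENNReal.ofReal (Real.exp (-n)) ∧
      2 * (numChunks n (P n).logDeg * ((2 ^ (P n).logDeg) ^ 2 *
        (((2 ^ (P n).logDeg) ^ 2 * (freshBound (t n) (2 ^ (P n).logDeg) (B n) + 1)) ^ addrBits n *
          N n))) < (P n).q := by
  obtain ⟨c, hc⟩ := hσ
  set S : ℕ → ℕ := fun n => n ^ c + c + 1 with hS
  -- With m = n and degree at most 2 (n + 1), the tail bound asks for B² ≥ 7 (n + 1) S ^ 4.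
  set B : ℕ → ℕ := fun n => 4 * ((n + 1) * S n ^ 2) with hB
  have gS : GrowsLike (fun n => n) S := ((GrowsLike.self.pow c).add (.const c)).add (.const 1)
  have gB : GrowsLike (fun n => n) B :=
    (GrowsLike.const 4).mul ((GrowsLike.self.add (.const 1)).mul (gS.pow 2))
  set G : ℕ → ℕ := fun n => 2 ^ addrBits n with hG
  have gG : GrowsLike (fun n => n) G := polyBounded_two_pow_addrBits
  have gt := polyBounded_iff.1 htp
  set X : ℕ → ℕ := fun n => G n ^ 2 * (freshBound (t n) (G n) (B n) + 1) with hX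
  have gX : GrowsLike (fun n => n) X := (gG.pow 2).mul ((gt.mul ((GrowsLike.const 1).add
    (gB.add ((GrowsLike.const 2).mul ((gG.pow 2).mul (gB.mul gB)))))).add (.const 1))
  set Y : ℕ → ℕ := fun n => 2 * ((n + 1) * (G n ^ 2 * N n)) with hY
  have gY : GrowsLike (fun n => n) Y := (GrowsLike.const 2).mul ((GrowsLike.self.add (.const 1)).mul
    ((gG.pow 2).mul (polyBounded_iff.1 hN)))
  obtain ⟨n₀, hn₀⟩ := eventually_pow_lt_modulus hq (gX.add gY)
  refine ⟨B, n₀, fun n hn => ⟨?_, ?_⟩⟩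
  · have hS1 : 1 ≤ S n := by simp [hS]
    refine pr_noise_le (S := S n) hS1 ?_ ?_
    · refine (hc n).trans ?_
      rw [hS]; push_cast; linarith
    · have hg : 2 ^ (P n).logDeg ≤ 2 * (n + 1) := by
        refine (Nat.pow_le_pow_right (by norm_num) (hr n)).trans ?_
        rcases Nat.eq_zero_or_pos n with rfl | hn
        · simp [addrBits]
        · exact (two_pow_addrBits_le hn).trans (by omega)
      rw [hB]
      simp only
      have h1 : 1 ≤ S n ^ 2 := Nat.one_le_pow _ _ hS1
      generalize S n ^ 2 = s at *
      generalize 2 ^ (P n).logDeg = g at *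
      calc s * (n + g * (2 * s + 1)) ≤ s * ((n + 1) * s + 2 * (n + 1) * (2 * s + s)) := by
            gcongr
            nlinarith
        _ = 7 * ((n + 1) * s ^ 2) := by ring
        _ ≤ (4 * ((n + 1) * s)) ^ 2 := by nlinarith [Nat.zero_le (n * s ^ 2), Nat.zero_le (n ^ 2 * s ^ 2)]
  · refine lt_of_le_of_lt ?_ (hn₀ n hn)
    have hg : 2 ^ (P n).logDeg ≤ G n := Nat.pow_le_pow_right (by norm_num) (hr n)
    have hnc := numChunks_le n (P n).logDeg
    calc 2 * (numChunks n (P n).logDeg * ((2 ^ (P n).logDeg) ^ 2 *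
        (((2 ^ (P n).logDeg) ^ 2 * (freshBound (t n) (2 ^ (P n).logDeg) (B n) + 1)) ^ addrBits n *
          N n)))
        ≤ 2 * ((n + 1) * (G n ^ 2 * (X n ^ addrBits n * N n))) := by
          have hf : freshBound (t n) (2 ^ (P n).logDeg) (B n) ≤ freshBound (t n) (G n) (B n) := by
            unfold freshBound; gcongr
          have hf' : (2 ^ (P n).logDeg) ^ 2 * (freshBound (t n) (2 ^ (P n).logDeg) (B n) + 1) ≤ X n := by
            rw [hX]; simp only; gcongr
          gcongr
      _ = X n ^ addrBits n * Y n := by rw [hY]; ring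
      -- A single base, so that the bound has the form of `eventually_pow_lt_modulus`.
      _ ≤ (X n + Y n) ^ addrBits n * (X n + Y n) := by
          gcongr <;> omega
      _ = _ := (pow_succ _ _).symm

theorem exists_pr_not_decryptsAt_le {N t : ℕ → ℕ} (hN : PolyBounded N) (ht : ∀ n, (t n).Prime)
    (htN : ∀ n, n * N n < t n) (htp : PolyBounded t) (hr : ∀ n, (P n).logDeg ≤ addrBits n)
    (hσ : ∃ c : ℕ, ∀ n : ℕ, (P n).σ ≤ (n : ℝ) ^ c + c)
    (hq : (fun n : ℕ => Real.log n ^ 2) =o[Filter.atTop] fun n : ℕ => Real.log (P n).q) :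
    ∃ ν : ℕ → ℝ, Negligible ν ∧ (∀ n, 0 ≤ ν n) ∧ ∀ n (m : Fin n),
      pr (encryptedCoordinate (P n) (t n) n m) (fun key => ¬DecryptsAt (P n) (t n) (N n) n m key) ≤
        ENNReal.ofReal (ν n) := by
  obtain ⟨B, n₀, h⟩ := exists_noise_bound hN htp hr hσ hq
  -- For small n the bound 1 is trivial. For n ≥ 2 the hypothesis n N < t yields 2 N < t.
  refine ⟨fun n => if n ≤ max n₀ 1 then 1 else (2 + 3 * addrBits n : ℕ) * Real.exp (-n), ?_, ?_, ?_⟩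
  · refine (negligible_exp.mul_poly (((GrowsLike.const 2).add
      ((GrowsLike.const 3).mul polylog_addrBits.growsLike)))).of_le (n₀ := max n₀ 1) fun n hn => ?_
    rw [if_neg (by omega)]
  · intro n
    simp only
    split <;> positivity
  · intro n m
    by_cases hn : n ≤ max n₀ 1
    · simp only [if_pos hn, ENNReal.ofReal_one]
      exact pr_le_one _ _
    · have h1 : n₀ < n := by omega
      have h2 : 2 ≤ n := by omega
      have : NeZero (t n) := ⟨(ht n).ne_zero⟩
      simp only [if_neg hn]
      refine (pr_not_decryptsAt_le (h n h1).1 ?_ (h n h1).2 m).trans ?_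
      · have := htN n
        nlinarith
      · rw [ENNReal.ofReal_mul (by positivity), ENNReal.ofReal_natCast]
        push_cast
        refine le_of_eq ?_
        ring

theorem decryption_correct {N t : ℕ → ℕ} (hN : PolyBounded N) (ht : ∀ n, (t n).Prime)
    (htN : ∀ n, n * N n < t n) (htp : PolyBounded t) (hr : ∀ n, (P n).logDeg ≤ addrBits n)
    (hσ : ∃ c : ℕ, ∀ n : ℕ, (P n).σ ≤ (n : ℝ) ^ c + c)
    (hq : (fun n : ℕ => Real.log n ^ 2) =o[Filter.atTop] fun n : ℕ => Real.log (P n).q) :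
    ∃ ν : ℕ → ℝ, Negligible ν ∧ ∀ n (m : Fin n),
      1 - ν n ≤ prob ((encryptedCoordinate (P n) (t n) n m).map (DecryptsAt (P n) (t n) (N n) n m)) := by
  obtain ⟨ν, hν, hν0, h⟩ := exists_pr_not_decryptsAt_le hN ht htN htp hr hσ hq
  refine ⟨ν, hν, fun n m => ?_⟩
  have h1 := pr_add_pr_not (encryptedCoordinate (P n) (t n) n m) (DecryptsAt (P n) (t n) (N n) n m)
  have h2 := congrArg ENNReal.toReal h1
  rw [ENNReal.toReal_add (pr_ne_top _ _) (pr_ne_top _ _), ENNReal.toReal_one] at h2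
  have h3 := ENNReal.toReal_mono ENNReal.ofReal_ne_top (h n m)
  rw [ENNReal.toReal_ofReal (hν0 n)] at h3
  rw [prob_map]
  linarith

end

/-! ## Inversion of runs -/

/-- Programs are deterministic: once one run on an input is known, every run on it is. -/
theorem Eval.det {r p : Prog} {v b b' : Val} {c c' : ℕ} (h : Eval r p v b c) (h' : Eval r p v b' c') :
    b = b' ∧ c = c' := by
  induction h generalizing b' c' with
  | id | const | fst | snd | add | sub | mul | div | mod => cases h'; exact ⟨rfl, rfl⟩
  | pair _ _ ih₁ ih₂ =>
    cases h' with
    | pair h₁ h₂ =>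
      obtain ⟨rfl, rfl⟩ := ih₁ h₁
      obtain ⟨rfl, rfl⟩ := ih₂ h₂
      exact ⟨rfl, rfl⟩
  | comp _ _ ih₁ ih₂ =>
    cases h' with
    | comp h₁ h₂ =>
      obtain ⟨rfl, rfl⟩ := ih₁ h₁
      obtain ⟨rfl, rfl⟩ := ih₂ h₂
      exact ⟨rfl, rfl⟩
  | cond_true _ hne _ ih₁ ih₂ =>
    cases h' with
    | cond_true h₁ _ h₂ =>
      obtain ⟨rfl, rfl⟩ := ih₁ h₁
      obtain ⟨rfl, rfl⟩ := ih₂ h₂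
      exact ⟨rfl, rfl⟩
    | cond_false h₁ _ => exact absurd (ih₁ h₁).1 hne
  | cond_false _ _ ih₁ ih₂ =>
    cases h' with
    | cond_true h₁ hne _ => exact absurd (ih₁ h₁).1.symm hne
    | cond_false h₁ h₂ =>
      obtain ⟨-, rfl⟩ := ih₁ h₁
      obtain ⟨rfl, rfl⟩ := ih₂ h₂
      exact ⟨rfl, rfl⟩
  | fix _ ih =>
    cases h' with
    | fix h₁ =>
      obtain ⟨rfl, rfl⟩ := ih h₁
      exact ⟨rfl, rfl⟩
  | self _ ih =>
    cases h' with
    | self h₁ =>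
      obtain ⟨rfl, rfl⟩ := ih h₁
      exact ⟨rfl, rfl⟩

theorem Runs.eq {p : Prog} {v b b' : Val} {t c : ℕ} (h : Runs p v b t) (h' : Eval p p v b' c) : b' = b :=
  let ⟨_, _, he⟩ := h
  (h'.det he).1

/-- Weakest liberal precondition: if `p` halts on `v`, then its output satisfies `Q`. -/
def post (r : Prog) : Prog → Val → (Val → Prop) → Prop
  | .id, v, Q => Q v
  | .const k, _, Q => Q (.nat k)
  | .fst, .pair a _, Q => Q a
  | .fst, .nat _, _ => True
  | .snd, .pair _ b, Q => Q b
  | .snd, .nat _, _ => True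
  | .pair f g, v, Q => post r f v fun a => post r g v fun b => Q (.pair a b)
  | .comp g f, v, Q => post r f v fun a => post r g a Q
  | .cond c f g, v, Q => post r c v fun a => (a ≠ .nat 0 → post r f v Q) ∧ (a = .nat 0 → post r g v Q)
  | .add, .pair (.nat a) (.nat b), Q => Q (.nat (a + b))
  | .sub, .pair (.nat a) (.nat b), Q => Q (.nat (a - b))
  | .mul, .pair (.nat a) (.nat b), Q => Q (.nat (a * b))
  | .div, .pair (.nat a) (.nat b), Q => Q (.nat (a / b))
  | .mod, .pair (.nat a) (.nat b), Q => Q (.nat (a % b))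
  | .add, _, _ => True
  | .sub, _, _ => True
  | .mul, _, _ => True
  | .div, _, _ => True
  | .mod, _, _ => True
  | .fix p, v, Q => ∀ b c, Eval p p v b c → Q b
  | .self, v, Q => ∀ b c, Eval r r v b c → Q b

/-- Soundness for partial correctness. It is wanted for inputs of unknown shape, on which a program
may get stuck or run for ever, so that `wp` does not apply. -/
theorem post.apply {r p : Prog} {v b : Val} {c : ℕ} {Q : Val → Prop} (h : post r p v Q)
    (he : Eval r p v b c) : Q b := by
  induction p generalizing v b c Q with
  | id | const | fst | snd | add | sub | mul | div | mod => cases he; exact h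
  | pair f g hf hg =>
    cases he with
    | pair h₁ h₂ => exact hg (Q := fun b => Q (.pair _ b)) (hf h h₁) h₂
  | comp g f hg hf =>
    cases he with
    | comp h₁ h₂ => exact hg (hf h h₁) h₂
  | cond c f g hc hf hg =>
    cases he with
    | cond_true h₁ hne h₂ => exact hf ((hc h h₁).1 hne) h₂
    | cond_false h₁ h₂ => exact hg ((hc h h₁).2 rfl) h₂
  | fix p _ =>
    cases he with
    | fix h₁ => exact h _ _ h₁
  | self =>
    cases he with
    | self h₁ => exact h _ _ h₁

/-! ## Adding up untrusted data -/

/-- The program without output. -/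
def Prog.fail : Prog := .comp .fst (.const 0)

/-- On input `acc, l`: adds the entries of a vector to sums of positive and of negative parts. -/
def addVec : Prog :=
  .cond (arg 0)
    (.pair
      (.cond (head (head (arg 1)))
        (.pair (head (head (arg 0))) (op .add (tail (head (arg 0))) (tail (head (arg 1)))))
        (.pair (op .add (head (head (arg 0))) (tail (head (arg 1)))) (tail (head (arg 0)))))
      (again [tail (arg 0), tail (arg 1)]))
    (.const 0)

/-- The list of the pairs `(p i, m i)`. -/
def partsVal {n : ℕ} (p m : Fin n → ℕ) : Val :=
  .list (List.ofFn fun i => .pair (.nat (p i)) (.nat (m i)))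

theorem runs_addVec {s n : ℕ} (p m : Fin n → ℕ) (x : Fin n → ℤ) (hp : ∀ i, p i < 2 ^ s)
    (hm : ∀ i, m i < 2 ^ s) (hx : ∀ i, (x i).natAbs < 2 ^ s) :
    Runs addVec (.list [partsVal p m, Val.vec x])
      (partsVal (fun i => p i + (x i).toNat) (fun i => m i + (-x i).toNat))
      ((n + 1) * (50 * opCost s)) := by
  have hW := two_mul_add_one_le_opCost s
  unfold partsVal Val.vec Val.int
  induction n with
  | zero =>
    refine .of_wp s ?_
    simp only [addVec, wp, arg, Val.list_cons, again, tup, op, head, tail, letIn, Val.list_nil,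
      List.ofFn_zero]
    exact .inr ⟨trivial, trivial, by omega⟩
  | succ n ih =>
    have h1 := ih (fun i => p i.succ) (fun i => m i.succ) (fun i => x i.succ) (fun i => hp _)
      (fun i => hm _) (fun i => hx _)
    have h2 := hp 0
    have h3 := hm 0
    have h4 := hx 0
    rw [Nat.succ_mul (n + 1)]
    refine .of_wp s ?_
    simp only [addVec, wp, arg, Val.list_cons, again, tup, op, head, tail, letIn, Val.list_nil,
      ofFn_succ_map]
    refine .inl ⟨Val.pair_ne_nat _ _ _, ?_⟩
    by_cases h : x 0 < 0
    · refine .inl ⟨Val.nat_ne_zero (by simp [h]), h3, h4, _, _, h1, ?_, by omega⟩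
      rw [show p 0 + (x 0).toNat = p 0 by omega, show m 0 + (-x 0).toNat = m 0 + (x 0).natAbs by omega]
    · refine .inr ⟨Val.nat_eq_zero (by simp [h]), h2, h4, _, _, h1, ?_, by omega⟩
      rw [show p 0 + (x 0).toNat = p 0 + (x 0).natAbs by omega, show m 0 + (-x 0).toNat = m 0 by omega]

/-- On input `acc, L`: adds all vectors of the list `L`. -/
def sumAll : Prog :=
  .cond (arg 1) (again [call addVec [arg 0, head (arg 1)], tail (arg 1)]) (arg 0)

/-- Subtraction of numbers is truncated, so positive and negative parts are summed separately. Each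
stays below T N plus its initial value, and so within the word length. -/
theorem runs_sumAll {s n T N : ℕ} (p m : Fin n → ℕ) (x : Fin T → Fin n → ℤ)
    (hp : ∀ i, p i + T * N < 2 ^ s) (hm : ∀ i, m i + T * N < 2 ^ s) (hx : ∀ t i, (x t i).natAbs ≤ N) :
    Runs sumAll (.list [partsVal p m, .list (List.ofFn fun t => Val.vec (x t))])
      (partsVal (fun i => p i + ∑ t, (x t i).toNat) (fun i => m i + ∑ t, (-x t i).toNat))
      ((T + 1) * ((n + 1) * (100 * opCost s))) := by
  have hW := two_mul_add_one_le_opCost s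
  have hlow : 100 * opCost s ≤ (n + 1) * (100 * opCost s) := Nat.le_mul_of_pos_left _ (by omega)
  have hd : (n + 1) * (100 * opCost s) = 2 * ((n + 1) * (50 * opCost s)) := by ring
  induction T generalizing p m with
  | zero =>
    refine .of_wp s ?_
    simp only [sumAll, wp, arg, Val.list_cons, again, tup, op, head, tail, letIn, Val.list_nil,
      List.ofFn_zero, Finset.univ_eq_empty, Finset.sum_empty, add_zero]
    exact .inr ⟨trivial, trivial, by omega⟩
  | succ T ih =>
    have hTN : (T + 1) * N = N + T * N := by ring
    have h0 := runs_addVec (s := s) p m (x 0) (fun i => by have := hp i; omega)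
      (fun i => by have := hm i; omega) (fun i => by have := hp i; have := hx 0 i; omega)
    have h1 := ih (fun i => p i + (x 0 i).toNat) (fun i => m i + (-x 0 i).toNat) (fun t => x t.succ)
      (fun i => by have := hp i; have := hx 0 i; omega)
      (fun i => by have := hm i; have := hx 0 i; omega) (fun t i => hx _ _)
    rw [Nat.succ_mul (T + 1)]
    refine .of_wp s ?_
    simp only [sumAll, wp, arg, Val.list_cons, again, tup, op, head, tail, letIn, Val.list_nil,
      ofFn_succ_map, call]
    refine .inl ⟨Val.pair_ne_nat _ _ _, _, _, h0, _, _, h1, ?_, by omega⟩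
    simp only [Fin.sum_univ_succ, add_assoc]

/-- On input `n, N, acc`: the vector of `n` integers with the given positive and negative parts;
without output if there is none with entries in `[-N, N]`. -/
def finishSum : Prog :=
  .cond (arg 0)
    (.pair
      (letIn (head (arg 2)) <|
        letIn (op .sub (head (arg 0)) (tail (arg 0))) <|
        letIn (op .sub (tail (arg 1)) (head (arg 1))) <|
        .cond (op .sub (op .add (arg 0) (arg 1)) (arg 4)) fail
          (.cond (arg 0) (.pair (.const 1) (arg 0)) (.pair (.const 0) (arg 1))))
      (again [op .sub (arg 0) (.const 1), arg 1, tail (arg 2)]))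
    (.const 0)

theorem runs_finishSum {s n N : ℕ} (p m : Fin n → ℕ) (hn : n < 2 ^ s) (hs : 1 ≤ s) (hN : N < 2 ^ s)
    (hp : ∀ i, p i < 2 ^ s) (hm : ∀ i, m i < 2 ^ s) (hx : InBox N fun i => (p i : ℤ) - m i) :
    Runs finishSum (.list [.nat n, .nat N, partsVal p m]) (Val.vec fun i => (p i : ℤ) - m i)
      ((n + 1) * (200 * opCost s)) := by
  have hW := two_mul_add_one_le_opCost s
  have h2s : 2 ≤ 2 ^ s := Nat.pow_le_pow_right (n := 2) (by norm_num) hs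
  unfold partsVal Val.vec Val.int
  induction n with
  | zero =>
    refine .of_wp s ?_
    simp only [finishSum, wp, arg, Val.list_cons, again, tup, op, head, tail, letIn, Val.list_nil,
      List.ofFn_zero]
    exact .inr ⟨trivial, trivial, by omega⟩
  | succ n ih =>
    have h1 := ih (fun i => p i.succ) (fun i => m i.succ) (by omega) (fun i => hp _)
      (fun i => hm _) (fun i => hx _)
    have h2 := hp 0
    have h3 := hm 0
    have h4 := abs_le.1 (hx 0)
    simp only at h4
    rw [Nat.succ_mul (n + 1)]
    refine .of_wp s ?_
    simp only [finishSum, wp, arg, Val.list_cons, again, tup, op, head, tail, letIn, Val.list_nil,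
      ofFn_succ_map, Nat.add_sub_cancel]
    refine .inl ⟨Val.nat_ne_zero (by omega), h2, h3, h3, h2, by omega, by omega, by omega, hN, .inr ⟨Val.nat_eq_zero (by omega), ?_⟩⟩
    by_cases h : (p 0 : ℤ) - m 0 < 0
    · refine .inl ⟨Val.nat_ne_zero (by omega), by omega, by omega, _, _, h1, ?_, by omega⟩
      rw [if_pos h, show ((p 0 : ℤ) - m 0).natAbs = m 0 - p 0 by omega]
    · refine .inr ⟨Val.nat_eq_zero (by omega), by omega, by omega, _, _, h1, ?_, by omega⟩
      rw [if_neg h, show ((p 0 : ℤ) - m 0).natAbs = p 0 - m 0 by omega]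

/-- Nothing is assumed about `v`: whatever the adversary has produced, if the program halts at all
then its output encodes a vector of the box, because entries out of range or of the wrong shape lead
to no output. -/
theorem exists_of_eval_finishSum {n N : ℕ} {v b : Val} {c : ℕ}
    (h : Eval finishSum finishSum (.list [.nat n, .nat N, v]) b c) :
    ∃ y : Fin n → ℤ, InBox N y ∧ b = Val.vec y := by
  induction n generalizing v b c with
  | zero =>
    refine ⟨Fin.elim0, fun i => i.elim0, post.apply (Q := fun b => b = Val.vec Fin.elim0) ?_ h⟩
    simp only [finishSum, post, arg, Val.list_cons, again, tup, op, head, tail, letIn, Val.list_nil]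
    exact ⟨fun h => absurd rfl h, fun _ => rfl⟩
  | succ n ih =>
    refine post.apply (Q := fun b => ∃ y : Fin (n + 1) → ℤ, InBox N y ∧ b = Val.vec y) ?_ h
    rcases v with _ | ⟨_ | ⟨p, m⟩, l⟩ <;>
    simp only [finishSum, post, arg, Val.list_cons, again, tup, op, head, tail, letIn, Val.list_nil,
      Nat.add_sub_cancel, fail, implies_true, and_true]
    · exact ⟨trivial, fun h => absurd h (Val.nat_ne_zero (by omega))⟩
    · exact ⟨trivial, fun h => absurd h (Val.nat_ne_zero (by omega))⟩
    refine ⟨fun _ => ?_, fun h => absurd h (Val.nat_ne_zero (by omega))⟩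
    rcases p with p | _ <;> rcases m with m | _ <;> simp only [post]
    have key : ∀ z : ℤ, z.natAbs ≤ N → ∀ b c, Eval finishSum finishSum (.list [.nat n, .nat N, l]) b c →
        ∃ y : Fin (n + 1) → ℤ, InBox N y ∧ Val.pair (Val.int z) b = Val.vec y := by
      intro z hz b c he
      obtain ⟨y, hy, rfl⟩ := ih he
      refine ⟨Fin.cons z y, fun i => ?_, ?_⟩
      · induction i using Fin.cases with
        | zero => rw [Fin.cons_zero, Int.abs_eq_natAbs]; exact_mod_cast hz
        | succ i => exact hy i
      · rw [Val.vec, Val.vec, ofFn_succ_map]; rfl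
    refine ⟨trivial, fun h0 => ?_⟩
    have h0 : m - p + (p - m) - N = 0 := by injection h0
    constructor
    · intro h1 b c he
      have h1 : m - p ≠ 0 := fun h' => h1 (by rw [h'])
      have e : Val.pair (.nat 1) (.nat (m - p)) = Val.int ((p : ℤ) - m) := by
        rw [Val.int, if_pos (by omega), show ((p : ℤ) - m).natAbs = m - p by omega]
      rw [e]
      exact key _ (by omega) b c he
    · intro h1 b c he
      have h1 : m - p = 0 := by injection h1
      have e : Val.pair (.nat 0) (.nat (p - m)) = Val.int ((p : ℤ) - m) := by
        rw [Val.int, if_neg (by omega), show ((p : ℤ) - m).natAbs = p - m by omega]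
      rw [e]
      exact key _ (by omega) b c he

/-- On input `m, u, v`: whether two integer vectors differ at position `m`. -/
def neEntry : Prog :=
  .cond (arg 0) (again [op .sub (arg 0) (.const 1), tail (arg 1), tail (arg 2)])
    (.cond (op .add
        (op .add (op .sub (head (head (arg 1))) (head (head (arg 2))))
          (op .sub (head (head (arg 2))) (head (head (arg 1)))))
        (op .add (op .sub (tail (head (arg 1))) (tail (head (arg 2))))
          (op .sub (tail (head (arg 2))) (tail (head (arg 1))))))
      (.const 1) (.const 0))

theorem runs_neEntry {s n : ℕ} (x y : Fin n → ℤ) (m : Fin n) (hn : n < 2 ^ s) (hs : 1 ≤ s)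
    (hx : ∀ i, (x i).natAbs < 2 ^ s) (hy : ∀ i, (y i).natAbs < 2 ^ s) :
    Runs neEntry (.list [.nat m, Val.vec x, Val.vec y]) (.nat (if x m ≠ y m then 1 else 0))
      ((n + 1) * (100 * opCost s)) := by
  have hW := two_mul_add_one_le_opCost s
  have h2s : 2 ≤ 2 ^ s := Nat.pow_le_pow_right (n := 2) (by norm_num) hs
  unfold Val.vec Val.int
  induction n with
  | zero => exact m.elim0
  | succ n ih =>
    rw [Nat.succ_mul (n + 1)]
    induction m using Fin.cases with
    | zero =>
      have h1 := hx 0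
      have h2 := hy 0
      have e : ∀ z : ℤ, (if z < 0 then 1 else 0) ≤ 1 := fun z => by split <;> norm_num
      have e1 := e (x 0)
      have e2 := e (y 0)
      refine .of_wp s ?_
      simp only [neEntry, wp, arg, Val.list_cons, again, tup, op, head, tail, letIn, Val.list_nil,
        ofFn_succ_map]
      refine .inr ⟨rfl, ?_⟩
      have key : ((if x 0 < 0 then 1 else 0) - (if y 0 < 0 then 1 else 0) +
          ((if y 0 < 0 then 1 else 0) - (if x 0 < 0 then 1 else 0)) +
          ((x 0).natAbs - (y 0).natAbs + ((y 0).natAbs - (x 0).natAbs)) = 0) ↔ x 0 = y 0 := by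
        split_ifs <;> omega
      refine ⟨by omega, by omega, by omega, by omega, by omega, by omega, by omega, by omega, by omega,
        by omega, by omega, by omega, by omega, by omega, ?_⟩
      by_cases h : x 0 = y 0
      · exact .inr ⟨Val.nat_eq_zero (key.2 h), by rw [if_neg (not_not.2 h)], by omega⟩
      · exact .inl ⟨Val.nat_ne_zero (mt key.1 h), by rw [if_pos h], by omega⟩
    | succ m =>
      have h1 := ih (fun i => x i.succ) (fun i => y i.succ) m (by omega) (fun i => hx _) (fun i => hy _)
      have := m.isLt
      refine .of_wp s ?_
      simp only [neEntry, wp, arg, Val.list_cons, again, tup, op, head, tail, letIn, Val.list_nil,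
        ofFn_succ_map, Fin.val_succ, Nat.add_sub_cancel]
      exact .inl ⟨Val.nat_ne_zero (by omega), by omega, by omega, _, _, h1, rfl, by omega⟩

/-! ## Searching for collisions of the hash -/

section

variable {k N : ℕ → ℕ} (A : RelaxedRecovery k N)

/-- The reconstruction of `y` collides with `y` under the hash and differs from it at `m`. -/
def Collides {n : ℕ} {P : RingParams} (ct : Fin (addrBits n) → P.R × P.R) (m : Fin n)
    (y : Fin n → ℤ) : Prop :=
  chunkedHash P ct (A.report n ((A.Φ n).apply y)) = chunkedHash P ct y ∧
    A.report n ((A.Φ n).apply y) m ≠ y m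

/-- On input `y, n, description, r, q, m, ciphertexts`: tests whether `y` gives a collision. -/
def testProg : Prog :=
  letIn (.comp (.fix A.reportProg) (.pair (arg 1) (.pair (arg 2)
    (.comp (.fix A.measureProg) (.pair (arg 1) (.pair (arg 2) (arg 0))))))) <|
  letIn (call densify [.const 0, arg 2, arg 0]) <|
  .cond (call eqRingLists [call hashProg [arg 5, arg 6, arg 8, arg 0],
      call hashProg [arg 5, arg 6, arg 8, arg 2]])
    (call neEntry [arg 7, arg 0, arg 2]) (.const 0)

open Classical in
-- The test is efficient since the measurement and the reconstruction are. It is exact for every y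
-- in the box, however y was obtained.
theorem runs_testProg {s n : ℕ} {P : RingParams} (h : FitsProtocol s P n (k n) (N n))
    (ct : Fin (addrBits n) → P.R × P.R) (m : Fin n) (y : Fin n → ℤ) (hy : InBox (N n) y) :
    Runs (testProg A) (.list [Val.vec y, .nat n, A.descr n, .nat P.logDeg, .nat P.q, .nat m,
      .list (List.ofFn fun i => P.encPair (ct i))]) (.nat (if Collides A ct m y then 1 else 0))
      (A.reportTime n + A.measureTime n + checkCost s P.logDeg n +
        hashCost s P.logDeg (addrBits n) + 100) := by
  have hW := two_mul_add_one_le_opCost s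
  have h1 := (A.measureProg_runs n y hy).runs
  have h2 := (A.reportProg_runs n y hy).runs
  have hbox := A.report_inBox n y hy
  rw [Collides]
  set x' := A.report n ((A.Φ n).apply y) with hx'
  have hdim := h.dim
  have h4 := runs_densify (s := s) (i := 0) (List.ofFn x') (by simp; omega)
  rw [← sparseVec_eq, ← vec_eq, List.length_ofFn] at h4
  have h5 := runs_hashProg P h.ring h.deg ct x' (hbox.natAbs_lt h.box)
  have h5' := runs_hashProg P h.ring h.deg ct y (hy.natAbs_lt h.box)
  have h6 := runs_eqRingLists (s := s) (by have := h.ring.modulus_lt; omega)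
    (fun i : Fin (addrBits n - P.logDeg + 1) => (chunkedHash P ct x').coeff i)
    (fun i : Fin (addrBits n - P.logDeg + 1) => (chunkedHash P ct y).coeff i)
  have hs : 1 ≤ s := by have := h.ring.1; omega
  have h7 := runs_neEntry (s := s) x' y m (by omega) hs (hbox.natAbs_lt h.box) (hy.natAbs_lt h.box)
  have c1 : (n + 1) * (100 * opCost s) + (n + 1) * (100 * opCost s) ≤ (n + 2) * (200 * opCost s) := by
    calc _ = (n + 1) * (200 * opCost s) := by ring
      _ ≤ _ := Nat.mul_le_mul_right _ (by omega)
  have c2 : (addrBits n - P.logDeg + 1 + 1) * (2 * ringCost s P.logDeg) ≤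
      (addrBits n + 2) * (2 * ringCost s P.logDeg) := Nat.mul_le_mul_right _ (by omega)
  refine .of_wp s ?_
  simp only [testProg, wp, arg, Val.list_cons, tup, call, head, tail, letIn, checkCost]
  refine ⟨_, _, h1, _, _, h2, _, _, h4, _, _, h5, _, _, h5', _, _, h6, ?_⟩
  by_cases he : chunkedHash P ct x' = chunkedHash P ct y
  · refine .inl ⟨Val.nat_ne_zero ?_, _, _, h7, ?_, by omega⟩
    · rw [if_pos ((chunkedHash_eq_iff P h.deg _ _ _).2 he)]; exact one_ne_zero
    · simp only [he, true_and]
  · refine .inr ⟨Val.nat_eq_zero ?_, ?_, by omega⟩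
    · rw [if_neg (mt (chunkedHash_eq_iff P h.deg _ _ _).1 he)]
    · simp only [he, false_and, if_false]

variable (D : Adversary)

/-- The advice for `collisionProg`. -/
def collisionAdvice (P : RingParams) (n m : ℕ) : Val :=
  .list [D.advice n, .nat n, A.descr n, .nat P.logDeg, .nat P.q, .nat m, .nat (N n),
    partsVal (fun _ : Fin n => 0) (fun _ => 0)]

/-- On input of a state, advice and random bits: runs the adversary, and tests whether the sum of its
data gives a collision. -/
def collisionProg : Prog :=
  let adv (i : ℕ) : Prog := .comp (arg i) (.comp .fst .snd)
  call (testProg A) [call finishSum [adv 1, adv 6, call sumAll [adv 7,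
      .comp (.fix D.prog) (.pair (adv 0) (.pair (.comp .snd .snd) .fst))]],
    adv 1, adv 2, adv 3, adv 4, adv 5, .comp .snd .fst]

/-- Number of steps for adding up the data and testing for a collision. -/
def collisionCost (s r n T : ℕ) : ℕ :=
  (T + 1) * ((n + 1) * (100 * opCost s)) + (n + 1) * (200 * opCost s) + checkCost s r n +
    hashCost s r (addrBits n) + 300

/-- Completeness: admissible data whose sum collides at m are accepted. Singletons among the subset
sums bound each summand by N, and the full sum lies in the box. -/
theorem runs_collisionProg {s n T : ℕ} {P : RingParams} (h : FitsProtocol s P n (k n) (N n))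
    (hT : T * N n < 2 ^ s) (ζ : (chunkedProtocol A P n T).State) (m : Fin n)
    (ρ : Val) (x : Fin T → Fin n → ℤ) (hx : ValidData (N n) x)
    {τ : ℕ} (hD : Runs D.prog (.pair (D.advice n) (.pair ρ ((chunkedProtocol A P n T).encState ζ)))
      (.list (List.ofFn fun t => Val.vec (x t))) τ) (hc : Collides A ζ.2 m (∑ t, x t)) :
    Runs (collisionProg A D) (.pair ((chunkedProtocol A P n T).encState ζ)
      (.pair (collisionAdvice A D P n m) ρ)) (.nat 1)
      (τ + A.reportTime n + A.measureTime n + collisionCost s P.logDeg n T) := by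
  classical
  have hW := two_mul_add_one_le_opCost s
  have hs : 1 ≤ s := by have := h.ring.1; omega
  have hxt (t : Fin T) (i : Fin n) : (x t i).natAbs ≤ N n := by
    have := hx {t} i
    rw [Finset.sum_singleton, Int.abs_eq_natAbs] at this
    exact_mod_cast this
  have hpos (i : Fin n) : ∑ t, (x t i).toNat ≤ T * N n := by
    refine (Finset.sum_le_card_nsmul Finset.univ _ (N n) fun t _ => ?_).trans (by simp)
    have := hxt t i; omega
  have hneg (i : Fin n) : ∑ t, (-x t i).toNat ≤ T * N n := by
    refine (Finset.sum_le_card_nsmul Finset.univ _ (N n) fun t _ => ?_).trans (by simp)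
    have := hxt t i; omega
  have hy : (fun i : Fin n => ((0 + ∑ t, (x t i).toNat : ℕ) : ℤ) - ((0 + ∑ t, (-x t i).toNat : ℕ) : ℤ)) =
      ∑ t, x t := by
    funext i
    rw [Finset.sum_apply]
    push_cast
    rw [zero_add, zero_add, ← Finset.sum_sub_distrib]
    refine Finset.sum_congr rfl fun t _ => ?_
    omega
  have h1 := runs_sumAll (s := s) (N := N n) (fun _ : Fin n => 0) (fun _ => 0) x
    (fun i => by omega) (fun i => by omega) hxt
  have hbox : InBox (N n) (∑ t, x t) := hx Finset.univ
  have h2 := runs_finishSum (s := s) (N := N n) (fun i : Fin n => 0 + ∑ t, (x t i).toNat)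
    (fun i => 0 + ∑ t, (-x t i).toNat) (by have := h.dim; omega) hs h.box
    (fun i => by have := hpos i; omega) (fun i => by have := hneg i; omega) (by rw [hy]; exact hbox)
  rw [hy] at h2
  have h3 := runs_testProg A h ζ.2 m _ hbox
  rw [if_pos hc] at h3
  refine .of_wp s ?_
  simp only [collisionProg, collisionAdvice, chunkedProtocol, wp, arg, Val.list_cons, tup, call, head, tail,
    letIn, collisionCost]
  exact ⟨_, _, hD, _, _, h1, _, _, h2, _, _, h3, rfl, by omega⟩

/-- Soundness without any assumption on the adversary: acceptance proves that some vector of the box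
collides at m. Its output and the sums computed from it remain arbitrary values until `finishSum`
has checked them. -/
theorem exists_collides {s n T : ℕ} {P : RingParams} (h : FitsProtocol s P n (k n) (N n))
    (ζ : (chunkedProtocol A P n T).State) (m : Fin n) (ρ : Val) {c : ℕ}
    (he : Eval (collisionProg A D) (collisionProg A D) (.pair ((chunkedProtocol A P n T).encState ζ)
      (.pair (collisionAdvice A D P n m) ρ)) (.nat 1) c) :
    ∃ y : Fin n → ℤ, InBox (N n) y ∧ Collides A ζ.2 m y := by
  classical
  refine post.apply (Q := fun b => b = .nat 1 →
    ∃ y : Fin n → ℤ, InBox (N n) y ∧ Collides A ζ.2 m y) ?_ he rfl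
  simp only [collisionProg, collisionAdvice, chunkedProtocol, post, arg, Val.list_cons, tup, call, head,
    tail, letIn]
  intro b₁ _ _ b₂ _ _ b₃ _ h₃ b₄ _ h₄ hb
  obtain ⟨y, hy, rfl⟩ := exists_of_eval_finishSum h₃
  have := (runs_testProg A h ζ.2 m y hy).eq h₄
  rw [hb] at this
  refine ⟨y, hy, ?_⟩
  by_contra hn
  rw [if_neg hn] at this
  injection this with h01
  exact one_ne_zero h01

end

/-! ## Affine maps -/

section

variable {q r : ℕ}

/-- An affine function of two pairs of ring elements. -/
def affine (c : Fin 5 → Ring2 q r) (y : Fin 2 → Ring2 q r × Ring2 q r) : Ring2 q r :=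
  c 0 * (y 0).1 + (c 1 * (y 0).2 + (c 2 * (y 1).1 + (c 3 * (y 1).2 + c 4)))

def coeffTrees (c : Fin 5 → Ring2 q r) : Val :=
  .list [(c 0).tree, (c 1).tree, (c 2).tree, (c 3).tree, (c 4).tree]

/-- On input `c, y, r, q`. -/
def affineElem : Prog :=
  let mul (i : ℕ) : Prog := call ringMul [arg 2, arg 3, .comp (arg i) (arg 0), .comp (arg i) (arg 1)]
  let add (e f : Prog) : Prog := call ringAdd [arg 2, arg 3, e, f]
  call flatten [arg 2, add (mul 0) (add (mul 1) (add (mul 2) (add (mul 3) (.comp (arg 4) (arg 0)))))]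

variable {s : ℕ} [NeZero q]

theorem runs_affineElem (hq : 2 ≤ q) (h : FitsWord s q r) (c : Fin 5 → Ring2 q r)
    (y : Fin 2 → Ring2 q r × Ring2 q r) :
    Runs affineElem (.list [coeffTrees c, .list [(y 0).1.tree, (y 0).2.tree, (y 1).1.tree, (y 1).2.tree],
      .nat r, .nat q]) (affine c y).enc (10 * ringCost s r) := by
  have hR := ringCost_ge_op s r
  have hW := two_mul_add_one_le_opCost s
  have hr : r < s := by have := h.1; omega
  have m0 := runs_ringMul hq h (c 0) (y 0).1
  have m1 := runs_ringMul hq h (c 1) (y 0).2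
  have m2 := runs_ringMul hq h (c 2) (y 1).1
  have m3 := runs_ringMul hq h (c 3) (y 1).2
  have a3 := runs_ringAdd h (c 3 * (y 1).2) (c 4)
  have a2 := runs_ringAdd h (c 2 * (y 1).1) (c 3 * (y 1).2 + c 4)
  have a1 := runs_ringAdd h (c 1 * (y 0).2) (c 2 * (y 1).1 + (c 3 * (y 1).2 + c 4))
  have a0 := runs_ringAdd h (c 0 * (y 0).1) (c 1 * (y 0).2 + (c 2 * (y 1).1 + (c 3 * (y 1).2 + c 4)))
  have hf := runs_flatten hr (affine c y)
  refine .of_wp s ?_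
  simp only [affineElem, coeffTrees, wp, arg, Val.list_cons, tup, call, head, tail, letIn]
  have : 1 ≤ opCost s := by omega
  exact ⟨_, _, m0, _, _, m1, _, _, m2, _, _, m3, _, _, a3, _, _, a2, _, _, a1, _, _, a0, _, _, hf, rfl,
    by omega⟩

/-- On input `rows, y, r, q`. -/
def affineList : Prog :=
  .cond (arg 0)
    (.pair (.pair (call affineElem [head (head (arg 0)), arg 1, arg 2, arg 3])
        (call affineElem [tail (head (arg 0)), arg 1, arg 2, arg 3]))
      (again [tail (arg 0), arg 1, arg 2, arg 3]))
    (.const 0)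

def rowsVal {L : ℕ} (M : Fin L → (Fin 5 → Ring2 q r) × (Fin 5 → Ring2 q r)) : Val :=
  .list (List.ofFn fun i => .pair (coeffTrees (M i).1) (coeffTrees (M i).2))

theorem runs_affineList (hq : 2 ≤ q) (h : FitsWord s q r) {L : ℕ}
    (M : Fin L → (Fin 5 → Ring2 q r) × (Fin 5 → Ring2 q r)) (y : Fin 2 → Ring2 q r × Ring2 q r) :
    Runs affineList (.list [rowsVal M, .list [(y 0).1.tree, (y 0).2.tree, (y 1).1.tree, (y 1).2.tree],
      .nat r, .nat q])
      (.list (List.ofFn fun i => .pair (affine (M i).1 y).enc (affine (M i).2 y).enc))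
      ((L + 1) * (30 * ringCost s r)) := by
  have hR := ringCost_ge_op s r
  have hW := two_mul_add_one_le_opCost s
  unfold rowsVal
  induction L with
  | zero =>
    refine .of_wp s ?_
    simp only [affineList, wp, arg, Val.list_cons, tup, call, again, head, tail, letIn, Val.list_nil,
      List.ofFn_zero]
    exact .inr ⟨trivial, trivial, by omega⟩
  | succ L ih =>
    have h1 := ih fun i => M i.succ
    have h2 := runs_affineElem hq h (M 0).1 y
    have h3 := runs_affineElem hq h (M 0).2 y
    rw [Nat.succ_mul (L + 1)]
    refine .of_wp s ?_
    simp only [affineList, wp, arg, Val.list_cons, tup, call, again, head, tail, letIn, ofFn_succ_map]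
    simp only [Val.list_cons] at h1 h2 h3
    exact .inl ⟨Val.pair_ne_nat _ _ _, _, _, h2, _, _, h3, _, _, h1, rfl, by omega⟩

/-- On input `rows, samples, r, q`. -/
def affineProg : Prog :=
  let sample (i : ℕ) : Prog := .comp (arg i) (arg 1)
  call affineList [arg 0, tup [call build [arg 2, head (sample 0)], call build [arg 2, tail (sample 0)],
    call build [arg 2, head (sample 1)], call build [arg 2, tail (sample 1)]], arg 2, arg 3]

theorem runs_affineProg (hq : 2 ≤ q) (h : FitsWord s q r) {L : ℕ}
    (M : Fin L → (Fin 5 → Ring2 q r) × (Fin 5 → Ring2 q r)) (y : Fin 2 → Ring2 q r × Ring2 q r) :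
    Runs affineProg (.list [rowsVal M, .list (List.ofFn fun i => .pair (y i).1.enc (y i).2.enc),
      .nat r, .nat q])
      (.list (List.ofFn fun i => .pair (affine (M i).1 y).enc (affine (M i).2 y).enc))
      ((L + 2) * (30 * ringCost s r)) := by
  have hR := ringCost_ge_op s r
  have hW := two_mul_add_one_le_opCost s
  have hr : r < s := by have := h.1; omega
  have b0 := runs_build_enc hr (y 0).1
  have b1 := runs_build_enc hr (y 0).2
  have b2 := runs_build_enc hr (y 1).1
  have b3 := runs_build_enc hr (y 1).2
  have h1 := runs_affineList hq h M y
  have hl : (L + 2) * (30 * ringCost s r) = (L + 1) * (30 * ringCost s r) + 30 * ringCost s r := by ring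
  rw [hl]
  refine .of_wp s ?_
  simp only [affineProg, wp, arg, Val.list_cons, tup, call, again, head, tail, letIn, ofFn_succ_map,
    List.ofFn_zero, Val.list_nil]
  exact ⟨_, _, b0, _, _, b1, _, _, b2, _, _, b3, _, _, h1, rfl, by omega⟩

end

/-! ## The distinguisher -/

section

variable {k N : ℕ → ℕ} (A : RelaxedRecovery k N) (D : Adversary)

/-- Coefficients for computing a public key and `L` ciphertexts from two samples. -/
abbrev Rows (P : RingParams) (L : ℕ) : Type := Fin (L + 1) → (Fin 5 → P.R) × (Fin 5 → P.R)

def affinePair {P : RingParams} (c : (Fin 5 → P.R) × (Fin 5 → P.R)) (y : Fin 2 → P.R × P.R) : P.R × P.R :=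
  (affine c.1 y, affine c.2 y)

def affineState {P : RingParams} {L : ℕ} (M : Rows P L) (y : Fin 2 → P.R × P.R) :
    (P.R × P.R) × (Fin L → P.R × P.R) :=
  (affinePair (M 0) y, fun i => affinePair (M i.succ) y)

/-- Computes the state from the samples. -/
def stateProg : Prog :=
  .pair (call affineProg [.comp .fst .fst, .comp .snd .snd, .comp (.comp (arg 3) .snd) .fst,
    .comp (.comp (arg 4) .snd) .fst]) (.pair (.comp .snd .fst) (.comp .fst .snd))

def distinguisherProg : Prog := .comp (.fix (collisionProg A D)) (.fix stateProg)

def distinguisherInput (P : RingParams) (n m : ℕ) (M : Rows P (addrBits n)) (ρ : Val)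
    (y : Fin 2 → P.R × P.R) : Val :=
  .pair (.pair (rowsVal M) (collisionAdvice A D P n m))
    (.pair ρ (.list (List.ofFn fun i => P.encPair (y i))))

/-- Number of steps for computing the state. -/
def affineCost (s r L : ℕ) : ℕ := (L + 3) * (30 * ringCost s r) + 100

theorem runs_stateProg {s n m : ℕ} (T : ℕ) {P : RingParams} (h : FitsWord s P.q P.logDeg)
    (M : Rows P (addrBits n)) (y : Fin 2 → P.R × P.R) (ρ : Val) :
    Runs stateProg (distinguisherInput A D P n m M ρ y)
      (.pair ((chunkedProtocol A P n T).encState (affineState M y))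
        (.pair (collisionAdvice A D P n m) ρ))
      ((addrBits n + 3) * (30 * ringCost s P.logDeg) + 90) := by
  have h1 := runs_affineProg P.q_prime.two_le h M y
  have e : (Val.list (List.ofFn fun i => .pair (affine (M i).1 y).enc (affine (M i).2 y).enc)) =
      (chunkedProtocol A P n T).encState (affineState M y) := by
    rw [ofFn_succ_map]; rfl
  rw [e] at h1
  refine .of_wp s ?_
  simp only [stateProg, distinguisherInput, collisionAdvice, wp, arg, Val.list_cons, tup, call,
    RingParams.encPair]
  simp only [Val.list_cons] at h1
  refine ⟨_, _, h1, rfl, ?_⟩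
  have : addrBits n + 1 + 2 = addrBits n + 3 := by ring
  rw [this]
  omega

/-- Within `τ` steps, a collision at `m` is found for the state `ζ` and random bits `ρ`. -/
def Finds (P : RingParams) {n T : ℕ} (m τ : ℕ) (ζ : (chunkedProtocol A P n T).State) (ρ : Val) : Prop :=
  Runs (collisionProg A D) (.pair ((chunkedProtocol A P n T).encState ζ)
    (.pair (collisionAdvice A D P n m) ρ)) (.nat 1) τ

/-- The time limit is part of the event. Passing from a finder to the distinguisher and back
therefore raises the limit by the cost of computing the state, and every hybrid step enlarges it
once. -/
theorem Finds.distinguisher {s n T m τ : ℕ} {P : RingParams} (h : FitsWord s P.q P.logDeg)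
    {M : Rows P (addrBits n)} {y : Fin 2 → P.R × P.R} {ρ : Val}
    (hf : Finds A D P (T := T) m τ (affineState M y) ρ) :
    Runs (distinguisherProg A D) (distinguisherInput A D P n m M ρ y) (.nat 1)
      (τ + affineCost s P.logDeg (addrBits n)) := by
  obtain ⟨c, hc, he⟩ := hf
  obtain ⟨c', hc', he'⟩ := runs_stateProg A D T h M y ρ (m := m)
  exact ⟨_, by unfold affineCost; omega, .comp (.fix he') (.fix he)⟩

/-- The state computed in the first stage is known by determinism, so the second stage of the run is
a run of the finder. -/
theorem finds_of_distinguisher {s n m τ : ℕ} (T : ℕ) {P : RingParams} (h : FitsWord s P.q P.logDeg)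
    {M : Rows P (addrBits n)} {y : Fin 2 → P.R × P.R} {ρ : Val}
    (hr : Runs (distinguisherProg A D) (distinguisherInput A D P n m M ρ y) (.nat 1) τ) :
    Finds A D P (T := T) m τ (affineState M y) ρ := by
  obtain ⟨c, hc, he⟩ := hr
  rcases he with _ | _ | _ | _ | _ | ⟨h₁, h₂⟩
  rcases h₁ with _ | _ | _ | _ | _ | _ | _ | _ | _ | _ | _ | _ | _ | h₁
  rcases h₂ with _ | _ | _ | _ | _ | _ | _ | _ | _ | _ | _ | _ | _ | h₂
  rw [(runs_stateProg A D T h M y ρ).eq h₁] at h₂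
  exact ⟨_, by omega, h₂⟩

end

/-! ## Expectations -/

section

variable {α β : Type}

/-- The expectation of a nonnegative function. -/
def expect (p : PMF α) (f : α → ℝ≥0∞) : ℝ≥0∞ := ∑' a, p a * f a

theorem expect_pure (a : α) (f : α → ℝ≥0∞) : expect (PMF.pure a) f = f a := by
  classical
  rw [expect, tsum_eq_single a fun b hb => by rw [PMF.pure_apply, if_neg hb, zero_mul], PMF.pure_apply,
    if_pos rfl, one_mul]

theorem expect_bind (p : PMF α) (g : α → PMF β) (f : β → ℝ≥0∞) :
    expect (p.bind g) f = expect p fun a => expect (g a) f := by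
  simp only [expect, PMF.bind_apply, ← ENNReal.tsum_mul_right, ← ENNReal.tsum_mul_left]
  rw [ENNReal.tsum_comm]
  simp only [mul_assoc]

theorem expect_map (p : PMF α) (g : α → β) (f : β → ℝ≥0∞) :
    expect (p.map g) f = expect p fun a => f (g a) := by
  rw [PMF.map, expect_bind]
  simp only [Function.comp, expect_pure]

theorem expect_comm (p : PMF α) (p' : PMF β) (f : α → β → ℝ≥0∞) :
    (expect p fun a => expect p' (f a)) = expect p' fun b => expect p fun a => f a b := by
  simp only [expect, ← ENNReal.tsum_mul_left]
  rw [ENNReal.tsum_comm]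
  simp only [mul_left_comm]

theorem expect_const (p : PMF α) (c : ℝ≥0∞) : (expect p fun _ => c) = c := by
  rw [expect, ENNReal.tsum_mul_right, p.tsum_coe, one_mul]

theorem expect_add (p : PMF α) (f g : α → ℝ≥0∞) :
    (expect p fun a => f a + g a) = expect p f + expect p g := by
  simp only [expect, mul_add, ENNReal.tsum_add]

theorem expect_mono (p : PMF α) {f g : α → ℝ≥0∞} (h : ∀ a, f a ≤ g a) : expect p f ≤ expect p g :=
  ENNReal.tsum_le_tsum fun a => mul_le_mul_right (h a) _

theorem expect_sum (p : PMF α) {ι : Type} (S : Finset ι) (f : ι → α → ℝ≥0∞) :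
    (expect p fun a => ∑ i ∈ S, f i a) = ∑ i ∈ S, expect p (f i) := by
  classical
  induction S using Finset.induction_on with
  | empty => simp [expect]
  | insert i S hi ih => simp only [Finset.sum_insert hi, expect_add, ih]

theorem pr_eq_expect (p : PMF α) (g : α → PMF β) (E : β → Prop) :
    pr (p.bind g) E = expect p fun a => pr (g a) E := pr_bind p g E

theorem expect_independent_succ {h : ℕ} (p : Fin (h + 1) → PMF α) (f : (Fin (h + 1) → α) → ℝ≥0∞) :
    expect (independent (h + 1) p) f =
      expect (p 0) fun a => expect (independent h fun i => p i.succ) fun g => f (Fin.cons a g) := by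
  rw [independent, expect_bind]
  simp only [expect_bind, expect_pure]

theorem independent_map {h : ℕ} (p : Fin h → PMF α) (g : α → β) :
    independent h (fun i => (p i).map g) = (independent h p).map fun f i => g (f i) := by
  induction h with
  | zero =>
    rw [independent, independent, PMF.pure_map]
    congr 1
    exact Subsingleton.elim _ _
  | succ h ih =>
    rw [independent, independent, ih, PMF.map_bind, PMF.bind_map]
    congr 1
    funext a
    rw [Function.comp, PMF.map_bind, PMF.bind_map]
    congr 1
    funext f
    rw [Function.comp, PMF.pure_map]
    congr 1
    funext i
    induction i using Fin.cases <;> rfl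

/-- Coordinate j of the sample is overwritten by a fresh one, so its distribution in p' is
irrelevant. With the other coordinates fixed, two hybrids differ in one draw only. -/
theorem expect_independent_resample {h : ℕ} {p p' : Fin h → PMF α} (j : Fin h)
    (hp : ∀ i, i ≠ j → p i = p' i) (f : (Fin h → α) → ℝ≥0∞) :
    expect (independent h p) f =
      expect (independent h p') fun ω => expect (p j) fun a => f (Function.update ω j a) := by
  induction h with
  | zero => exact j.elim0
  | succ h ih =>
    rw [expect_independent_succ, expect_independent_succ]
    induction j using Fin.cases with
    | zero =>
      have e : (fun i : Fin h => p i.succ) = fun i => p' i.succ :=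
        funext fun i => hp _ (Fin.succ_ne_zero i)
      simp only [Fin.update_cons_zero]
      rw [expect_const, e, expect_comm]
    | succ j =>
      rw [hp 0 (Fin.succ_ne_zero j).symm]
      congr 1
      funext a
      rw [ih (p := fun i => p i.succ) (p' := fun i => p' i.succ) j fun i hi =>
        hp _ fun h => hi (Fin.succ_injective _ h)]
      simp only [Fin.cons_update]

end

/-! ## Uniform ring elements -/

theorem expect_uniform_equiv (P : RingParams) (σ : P.R ≃ P.R) (f : P.R → ℝ≥0∞) :
    (expect P.uniform fun a => f (σ a)) = expect P.uniform f := by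
  let e : (Fin (2 ^ P.logDeg) → ZMod P.q) ≃ P.R :=
    ⟨Ring2.ofCoeffs, Ring2.coeffs, Ring2.coeffs_ofCoeffs, Ring2.ofCoeffs_coeffs⟩
  have key (f : P.R → ℝ≥0∞) : expect P.uniform f =
      (Fintype.card (Fin (2 ^ P.logDeg) → ZMod P.q) : ℝ≥0∞)⁻¹ * ∑' a, f a := by
    rw [RingParams.uniform, expect_map, expect]
    simp only [PMF.uniformOfFintype_apply]
    rw [ENNReal.tsum_mul_left]
    congr 1
    exact e.tsum_eq f
  rw [key, key]
  congr 1
  exact σ.tsum_eq f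

/-- Used with u = ± t: scaling Ring-LWE samples by t, as the noise of BV requires, leaves uniform
elements uniform. -/
theorem expect_uniform_affine (P : RingParams) {u : P.R} (hu : IsUnit u) (c : P.R) (f : P.R → ℝ≥0∞) :
    (expect P.uniform fun a => f (u * a + c)) = expect P.uniform f := by
  obtain ⟨u, rfl⟩ := hu
  exact expect_uniform_equiv P ((Units.mulLeft u).trans (Equiv.addRight c)) f

/-! ## Hybrid distributions of states -/

section

variable {P : RingParams} {L : ℕ}

/-- A ciphertext from its randomness. -/
def cipher (pk : P.R × P.R) (ω : P.R × P.R × P.R) : P.R × P.R :=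
  (pk.1 * ω.1 + ω.2.1, pk.2 * ω.1 + ω.2.2)

/-- The randomness of an encryption of a message with lift `μ`. -/
def encRand (P : RingParams) (t : ℕ) (μ : P.R) : PMF (P.R × P.R × P.R) :=
  P.noise.bind fun v => P.noise.bind fun e₁ => P.noise.bind fun e₂ =>
    PMF.pure (v, (t : P.R) * e₁ + μ, (t : P.R) * e₂)

/-- The randomness of a pseudo-ciphertext. -/
def unifRand (P : RingParams) : PMF (P.R × P.R × P.R) :=
  P.uniform.bind fun u₁ => P.uniform.bind fun u₂ => PMF.pure (0, u₁, u₂)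

theorem encrypt_eq (t : ℕ) (pk : P.R × P.R) (μ : Ring2 t P.logDeg) :
    BV.encrypt P t pk μ = (encRand P t (Ring2.lift P.q μ)).map (cipher pk) := by
  simp only [BV.encrypt, encRand, PMF.map_bind, PMF.pure_map, cipher, add_assoc]

/-- Taking v = 0 writes a uniform ciphertext in the form of an encryption. In both cases the
randomness does not depend on the public key, so it can be drawn first and held fixed. -/
theorem uniformPair_eq (pk : P.R × P.R) : P.uniformPair = (unifRand P).map (cipher pk) := by
  simp only [RingParams.uniformPair, unifRand, PMF.map_bind, PMF.pure_map, cipher, mul_zero, zero_add]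

/-- The expectation of a function of the state, for a uniform public key and given randomness of the
ciphertexts. -/
def hybrid (θ : Fin L → PMF (P.R × P.R × P.R))
    (F : (P.R × P.R) × (Fin L → P.R × P.R) → ℝ≥0∞) : ℝ≥0∞ :=
  expect (independent L θ) fun ω => expect P.uniform fun a₀ => expect P.uniform fun a₁ =>
    F ((a₀, a₁), fun i => cipher (a₀, a₁) (ω i))

/-- The same for a genuine public key. -/
def genuine (t : ℕ) (θ : Fin L → PMF (P.R × P.R × P.R))
    (F : (P.R × P.R) × (Fin L → P.R × P.R) → ℝ≥0∞) : ℝ≥0∞ :=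
  expect (independent L θ) fun ω => expect (BV.keyGen P t) fun key =>
    F (key.1, fun i => cipher key.1 (ω i))

/-- Replacing samples from Ring-LWE by uniform ones costs at most `ε`. -/
def Reduces (P : RingParams) (L : ℕ) (ε : ℝ≥0∞) (F F' : (P.R × P.R) × (Fin L → P.R × P.R) → ℝ≥0∞) :
    Prop :=
  ∀ M : Rows P L, expect (iid 2 P.uniformPair) (fun y => F (affineState M y)) ≤
    expect (P.rlweSamples 2) (fun y => F' (affineState M y)) + ε

theorem expect_setup (F : (P.R × P.R) × (Fin L → P.R × P.R) → ℝ≥0∞) :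
    (expect P.uniformPair fun pk => expect (iid L P.uniformPair) fun ct => F (pk, ct)) =
      hybrid (fun _ => unifRand P) F := by
  have h (pk : P.R × P.R) : (expect (iid L P.uniformPair) fun ct => F (pk, ct)) =
      expect (independent L fun _ => unifRand P) fun ω => F (pk, fun i => cipher pk (ω i)) := by
    rw [iid, uniformPair_eq pk, independent_map, expect_map]
  simp only [h]
  rw [expect_comm, hybrid]
  simp only [RingParams.uniformPair, expect_bind, expect_pure]

theorem expect_iid_two {α : Type} (p : PMF α) (f : (Fin 2 → α) → ℝ≥0∞) :
    expect (iid 2 p) f = expect p fun a => expect p fun b => f ![a, b] := by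
  rw [iid, expect_independent_succ]
  simp only [expect_independent_succ]
  congr 1
  funext a
  congr 1
  funext b
  rw [independent, expect_pure]
  congr 1

theorem expect_uniform_samples (F : (Fin 2 → P.R × P.R) → ℝ≥0∞) :
    expect (iid 2 P.uniformPair) F = expect P.uniform fun a₀ => expect P.uniform fun b₀ =>
      expect P.uniform fun a₁ => expect P.uniform fun b₁ => F ![(a₀, b₀), (a₁, b₁)] := by
  rw [expect_iid_two]
  simp only [RingParams.uniformPair, expect_bind, expect_pure]

theorem expect_rlwe_samples (F : (Fin 2 → P.R × P.R) → ℝ≥0∞) :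
    expect (P.rlweSamples 2) F = expect P.noise fun s => expect P.uniform fun a₀ =>
      expect P.noise fun e₀ => expect P.uniform fun a₁ => expect P.noise fun e₁ =>
        F ![(a₀, a₀ * s + e₀), (a₁, a₁ * s + e₁)] := by
  rw [RingParams.rlweSamples, expect_bind]
  simp only [expect_iid_two, expect_bind, expect_pure]

/-- With the randomness ω fixed, every ciphertext is affine in the public key, so it suffices to
exchange the public key. From one sample (a, b) form (-t b, t a): for b = a s + e this is the
genuine key -(t a s + t e) with uniform part t a, and for uniform b it is uniform. -/
theorem hybrid_le_genuine {t : ℕ} (ht : IsUnit (t : P.R)) (θ : Fin L → PMF (P.R × P.R × P.R))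
    {ε : ℝ≥0∞} {F F' : (P.R × P.R) × (Fin L → P.R × P.R) → ℝ≥0∞} (h : Reduces P L ε F F') :
    hybrid θ F ≤ genuine t θ F' + ε := by
  have hr (ω : Fin L → P.R × P.R × P.R) :
      (expect P.uniform fun a₀ => expect P.uniform fun a₁ =>
        F ((a₀, a₁), fun i => cipher (a₀, a₁) (ω i))) ≤
      (expect (BV.keyGen P t) fun key => F' (key.1, fun i => cipher key.1 (ω i))) + ε := by
    -- The columns multiply a, b, a', b' and 1. The second sample is not needed, and its expectation
    -- disappears.
    let M : Rows P L := Fin.cons (![0, -(t : P.R), 0, 0, 0], ![(t : P.R), 0, 0, 0, 0]) fun i =>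
      (![0, -((t : P.R) * (ω i).1), 0, 0, (ω i).2.1], ![(t : P.R) * (ω i).1, 0, 0, 0, (ω i).2.2])
    have hM (a b a' b' : P.R) : affineState M ![(a, b), (a', b')] =
        ((-((t : P.R) * b), (t : P.R) * a), fun i => cipher (-((t : P.R) * b), (t : P.R) * a) (ω i)) := by
      refine Prod.ext (Prod.ext ?_ ?_) (funext fun i => Prod.ext ?_ ?_) <;>
        simp [affineState, affinePair, affine, M, cipher] <;> ring
    have h1 := h M
    simp only [expect_uniform_samples, expect_rlwe_samples, hM, expect_const] at h1
    have e1 : (expect P.uniform fun a₀ => expect P.uniform fun b₀ =>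
        F ((-((t : P.R) * b₀), (t : P.R) * a₀), fun i =>
          cipher (-((t : P.R) * b₀), (t : P.R) * a₀) (ω i))) =
        expect P.uniform fun a₀ => expect P.uniform fun a₁ =>
          F ((a₀, a₁), fun i => cipher (a₀, a₁) (ω i)) := by
      have h2 := fun a₁ : P.R => expect_uniform_affine P ht.neg 0 fun a₀ =>
        F ((a₀, a₁), fun i => cipher (a₀, a₁) (ω i))
      simp only [add_zero, neg_mul] at h2
      have h3 := expect_uniform_affine P ht 0 fun a₁ => expect P.uniform fun a₀ =>
        F ((a₀, a₁), fun i => cipher (a₀, a₁) (ω i))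
      simp only [add_zero] at h3
      simp only [h2]
      rw [h3, expect_comm]
    have e2 : (expect P.noise fun s => expect P.uniform fun a₀ => expect P.noise fun e₀ =>
        F' ((-((t : P.R) * (a₀ * s + e₀)), (t : P.R) * a₀), fun i =>
          cipher (-((t : P.R) * (a₀ * s + e₀)), (t : P.R) * a₀) (ω i))) =
        expect (BV.keyGen P t) fun key => F' (key.1, fun i => cipher key.1 (ω i)) := by
      simp only [BV.keyGen, expect_bind, expect_pure]
      congr 1
      funext s
      have h2 := expect_uniform_affine P ht 0 fun a => expect P.noise fun e =>
        F' ((-(a * s + (t : P.R) * e), a), fun i => cipher (-(a * s + (t : P.R) * e), a) (ω i))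
      rw [← h2]
      simp only [add_zero, mul_add, mul_assoc]
    rwa [e1, e2] at h1
  calc hybrid θ F ≤ expect (independent L θ) fun ω =>
        (expect (BV.keyGen P t) fun key => F' (key.1, fun i => cipher key.1 (ω i))) + ε :=
        expect_mono _ hr
    _ = _ := by rw [expect_add, expect_const]; rfl

/-- Two samples with common secret v serve as the two halves of an encryption: with public key (t a,
t a'), the pair (t b + μ, t b') encrypts μ if b = a v + e and b' = a' v + e', and is uniform if b
and b' are. The other ciphertexts are affine in the public key. Here it matters that the secret of
Ring-LWE has the noise distribution, as the randomness v of an encryption does. -/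
theorem hybrid_step {t : ℕ} (ht : IsUnit (t : P.R)) {θ θ' : Fin L → PMF (P.R × P.R × P.R)} (j : Fin L)
    {μ : P.R} (hθ : ∀ i, i ≠ j → θ i = θ' i) (hj : θ j = unifRand P) (hj' : θ' j = encRand P t μ)
    {ε : ℝ≥0∞} {F F' : (P.R × P.R) × (Fin L → P.R × P.R) → ℝ≥0∞} (h : Reduces P L ε F F') :
    hybrid θ F ≤ hybrid θ' F' + ε := by
  classical
  have hr (ω : Fin L → P.R × P.R × P.R) :
      (expect (unifRand P) fun a => expect P.uniform fun a₀ => expect P.uniform fun a₁ =>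
        F ((a₀, a₁), fun i => cipher (a₀, a₁) (Function.update ω j a i))) ≤
      (expect (encRand P t μ) fun a => expect P.uniform fun a₀ => expect P.uniform fun a₁ =>
        F' ((a₀, a₁), fun i => cipher (a₀, a₁) (Function.update ω j a i))) + ε := by
    -- Row j uses b and b' directly; the rows i ≠ j encrypt under (t a, t a') with the fixed
    -- randomness ω i.
    let M : Rows P L := Fin.cons (![(t : P.R), 0, 0, 0, 0], ![0, 0, (t : P.R), 0, 0]) fun i =>
      if i = j then (![0, (t : P.R), 0, 0, μ], ![0, 0, 0, (t : P.R), 0]) else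
      (![(t : P.R) * (ω i).1, 0, 0, 0, (ω i).2.1], ![0, 0, (t : P.R) * (ω i).1, 0, (ω i).2.2])
    have hM (a b a' b' : P.R) : affineState M ![(a, b), (a', b')] =
        (((t : P.R) * a, (t : P.R) * a'), fun i => cipher ((t : P.R) * a, (t : P.R) * a')
          (Function.update ω j (0, (t : P.R) * b + μ, (t : P.R) * b' + 0) i)) := by
      refine Prod.ext (Prod.ext ?_ ?_) (funext fun i => ?_)
      · simp [affineState, affinePair, affine, M]
      · simp [affineState, affinePair, affine, M]
      · by_cases hi : i = j
        · subst hi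
          refine Prod.ext ?_ ?_ <;> simp [affineState, affinePair, affine, M, cipher]
        · refine Prod.ext ?_ ?_ <;> simp [affineState, affinePair, affine, M, cipher, hi] <;> ring
    have hM' (a s e a' e' : P.R) : affineState M ![(a, a * s + e), (a', a' * s + e')] =
        (((t : P.R) * a, (t : P.R) * a'), fun i => cipher ((t : P.R) * a, (t : P.R) * a')
          (Function.update ω j (s, (t : P.R) * e + μ, (t : P.R) * e') i)) := by
      rw [hM]
      refine Prod.ext rfl (funext fun i => ?_)
      by_cases hi : i = j
      · subst hi
        refine Prod.ext ?_ ?_ <;> simp [cipher] <;> ring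
      · simp [hi]
    have h1 := h M
    simp only [expect_uniform_samples, expect_rlwe_samples, hM'] at h1
    simp only [hM] at h1
    set G : P.R → P.R → P.R × P.R × P.R → ℝ≥0∞ := fun a₀ a₁ a =>
      F ((a₀, a₁), fun i => cipher (a₀, a₁) (Function.update ω j a i)) with hG
    set G' : P.R → P.R → P.R × P.R × P.R → ℝ≥0∞ := fun a₀ a₁ a =>
      F' ((a₀, a₁), fun i => cipher (a₀, a₁) (Function.update ω j a i)) with hG'
    have e1 : (expect P.uniform fun a₀ => expect P.uniform fun b₀ => expect P.uniform fun a₁ =>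
        expect P.uniform fun b₁ => G ((t : P.R) * a₀) ((t : P.R) * a₁)
          (0, (t : P.R) * b₀ + μ, (t : P.R) * b₁ + 0)) =
        expect (unifRand P) fun a => expect P.uniform fun a₀ => expect P.uniform fun a₁ => G a₀ a₁ a := by
      have f1 := fun a₀ a₁ b₀ : P.R => expect_uniform_affine P ht 0 fun b₁ => G a₀ a₁ (0, b₀, b₁)
      have f2 := fun a₀ b₀ : P.R => expect_uniform_affine P ht 0 fun a₁ => expect P.uniform fun b₁ =>
        G a₀ a₁ (0, b₀, b₁)
      have f3 := fun a₀ : P.R => expect_uniform_affine P ht μ fun b₀ => expect P.uniform fun a₁ =>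
        expect P.uniform fun b₁ => G a₀ a₁ (0, b₀, b₁)
      have f4 := expect_uniform_affine P ht 0 fun a₀ => expect P.uniform fun b₀ =>
        expect P.uniform fun a₁ => expect P.uniform fun b₁ => G a₀ a₁ (0, b₀, b₁)
      simp only [add_zero] at f1 f2 f4
      simp only [add_zero, f1, f2, f3, f4]
      simp only [unifRand, expect_bind, expect_pure]
      rw [expect_comm]
      congr 1
      funext b₀
      rw [expect_comm P.uniform P.uniform fun b₁ a₀ => expect P.uniform fun a₁ => G a₀ a₁ (0, b₀, b₁)]
      congr 1
      funext a₀
      rw [expect_comm]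
    have e2 : (expect P.noise fun s => expect P.uniform fun a₀ => expect P.noise fun e₀ =>
        expect P.uniform fun a₁ => expect P.noise fun e₁ => G' ((t : P.R) * a₀) ((t : P.R) * a₁)
          (s, (t : P.R) * e₀ + μ, (t : P.R) * e₁)) =
        expect (encRand P t μ) fun a => expect P.uniform fun a₀ => expect P.uniform fun a₁ =>
          G' a₀ a₁ a := by
      have f2 := fun a₀ s e₀ : P.R => expect_uniform_affine P ht 0 fun a₁ => expect P.noise fun e₁ =>
        G' a₀ a₁ (s, (t : P.R) * e₀ + μ, (t : P.R) * e₁)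
      have f4 := fun s : P.R => expect_uniform_affine P ht 0 fun a₀ => expect P.noise fun e₀ =>
        expect P.uniform fun a₁ => expect P.noise fun e₁ =>
          G' a₀ a₁ (s, (t : P.R) * e₀ + μ, (t : P.R) * e₁)
      simp only [add_zero] at f2 f4
      simp only [f2, f4]
      simp only [encRand, expect_bind, expect_pure]
      congr 1
      funext s
      rw [expect_comm]
      congr 1
      funext e₀
      rw [expect_comm P.noise P.uniform fun e₁ a₀ => expect P.uniform fun a₁ =>
        G' a₀ a₁ (s, (t : P.R) * e₀ + μ, (t : P.R) * e₁)]
      congr 1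
      funext a₀
      rw [expect_comm]
    rwa [e1, e2] at h1
  have h₂ := expect_independent_resample (p := θ') (p' := θ') j (fun _ _ => rfl) fun ω =>
    expect P.uniform fun a₀ => expect P.uniform fun a₁ => F' ((a₀, a₁), fun i => cipher (a₀, a₁) (ω i))
  rw [hybrid, hybrid, expect_independent_resample j hθ, h₂, hj, hj']
  refine (expect_mono _ hr).trans ?_
  rw [expect_add, expect_const]

end

/-! ## From wrong answers to collisions -/

theorem prob_eq (E : PMF Prop) : prob E = (pr E fun p => p).toReal := by
  have : {p : Prop | p} = {True} := by ext p; simp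
  rw [prob, pr, this, PMF.toOuterMeasure_apply_singleton]

theorem expect_le_one {α : Type} (p : PMF α) {f : α → ℝ≥0∞} (h : ∀ a, f a ≤ 1) : expect p f ≤ 1 :=
  (expect_mono p h).trans (expect_const p 1).le

/-- A function with values at most 1 that vanishes off the event is bounded by its indicator. -/
theorem expect_le_pr {α : Type} (p : PMF α) {f : α → ℝ≥0∞} {E : α → Prop} (h1 : ∀ a, f a ≤ 1)
    (h0 : ∀ a, ¬E a → f a = 0) : expect p f ≤ pr p E := by
  rw [pr, PMF.toOuterMeasure_apply]
  refine ENNReal.tsum_le_tsum fun a => ?_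
  by_cases ha : E a
  · rw [Set.indicator_of_mem (by exact ha)]
    simpa using mul_le_mul_right (h1 a) (p a)
  · rw [h0 a ha, mul_zero]
    exact zero_le

section

variable {k N : ℕ → ℕ} (A : RelaxedRecovery k N)

/-- If the reconstruction equals y, the answer is correct. If it does not, y is not sparse and ⊥ is
right, so that an error requires the hash check to pass although some coordinate differs. -/
theorem exists_collides_of_ne {n T : ℕ} {P : RingParams} (ζ : (chunkedProtocol A P n T).State)
    {x : Fin T → Fin n → ℤ} (hx : ValidData (N n) x)
    (h : (chunkedProtocol A P n T).coordinator ζ (fun i => (chunkedProtocol A P n T).server ζ (x i)) ≠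
      sparseRecovery (k n) (∑ t, x t)) : ∃ m, Collides A ζ.2 m (∑ t, x t) := by
  classical
  have hbox : InBox (N n) (∑ t, x t) := hx Finset.univ
  have hout : (chunkedProtocol A P n T).coordinator ζ (fun i => (chunkedProtocol A P n T).server ζ (x i)) =
      if sparsity (A.report n ((A.Φ n).apply (∑ t, x t))) ≤ k n ∧
        chunkedHash P ζ.2 (A.report n ((A.Φ n).apply (∑ t, x t))) = chunkedHash P ζ.2 (∑ t, x t)
      then some (A.report n ((A.Φ n).apply (∑ t, x t))) else none := by
    simp only [chunkedProtocol]
    rw [← chunkedHash_sum, ← Measurement.apply_sum]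
  rw [hout, sparseRecovery] at h
  have hs := A.report_sparse n _ hbox
  unfold Collides
  set y := ∑ t, x t
  set x' := A.report n ((A.Φ n).apply y)
  by_cases hxy : x' = y
  · rw [hxy] at h
    simp at h
  · by_cases hc : sparsity x' ≤ k n ∧ chunkedHash P ζ.2 x' = chunkedHash P ζ.2 y
    · obtain ⟨m, hm⟩ := Function.ne_iff.1 hxy
      exact ⟨m, hc.2, hm⟩
    · rw [if_neg hc, if_neg fun h => hxy (hs h)] at h
      exact absurd rfl h

variable (D : Adversary)

/-- The probability, over the random bits, that a collision at `m` is found. -/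
def findProb (P : RingParams) (n T m τ : ℕ)
    (ζ : (P.R × P.R) × (Fin (addrBits n) → P.R × P.R)) : ℝ≥0∞ :=
  pr (D.coinDist n) fun ρ => Finds A D P (n := n) (T := T) m τ ζ (Val.bitString ρ)

/-- Time for finding a collision. -/
def findTime (s r n T : ℕ) : ℕ := D.time n + A.reportTime n + A.measureTime n + collisionCost s r n T

/-- A wrong answer gives a collision at some m, which the finder for this m detects within the
stated time. The union bound replaces a guess of m. -/
theorem pr_experiment_le {s n T : ℕ} {P : RingParams} (h : FitsProtocol s P n (k n) (N n))
    (hT : T * N n < 2 ^ s) :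
    pr ((chunkedProtocol A P n T).experiment (sparseRecovery (k n)) (N n) D) (fun p => p) ≤
      ∑ m : Fin n, hybrid (fun _ => unifRand P)
        (findProb A D P n T m (findTime A D s P.logDeg n T)) := by
  have h1 : pr ((chunkedProtocol A P n T).experiment (sparseRecovery (k n)) (N n) D) (fun p => p) ≤
      expect (chunkedProtocol A P n T).setup fun ζ => ∑ m : Fin n,
        findProb A D P n T m (findTime A D s P.logDeg n T) ζ := by
    rw [DistProt.experiment, pr_eq_expect]
    refine expect_mono _ fun ζ => ?_
    rw [pr_map]
    refine (pr_mono _ fun ρ hρ => ?_).trans (pr_exists_le _ _)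
    obtain ⟨x, hout, hx, hne⟩ := hρ
    obtain ⟨m, hm⟩ := exists_collides_of_ne A ζ hx hne
    exact ⟨m, runs_collisionProg A D h hT ζ m _ x hx hout.runs hm⟩
  refine h1.trans (le_of_eq ((expect_sum _ _ _).trans (Finset.sum_congr rfl fun m _ => ?_)))
  refine Eq.trans ?_ (expect_setup (P := P) (findProb A D P n T m (findTime A D s P.logDeg n T)))
  simp only [chunkedProtocol, expect_bind, expect_pure]

/-- The randomness of the ciphertexts of which the first `j` are pseudo-ciphertexts. -/
def hybridRand (P : RingParams) (t n m j : ℕ) (i : Fin (addrBits n)) : PMF (P.R × P.R × P.R) :=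
  if (i : ℕ) < j then unifRand P else
    encRand P t (Ring2.lift P.q (if digit n m i then 1 else 0 : Ring2 t P.logDeg))

/-- Ciphertexts are exchanged from the last to the first, then the public key: one more step than
there are ciphertexts. `F i` changes along the way because the time limit does. -/
theorem hybrid_unif_le {P : RingParams} {t n m : ℕ} (ht : IsUnit (t : P.R)) {ε : ℝ≥0∞}
    (F : ℕ → (P.R × P.R) × (Fin (addrBits n) → P.R × P.R) → ℝ≥0∞)
    (h : ∀ i ≤ addrBits n, Reduces P (addrBits n) ε (F i) (F (i + 1))) :
    hybrid (fun _ => unifRand P) (F 0) ≤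
      genuine t (hybridRand P t n m 0) (F (addrBits n + 1)) + (addrBits n + 1) * ε := by
  have key : ∀ i ≤ addrBits n, hybrid (fun _ => unifRand P) (F 0) ≤
      hybrid (hybridRand P t n m (addrBits n - i)) (F i) + i * ε := by
    intro i
    induction i with
    | zero =>
      intro _
      have e : hybridRand P t n m (addrBits n - 0) = fun _ => unifRand P :=
        funext fun i => if_pos (by simp)
      rw [e]
      simp
    | succ i ih =>
      intro hi
      refine (ih (by omega)).trans ?_
      have hs := hybrid_step ht (θ := hybridRand P t n m (addrBits n - i))
        (θ' := hybridRand P t n m (addrBits n - (i + 1))) ⟨addrBits n - (i + 1), by omega⟩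
        (fun j hj => by
          have : (j : ℕ) ≠ addrBits n - (i + 1) := fun h => hj (Fin.ext h)
          by_cases hc : (j : ℕ) < addrBits n - i
          · exact (if_pos hc).trans (if_pos (by omega)).symm
          · exact (if_neg hc).trans (if_neg (by omega)).symm)
        (if_pos (by simp only; omega)) (if_neg (by simp)) (h i (by omega))
      refine (add_le_add_left hs _).trans (le_of_eq ?_)
      push_cast
      ring
  refine (key _ le_rfl).trans ?_
  rw [Nat.sub_self]
  refine (add_le_add_left (hybrid_le_genuine ht _ (h _ le_rfl)) _).trans (le_of_eq ?_)
  ring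

/-- If decryption at m is correct for all vectors of the box, no collision at m exists. The finder,
being sound, then has success probability 0, regardless of its running time and of the adversary
having seen all of the state. -/
theorem genuine_le {s n T t : ℕ} {P : RingParams} (h : FitsProtocol s P n (k n) (N n)) (m : Fin n) (τ : ℕ) :
    genuine t (hybridRand P t n m 0) (findProb A D P n T m τ) ≤
      pr (encryptedCoordinate P t n m) fun key => ¬DecryptsAt P t (N n) n m key := by
  unfold genuine
  rw [expect_comm, encryptedCoordinate, pr_eq_expect]
  refine expect_mono _ fun key => ?_
  rw [pr_map]
  have e : (independent (addrBits n) fun i => BV.encrypt P t key.1 (if digit n m i then 1 else 0)) =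
      (independent (addrBits n) (hybridRand P t n m 0)).map fun ω i => cipher key.1 (ω i) := by
    rw [← independent_map]
    congr 1
    funext i
    rw [encrypt_eq]
    exact congrArg (PMF.map (cipher key.1)) (if_neg (Nat.not_lt_zero _)).symm
  rw [e, pr_map]
  refine expect_le_pr _ (fun ω => pr_le_one _ _) fun ω hω => ?_
  have hω := not_not.1 hω
  refine le_antisymm ((pr_mono _ fun ρ hρ => ?_).trans (le_of_eq (?_ : pr _ (fun _ => False) = 0)))
    zero_le
  · obtain ⟨c, -, he⟩ := hρ
    obtain ⟨y, hy, hc, hne⟩ := exists_collides A D h _ m _ he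
    exact (hω.2 _ y (A.report_inBox n y hy) hy hne).2 hc
  · simp [pr]

/-- Finding within τ implies acceptance by the distinguisher within τ plus the cost of the state,
and this implies finding within the larger limit. Hence the two different limits. -/
theorem reduces_findProb {s n T : ℕ} {P : RingParams} (h : FitsWord s P.q P.logDeg) {m τ : ℕ}
    {ε : ℝ≥0∞} (hM : ∀ M : Rows P (addrBits n),
      (expect (iid 2 P.uniformPair) fun y => pr (D.coinDist n) fun ρ => Runs (distinguisherProg A D)
        (distinguisherInput A D P n m M (Val.bitString ρ) y) (.nat 1)
        (τ + affineCost s P.logDeg (addrBits n))) ≤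
      (expect (P.rlweSamples 2) fun y => pr (D.coinDist n) fun ρ => Runs (distinguisherProg A D)
        (distinguisherInput A D P n m M (Val.bitString ρ) y) (.nat 1)
        (τ + affineCost s P.logDeg (addrBits n))) + ε) :
    Reduces P (addrBits n) ε (findProb A D P n T m τ)
      (findProb A D P n T m (τ + affineCost s P.logDeg (addrBits n))) := by
  intro M
  refine le_trans (expect_mono _ fun y => ?_) ((hM M).trans (add_le_add_left (expect_mono _ fun y => ?_) _))
  · exact pr_mono _ fun ρ hρ => Finds.distinguisher A D h hρ
  · exact pr_mono _ fun ρ hρ => finds_of_distinguisher A D T h hρ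

end

/-! ## Resources of the distinguisher -/

theorem size_treeOf_lt {q d : ℕ} {f : ℕ → ℕ} (hf : ∀ i, f i < q) :
    (treeOf d f).size < 2 ^ d * (2 * q.size + 3) := by
  induction d generalizing f with
  | zero =>
    have := Nat.size_le_size (hf 0).le
    rw [treeOf, Val.size_nat]
    omega
  | succ d ih =>
    have h1 := ih (f := fun i => f (2 * i)) fun i => hf _
    have h2 := ih (f := fun i => f (2 * i + 1)) fun i => hf _
    rw [treeOf, Val.size_pair, pow_succ]
    have e : 2 ^ d * 2 * (2 * q.size + 3) = 2 ^ d * (2 * q.size + 3) + 2 ^ d * (2 * q.size + 3) := by ring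
    omega

theorem size_coeffTrees_le {q r : ℕ} [NeZero q] (c : Fin 5 → Ring2 q r) :
    (coeffTrees c).size ≤ 5 * (2 ^ r * (2 * q.size + 3) + 1) + 2 := by
  have h (i) : (c i).tree.size < 2 ^ r * (2 * q.size + 3) := size_treeOf_lt (Ring2.natCoeff_lt _)
  refine (Val.size_list_le fun v hv => ?_).trans le_rfl
  simp only [List.mem_cons, List.not_mem_nil, or_false] at hv
  rcases hv with rfl | rfl | rfl | rfl | rfl <;> exact (h _).le

section

variable {k N : ℕ → ℕ} (A : RelaxedRecovery k N) (D : Adversary)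

/-- A bound for the size of the advice. -/
def adviceBound (L b n aD aA N : ℕ) : ℕ :=
  ((L + 1) * (2 * (5 * (2 ^ L * (2 * b + 3) + 1) + 2) + 1 + 1) + 2) +
    (aD + aA + 5 * (2 * (n + L + b + N) + 2) + (n * (5 + 1) + 2) + 10) + 1

theorem size_advice_le {P : RingParams} {n m : ℕ} (hr : P.logDeg ≤ addrBits n) (hm : m ≤ n)
    (M : Rows P (addrBits n)) :
    (Val.pair (rowsVal M) (collisionAdvice A D P n m)).size ≤
      adviceBound (addrBits n) P.q.size n (D.advice n).size (A.descr n).size (N n) := by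
  have h1 : (rowsVal M).size ≤ (addrBits n + 1) *
      (2 * (5 * (2 ^ addrBits n * (2 * P.q.size + 3) + 1) + 2) + 1 + 1) + 2 := by
    refine Val.size_list_ofFn_le fun i => ?_
    have h2 := size_coeffTrees_le (M i).1
    have h3 := size_coeffTrees_le (M i).2
    have h4 : 2 ^ P.logDeg * (2 * P.q.size + 3) ≤ 2 ^ addrBits n * (2 * P.q.size + 3) :=
      Nat.mul_le_mul_right _ (Nat.pow_le_pow_right (by norm_num) hr)
    rw [Val.size_pair]
    omega
  have h5 : (partsVal (fun _ : Fin n => 0) (fun _ => 0)).size ≤ n * (5 + 1) + 2 :=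
    Val.size_list_ofFn_le fun i => by rw [Val.size_pair, Val.size_nat]; simp
  have hsz (a : ℕ) : a.size ≤ a := Nat.size_le.2 Nat.lt_two_pow_self
  have hn := hsz n
  have hm' := hsz m
  have hN := hsz (N n)
  have hr' := hsz P.logDeg
  rw [Val.size_pair]
  refine Nat.add_le_add_right (Nat.add_le_add h1 ?_) 1
  simp only [collisionAdvice, Val.list_cons, Val.list_nil, Val.size_pair, Val.size_nat, Nat.size_zero]
  omega

end

section

variable {k N T : ℕ → ℕ} {P : ℕ → RingParams} (A : RelaxedRecovery k N) (D : Adversary)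

theorem growsLike_ringCost {s : ℕ → ℕ} (hr : ∀ n, (P n).logDeg ≤ addrBits n) (hs : Polylog s) :
    GrowsLike (fun n => n) fun n => ringCost (s n) (P n).logDeg := by
  refine (polyBounded_two_pow_addrBits.mul (polylog_coeffCost hs).growsLike).of_le fun n => ?_
  refine (ringCost_le (hr n)).trans ?_
  exact Nat.mul_le_mul_right _ (Nat.pow_le_pow_right (by norm_num) (hr n))

theorem growsLike_hashCost {s : ℕ → ℕ} (hr : ∀ n, (P n).logDeg ≤ addrBits n) (hs : Polylog s) :
    GrowsLike (fun n => n) fun n => hashCost (s n) (P n).logDeg (addrBits n) := by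
  refine ((GrowsLike.const 60).mul ((polylog_addrBits.growsLike.add (.const 1)).mul
    (polyBounded_two_pow_addrBits.mul (growsLike_ringCost hr hs)))).of_le fun n => ?_
  unfold hashCost
  gcongr
  · norm_num
  · omega

theorem growsLike_findTime {s : ℕ → ℕ} (hr : ∀ n, (P n).logDeg ≤ addrBits n) (hs : Polylog s)
    (hT : PolyBounded T) :
    GrowsLike (fun n => n) fun n => findTime A D (s n) (P n).logDeg n (T n) := by
  have hD := polyBounded_iff.1 D.time_poly
  have h1 := polyBounded_iff.1 A.reportTime_poly
  have h2 := polyBounded_iff.1 A.measureTime_poly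
  have h3 := polyBounded_iff.1 hT
  have ho := (polylog_opCost hs).growsLike
  have hh := growsLike_hashCost hr hs
  have hL := polylog_addrBits.growsLike
  have hid : GrowsLike (fun n => n) fun n => n := GrowsLike.self
  have hcheck : GrowsLike (fun n => n) fun n => checkCost (s n) (P n).logDeg n :=
    ((hh.add ((hid.add (.const 2)).mul ((GrowsLike.const 200).mul ho))).add
      ((hL.add (.const 2)).mul ((GrowsLike.const 2).mul (growsLike_ringCost hr hs)))).add (.const 300)
  exact ((hD.add h1).add h2).add
    ((((((h3.add (.const 1)).mul ((hid.add (.const 1)).mul ((GrowsLike.const 100).mul ho))).add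
      ((hid.add (.const 1)).mul ((GrowsLike.const 200).mul ho))).add hcheck).add hh).add (.const 300))

theorem growsLike_affineCost {s : ℕ → ℕ} (hr : ∀ n, (P n).logDeg ≤ addrBits n) (hs : Polylog s) :
    GrowsLike (fun n => n) fun n => affineCost (s n) (P n).logDeg (addrBits n) :=
  ((polylog_addrBits.growsLike.add (.const 3)).mul
    ((GrowsLike.const 30).mul (growsLike_ringCost hr hs))).add (.const 100)

theorem growsLike_adviceBound (hN : PolyBounded N) (hq : Polylog fun n => (P n).q.size) :
    GrowsLike (fun n => n) fun n => adviceBound (addrBits n) (P n).q.size n (D.advice n).size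
      (A.descr n).size (N n) := by
  have hL := polylog_addrBits.growsLike
  have hb := hq.growsLike
  have h2 := GrowsLike.const (u := fun n => n) 2
  have h5 := GrowsLike.const (u := fun n => n) 5
  have h1 := GrowsLike.const (u := fun n => n) 1
  have hid : GrowsLike (fun n => n) fun n => n := GrowsLike.self
  have hD := polyBounded_iff.1 D.advice_poly
  have hA := polyBounded_iff.1 A.descr_poly
  have hN' := polyBounded_iff.1 hN
  exact ((((hL.add h1).mul (((h2.mul ((h5.mul ((polyBounded_two_pow_addrBits.mul
    ((h2.mul hb).add (.const 3))).add h1)).add h2)).add h1).add h1)).add h2).add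
    ((((hD.add hA).add (h5.mul ((h2.mul (((hid.add hL).add hb).add hN')).add h2))).add
      ((hid.mul (h5.add h1)).add h2)).add (.const 10))).add h1

/-! ## Robustness -/

/-- Finiteness is used only to choose the best coefficients as advice. -/
instance (q r : ℕ) [NeZero q] : Finite (Ring2 q r) :=
  Finite.of_injective _ Ring2.coeffs_injective

theorem le_add_ofReal {a b : ℝ≥0∞} {δ : ℝ} (ha : a ≤ 1) (hb : b ≤ 1) (h : |b.toReal - a.toReal| ≤ δ) :
    a ≤ b + ENNReal.ofReal δ := by
  have ha' := ne_top_of_le_ne_top ENNReal.one_ne_top ha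
  have hb' := ne_top_of_le_ne_top ENNReal.one_ne_top hb
  rw [← ENNReal.ofReal_toReal ha', ← ENNReal.ofReal_toReal hb',
    ← ENNReal.ofReal_add ENNReal.toReal_nonneg ((abs_nonneg _).trans h)]
  refine ENNReal.ofReal_le_ofReal ?_
  have := (abs_le.1 h).1
  linarith

/-- Ring-LWE bounds the advantage of all distinguishers for choices of coefficients, coordinate and
time limit. -/
theorem exists_advantage_bound {s : ℕ → ℕ} (hN : PolyBounded N) (hT : PolyBounded T)
    (hr : ∀ n, (P n).logDeg ≤ addrBits n) (hq : Polylog fun n => (P n).q.size) (hs : Polylog s)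
    (hard : RingLWEHard P) :
    ∃ δ : ℕ → ℝ, Negligible δ ∧ (∀ n, 0 ≤ δ n) ∧ ∀ (n : ℕ) (m : Fin n) (i : ℕ), i ≤ addrBits n →
      ∀ M : Rows (P n) (addrBits n), ∀ τ, τ = findTime A D (s n) (P n).logDeg n (T n) +
        (i + 1) * affineCost (s n) (P n).logDeg (addrBits n) →
      (expect (iid 2 (P n).uniformPair) fun y => pr (D.coinDist n) fun ρ => Runs (distinguisherProg A D)
        (distinguisherInput A D (P n) n m M (Val.bitString ρ) y) (.nat 1) τ) ≤
      (expect ((P n).rlweSamples 2) fun y => pr (D.coinDist n) fun ρ => Runs (distinguisherProg A D)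
        (distinguisherInput A D (P n) n m M (Val.bitString ρ) y) (.nat 1) τ) + ENNReal.ofReal (δ n) := by
  let time (n i : ℕ) : ℕ := findTime A D (s n) (P n).logDeg n (T n) +
    (i + 1) * affineCost (s n) (P n).logDeg (addrBits n)
  -- `Fin (n + 1)` in place of `Fin n` keeps the index set nonempty at n = 0.
  let I (n : ℕ) : Type := Rows (P n) (addrBits n) × Fin (n + 1) × Fin (addrBits n + 1)
  have hne (n : ℕ) : Nonempty (I n) := ⟨fun _ => (fun _ => 0, fun _ => 0), 0, 0⟩
  have hfin (n : ℕ) : Finite (I n) := inferInstance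
  let acc (n : ℕ) (ι : I n) (d : PMF (Fin 2 → (P n).R × (P n).R)) : ℝ≥0∞ :=
    expect d fun y => pr (D.coinDist n) fun ρ => Runs (distinguisherProg A D)
      (distinguisherInput A D (P n) n ι.2.1 ι.1 (Val.bitString ρ) y) (.nat 1) (time n ι.2.2)
  let adv (n : ℕ) (ι : I n) : ℝ :=
    |(acc n ι ((P n).rlweSamples 2)).toReal - (acc n ι (iid 2 (P n).uniformPair)).toReal|
  -- For each n the coefficients, the coordinate and the time limit of largest advantage are
  -- selected. Non-uniformity makes this choice one distinguisher, whose advantage bounds all the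
  -- others.
  have hmax (n : ℕ) : ∃ ι : I n, ∀ ι', adv n ι' ≤ adv n ι :=
    have := hne n
    have := hfin n
    Finite.exists_max _
  choose best hbest using hmax
  have htime : GrowsLike (fun n => n) fun n => time n (best n).2.2 := by
    refine ((growsLike_findTime A D hr hs hT).add ((polylog_addrBits.growsLike.add (.const 1)).mul
      (growsLike_affineCost hr hs))).of_le fun n => ?_
    have := (best n).2.2.isLt
    exact Nat.add_le_add_left (Nat.mul_le_mul_right _ (by omega)) _
  let D' : Adversary :=
    { prog := distinguisherProg A D
      advice := fun n => .pair (rowsVal (best n).1) (collisionAdvice A D (P n) n (best n).2.1)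
      coins := D.coins
      time := fun n => time n (best n).2.2
      advice_poly := polyBounded_iff.2 ((growsLike_adviceBound A D hN hq).of_le fun n =>
        size_advice_le A D (hr n) (by have := (best n).2.1.isLt; omega) _)
      coins_poly := D.coins_poly
      time_poly := polyBounded_iff.2 htime }
  have hacc (n : ℕ) (d : PMF (Fin 2 → (P n).R × (P n).R)) :
      prob (acceptExperiment (P n) D' n 2 d) = (acc n (best n) d).toReal := by
    rw [prob_eq, acceptExperiment, pr_eq_expect]
    congr 2
    funext y
    rw [pr_map]
    refine pr_congr _ fun ρ => ⟨fun h => Prog.RunsIn.runs h, fun h => Runs.runsIn h le_rfl⟩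
  have hneg := hard (fun _ => 2) ⟨2, fun n => Nat.le_add_left _ _⟩ D'
  simp only [hacc] at hneg
  refine ⟨fun n => adv n (best n), hneg, fun n => abs_nonneg _, fun n m i hi M τ hτ => ?_⟩
  subst hτ
  refine le_add_ofReal (expect_le_one _ fun _ => pr_le_one _ _) (expect_le_one _ fun _ => pr_le_one _ _) ?_
  exact hbest n (M, ⟨m, by have := m.isLt; omega⟩, ⟨i, by omega⟩)

/-- A positive integer below the prime q is invertible modulo q, hence in the ring. -/
theorem isUnit_natCast {P : RingParams} {t : ℕ} (h0 : 0 < t) (h : t < P.q) : IsUnit (t : P.R) := by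
  have : Fact P.q.Prime := ⟨P.q_prime⟩
  have h1 : (t : ZMod P.q) ≠ 0 := by
    rw [Ne, ZMod.natCast_eq_zero_iff]
    exact fun hd => absurd (Nat.le_of_dvd h0 hd) (by omega)
  have h2 := (isUnit_iff_ne_zero.2 h1).map (AdjoinRoot.of (X ^ 2 ^ P.logDeg + 1 : (ZMod P.q)[X]))
  rwa [map_natCast] at h2

/-- For each m, the chain of hybrids bounds the probability of finding a collision by the decryption
error plus one advantage per step. The sum over m has n terms, and negligible functions absorb
polynomial factors. -/
theorem whiteBoxRobust {t : ℕ → ℕ} (hk : ∀ n, k n ≤ n) (hN : PolyBounded N) (hT : PolyBounded T)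
    (ht : ∀ n, (t n).Prime) (htN : ∀ n, n * N n < t n) (htp : PolyBounded t)
    (hr : ∀ n, (P n).logDeg ≤ addrBits n)
    (hσ : ∃ c : ℕ, ∀ n : ℕ, (P n).σ ≤ (n : ℝ) ^ c + c)
    (hq : (fun n : ℕ => Real.log n ^ 2) =o[Filter.atTop] fun n : ℕ => Real.log (P n).q)
    (hqp : ∃ C c : ℕ, ∀ n : ℕ, Real.log (P n).q ≤ C * polylog c n) (hard : RingLWEHard P) :
    WhiteBoxRobust (fun n => chunkedProtocol A (P n) n (T n)) (fun n => sparseRecovery (k n)) N := by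
  intro D
  have hqs : Polylog fun n => (P n).q.size :=
    polylog_size_of_log_le (fun n => (P n).q_prime.pos) hqp
  have hTN : PolyBounded fun n => T n * N n :=
    polyBounded_iff.2 ((polyBounded_iff.1 hT).mul (polyBounded_iff.1 hN))
  set s : ℕ → ℕ := fun n => wordSize P N n + (T n * N n).size with hs_def
  have hs : Polylog s := (polylog_wordSize hN hqs).add hTN.polylog_size
  have hfit (n : ℕ) : FitsProtocol (s n) (P n) n (k n) (N n) := by
    have h := fitsProtocol_wordSize hk hr (N := N) n
    have h1 : 2 ^ wordSize P N n ≤ 2 ^ s n := Nat.pow_le_pow_right (by norm_num) (Nat.le_add_right _ _)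
    exact ⟨⟨h.ring.1.trans_le (Nat.le_add_right _ _), h.ring.2.trans_le h1⟩, h.deg, h.dim.trans_le h1,
      h.sparse.trans_le h1, h.box.trans_le h1⟩
  have hTs (n : ℕ) : T n * N n < 2 ^ s n :=
    (Nat.lt_size_self _).trans_le (Nat.pow_le_pow_right (by norm_num) (Nat.le_add_left _ _))
  obtain ⟨ν, hν, hν0, hdec⟩ := exists_pr_not_decryptsAt_le hN ht htN htp hr hσ hq
  obtain ⟨δ, hδ, hδ0, hadv⟩ := exists_advantage_bound A D hN hT hr hqs hs hard
  -- Only t < q is needed from this, to make t a unit.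
  obtain ⟨n₀, hn₀⟩ := eventually_pow_lt_modulus hq (polyBounded_iff.1 htp)
  have hneg : Negligible fun n => (n : ℕ) * (ν n + (addrBits n + 1 : ℕ) * δ n) :=
    (hν.add (hδ.mul_poly (polylog_addrBits.growsLike.add (.const 1)))).mul_poly GrowsLike.self
  refine hneg.of_le (n₀ := n₀) fun n hn => ?_
  have htq : t n < (P n).q := lt_of_le_of_lt (Nat.le_self_pow (by omega) _) (hn₀ n hn)
  have hu : IsUnit ((t n : ℕ) : (P n).R) := isUnit_natCast (ht n).pos htq
  have hm (m : Fin n) : hybrid (fun _ => unifRand (P n)) (findProb A D (P n) n (T n) m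
      (findTime A D (s n) (P n).logDeg n (T n))) ≤
      ENNReal.ofReal (ν n + (addrBits n + 1 : ℕ) * δ n) := by
    have h := hybrid_unif_le (m := m) hu (fun i => findProb A D (P n) n (T n) m
      (findTime A D (s n) (P n).logDeg n (T n) + i * affineCost (s n) (P n).logDeg (addrBits n)))
      fun i hi => by
        have := reduces_findProb A D (T := T n) (hfit n).ring fun M => hadv n m i hi M _ (by
          rw [Nat.succ_mul, ← add_assoc])
        rwa [add_assoc, ← Nat.succ_mul] at this
    rw [zero_mul, add_zero] at h
    refine h.trans ((add_le_add_left ((genuine_le A D (hfit n) m _).trans (hdec n m)) _).trans ?_)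
    rw [ENNReal.ofReal_add (hν0 n) (mul_nonneg (Nat.cast_nonneg _) (hδ0 n)),
      ENNReal.ofReal_mul (Nat.cast_nonneg _), ENNReal.ofReal_natCast]
    push_cast
    exact le_rfl
  have htotal := (pr_experiment_le A D (hfit n) (hTs n)).trans (Finset.sum_le_sum fun m _ => hm m)
  rw [Finset.sum_const, Finset.card_univ, Fintype.card_fin, nsmul_eq_mul, ← ENNReal.ofReal_natCast,
    ← ENNReal.ofReal_mul (Nat.cast_nonneg _)] at htotal
  rw [prob_eq]
  exact ENNReal.toReal_le_of_le_ofReal (mul_nonneg (Nat.cast_nonneg _)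
    (add_nonneg (hν0 n) (mul_nonneg (Nat.cast_nonneg _) (hδ0 n)))) htotal

end

end WBRecovery

end

theorem proposition5p4
    (w : ℝ) (hw₀ : 0 < w) (hw₁ : w < 1)
    (k N T t : ℕ → ℕ) (P : ℕ → RingParams)
    (hk : ∀ n, k n ≤ n) (hN : PolyBounded N)
    (hT : PolyBounded T) (hT₁ : ∀ n, 1 ≤ T n)
    -- modulus of the message space
    (ht : ∀ n, (t n).Prime) (htN : ∀ n, n * N n < t n) (htp : PolyBounded t)
    -- the degree `2 ^ logDeg` is the least power of two that is at least `n ^ w`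
    (hdeg : ∀ n, (P n).logDeg = ⌈w * Real.logb 2 n⌉₊)
    (hσ : ∃ c : ℕ, ∀ n : ℕ, (P n).σ ≤ (n : ℝ) ^ c + c)
    -- the modulus exceeds every `n ^ (C log n)`, and has polylogarithmic bit length
    (hq : (fun n : ℕ => Real.log n ^ 2) =o[Filter.atTop] fun n : ℕ => Real.log (P n).q)
    (hqp : ∃ C c : ℕ, ∀ n : ℕ, Real.log (P n).q ≤ C * polylog c n)
    (A : RelaxedRecovery k N) :
    ∃ (serverProg coordProg : Prog) (C c : ℕ),
      -- communication between each server and the coordinator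
      (∀ n, 1 ≤ n → ∀ ζ (x : Fin n → ℤ), InBox (N n) x →
        ((chunkedProtocol A (P n) n (T n)).communication ζ x : ℝ) ≤
          C * (n : ℝ) ^ w * polylog c n + ((A.Φ n).enc ((A.Φ n).apply x)).size) ∧
      -- running time of the coordinator; the last summand is for adding up the `T` packets
      (∀ n, 1 ≤ n → ∀ ζ (x : Fin (T n) → Fin n → ℤ), ValidData (N n) x →
        (chunkedProtocol A (P n) n (T n)).CoordinatorRunsIn coordProg (publicParams A (P n) n)
          encAnswer ζ (fun i => (chunkedProtocol A (P n) n (T n)).server ζ (x i))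
          (C * n * polylog c n + A.reportTime n +
            C * T n * ((n : ℝ) ^ w * polylog c n + (A.Φ n).resultBits))) ∧
      -- running time of each server
      (∀ n, 1 ≤ n → ∀ ζ (x : Fin n → ℤ), InBox (N n) x →
        (chunkedProtocol A (P n) n (T n)).ServerRunsIn serverProg (publicParams A (P n) n) ζ x
          (C * n * polylog c n + A.measureTime n)) ∧
      -- if the ciphertexts encrypt a coordinate `m`, then hashes decrypt to the chunks around `m`,
      -- and vectors that differ at `m` decrypt to distinct ring elements
      (∃ ν : ℕ → ℝ, Negligible ν ∧ ∀ n (m : Fin n),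
        1 - ν n ≤ prob ((encryptedCoordinate (P n) (t n) n m).map fun key =>
          (∀ x : Fin n → ℤ, InBox (N n) x →
            BV.decrypt (P n) (t n) key.1 (chunkedHash (P n) key.2 x) =
              chunk (t n) (P n).logDeg x (m / 2 ^ (P n).logDeg)) ∧
          ∀ x x' : Fin n → ℤ, InBox (N n) x → InBox (N n) x' → x m ≠ x' m →
            BV.decrypt (P n) (t n) key.1 (chunkedHash (P n) key.2 x) ≠
                BV.decrypt (P n) (t n) key.1 (chunkedHash (P n) key.2 x') ∧
              chunkedHash (P n) key.2 x ≠ chunkedHash (P n) key.2 x')) ∧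
      -- correctness of the responses against white-box adversaries, under Ring-LWE
      (RingLWEHard P →
        WhiteBoxRobust (fun n => chunkedProtocol A (P n) n (T n))
          (fun n => sparseRecovery (k n)) N) := by
  have hr := logDeg_le_addrBits hw₁ hdeg
  obtain ⟨C, c, h₁, h₂, h₃⟩ := resources A hk hN hT₁ hw₀ hw₁ hdeg hqp
  exact ⟨serverProg A, coordProg A, C, c, h₁, h₂, h₃, decryption_correct hN ht htN htp hr hσ hq,
    fun hard => whiteBoxRobust A hk hN hT ht htN htp hr hσ hq hqp hard⟩
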